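/- **Setting.** Graphs are finite and simple, and classes and languages of graphs do not distinguish isomorphic graphs. A boundaried graph is a graph $G$ with a set $\partial(G)$ of vertices carrying distinct labels from $\{1,2,\dots\}$; $\Lambda(G)$ is its set of labels, and $G$ is $t$-boundaried, $G\in\mathcal B_t$, if $\Lambda(G)\subseteq\{1,\dots,t\}$. $G_1\oplus G_2$ is the disjoint union with equally labelled vertices identified. $\mathcal F_t\subseteq\mathcal B_t$ consists of the graphs that have a tree decomposition of width at most $t-1$ with a bag containing the whole boundary. For a graph class $\mathcal G$ and $G_1,G_2\in\mathcal B_t\cap\mathcal G$, let $G_1\sim_{\mathcal G,t}G_2$ if for all $K\in\mathcal B_t$: $G_1\oplus K\in\mathcal G\iff G_2\oplus K\in\mathcal G$; let $r_{\mathcal G,t}$ be the number of classes of $\sim_{\mathcal G,t}$. A parameterized graph problem $\Pi$ on $\mathcal G$ (a set of pairs $(G,k)$, $G\in\mathcal G$, $k\in\mathbb Z$, all instances with $k<0$ having the same answer) is vertex-certifiable if there is a language $L_\Pi$ of pairs $(G,S)$, $S\subseteq V(G)$, such that $(G,k)\in\Pi$ iff some $S$ with $|S|\le k$ (minimization; $|S|\ge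 k$ for maximization) has $(G,S)\in L_\Pi$. An encoder $\mathcal E=(\mathcal C,L_{\mathcal C})$ assigns to every finite set $I$ of labels a finite set $\mathcal C(I)$ of strings, and $L_{\mathcal C}$ is a computable language of triples $(G,S,R)$ with $G$ boundaried, $S\subseteq V(G)$, $R\in\mathcal C(\Lambda(G))$. It is a $\Pi$-encoder if $\mathcal C(\emptyset)=\{R_\emptyset\}$ and, for graphs without boundary, $(G,S,R_\emptyset)\in L_{\mathcal C}\iff(G,S)\in L_\Pi$. For minimization $f_G^{\mathcal E}(R)$ is the minimum $|S|$ with $(G,S,R)\in L_{\mathcal C}$ ($+\infty$ if there is none), and $f_G^{\mathcal E,g}(R)$ is $+\infty$ if $f_G^{\mathcal E}(R)-g(t)>\min_{R'}f_G^{\mathcal E}(R')$ and $f_G^{\mathcal E}(R)$ otherwise; for maximization, $f_G^{\mathcal E}(R)$ is the maximum ($-\infty$ if there is none), and $f_G^{\mathcal E,g}(R)$ is $-\infty$ if $f_G^{\mathcal E}(R)+g(t)<\max_{R'}f_G^{\mathcal E}(R')$ and $f_G^{\mathcal E}(R)$ otherwise. For $G_1,G_2\in\mathcal B_t\cap\mathcal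 G$ let $G_1\sim^*_{\mathcal E,g,t,\mathcal G}G_2$ if $G_1\sim_{\mathcal G,t}G_2$, $\Lambda(G_1)=\Lambda(G_2)$ and there is $c\in\mathbb Z$ with $f_{G_1}^{\mathcal E,g}=f_{G_2}^{\mathcal E,g}+c$ on $\mathcal C(\Lambda(G_1))$; $\Delta(G_1,G_2)$ is $c$ if it is unique, and $0$ if every integer will do. The relation is DP-friendly if, whenever $G\in\mathcal B_t\cap\mathcal G$, $B\subseteq V(G)$ has distinct labels from $\{1,\dots,t\}$ (in any way), $U$ is a union of components of $G-B$ with $U\cap\partial(G)=\emptyset$, $G_B=G[B\cup U]$ with boundary $B$, and $G_B\sim^*_{\mathcal E,g,t,\mathcal G}G_B'$, the graph $G'=(G-U)\oplus G_B'$ (glued along $B$) with the boundary of $G$ satisfies $G\sim^*_{\mathcal E,g,t,\mathcal G}G'$ and $\Delta(G,G')=\Delta(G_B,G_B')$. Put $s_{\mathcal E}(t)=\max_{I\subseteq\{1,\dots,t\}}|\mathcal C(I)|$, $\;r=(g(t)+2)^{s_{\mathcal E}(t)}\cdot2^t\cdot r_{\mathcal G,t}$ and $b(\mathcal E,g,t,\mathcal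 G)=2^{r+1}\cdot t$. For $W\subseteq V(G)$ let $\mathbf{bd}(W)$ be the set of vertices of $W$ with a neighbour outside $W$; $W$ is a $t$-protrusion if $|\mathbf{bd}(W)|\le t$ and $G[W]$ with boundary $\mathbf{bd}(W)$ is in $\mathcal F_t$. An $(a,t)$-protrusion decomposition of $G$ is a partition $V(G)=Y_0\uplus\cdots\uplus Y_\ell$ with $\max\{\ell,|Y_0|\}\le a$ such that for $1\le i\le\ell$, $N(Y_i)\subseteq Y_0$ and $Y_i\cup N(Y_i)$ is a $t$-protrusion. **Corollary.** Let $H$ be a fixed graph and let $\mathcal G$ be the class of graphs that exclude $H$ as a minor, or the class of those that exclude $H$ as a topological minor. Let $\Pi$ be a vertex-certifiable parameterized graph problem on $\mathcal G$, and let $\mathcal E$ be a $\Pi$-encoder, $g:\mathbb N\to\mathbb N$ and $t\in\mathbb N$ such that $\sim^*_{\mathcal E,g,t,\mathcal G}$ is DP-friendly. Let $\alpha\in\mathbb R$. Then $r_{\mathcal G,t}$ is finite, and there is a (deterministic) algorithm that, given $G\in\mathcal G$, $k\in\mathbb Z$ and an $(\alpha k,t)$-protrusion decomposition of $G$, computes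 in time polynomial in $|V(G)|+|k|$ a pair $(G',k')$ with $$G'\in\mathcal G,\qquad (G,k)\in\Pi\iff(G',k')\in\Pi,\qquad |V(G')|\le(1+b(\mathcal E,g,t,\mathcal G))\cdot\alpha\cdot k,\qquad k'\le k.$$ -/

import Mathlib

noncomputable section

namespace ProtrusionKernel

/-! ## Finite graphs, minors, treewidth -/

/-- A finite simple graph. -/
structure FinGraph where
  V : Type
  [fin : Finite V]
  graph : SimpleGraph V

attribute [instance] FinGraph.fin

/-- The graph on `Fin n` as a finite graph. -/
def FinGraph.of {n : ℕ} (G : SimpleGraph (Fin n)) : FinGraph := ⟨Fin n, G⟩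

/-- `H` is a minor of `G`: there are pairwise disjoint connected (nonempty) branch sets in `G`, one
for each vertex of `H`, with an edge of `G` between the branch sets of adjacent vertices of `H`. -/
def IsMinor (H G : FinGraph) : Prop :=
  ∃ β : H.V → Set G.V,
    (∀ h, (G.graph.induce (β h)).Connected) ∧
    (∀ h h', h ≠ h' → Disjoint (β h) (β h')) ∧
    ∀ h h', H.graph.Adj h h' → ∃ u ∈ β h, ∃ v ∈ β h', G.graph.Adj u v

/-- `H` is a topological minor of `G`: a subdivision of `H` is a subgraph of `G`. The vertices of
`H` are sent to distinct branch vertices of `G`, the edges of `H` to paths of `G` between them that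
meet the branch vertices and one another only at their ends. -/
def IsTopMinor (H G : FinGraph) : Prop :=
  ∃ (φ : H.V → G.V) (P : ∀ a b, H.graph.Adj a b → G.graph.Walk (φ a) (φ b)),
    Function.Injective φ ∧
    (∀ a b (h : H.graph.Adj a b), (P a b h).IsPath) ∧
    (∀ a b (h : H.graph.Adj a b) (c : H.V), φ c ∈ (P a b h).support → c = a ∨ c = b) ∧
    ∀ a b (h : H.graph.Adj a b) c d (h' : H.graph.Adj c d), s(a, b) ≠ s(c, d) →
      ∀ x, x ∈ (P a b h).support → x ∈ (P c d h').support → x ∈ Set.range φ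

/-- The class of graphs that exclude `H` as a minor. -/
def minorFree (H : FinGraph) : Set FinGraph := {G | ¬ IsMinor H G}

/-- The class of graphs that exclude `H` as a topological minor. -/
def topMinorFree (H : FinGraph) : Set FinGraph := {G | ¬ IsTopMinor H G}

/-- A tree decomposition of a graph. -/
structure TreeDecomp {V : Type} (G : SimpleGraph V) where
  ι : Type
  [fin : Finite ι]
  T : SimpleGraph ι
  isTree : T.IsTree
  bag : ι → Set V
  cover : ∀ v, ∃ x, v ∈ bag x
  edge : ∀ u v, G.Adj u v → ∃ x, u ∈ bag x ∧ v ∈ bag x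
  conn : ∀ v, (T.induce {x | v ∈ bag x}).Connected

/-- Every bag has at most `t` vertices, that is, the width is at most `t - 1`. -/
def TreeDecomp.WidthLT {V : Type} {G : SimpleGraph V} (D : TreeDecomp G) (t : ℕ) : Prop :=
  ∀ x, (D.bag x).ncard ≤ t

/-! ## Boundaried graphs -/

/-- An injective labelling, by positive integers, of some of the elements of `V`;
`lab v = none` means that `v` carries no label. -/
structure Labelling (V : Type) where
  lab : V → Option ℕ
  pos : ∀ v i, lab v = some i → 1 ≤ i
  inj : ∀ u v i, lab u = some i → lab v = some i → u = v

/-- The set of labelled elements. -/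
def Labelling.dom {V : Type} (ν : Labelling V) : Set V := {v | ∃ i, ν.lab v = some i}

/-- The labelling of a subset that is obtained by restriction. -/
def Labelling.restrict {V : Type} (ν : Labelling V) (U : Set V) : Labelling U where
  lab v := ν.lab v
  pos v i h := ν.pos v i h
  inj u v i hu hv := Subtype.ext (ν.inj u v i hu hv)

/-- A boundaried graph. Its boundary is the set of labelled vertices. -/
structure BGraph extends FinGraph where
  bd : Labelling V

namespace BGraph

/-- The boundary `∂(G)`. -/
def boundary (G : BGraph) : Set G.V := G.bd.dom

/-- The label set `Λ(G)`. -/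
def labels (G : BGraph) : Finset ℕ :=
  Set.Finite.toFinset (s := {i | ∃ v, G.bd.lab v = some i}) <| by
    have h : {i | ∃ v, G.bd.lab v = some i} ⊆ Set.range fun v => (G.bd.lab v).getD 0 := by
      rintro i ⟨v, hv⟩
      exact ⟨v, by simp [hv]⟩
    exact (Set.finite_range _).subset h

/-- `G` is a `t`-boundaried graph, that is, `G ∈ 𝓑_t`. -/
def IsBoundaried (t : ℕ) (G : BGraph) : Prop := G.labels ⊆ Finset.Icc 1 t

/-- Isomorphisms of boundaried graphs: isomorphisms of the graphs that preserve the labels. -/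
structure Iso (G₁ G₂ : BGraph) where
  toIso : G₁.graph ≃g G₂.graph
  lab_eq : ∀ v, G₂.bd.lab (toIso v) = G₁.bd.lab v

/-- The subgraph of `G` induced by `U`, with the labels that `ν` gives to the vertices of `U`. -/
def induced (G : FinGraph) (U : Set G.V) (ν : Labelling G.V) : BGraph where
  V := U
  graph := G.graph.induce U
  bd := ν.restrict U

/-- The vertices of `G₁ ⊕ G₂`: those of `G₁`, and those of `G₂` whose label (if any) is not a label
of `G₁`. -/
abbrev GlueV (G₁ G₂ : BGraph) : Type :=
  G₁.V ⊕ {v : G₂.V // ∀ u i, G₁.bd.lab u = some i → G₂.bd.lab v ≠ some i}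

/-- The vertex `x` of `G₁ ⊕ G₂` is the one that comes from the vertex `v` of `G₂`. -/
def FromRight (G₁ G₂ : BGraph) (v : G₂.V) : GlueV G₁ G₂ → Prop
  | .inl u => ∃ i, G₁.bd.lab u = some i ∧ G₂.bd.lab v = some i
  | .inr w => w.1 = v

/-- The gluing `G₁ ⊕ G₂` (as a graph without boundary): the disjoint union of `G₁` and `G₂`, with
boundary vertices of the same label identified. -/
def glue (G₁ G₂ : BGraph) : FinGraph where
  V := GlueV G₁ G₂
  graph := SimpleGraph.fromRel fun x y =>
    (∃ a b, G₁.graph.Adj a b ∧ x = .inl a ∧ y = .inl b) ∨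
    (∃ a b, G₂.graph.Adj a b ∧ FromRight G₁ G₂ a x ∧ FromRight G₁ G₂ b y)

/-- The gluing of the subgraph of `G` induced by `U` (with boundary labelled by `ν`) and of `K`,
considered as a boundaried graph whose boundary and labels are those of `G` in `U`. -/
def glueInto (G : BGraph) (U : Set G.V) (ν : Labelling G.V) (K : BGraph) : BGraph where
  toFinGraph := glue (induced G.toFinGraph U ν) K
  bd :=
    { lab := Sum.elim (fun u : U => G.bd.lab u) (fun _ => none)
      pos := by
        rintro (u | w) i h
        · exact G.bd.pos _ _ h
        · cases h
      inj := by
        rintro (u | w) (u' | w') i h h'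
        · exact congrArg Sum.inl (Subtype.ext (G.bd.inj _ _ _ h h'))
        · cases h'
        · cases h
        · cases h }

end BGraph

/-! ## Parameterized problems and encoders -/

/-- A parameterized graph problem on the graph class `𝒢`: the set of its Yes-instances `(G, k)`.
It does not distinguish isomorphic graphs, and all the instances with `k < 0` have the same
answer. -/
structure ParamProblem (𝒢 : Set FinGraph) where
  yes : FinGraph → ℤ → Prop
  yes_iso : ∀ G₁ ∈ 𝒢, ∀ G₂ ∈ 𝒢, Nonempty (G₁.graph ≃g G₂.graph) →
    ∀ k, yes G₁ k ↔ yes G₂ k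
  yes_neg : ∀ G₁ ∈ 𝒢, ∀ G₂ ∈ 𝒢, ∀ k₁ < 0, ∀ k₂ < 0, yes G₁ k₁ ↔ yes G₂ k₂

/-- Whether solutions of size at most `k` or of size at least `k` are looked for. -/
inductive Objective
  | minimize
  | maximize

/-- A language of pairs `(G, S)` with `S ⊆ V(G)`. -/
abbrev VertexLanguage := ∀ G : FinGraph, Set G.V → Prop

/-- `L` is a certifying language for the problem `Q` on `𝒢` with objective `o`. A problem that has
one is vertex-certifiable. -/
def IsCertifying {𝒢 : Set FinGraph} (o : Objective) (L : VertexLanguage)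
    (Q : ParamProblem 𝒢) : Prop :=
  ∀ G ∈ 𝒢, ∀ k : ℤ, Q.yes G k ↔
    match o with
    | .minimize => ∃ S : Set G.V, (S.ncard : ℤ) ≤ k ∧ L G S
    | .maximize => ∃ S : Set G.V, k ≤ (S.ncard : ℤ) ∧ L G S

/-- Codes of triples `(G, S, R)`: the number of vertices, a list of edges, a list of
(vertex, label) pairs, a list of the vertices of `S`, and the string `R`. -/
abbrev TripleCode := ℕ × List (ℕ × ℕ) × List (ℕ × ℕ) × List ℕ × List ℕ

/-- The code `c` describes the triple `(G, S, R)`, for some numbering of the vertices. -/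
def Codes (c : TripleCode) (G : BGraph) (S : Set G.V) (R : List ℕ) : Prop :=
  ∃ e : G.V ≃ Fin c.1,
    (∀ u v, G.graph.Adj u v ↔ (((e u : ℕ), (e v : ℕ)) ∈ c.2.1 ∨ ((e v : ℕ), (e u : ℕ)) ∈ c.2.1)) ∧
    (∀ v i, G.bd.lab v = some i ↔ ((e v : ℕ), i) ∈ c.2.2.1) ∧
    (∀ v, v ∈ S ↔ (e v : ℕ) ∈ c.2.2.2.1) ∧
    R = c.2.2.2.2

/-- An encoder `(C, L)`. Strings are lists of natural numbers (the symbols of the alphabet).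
`L G S R` says that `S` satisfies the encoding `R` of the label set of `G`. -/
structure Encoder where
  C : Finset ℕ → Finset (List ℕ)
  L : ∀ G : BGraph, Set G.V → List ℕ → Prop
  mem_C : ∀ G S R, L G S R → R ∈ C G.labels
  L_iso : ∀ (G₁ G₂ : BGraph) (e : BGraph.Iso G₁ G₂) (S : Set G₁.V) (R : List ℕ),
    L G₁ S R ↔ L G₂ (e.toIso '' S) R
  computable : ComputablePred fun c : TripleCode => ∃ G S R, Codes c G S R ∧ L G S R

namespace Encoder

/-- `E` is an encoder for the problem on `𝒢` that has the certifying language `LQ`. -/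
def IsEncoderFor (E : Encoder) (𝒢 : Set FinGraph) (LQ : VertexLanguage) : Prop :=
  ∃ R₀, E.C ∅ = {R₀} ∧
    ∀ G : BGraph, G.labels = ∅ → G.toFinGraph ∈ 𝒢 →
      ∀ S : Set G.V, E.L G S R₀ ↔ LQ G.toFinGraph S

variable (o : Objective) (E : Encoder)

open Classical in
/-- The value `f_G^E(R)`; `none` is the infinite value, which is `+∞` for minimization and `-∞` for
maximization. -/
def value (G : BGraph) (R : List ℕ) : Option ℕ :=
  if ∃ S : Set G.V, E.L G S R then
    some (match o with
      | .minimize => sInf {k : ℕ | ∃ S : Set G.V, S.ncard ≤ k ∧ E.L G S R}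
      | .maximize => sSup {k : ℕ | ∃ S : Set G.V, k ≤ S.ncard ∧ E.L G S R})
  else none

/-- The finite value `m` of some encoding of `Λ(G)` is to be cut off, as it is by more than `d`
worse than the value of another one. -/
def TooFar (d : ℕ) (G : BGraph) (m : ℕ) : Prop :=
  ∃ R ∈ E.C G.labels, ∃ m', E.value o G R = some m' ∧
    match o with
    | .minimize => m' + d < m
    | .maximize => m + d < m'

open Classical in
/-- The truncated value `f_G^{E,g}(R)` of a `t`-boundaried graph, with `d = g(t)`. -/
def truncValue (d : ℕ) (G : BGraph) (R : List ℕ) : Option ℕ :=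
  match E.value o G R with
  | none => none
  | some m => if E.TooFar o d G m then none else some m

/-- `f_{G₁}^{E,g}(R) = f_{G₂}^{E,g}(R) + c` for all the encodings `R` of the label set. -/
def IsShift (d : ℕ) (G₁ G₂ : BGraph) (c : ℤ) : Prop :=
  ∀ R ∈ E.C G₁.labels,
    (E.truncValue o d G₁ R).map (fun m => (m : ℤ)) =
      (E.truncValue o d G₂ R).map (fun m => (m : ℤ) + c)

/-- The relation `G₁ ∼*_{E,g,t} G₂` on `t`-boundaried graphs. -/
def Sim (g : ℕ → ℕ) (t : ℕ) (G₁ G₂ : BGraph) : Prop :=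
  G₁.labels = G₂.labels ∧ ∃ c, E.IsShift o (g t) G₁ G₂ c

open Classical in
/-- The transposition function `Δ_{E,g,t}` (only meaningful for `G₁ ∼*_{E,g,t} G₂`): the unique
`c` if there is only one, and `0` if every integer will do. -/
def delta (g : ℕ → ℕ) (t : ℕ) (G₁ G₂ : BGraph) : ℤ :=
  if h : ∃! c, E.IsShift o (g t) G₁ G₂ c then h.choose else 0

/-- `s_E(t)`, the largest number of encodings of a subset of `{1, …, t}`. -/
def s (t : ℕ) : ℕ := (Finset.Icc 1 t).powerset.sup fun I => (E.C I).card

end Encoder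

/-- `𝓑_t ∩ 𝒢`. -/
def BClass (t : ℕ) (𝒢 : Set FinGraph) : Set BGraph :=
  {G | G.IsBoundaried t ∧ G.toFinGraph ∈ 𝒢}

/-- The equivalence relation `∼_{𝒢,t}` on `𝓑_t ∩ 𝒢`. -/
def classSetoid (t : ℕ) (𝒢 : Set FinGraph) : Setoid (BClass t 𝒢) where
  r G₁ G₂ := ∀ K : BGraph, K.IsBoundaried t →
    (BGraph.glue G₁.1 K ∈ 𝒢 ↔ BGraph.glue G₂.1 K ∈ 𝒢)
  iseqv :=
    { refl := fun _ _ _ => Iff.rfl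
      symm := fun h K hK => (h K hK).symm
      trans := fun h h' K hK => (h K hK).trans (h' K hK) }

/-- The number `r_{𝒢,t}` of equivalence classes of `∼_{𝒢,t}` (if it is finite). -/
def numClasses (t : ℕ) (𝒢 : Set FinGraph) : ℕ := Nat.card (Quotient (classSetoid t 𝒢))

/-- The relation `∼*_{E,g,t,𝒢}` on `𝓑_t ∩ 𝒢`. -/
def SimIn (o : Objective) (E : Encoder) (g : ℕ → ℕ) (t : ℕ) (𝒢 : Set FinGraph)
    (G₁ G₂ : BGraph) : Prop :=
  ∃ (h₁ : G₁ ∈ BClass t 𝒢) (h₂ : G₂ ∈ BClass t 𝒢),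
    E.Sim o g t G₁ G₂ ∧ (classSetoid t 𝒢).r ⟨G₁, h₁⟩ ⟨G₂, h₂⟩

/-- `∼*_{E,g,t,𝒢}` is DP-friendly. Here `U` is the union of a collection of connected components
of `G - B` that avoids the boundary of `G`, so that `B ∪ U` induces the subgraph that is replaced,
with boundary `B`, labelled in any way by labels from `{1, …, t}`. The graph `K` replaces it: it is
glued to what remains after the deletion of `U`, and the result has the boundary of `G`. -/
def DPFriendly (o : Objective) (E : Encoder) (g : ℕ → ℕ) (t : ℕ) (𝒢 : Set FinGraph) : Prop :=
  ∀ G ∈ BClass t 𝒢, ∀ (B U : Set G.V) (ν : Labelling G.V), ν.dom = B →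
    (∀ v i, ν.lab v = some i → i ≤ t) →
    Disjoint U B → Disjoint U G.boundary →
    (∀ u ∈ U, ∀ v, G.graph.Adj u v → v ∉ B → v ∈ U) →
    ∀ K : BGraph, SimIn o E g t 𝒢 (BGraph.induced G.toFinGraph (B ∪ U) ν) K →
      SimIn o E g t 𝒢 G (BGraph.glueInto G Uᶜ ν K) ∧
      E.delta o g t G (BGraph.glueInto G Uᶜ ν K) =
        E.delta o g t (BGraph.induced G.toFinGraph (B ∪ U) ν) K

/-- `r(E,g,t,𝒢) = (g(t) + 2)^{s_E(t)} · 2^t · r_{𝒢,t}`. -/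
def classBound (E : Encoder) (g : ℕ → ℕ) (t : ℕ) (𝒢 : Set FinGraph) : ℕ :=
  (g t + 2) ^ E.s t * 2 ^ t * numClasses t 𝒢

/-- `b(E,g,t,𝒢) = 2^{r(E,g,t,𝒢) + 1} · t`. -/
def sizeBound (E : Encoder) (g : ℕ → ℕ) (t : ℕ) (𝒢 : Set FinGraph) : ℕ :=
  2 ^ (classBound E g t 𝒢 + 1) * t

/-! ## Protrusion decompositions -/

/-- The vertices of `W` that have a neighbour outside `W`. -/
def bdry {V : Type} (G : SimpleGraph V) (W : Set V) : Set V :=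
  {v | v ∈ W ∧ ∃ u, u ∉ W ∧ G.Adj v u}

/-- `W` is a `t`-protrusion, in the sense that `G[W]` with boundary `bd(W)` is a `t`-boundaried
graph in `𝓕_t`: the boundary has at most `t` vertices and `G[W]` has a tree decomposition of width
at most `t - 1` in which the boundary is contained in one bag (the root-bag). -/
def IsProtrusion {V : Type} (G : SimpleGraph V) (W : Set V) (t : ℕ) : Prop :=
  (bdry G W).ncard ≤ t ∧
  ∃ D : TreeDecomp (G.induce W), D.WidthLT t ∧
    ∃ r, ∀ v : W, (v : V) ∈ bdry G W → v ∈ D.bag r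

/-- `Y` describes an `(a, t)`-protrusion decomposition `Y₀ ⊎ Y₁ ⊎ ⋯ ⊎ Y_ℓ` of `G`: the part `Y_i`
is the set of the vertices `v` with `Y v = i`. -/
def IsProtrusionDecomp {V : Type} (G : SimpleGraph V) {ℓ : ℕ} (Y : V → Fin (ℓ + 1))
    (a : ℝ) (t : ℕ) : Prop :=
  (∀ u v, G.Adj u v → Y u ≠ 0 → Y v = Y u ∨ Y v = 0) ∧
  (ℓ : ℝ) ≤ a ∧ ({v | Y v = 0}.ncard : ℝ) ≤ a ∧
  ∀ i, i ≠ 0 →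
    IsProtrusion G ({v | Y v = i} ∪ {v | Y v = 0 ∧ ∃ u, Y u = i ∧ G.Adj u v}) t

/-! ## Algorithms and running time

Random access machines with integer registers, indirect addressing, addition and subtraction as the
only arithmetic, and unit costs; the control flow is structured. As there is no multiplication, the
length of the numbers grows by at most one bit per step, so that polynomially many steps amount to
polynomial time on Turing machines. -/

/-- The memory: registers, and arrays, which are accessed through an index held in a register. -/
structure Memory where
  reg : ℕ → ℤ
  arr : ℕ → ℤ → ℤ

def Memory.setReg (σ : Memory) (x : ℕ) (c : ℤ) : Memory :=
  { σ with reg := Function.update σ.reg x c }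

def Memory.setArr (σ : Memory) (a : ℕ) (i c : ℤ) : Memory :=
  { σ with arr := Function.update σ.arr a (Function.update (σ.arr a) i c) }

/-- Programs. In `load` and `store`, `a` is the (fixed) number of an array. -/
inductive Prog
  | skip
  | const (x : ℕ) (c : ℤ)
  | add (x y z : ℕ)
  | sub (x y z : ℕ)
  | load (x a y : ℕ)
  | store (a x y : ℕ)
  | seq (p q : Prog)
  | ifPos (x : ℕ) (p q : Prog)
  | whilePos (x : ℕ) (p : Prog)

/-- `Run p σ σ' m`: started in `σ`, the program `p` halts in `σ'` after `m` steps. -/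
inductive Run : Prog → Memory → Memory → ℕ → Prop
  | skip (σ) : Run .skip σ σ 1
  | const (σ x c) : Run (.const x c) σ (σ.setReg x c) 1
  | add (σ x y z) : Run (.add x y z) σ (σ.setReg x (σ.reg y + σ.reg z)) 1
  | sub (σ x y z) : Run (.sub x y z) σ (σ.setReg x (σ.reg y - σ.reg z)) 1
  | load (σ x a y) : Run (.load x a y) σ (σ.setReg x (σ.arr a (σ.reg y))) 1
  | store (σ a x y) : Run (.store a x y) σ (σ.setArr a (σ.reg x) (σ.reg y)) 1
  | seq {p q σ₁ σ₂ σ₃ m n} :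
      Run p σ₁ σ₂ m → Run q σ₂ σ₃ n → Run (.seq p q) σ₁ σ₃ (m + n)
  | ifPos_true {x p q σ σ' m} :
      0 < σ.reg x → Run p σ σ' m → Run (.ifPos x p q) σ σ' (m + 1)
  | ifPos_false {x p q σ σ' m} :
      σ.reg x ≤ 0 → Run q σ σ' m → Run (.ifPos x p q) σ σ' (m + 1)
  | whilePos_true {x p σ₁ σ₂ σ₃ m n} :
      0 < σ₁.reg x → Run p σ₁ σ₂ m → Run (.whilePos x p) σ₂ σ₃ n →
      Run (.whilePos x p) σ₁ σ₃ (m + n + 1)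
  | whilePos_false {x p σ} :
      σ.reg x ≤ 0 → Run (.whilePos x p) σ σ 1

open Classical in
/-- The input `(G, k, Y)`: the number `n` of vertices, `k` and `ℓ` are in the first three registers,
the adjacency matrix is in array `0` (row by row), and array `1` says which part of the partition a
vertex belongs to. Everything else is `0`. -/
def inputMemory {n ℓ : ℕ} (G : SimpleGraph (Fin n)) (k : ℤ) (Y : Fin n → Fin (ℓ + 1)) : Memory where
  reg x := if x = 0 then (n : ℤ) else if x = 1 then k else if x = 2 then (ℓ : ℤ) else 0
  arr a z :=
    if a = 0 then
      if ∃ u v : Fin n, G.Adj u v ∧ z = (u : ℤ) * n + v then 1 else 0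
    else if a = 1 then
      if h : ∃ v : Fin n, z = (v : ℤ) then ((Y h.choose : ℕ) : ℤ) else 0
    else 0

open Classical in
/-- The memory `σ` holds the output `(G, k)`, in the same format as the input. -/
def IsOutput {n : ℕ} (σ : Memory) (G : SimpleGraph (Fin n)) (k : ℤ) : Prop :=
  σ.reg 0 = (n : ℤ) ∧ σ.reg 1 = k ∧
  ∀ u v : Fin n, σ.arr 0 ((u : ℤ) * n + v) = if G.Adj u v then 1 else 0

end ProtrusionKernel

end

/-!
Protrusions are replaced, as long as possible, by equivalent graphs of bounded size. There are at
most `r = classBound E g t 𝒢` classes of `∼*` (`card_simClass`), as truncated values differ by at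
most `g t`. A piece of treewidth less than `t` with more than `2 ^ r * t` vertices therefore has two
properly nested subpieces in the same class (`Piece.exists_repeated`), and the outer one may be
replaced by the inner one. Since `∼*` is DP-friendly, the result is equivalent, and iterating this
leads to an equivalent graph with at most `2 ^ r * t` vertices off the boundary
(`exists_small_equivalent`). The parameter never increases: if the replacement of a graph by a
subgraph of itself had a negative `Δ`, then putting the larger graph in the place of the smaller one
again and again would produce graphs of negative value (`delta_nonneg_of_self_replacement`).

The algorithm only needs a finite list of rules of the form "replace a copy of `M` by `K`", chosen
once and for all (`exists_rule_list`), so that neither `∼*` nor tree decompositions have to be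
computed: one pass over all the tuples of a fixed length either deletes a vertex or certifies that no
rule applies (`Progress`). This requires that some rule with a left-hand side of bounded size applies
to every part with more than `sizeBound E g t 𝒢` vertices (`exists_rule`).

* If the part is not larger than a certain constant, it is replaced as a whole by a small equivalent
  graph that has a tree decomposition of the same kind.
* If it is larger, then a tree decomposition yields a subpiece of bounded size which is still so
  large that it contains a long chain of nested cuts (`Piece.exists_window`, `Piece.exists_chain`).
  Two of them have the same order, are equivalent, and are linked by disjoint connected sets, by
  Menger's theorem (`CutChain.exists_linked`, `exists_linkage`). The connected sets make the inner
  graph a rooted minor of the outer one (`rootedMinor_of_crossing`), so that the replacement of the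
  outer graph by the inner one turns the part into a minor of itself, whose treewidth is again less
  than `t` (`Piece.minor`). The linkage is indispensable here, because the subpiece is found by brute
  force and need not fit into a tree decomposition of the part.

In the end, every part has at most `sizeBound E g t 𝒢` vertices, and the remaining vertices belong to
`Y 0`. The program is written in a small language with bounded loops and first-order conditions,
which is compiled to random access machines (`Cmd.compile_spec`).

That `∼_{𝒢,t}` has finitely many classes is proved as for properties definable in monadic
second-order logic: containing `H` as a (topological) minor is obtained from local properties of
coloured graphs by Boolean operations and projections of colours, all of which preserve
recognizability (`Recognizable`).
-/

namespace ProtrusionKernel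

/-! ### Connected sets -/

/-- `S` induces a preconnected subgraph of `G`, expressed without walks: a nonempty subset of `S`
that is closed under adjacency inside `S` is all of `S`. -/
def ConnOn {V : Type} (G : SimpleGraph V) (S : Set V) : Prop :=
  ∀ Z ⊆ S, Z.Nonempty → (∀ u ∈ Z, ∀ v ∈ S, G.Adj u v → v ∈ Z) → S ⊆ Z

section ConnOn

variable {V : Type} {G : SimpleGraph V}

theorem connOn_iff {S : Set V} : ConnOn G S ↔ (G.induce S).Preconnected := by
  constructor
  · intro h u v
    let Z : Set V := {x | ∃ hx : x ∈ S, (G.induce S).Reachable u ⟨x, hx⟩}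
    have hv : (v : V) ∈ Z := by
      refine h Z (fun x hx => hx.1) ⟨u, u.2, SimpleGraph.Reachable.refl _⟩ ?_ v.2
      rintro a ⟨ha, hr⟩ b hb hab
      exact ⟨hb, hr.trans (SimpleGraph.Adj.reachable (by simpa using hab))⟩
    exact hv.2
  · rintro h Z hZS ⟨z, hz⟩ hcl s hs
    obtain ⟨p⟩ := h ⟨z, hZS hz⟩ ⟨s, hs⟩
    have key : ∀ (a b : S) (_ : (G.induce S).Walk a b), (a : V) ∈ Z → (b : V) ∈ Z := by
      intro a b p
      induction p with
      | nil => exact id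
      | cons hadj _ ih => exact fun ha => ih (hcl _ ha _ (Subtype.prop _) (by simpa using hadj))
    exact key _ _ p hz

theorem connOn_singleton (v : V) : ConnOn G {v} := by
  rintro Z hZ ⟨z, hz⟩ - x hx
  have := hZ hz
  simp only [Set.mem_singleton_iff] at this hx
  rw [hx, ← this]; exact hz

theorem connOn_empty : ConnOn G ∅ := fun _ _ _ _ => Set.empty_subset _

theorem ConnOn.mono {G' : SimpleGraph V} (h : G ≤ G') {S : Set V} (hS : ConnOn G S) :
    ConnOn G' S :=
  fun Z hZ hne hcl => hS Z hZ hne fun u hu v hv huv => hcl u hu v hv (h huv)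

theorem ConnOn.image {V' : Type} {G' : SimpleGraph V'} {S : Set V} (hS : ConnOn G S) (f : V → V')
    (hf : ∀ u ∈ S, ∀ v ∈ S, G.Adj u v → G'.Adj (f u) (f v)) : ConnOn G' (f '' S) := by
  rintro Z hZ ⟨z, hz⟩ hcl _ ⟨x, hx, rfl⟩
  obtain ⟨y, hy, rfl⟩ := hZ hz
  have := hS {v | v ∈ S ∧ f v ∈ Z} (fun v hv => hv.1) ⟨y, hy, hz⟩
    (fun u hu v hv huv => ⟨hv, hcl _ hu.2 _ ⟨v, hv, rfl⟩ (hf u hu.1 v hv huv)⟩)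
  exact (this hx).2

theorem ConnOn.preimage_val {A : Set V} {S : Set V} (hS : ConnOn G S) (hSA : S ⊆ A) :
    ConnOn (G.induce A) (Subtype.val ⁻¹' S) := by
  rintro Z hZ ⟨z, hz⟩ hcl ⟨x, hxA⟩ hx
  have := hS (Subtype.val '' Z) (by rintro _ ⟨y, hy, rfl⟩; exact hZ hy) ⟨_, z, hz, rfl⟩
    (by
      rintro _ ⟨y, hy, rfl⟩ v hv huv
      exact ⟨⟨v, hSA hv⟩, hcl y hy _ hv (by simpa using huv), rfl⟩)
  obtain ⟨y, hy, hyx⟩ := this hx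
  have : y = ⟨x, hxA⟩ := Subtype.ext hyx
  exact this ▸ hy

/-- If every edge that leaves `U` ends in `B`, then a connected set that meets `U` but not `B` is
contained in `U`. -/
theorem ConnOn.subset_of_closed {S B U : Set V} (hS : ConnOn G S)
    (hcl : ∀ u ∈ U, ∀ v, G.Adj u v → v ∈ B ∪ U) (hU : (S ∩ U).Nonempty)
    (hB : ¬ (S ∩ B).Nonempty) : S ⊆ U := by
  have := hS (S ∩ U) Set.inter_subset_left hU (fun u hu v hv huv =>
    ⟨hv, (hcl u hu.2 v huv).resolve_left fun h => hB ⟨v, hv, h⟩⟩)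
  exact fun x hx => (this hx).2

theorem ConnOn.union {S T : Set V} (hS : ConnOn G S) (hT : ConnOn G T)
    (h : ∃ u ∈ S, ∃ v ∈ T, u = v ∨ G.Adj u v) : ConnOn G (S ∪ T) := by
  obtain ⟨u, hu, v, hv, huv⟩ := h
  rintro Z hZ ⟨z, hz⟩ hcl
  have hSZ : (Z ∩ S).Nonempty → S ⊆ Z := fun hne x hx =>
    (hS (Z ∩ S) Set.inter_subset_right hne
      (fun a ha b hb hab => ⟨hcl a ha.1 b (Or.inl hb) hab, hb⟩) hx).1
  have hTZ : (Z ∩ T).Nonempty → T ⊆ Z := fun hne x hx =>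
    (hT (Z ∩ T) Set.inter_subset_right hne
      (fun a ha b hb hab => ⟨hcl a ha.1 b (Or.inr hb) hab, hb⟩) hx).1
  have hS' : S ⊆ Z → T ⊆ Z := by
    intro h
    refine hTZ ⟨v, ?_, hv⟩
    rcases huv with rfl | huv
    · exact h hu
    · exact hcl u (h hu) v (Or.inr hv) huv
  have hT' : T ⊆ Z → S ⊆ Z := by
    intro h
    refine hSZ ⟨u, ?_, hu⟩
    rcases huv with rfl | huv
    · exact h hv
    · exact hcl v (h hv) u (Or.inl hu) huv.symm
  rcases hZ hz with hzS | hzT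
  · have := hSZ ⟨z, hz, hzS⟩
    exact Set.union_subset this (hS' this)
  · have := hTZ ⟨z, hz, hzT⟩
    exact Set.union_subset (hT' this) this

/-- A connected set that meets the separator of a separation `(L, R)` in a single vertex stays
connected when it is restricted to `L`. -/
theorem ConnOn.inter_side {C L R : Set V} {v : V} (hC : ConnOn G C) (hLR : C ⊆ L ∪ R)
    (hsep : ∀ a ∈ L, a ∉ R → ∀ b, G.Adj a b → b ∈ C → b ∈ L) (hv : C ∩ (L ∩ R) = {v})
    (hsep' : ∀ a ∈ R, a ∉ L → ∀ b, G.Adj a b → b ∈ C → b ∈ R) :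
    ConnOn G (C ∩ L) := by
  have hvm : v ∈ C ∩ (L ∩ R) := by rw [hv]; rfl
  have huniq : ∀ x ∈ C, x ∈ L → x ∈ R → x = v := fun x h1 h2 h3 => by
    have : x ∈ C ∩ (L ∩ R) := ⟨h1, h2, h3⟩
    rwa [hv] at this
  intro Z hZ hne hcl
  by_cases hvZ : v ∈ Z
  · have := hC (Z ∪ (C ∩ R)) (by
      rintro x (hx | hx)
      · exact (hZ hx).1
      · exact hx.1) (hne.mono Set.subset_union_left) (by
      rintro a (ha | ha) b hb hab
      · by_cases haR : a ∈ R
        · have hav := huniq a (hZ ha).1 (hZ ha).2 haR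
          rcases hLR hb with h | h
          · exact Or.inl (hcl a ha b ⟨hb, h⟩ hab)
          · exact Or.inr ⟨hb, h⟩
        · exact Or.inl (hcl a ha b ⟨hb, hsep a (hZ ha).2 haR b hab hb⟩ hab)
      · by_cases haL : a ∈ L
        · have hav := huniq a ha.1 haL ha.2
          subst hav
          rcases hLR hb with h | h
          · exact Or.inl (hcl a hvZ b ⟨hb, h⟩ hab)
          · exact Or.inr ⟨hb, h⟩
        · exact Or.inr ⟨hb, hsep' a ha.2 haL b hab hb⟩)
    intro x hx
    rcases this hx.1 with h | h
    · exact h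
    · rw [huniq x hx.1 hx.2 h.2]; exact hvZ
  · have := hC Z (fun x hx => (hZ hx).1) hne (by
      intro a ha b hb hab
      have haR : a ∉ R := fun h => hvZ (huniq a (hZ ha).1 (hZ ha).2 h ▸ ha)
      exact hcl a ha b ⟨hb, hsep a (hZ ha).2 haR b hab hb⟩ hab)
    exact absurd (this hvm.1) hvZ

end ConnOn

/-! ### Pieces of bounded treewidth -/

/-- `Piece G t B U`: the set `B` has at most `t` vertices, all edges that leave `U` end in `B`, and
`G[B ∪ U]` minus the edges inside `B` has a tree decomposition with bags of size at most `t`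
whose root-bag is `B`. The decomposition is recorded by the way in which it is built: two pieces
with the same root-bag are united, or the root-bag `B'` is replaced by `B`, where the vertices of
`B' \ B` are forgotten. Edges inside `B` play no role. -/
inductive Piece {V : Type} (G : SimpleGraph V) (t : ℕ) : Set V → Set V → Prop
  | nil (B : Set V) : B.ncard ≤ t → Piece G t B ∅
  | union {B U₁ U₂ : Set V} :
      Piece G t B U₁ → Piece G t B U₂ → Disjoint U₁ U₂ → Piece G t B (U₁ ∪ U₂)
  | shift {B B' U' : Set V} :
      Piece G t B' U' → B.ncard ≤ t → Disjoint B U' →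
      (∀ u ∈ U' ∪ (B' \ B), ∀ v, G.Adj u v → v ∈ B ∪ (U' ∪ (B' \ B))) →
      Piece G t B (U' ∪ (B' \ B))

theorem disjoint_image_of_injOn {V V' : Type} {f : V → V'} {S T : Set V}
    (hf : Set.InjOn f (S ∪ T)) (h : Disjoint S T) : Disjoint (f '' S) (f '' T) := by
  refine Set.disjoint_left.2 ?_
  rintro _ ⟨x, hx, rfl⟩ ⟨y, hy, hyx⟩
  exact Set.disjoint_left.1 h hx (hf (Or.inr hy) (Or.inl hx) hyx ▸ hy)

namespace Piece

variable {V : Type} {G : SimpleGraph V} {t : ℕ} {B U : Set V}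

theorem ncard_le (h : Piece G t B U) : B.ncard ≤ t := by
  induction h with
  | nil B h => exact h
  | union _ _ _ ih _ => exact ih
  | shift _ h _ _ _ => exact h

theorem disjoint (h : Piece G t B U) : Disjoint B U := by
  induction h with
  | nil B h => exact Set.disjoint_empty _
  | union _ _ _ ih₁ ih₂ => exact Set.disjoint_union_right.2 ⟨ih₁, ih₂⟩
  | shift _ _ h _ _ => exact Set.disjoint_union_right.2 ⟨h, Set.disjoint_sdiff_right⟩

theorem closed (h : Piece G t B U) : ∀ u ∈ U, ∀ v, G.Adj u v → v ∈ B ∪ U := by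
  induction h with
  | nil B h => exact fun u hu => hu.elim
  | union _ _ _ ih₁ ih₂ =>
    rintro u (hu | hu) v huv
    · rcases ih₁ u hu v huv with h | h
      · exact Or.inl h
      · exact Or.inr (Or.inl h)
    · rcases ih₂ u hu v huv with h | h
      · exact Or.inl h
      · exact Or.inr (Or.inr h)
  | shift _ _ _ h _ => exact h

/-- Pieces are transported along maps that reflect the edges at `U`. -/
theorem map {V' : Type} {G' : SimpleGraph V'} [Finite V] (h : Piece G t B U) (f : V → V')
    (hinj : Set.InjOn f (B ∪ U))
    (hadj : ∀ u ∈ U, ∀ w, G'.Adj (f u) w → ∃ v, G.Adj u v ∧ f v = w) :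
    Piece G' t (f '' B) (f '' U) := by
  induction h with
  | nil B h =>
    rw [Set.image_empty]
    exact .nil _ ((Set.ncard_image_le (Set.toFinite B)).trans h)
  | @union B U₁ U₂ h₁ h₂ hd ih₁ ih₂ =>
    rw [Set.image_union]
    refine .union (ih₁ (hinj.mono ?_) fun u hu => hadj u (Or.inl hu))
      (ih₂ (hinj.mono ?_) fun u hu => hadj u (Or.inr hu)) ?_
    · exact Set.union_subset_union_right _ Set.subset_union_left
    · exact Set.union_subset_union_right _ Set.subset_union_right
    · exact disjoint_image_of_injOn (hinj.mono Set.subset_union_right) hd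
  | @shift B B' U' h hB hd hcl ih =>
    have e : f '' (U' ∪ (B' \ B)) = f '' U' ∪ (f '' B' \ f '' B) := by
      rw [Set.image_union]
      congr 1
      ext x
      constructor
      · rintro ⟨y, ⟨hy, hyB⟩, rfl⟩
        refine ⟨⟨y, hy, rfl⟩, ?_⟩
        rintro ⟨z, hz, hzy⟩
        exact hyB (hinj (Or.inl hz) (Or.inr (Or.inr ⟨hy, hyB⟩)) hzy ▸ hz)
      · rintro ⟨⟨y, hy, rfl⟩, hn⟩
        exact ⟨y, ⟨hy, fun hyB => hn ⟨y, hyB, rfl⟩⟩, rfl⟩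
    have hsub : B' ∪ U' ⊆ B ∪ (U' ∪ B' \ B) := by
      rintro x (hx | hx)
      · by_cases hxB : x ∈ B
        · exact Or.inl hxB
        · exact Or.inr (Or.inr ⟨hx, hxB⟩)
      · exact Or.inr (Or.inl hx)
    rw [e]
    refine .shift (ih (hinj.mono hsub) fun u hu => hadj u (Or.inl hu))
      ((Set.ncard_image_le (Set.toFinite B)).trans hB) ?_ ?_
    · exact disjoint_image_of_injOn
        (hinj.mono (Set.union_subset_union_right _ Set.subset_union_left)) hd
    · rw [← e]
      rintro _ ⟨u, hu, rfl⟩ w huw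
      obtain ⟨v, huv, rfl⟩ := hadj u hu w huw
      rcases hcl u hu v huv with h | h
      · exact Or.inl ⟨v, h, rfl⟩
      · exact Or.inr ⟨v, h, rfl⟩

/-- Whether `(B, U)` is a piece depends only on the edges at `U`. -/
theorem congr_adj {G' : SimpleGraph V} [Finite V] (h : Piece G t B U)
    (hadj : ∀ u ∈ U, ∀ w, G'.Adj u w → G.Adj u w) : Piece G' t B U := by
  have := h.map (G' := G') id (Set.injOn_id _) (fun u hu w huw => ⟨w, hadj u hu w huw, rfl⟩)
  simpa using this

/-- Pieces are closed under minors. The branch sets `β x` are disjoint and connected, possibly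
empty, and realize the edges of the minor `G'`. -/
theorem minor {V' : Type} {G' : SimpleGraph V'} [Finite V] [Finite V'] (h : Piece G t B U)
    (β : V' → Set V) (hconn : ∀ x, ConnOn G (β x))
    (hdisj : ∀ x y, x ≠ y → Disjoint (β x) (β y))
    (hadj : ∀ x y, G'.Adj x y → ∃ u ∈ β x, ∃ v ∈ β y, G.Adj u v) :
    Piece G' t {x | (β x ∩ B).Nonempty} {x | (β x ∩ U).Nonempty ∧ ¬ (β x ∩ B).Nonempty} := by
  have hcard : ∀ B : Set V, {x | (β x ∩ B).Nonempty}.ncard ≤ B.ncard := by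
    intro B
    choose f hf using fun x : {x | (β x ∩ B).Nonempty} => x.2
    rw [← Nat.card_coe_set_eq, ← Nat.card_coe_set_eq]
    refine Nat.card_le_card_of_injective (fun x => (⟨f x, (hf x).2⟩ : B)) ?_
    intro x y hxy
    by_contra hne
    refine Set.disjoint_left.1 (hdisj x y fun h => hne (Subtype.ext h)) (hf x).1 ?_
    rw [Subtype.mk.injEq] at hxy
    rw [hxy]
    exact (hf y).1
  have hin : ∀ {B U : Set V}, (∀ u ∈ U, ∀ v, G.Adj u v → v ∈ B ∪ U) → ∀ x,
      (β x ∩ U).Nonempty → ¬ (β x ∩ B).Nonempty → β x ⊆ U :=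
    fun hcl x h₁ h₂ => (hconn x).subset_of_closed hcl h₁ h₂
  have hcl' : ∀ {B U : Set V}, (∀ u ∈ U, ∀ v, G.Adj u v → v ∈ B ∪ U) →
      ∀ x ∈ {x | (β x ∩ U).Nonempty ∧ ¬ (β x ∩ B).Nonempty}, ∀ y, G'.Adj x y →
      y ∈ {x | (β x ∩ B).Nonempty} ∪ {x | (β x ∩ U).Nonempty ∧ ¬ (β x ∩ B).Nonempty} := by
    rintro B U hcl x ⟨hx₁, hx₂⟩ y hxy
    obtain ⟨u, hu, v, hv, huv⟩ := hadj x y hxy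
    by_cases hy : (β y ∩ B).Nonempty
    · exact Or.inl hy
    · refine Or.inr ⟨⟨v, hv, ?_⟩, hy⟩
      exact (hcl u (hin hcl x hx₁ hx₂ hu) v huv).resolve_left fun h => hy ⟨v, hv, h⟩
  induction h with
  | nil B h =>
    have : {x | (β x ∩ ∅).Nonempty ∧ ¬ (β x ∩ B).Nonempty} = ∅ := by ext; simp
    rw [this]
    exact .nil _ ((hcard B).trans h)
  | @union B U₁ U₂ h₁ h₂ hd ih₁ ih₂ =>
    have e : {x | (β x ∩ (U₁ ∪ U₂)).Nonempty ∧ ¬ (β x ∩ B).Nonempty} =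
        {x | (β x ∩ U₁).Nonempty ∧ ¬ (β x ∩ B).Nonempty} ∪
        {x | (β x ∩ U₂).Nonempty ∧ ¬ (β x ∩ B).Nonempty} := by
      ext x
      simp only [Set.mem_ofPred_eq, Set.mem_union, Set.inter_union_distrib_left,
        Set.union_nonempty]
      tauto
    rw [e]
    refine .union ih₁ ih₂ (Set.disjoint_left.2 ?_)
    rintro x ⟨hx₁, hx⟩ ⟨hx₂, -⟩
    obtain ⟨v, hv, hv₂⟩ := hx₂
    exact Set.disjoint_left.1 hd (hin h₁.closed x hx₁ hx hv) hv₂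
  | @shift B B' U' h hB hd hcl ih =>
    have e : {x | (β x ∩ (U' ∪ (B' \ B))).Nonempty ∧ ¬ (β x ∩ B).Nonempty} =
        {x | (β x ∩ U').Nonempty ∧ ¬ (β x ∩ B').Nonempty} ∪
        ({x | (β x ∩ B').Nonempty} \ {x | (β x ∩ B).Nonempty}) := by
      ext x
      constructor
      · rintro ⟨hx, hxB⟩
        by_cases hx' : (β x ∩ B').Nonempty
        · exact Or.inr ⟨hx', hxB⟩
        · refine Or.inl ⟨?_, hx'⟩
          obtain ⟨v, hv, hv' | hv'⟩ := hx
          · exact ⟨v, hv, hv'⟩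
          · exact absurd ⟨v, hv, hv'.1⟩ hx'
      · rintro (⟨hx, hxB'⟩ | ⟨⟨v, hv, hvB'⟩, hxB⟩)
        · have hsub := hin h.closed x hx hxB'
          obtain ⟨v, hv, hv'⟩ := hx
          refine ⟨⟨v, hv, Or.inl hv'⟩, ?_⟩
          rintro ⟨w, hw, hwB⟩
          exact Set.disjoint_left.1 hd hwB (hsub hw)
        · exact ⟨⟨v, hv, Or.inr ⟨hvB', fun hvB => hxB ⟨v, hv, hvB⟩⟩⟩, hxB⟩
    rw [e]
    refine .shift ih ((hcard B).trans hB) (Set.disjoint_left.2 ?_) ?_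
    · rintro x ⟨v, hv, hvB⟩ ⟨hx₁, hx₂⟩
      exact Set.disjoint_left.1 hd hvB (hin h.closed x hx₁ hx₂ hv)
    · rw [← e]
      exact hcl' hcl

end Piece

/-- `Subpiece G t B U B' U'`: the piece `(B', U')` occurs in the construction of the piece
`(B, U)`. -/
inductive Subpiece {V : Type} (G : SimpleGraph V) (t : ℕ) : Set V → Set V → Set V → Set V → Prop
  | refl {B U : Set V} : Piece G t B U → Subpiece G t B U B U
  | union {B U₁ U₂ B' U' : Set V} :
      Subpiece G t B U₁ B' U' → Piece G t B U₂ → Disjoint U₁ U₂ →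
      Subpiece G t B (U₁ ∪ U₂) B' U'
  | shift {B B₁ U₁ B' U' : Set V} :
      Subpiece G t B₁ U₁ B' U' → B.ncard ≤ t → Disjoint B U₁ →
      (∀ u ∈ U₁ ∪ (B₁ \ B), ∀ v, G.Adj u v → v ∈ B ∪ (U₁ ∪ (B₁ \ B))) →
      Subpiece G t B (U₁ ∪ (B₁ \ B)) B' U'

namespace Subpiece

variable {V : Type} {G : SimpleGraph V} {t : ℕ} {B U B' U' : Set V}

theorem piece (h : Subpiece G t B U B' U') : Piece G t B U := by
  induction h with
  | refl h => exact h
  | union _ h₂ hd ih => exact .union ih h₂ hd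
  | shift _ hB hd hcl ih => exact .shift ih hB hd hcl

theorem piece_right (h : Subpiece G t B U B' U') : Piece G t B' U' := by
  induction h with
  | refl h => exact h
  | union _ _ _ ih => exact ih
  | shift _ _ _ _ ih => exact ih

theorem subset (h : Subpiece G t B U B' U') : U' ⊆ U := by
  induction h with
  | refl h => exact subset_rfl
  | union _ _ _ ih => exact ih.trans Set.subset_union_left
  | shift _ _ _ _ ih => exact ih.trans Set.subset_union_left

theorem union_subset (h : Subpiece G t B U B' U') : B' ∪ U' ⊆ B ∪ U := by
  induction h with
  | refl h => exact subset_rfl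
  | union _ _ _ ih => exact ih.trans (Set.union_subset_union_right _ Set.subset_union_left)
  | @shift B B₁ U₁ B' U' _ _ _ _ ih =>
    refine ih.trans ?_
    rintro x (hx | hx)
    · by_cases hxB : x ∈ B
      · exact Or.inl hxB
      · exact Or.inr (Or.inr ⟨hx, hxB⟩)
    · exact Or.inr (Or.inl hx)

/-- If the subpiece `(B', U')` of `(B, U)` is replaced by another piece `(f '' B', Z)`, then the
result is a piece again. Here `f` embeds what is not replaced into the new graph `G'`, which may
have additional edges inside the image of `B'`. -/
theorem replace {W : Type} {G' : SimpleGraph W} [Finite V] (h : Subpiece G t B U B' U')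
    (f : V → W) (Z : Set W) (hZ : Piece G' t (f '' B') Z) (hinj : Set.InjOn f U'ᶜ)
    (hZd : Disjoint (f '' U'ᶜ) Z)
    (hadj : ∀ a ∉ U', ∀ w, G'.Adj (f a) w → (∃ b ∉ U', G.Adj a b ∧ f b = w) ∨
      (a ∈ B' ∧ w ∈ f '' B' ∪ Z)) :
    Piece G' t (f '' B) (f '' (U \ U') ∪ Z) := by
  have im : ∀ {S : Set V}, Disjoint S U' → S ⊆ U'ᶜ := fun hd x hx hx' =>
    Set.disjoint_left.1 hd hx hx'
  induction h with
  | refl h => simpa using hZ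
  | @union B U₁ U₂ B' U' h h₂ hd ih =>
    have e : (U₁ ∪ U₂) \ U' = (U₁ \ U') ∪ U₂ := by
      rw [Set.union_sdiff_distrib]
      congr 1
      exact sdiff_eq_left.2 (hd.symm.mono_right h.subset)
    have hU₂ : U₂ ⊆ U'ᶜ := im (hd.symm.mono_right h.subset)
    have hB : B ⊆ U'ᶜ := im (h.piece.disjoint.mono_right h.subset)
    rw [e, Set.image_union, Set.union_assoc, Set.union_comm (f '' U₂), ← Set.union_assoc]
    refine .union (ih hZ hinj hZd hadj im) (h₂.map f ?_ ?_) ?_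
    · exact hinj.mono (Set.union_subset hB hU₂)
    · intro u hu w huw
      rcases hadj u (hU₂ hu) w huw with ⟨b, -, hb, rfl⟩ | ⟨hu', -⟩
      · exact ⟨b, hb, rfl⟩
      · exfalso
        rcases h.union_subset (Or.inl hu') with hx | hx
        · exact Set.disjoint_left.1 h₂.disjoint hx hu
        · exact Set.disjoint_left.1 hd hx hu
    · refine Set.disjoint_union_left.2 ⟨?_, ?_⟩
      · refine disjoint_image_of_injOn (hinj.mono (Set.union_subset ?_ hU₂))
          (hd.mono_left Set.sdiff_subset)
        exact fun x hx => hx.2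
      · exact (hZd.mono_left (Set.image_mono hU₂)).symm
  | @shift B B₁ U₁ B' U' h hB hd hcl ih =>
    have hB₁ : B₁ ⊆ U'ᶜ := im (h.piece.disjoint.mono_right h.subset)
    have hBc : B ⊆ U'ᶜ := im (hd.mono_right h.subset)
    have e : f '' ((U₁ ∪ (B₁ \ B)) \ U') ∪ Z =
        (f '' (U₁ \ U') ∪ Z) ∪ (f '' B₁ \ f '' B) := by
      ext x
      constructor
      · rintro (⟨y, ⟨hy | hy, hyU⟩, rfl⟩ | hx)
        · exact Or.inl (Or.inl ⟨y, ⟨hy, hyU⟩, rfl⟩)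
        · refine Or.inr ⟨⟨y, hy.1, rfl⟩, ?_⟩
          rintro ⟨z, hz, hzy⟩
          exact hy.2 (hinj (hBc hz) hyU hzy ▸ hz)
        · exact Or.inl (Or.inr hx)
      · rintro ((⟨y, ⟨hy, hyU⟩, rfl⟩ | hx) | ⟨⟨y, hy, rfl⟩, hn⟩)
        · exact Or.inl ⟨y, ⟨Or.inl hy, hyU⟩, rfl⟩
        · exact Or.inr hx
        · exact Or.inl ⟨y, ⟨Or.inr ⟨hy, fun h => hn ⟨y, h, rfl⟩⟩, hB₁ hy⟩, rfl⟩
    rw [e]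
    refine .shift (ih hZ hinj hZd hadj im) ((Set.ncard_image_le (Set.toFinite B)).trans hB) ?_ ?_
    · refine Set.disjoint_union_right.2 ⟨?_, hZd.mono_left (Set.image_mono hBc)⟩
      refine disjoint_image_of_injOn (hinj.mono (Set.union_subset hBc ?_))
        (hd.mono_right Set.sdiff_subset)
      exact fun x hx => hx.2
    · rw [← e]
      have hsub : B' ∪ U' ⊆ B ∪ (U₁ ∪ (B₁ \ B)) := (Subpiece.shift h hB hd hcl).union_subset
      have hB'c : B' ⊆ U'ᶜ := im h.piece_right.disjoint
      have hfB' : f '' B' ⊆ f '' B ∪ (f '' ((U₁ ∪ (B₁ \ B)) \ U') ∪ Z) := by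
        rintro _ ⟨b, hb, rfl⟩
        rcases hsub (Or.inl hb) with h | h
        · exact Or.inl ⟨b, h, rfl⟩
        · exact Or.inr (Or.inl ⟨b, ⟨h, hB'c hb⟩, rfl⟩)
      rintro _ (⟨u, ⟨hu, huU⟩, rfl⟩ | hx) w huw
      · rcases hadj u huU w huw with ⟨b, hbU, hb, rfl⟩ | ⟨-, hw⟩
        · rcases hcl u hu b hb with h | h
          · exact Or.inl ⟨b, h, rfl⟩
          · exact Or.inr (Or.inl ⟨b, ⟨h, hbU⟩, rfl⟩)
        · rcases hw with hw | hw
          · exact hfB' hw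
          · exact Or.inr (Or.inr hw)
      · rcases hZ.closed _ hx w huw with hw | hw
        · exact hfB' hw
        · exact Or.inr (Or.inr hw)

end Subpiece

namespace Piece

variable {V : Type} {G : SimpleGraph V} {t : ℕ} {B U : Set V}

/-- A piece with more than `2 ^ |S| * t` vertices contains a subpiece whose class is not in `S`, or
two properly nested subpieces of the same class. -/
theorem exists_repeated [Finite V] {T : Type*} [DecidableEq T] (cls : Set V → Set V → T)
    (h : Piece G t B U) : ∀ S : Finset T, 2 ^ S.card * t < U.ncard →
    (∃ B' U', Subpiece G t B U B' U' ∧ cls B' U' ∉ S) ∨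
    ∃ B₁ U₁ B₂ U₂, Subpiece G t B U B₁ U₁ ∧ Subpiece G t B₁ U₁ B₂ U₂ ∧ U₂ ⊂ U₁ ∧
      cls B₁ U₁ = cls B₂ U₂ := by
  induction h with
  | nil B h => intro S hS; simp at hS
  | @union B U₁ U₂ h₁ h₂ hd ih₁ ih₂ =>
    intro S hS
    by_cases hc : cls B (U₁ ∪ U₂) ∈ S
    swap
    · exact Or.inl ⟨B, _, .refl (.union h₁ h₂ hd), hc⟩
    -- one of the two parts is large, and misses the other one
    have key : ∀ {U₁ U₂ : Set V}, cls B (U₁ ∪ U₂) ∈ S → Disjoint U₁ U₂ → Piece G t B U₁ →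
        Piece G t B U₂ → U₂.Nonempty → 2 ^ (S.card - 1) * t < U₁.ncard →
        (∀ S : Finset T, 2 ^ S.card * t < U₁.ncard →
          (∃ B' U', Subpiece G t B U₁ B' U' ∧ cls B' U' ∉ S) ∨
          ∃ B₁ U₁' B₂ U₂, Subpiece G t B U₁ B₁ U₁' ∧ Subpiece G t B₁ U₁' B₂ U₂ ∧ U₂ ⊂ U₁' ∧
          cls B₁ U₁' = cls B₂ U₂) →
        (∃ B' U', Subpiece G t B (U₁ ∪ U₂) B' U' ∧ cls B' U' ∉ S) ∨
        ∃ B₁ U₁' B₂ U₂', Subpiece G t B (U₁ ∪ U₂) B₁ U₁' ∧ Subpiece G t B₁ U₁' B₂ U₂' ∧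
          U₂' ⊂ U₁' ∧ cls B₁ U₁' = cls B₂ U₂' := by
      intro U₁ U₂ hc hd h₁ h₂ hne hlt ih
      rcases ih (S.erase (cls B (U₁ ∪ U₂))) (by rwa [Finset.card_erase_of_mem hc]) with
        ⟨B', U', hsub, hn⟩ | ⟨B₁, U₁', B₂, U₂', h1, h2, h3, h4⟩
      · by_cases he : cls B' U' = cls B (U₁ ∪ U₂)
        · refine Or.inr ⟨B, _, B', U', .refl (.union h₁ h₂ hd), .union hsub h₂ hd, ?_, he.symm⟩
          refine (hsub.subset.trans Set.subset_union_left).ssubset_of_ne fun h => ?_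
          obtain ⟨x, hx⟩ := hne
          exact Set.disjoint_left.1 hd (hsub.subset (h ▸ Or.inr hx)) hx
        · exact Or.inl ⟨B', U', .union hsub h₂ hd, fun h => hn (Finset.mem_erase.2 ⟨he, h⟩)⟩
      · exact Or.inr ⟨B₁, U₁', B₂, U₂', .union h1 h₂ hd, h2, h3, h4⟩
    rcases Set.eq_empty_or_nonempty U₁ with rfl | hne₁
    · simp only [Set.empty_union] at hS ⊢; exact ih₂ S hS
    rcases Set.eq_empty_or_nonempty U₂ with rfl | hne₂
    · simp only [Set.union_empty] at hS ⊢; exact ih₁ S hS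
    rw [Set.ncard_union_eq hd] at hS
    obtain ⟨q, hq⟩ : ∃ q, S.card = q + 1 := ⟨S.card - 1, by
      have := Finset.card_pos.2 ⟨_, hc⟩; omega⟩
    rw [hq, pow_succ] at hS
    have : 2 ^ q * t < U₁.ncard ∨ 2 ^ q * t < U₂.ncard := by
      by_contra hcon
      push Not at hcon
      nlinarith [hcon.1, hcon.2]
    rcases this with hlt | hlt
    · exact key hc hd h₁ h₂ hne₂ (by rw [hq]; exact hlt) ih₁
    · have := key (by rwa [Set.union_comm]) hd.symm h₂ h₁ hne₁ (by rw [hq]; exact hlt) ih₂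
      rwa [Set.union_comm]
  | @shift B B' U' h hB hd hcl ih =>
    intro S hS
    by_cases hc : cls B (U' ∪ (B' \ B)) ∈ S
    swap
    · exact Or.inl ⟨B, _, .refl (.shift h hB hd hcl), hc⟩
    rcases Set.eq_empty_or_nonempty (B' \ B) with he | ⟨x, hx⟩
    · have : U' ∪ (B' \ B) = U' := by rw [he, Set.union_empty]
      rcases ih S (by rwa [this] at hS) with ⟨B₁, U₁, h1, h2⟩ | ⟨B₁, U₁', B₂, U₂', h1, h2, h3, h4⟩
      · exact Or.inl ⟨B₁, U₁, .shift h1 hB hd hcl, h2⟩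
      · exact Or.inr ⟨B₁, U₁', B₂, U₂', .shift h1 hB hd hcl, h2, h3, h4⟩
    obtain ⟨q, hq⟩ : ∃ q, S.card = q + 1 := ⟨S.card - 1, by
      have := Finset.card_pos.2 ⟨_, hc⟩; omega⟩
    have h1 : (U' ∪ (B' \ B)).ncard ≤ U'.ncard + t :=
      (Set.ncard_union_le _ _).trans (Nat.add_le_add_left
        ((Set.ncard_le_ncard Set.sdiff_subset).trans h.ncard_le) _)
    rw [hq, pow_succ] at hS
    have h2 : 2 ^ (S.erase (cls B (U' ∪ (B' \ B)))).card * t < U'.ncard := by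
      rw [Finset.card_erase_of_mem hc, hq, Nat.add_sub_cancel]
      have : t ≤ 2 ^ q * t := Nat.le_mul_of_pos_left _ (by positivity)
      nlinarith
    rcases ih _ h2 with ⟨B₁, U₁, hsub, hn⟩ | ⟨B₁, U₁', B₂, U₂', h1, h2, h3, h4⟩
    · by_cases he : cls B₁ U₁ = cls B (U' ∪ (B' \ B))
      · refine Or.inr ⟨B, _, B₁, U₁, .refl (.shift h hB hd hcl), .shift hsub hB hd hcl, ?_,
          he.symm⟩
        refine (hsub.subset.trans Set.subset_union_left).ssubset_of_ne fun h' => ?_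
        exact Set.disjoint_left.1 h.disjoint hx.1 (hsub.subset (h' ▸ Or.inr hx))
      · exact Or.inl ⟨B₁, U₁, .shift hsub hB hd hcl, fun h => hn (Finset.mem_erase.2 ⟨he, h⟩)⟩
    · exact Or.inr ⟨B₁, U₁', B₂, U₂', .shift h1 hB hd hcl, h2, h3, h4⟩

/-- A piece with more than `M ≥ t` vertices has a subpiece with more than `M` and at most `2 * M`
vertices. -/
theorem exists_window [Finite V] {M : ℕ} (hM : t ≤ M) (h : Piece G t B U) (hU : M < U.ncard) :
    ∃ B' U', Piece G t B' U' ∧ U' ⊆ U ∧ B' ∪ U' ⊆ B ∪ U ∧ M < U'.ncard ∧ U'.ncard ≤ 2 * M := by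
  induction h with
  | nil B h => simp at hU
  | @union B U₁ U₂ h₁ h₂ hd ih₁ ih₂ =>
    by_cases hlt₁ : M < U₁.ncard
    · obtain ⟨B', U', h1, h2, h3, h4⟩ := ih₁ hlt₁
      exact ⟨B', U', h1, h2.trans Set.subset_union_left,
        h3.trans (Set.union_subset_union_right _ Set.subset_union_left), h4⟩
    by_cases hlt₂ : M < U₂.ncard
    · obtain ⟨B', U', h1, h2, h3, h4⟩ := ih₂ hlt₂
      exact ⟨B', U', h1, h2.trans Set.subset_union_right,
        h3.trans (Set.union_subset_union_right _ Set.subset_union_right), h4⟩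
    refine ⟨B, _, .union h₁ h₂ hd, subset_rfl, subset_rfl, hU, ?_⟩
    have := Set.ncard_union_le U₁ U₂
    omega
  | @shift B B' U' h hB hd hcl ih =>
    by_cases hlt : M < U'.ncard
    · obtain ⟨B₁, U₁, h1, h2, h3, h4⟩ := ih hlt
      exact ⟨B₁, U₁, h1, h2.trans Set.subset_union_left,
        h3.trans (Subpiece.shift (.refl h) hB hd hcl).union_subset, h4⟩
    refine ⟨B, _, .shift h hB hd hcl, subset_rfl, subset_rfl, hU, ?_⟩
    have h1 : (U' ∪ (B' \ B)).ncard ≤ U'.ncard + t :=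
      (Set.ncard_union_le _ _).trans (Nat.add_le_add_left
        ((Set.ncard_le_ncard Set.sdiff_subset).trans h.ncard_le) _)
    omega

end Piece

/-! ### Nested cuts -/

/-- A cut `(B, U)` of order at most `s`: all edges that leave `U` end in `B`. -/
structure IsCut {V : Type} (G : SimpleGraph V) (s : ℕ) (x : Set V × Set V) : Prop where
  ncard_le : x.1.ncard ≤ s
  disj : Disjoint x.1 x.2
  closed : ∀ u ∈ x.2, ∀ v, G.Adj u v → v ∈ x.1 ∪ x.2

/-- The cut `y` is nested in the cut `x`. -/
def Nested {V : Type} (x y : Set V × Set V) : Prop :=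
  y.2 ⊆ x.2 ∧ y.1 ∪ y.2 ⊆ x.1 ∪ x.2

theorem Nested.refl {V : Type} (x : Set V × Set V) : Nested x x := ⟨subset_rfl, subset_rfl⟩

theorem Nested.trans {V : Type} {x y z : Set V × Set V} (h₁ : Nested x y) (h₂ : Nested y z) :
    Nested x z := ⟨h₂.1.trans h₁.1, h₂.2.trans h₁.2⟩

/-- The first `m` terms of `c` are properly nested cuts of order at most `s`. -/
structure CutChain {V : Type} (G : SimpleGraph V) (s m : ℕ) (c : ℕ → Set V × Set V) : Prop where
  cut : ∀ i < m, IsCut G s (c i)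
  nested : ∀ i j, i < j → j < m → Nested (c i) (c j)
  strict : ∀ i j, i < j → j < m → (c j).2 ≠ (c i).2

theorem CutChain.nested_le {V : Type} {G : SimpleGraph V} {s m : ℕ} {c : ℕ → Set V × Set V}
    (h : CutChain G s m c) {i j : ℕ} (hij : i ≤ j) (hj : j < m) : Nested (c i) (c j) := by
  rcases hij.eq_or_lt with rfl | hlt
  · exact Nested.refl _
  · exact h.nested i j hlt hj

theorem Piece.isCut {V : Type} {G : SimpleGraph V} {t : ℕ} {B U : Set V} (h : Piece G t B U) :
    IsCut G t (B, U) := ⟨h.ncard_le, h.disjoint, h.closed⟩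

theorem CutChain.cons {V : Type} {G : SimpleGraph V} {s m : ℕ} {c : ℕ → Set V × Set V}
    (h : CutChain G s m c) {x : Set V × Set V} (hx : IsCut G s x)
    (hn : ∀ i < m, Nested x (c i)) (hs : ∀ i < m, (c i).2 ≠ x.2) :
    CutChain G s (m + 1) (fun i => Nat.casesOn i x c) := by
  refine ⟨?_, ?_, ?_⟩
  · rintro (_ | i) hi
    · exact hx
    · exact h.cut i (by omega)
  · rintro (_ | i) (_ | j) hij hj
    · omega
    · exact hn j (by omega)
    · omega
    · exact h.nested i j (by omega) (by omega)
  · rintro (_ | i) (_ | j) hij hj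
    · omega
    · exact hs j (by omega)
    · omega
    · exact h.strict i j (by omega) (by omega)

/-- A large piece contains a long chain of properly nested cuts. -/
theorem Piece.exists_chain {V : Type} {G : SimpleGraph V} {t : ℕ} {B U : Set V} [Finite V]
    (h : Piece G t B U) : ∀ N : ℕ, 2 ^ N * t < U.ncard →
    ∃ c, CutChain G t (N + 1) c ∧ ∀ i < N + 1, Nested (B, U) (c i) := by
  have single : ∀ {B U : Set V}, Piece G t B U → ∃ c, CutChain G t (0 + 1) c ∧
      ∀ i < 0 + 1, Nested (B, U) (c i) := by
    intro B U h
    refine ⟨fun _ => (B, U), ⟨fun _ _ => h.isCut, ?_, ?_⟩, fun _ _ => Nested.refl _⟩ <;>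
    · intro i j hij hj; omega
  have step : ∀ {B U B' U' : Set V} {N : ℕ}, Piece G t B U → U' ⊂ U → B' ∪ U' ⊆ B ∪ U →
      (∃ c, CutChain G t (N + 1) c ∧ ∀ i < N + 1, Nested (B', U') (c i)) →
      ∃ c, CutChain G t (N + 1 + 1) c ∧ ∀ i < N + 1 + 1, Nested (B, U) (c i) := by
    rintro B U B' U' N h hss hsub ⟨c, hc, hn⟩
    have hn' : ∀ i < N + 1, Nested (B, U) (c i) := fun i hi =>
      Nested.trans ⟨hss.1, hsub⟩ (hn i hi)
    refine ⟨_, hc.cons h.isCut hn' ?_, ?_⟩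
    · intro i hi he
      have := (hn i hi).1
      rw [he] at this
      exact hss.2 this
    · rintro (_ | i) hi
      · exact Nested.refl _
      · exact hn' i (by omega)
  induction h with
  | nil B h => intro N hN; simp at hN
  | @union B U₁ U₂ h₁ h₂ hd ih₁ ih₂ =>
    intro N hN
    rcases Set.eq_empty_or_nonempty U₁ with rfl | ⟨x₁, hx₁⟩
    · simp only [Set.empty_union] at hN ⊢; exact ih₂ N hN
    rcases Set.eq_empty_or_nonempty U₂ with rfl | ⟨x₂, hx₂⟩
    · simp only [Set.union_empty] at hN ⊢; exact ih₁ N hN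
    rcases N with _ | N
    · exact single (.union h₁ h₂ hd)
    rw [Set.ncard_union_eq hd, pow_succ] at hN
    have : 2 ^ N * t < U₁.ncard ∨ 2 ^ N * t < U₂.ncard := by
      by_contra hcon
      push Not at hcon
      nlinarith [hcon.1, hcon.2]
    rcases this with hlt | hlt
    · refine step (.union h₁ h₂ hd) ?_
        (Set.union_subset_union_right _ Set.subset_union_left) (ih₁ N hlt)
      exact ⟨Set.subset_union_left, fun h => Set.disjoint_left.1 hd (h (Or.inr hx₂)) hx₂⟩
    · refine step (.union h₁ h₂ hd) ?_
        (Set.union_subset_union_right _ Set.subset_union_right) (ih₂ N hlt)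
      exact ⟨Set.subset_union_right, fun h => Set.disjoint_left.1 hd hx₁ (h (Or.inl hx₁))⟩
  | @shift B B' U' h hB hd hcl ih =>
    intro N hN
    have hsub := (Subpiece.shift (.refl h) hB hd hcl).union_subset
    rcases Set.eq_empty_or_nonempty (B' \ B) with he | ⟨x, hx⟩
    · have he' : U' ∪ (B' \ B) = U' := by rw [he, Set.union_empty]
      obtain ⟨c, hc, hn⟩ := ih N (by rwa [he'] at hN)
      exact ⟨c, hc, fun i hi => Nested.trans ⟨Set.subset_union_left, hsub⟩ (hn i hi)⟩
    rcases N with _ | N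
    · exact single (.shift h hB hd hcl)
    refine step (.shift h hB hd hcl) ?_ hsub (ih N ?_)
    · exact ⟨Set.subset_union_left, fun h' => Set.disjoint_left.1 h.disjoint hx.1 (h' (Or.inr hx))⟩
    · have h1 : (U' ∪ (B' \ B)).ncard ≤ U'.ncard + t :=
        (Set.ncard_union_le _ _).trans (Nat.add_le_add_left
          ((Set.ncard_le_ncard Set.sdiff_subset).trans h.ncard_le) _)
      rw [pow_succ] at hN
      have : t ≤ 2 ^ N * t := Nat.le_mul_of_pos_left _ (by positivity)
      nlinarith

/-- From a long chain of nested cuts, one can pass to a chain of `m` cuts that have the same order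
`s'` and that are linked: no cut of smaller order lies between the first and the last one. -/
theorem CutChain.exists_linked {V : Type} {G : SimpleGraph V} {m : ℕ} (hm : 1 ≤ m) :
    ∀ (s : ℕ) {c : ℕ → Set V × Set V}, CutChain G s (m ^ (s + 1)) c →
    ∃ c' s', s' ≤ s ∧ CutChain G s' m c' ∧ (∀ i < m, (c' i).1.ncard = s') ∧
      (∀ i < m, Nested (c 0) (c' i)) ∧
      ∀ z, IsCut G s z → Nested (c' 0) z → Nested z (c' (m - 1)) → s' ≤ z.1.ncard := by
  intro s
  induction s with
  | zero =>
    intro c hc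
    have e : m ^ (0 + 1) = m := by simp
    rw [e] at hc
    exact ⟨c, 0, le_rfl, hc, fun i hi => Nat.le_zero.1 (hc.cut i hi).ncard_le,
      fun i hi => hc.nested_le (Nat.zero_le _) hi, fun _ _ _ _ => Nat.zero_le _⟩
  | succ s ih =>
    intro c hc
    have hlt : ∀ j < m ^ (s + 1), ∀ i < m, j * m + i < m ^ (s + 1 + 1) := by
      intro j hj i hi
      have : (j + 1) * m ≤ m ^ (s + 1) * m := Nat.mul_le_mul_right _ hj
      rw [pow_succ]
      nlinarith
    -- the chain is cut into `m ^ (s + 1)` blocks of length `m`; a block that is not linked has a cut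
    -- of order at most `s` inside
    by_cases hblock : ∃ j < m ^ (s + 1), ∀ z, IsCut G (s + 1) z → Nested (c (j * m)) z →
        Nested z (c (j * m + (m - 1))) → s + 1 ≤ z.1.ncard
    · obtain ⟨j, hj, hz⟩ := hblock
      refine ⟨fun i => c (j * m + i), s + 1, le_rfl, ⟨?_, ?_, ?_⟩, ?_, ?_, ?_⟩
      · exact fun i hi => hc.cut _ (hlt j hj i hi)
      · exact fun i i' h h' => hc.nested _ _ (by omega) (hlt j hj i' h')
      · exact fun i i' h h' => hc.strict _ _ (by omega) (hlt j hj i' h')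
      · intro i hi
        refine le_antisymm (hc.cut _ (hlt j hj i hi)).ncard_le ?_
        exact hz _ (hc.cut _ (hlt j hj i hi)) (hc.nested_le (by omega) (hlt j hj i hi))
          (hc.nested_le (by omega) (hlt j hj _ (by omega)))
      · exact fun i hi => hc.nested_le (Nat.zero_le _) (hlt j hj i hi)
      · exact fun z h1 h2 h3 => hz z h1 h2 h3
    · push Not at hblock
      choose! z hz1 hz2 hz3 hz4 using hblock
      have hblk : ∀ i j, i < j → j < m ^ (s + 1) → i * m + (m - 1) < j * m := by
        intro i j hij hj
        have : (i + 1) * m ≤ j * m := Nat.mul_le_mul_right _ hij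
        have : i * m + m = (i + 1) * m := by ring
        omega
      -- the cuts inside the blocks form a chain themselves
      have hch : CutChain G s (m ^ (s + 1)) z := by
        refine ⟨?_, ?_, ?_⟩
        · intro i hi
          exact ⟨Nat.lt_succ_iff.1 (hz4 i hi), (hz1 i hi).disj, (hz1 i hi).closed⟩
        · intro i j hij hj
          have h1 := hz3 i (hij.trans hj)
          have h2 := hc.nested _ _ (hblk i j hij hj) (hlt j hj 0 (by omega))
          exact (h1.trans h2).trans (hz2 j hj)
        · intro i j hij hj he
          have h1 := hz3 i (hij.trans hj)
          have h2 := hc.nested _ _ (hblk i j hij hj) (hlt j hj 0 (by omega))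
          refine hc.strict _ _ (hblk i j hij hj) (hlt j hj 0 (by omega)) ?_
          refine subset_antisymm h2.1 ?_
          exact h1.1.trans (he ▸ (hz2 j hj).1)
      obtain ⟨c', s', h1, h2, h3, h4, h5⟩ := ih hch
      refine ⟨c', s', h1.trans (Nat.le_succ s), h2, h3, ?_, ?_⟩
      · intro i hi
        have := hz2 0 (by positivity)
        rw [zero_mul] at this
        exact this.trans (h4 i hi)
      · intro x hx hx1 hx2
        by_cases hxs : x.1.ncard ≤ s
        · exact h5 x ⟨hxs, hx.disj, hx.closed⟩ hx1 hx2
        · omega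

/-! ### Menger's theorem for connected sets -/

/-- Every separation `(L, R)` of `G` with `A ⊆ L` and `B ⊆ R` has order at least `k`. -/
def SepGE {V : Type} (G : SimpleGraph V) (A B : Set V) (k : ℕ) : Prop :=
  ∀ L R : Set V, A ⊆ L → B ⊆ R → L ∪ R = Set.univ →
    (∀ u ∈ L, u ∉ R → ∀ v, G.Adj u v → v ∈ L) → k ≤ (L ∩ R).ncard

/-- If `k` disjoint sets meet a set `T` of size `k`, then each of them contains exactly one element
of `T`. -/
theorem exists_transversal {V : Type} [Finite V] {k : ℕ} (C : Fin k → Set V) (T : Set V)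
    (hT : T.ncard = k) (hdj : ∀ i j, i ≠ j → Disjoint (C i) (C j))
    (hne : ∀ i, (C i ∩ T).Nonempty) :
    ∃ f : Fin k → V, (∀ i, f i ∈ C i ∧ f i ∈ T) ∧ (∀ i, ∀ v ∈ C i, v ∈ T → v = f i) ∧
      ∀ v ∈ T, ∃ i, f i = v := by
  choose f hf1 hf2 using hne
  have hinj : Function.Injective f := by
    intro i j hij
    by_contra hne
    exact Set.disjoint_left.1 (hdj i j hne) (hf1 i) (hij ▸ hf1 j)
  have hsurj : ∀ v ∈ T, ∃ i, f i = v := by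
    have : Set.range f = T := by
      refine Set.eq_of_subset_of_ncard_le (by rintro _ ⟨i, rfl⟩; exact hf2 i) ?_
      rw [hT, ← Set.image_univ, Set.ncard_image_of_injective _ hinj, Set.ncard_univ]
      simp
    intro v hv
    rwa [← this] at hv
  refine ⟨f, fun i => ⟨hf1 i, hf2 i⟩, ?_, hsurj⟩
  intro i v hv hvT
  obtain ⟨j, rfl⟩ := hsurj v hvT
  by_contra hne
  exact Set.disjoint_left.1 (hdj i j fun h => hne (h ▸ rfl)) hv (hf1 j)

/-- If no separation of order less than `k` separates `A` from `B`, then there are `k` disjoint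
connected sets that meet both `A` and `B`. The induction is on the number of edges: if deleting the
edge `xy` destroys the hypothesis, witnessed by the separation `(L, R)` of order `k - 1`, then the
induction hypothesis is applied to the part of `G` in `L` with the targets `(L ∩ R) ∪ {x}`, and to
the part in `R` with the targets `(L ∩ R) ∪ {y}`. -/
theorem exists_linkage {V : Type} [Finite V] (k : ℕ) : ∀ (G : SimpleGraph V) (A B : Set V),
    SepGE G A B k → ∃ C : Fin k → Set V, (∀ i, ConnOn G (C i)) ∧
      (∀ i j, i ≠ j → Disjoint (C i) (C j)) ∧ ∀ i, (C i ∩ A).Nonempty ∧ (C i ∩ B).Nonempty := by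
  classical
  intro G
  induction hN : G.edgeSet.ncard using Nat.strong_induction_on generalizing G with
  | _ N ih =>
  subst hN
  intro A B hsep
  have hlt : ∀ {G' : SimpleGraph V} {x y : V}, G' ≤ G → G.Adj x y → ¬ G'.Adj x y →
      G'.edgeSet.ncard < G.edgeSet.ncard := by
    intro G' x y hle hxy hn
    refine Set.ncard_lt_ncard ⟨SimpleGraph.edgeSet_subset_edgeSet.2 hle, fun h => hn ?_⟩
    exact h (show s(x, y) ∈ G.edgeSet from hxy)
  by_cases hE : ∃ x y, G.Adj x y
  swap
  · push Not at hE
    have h1 := hsep A (Aᶜ ∪ B) subset_rfl Set.subset_union_right (by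
      ext x; by_cases x ∈ A <;> simp [*]) (fun u _ _ v huv => (hE u v huv).elim)
    have h2 : A ∩ (Aᶜ ∪ B) = A ∩ B := by ext x; by_cases x ∈ A <;> simp [*]
    rw [h2] at h1
    obtain ⟨T, hT, hTk⟩ := Set.exists_subset_card_eq h1
    have e : Nonempty (Fin k ≃ T) := by
      rw [← hTk, ← Nat.card_coe_set_eq]
      exact ⟨(Finite.equivFin T).symm⟩
    obtain ⟨e⟩ := e
    refine ⟨fun i => {(e i : V)}, fun i => connOn_singleton _, ?_, ?_⟩
    · intro i j hij
      rw [Set.disjoint_singleton]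
      exact fun h => hij (e.injective (Subtype.ext h))
    · exact fun i => ⟨⟨_, rfl, (hT (e i).2).1⟩, ⟨_, rfl, (hT (e i).2).2⟩⟩
  obtain ⟨x₀, y₀, hxy₀⟩ := hE
  -- the graph without the edge
  by_cases hdel : SepGE (G.deleteEdges {s(x₀, y₀)}) A B k
  · have hle : G.deleteEdges {s(x₀, y₀)} ≤ G := SimpleGraph.deleteEdges_le _
    obtain ⟨C, h1, h2, h3⟩ := ih _ (hlt hle hxy₀ (by simp)) _ rfl A B hdel
    exact ⟨C, fun i => (h1 i).mono hle, h2, h3⟩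
  unfold SepGE at hdel
  push Not at hdel
  obtain ⟨L, R, hA, hB, hLR, hno, hk⟩ := hdel
  have hadj : ∀ {x y u v : V}, s(x, y) = s(x₀, y₀) → G.Adj u v → ¬ (u = x ∧ v = y) →
      ¬ (u = y ∧ v = x) → (G.deleteEdges {s(x₀, y₀)}).Adj u v := by
    intro x y u v he huv h1 h2
    rw [SimpleGraph.deleteEdges_adj]
    refine ⟨huv, ?_⟩
    rw [← he, Set.mem_singleton_iff, Sym2.eq_iff]
    tauto
  -- the deleted edge joins `x ∈ L \ R` to `y ∈ R \ L`
  obtain ⟨x, y, he, hxy, hxL, hxR, hyL⟩ : ∃ x y, s(x, y) = s(x₀, y₀) ∧ G.Adj x y ∧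
      x ∈ L ∧ x ∉ R ∧ y ∉ L := by
    by_contra hcon
    push Not at hcon
    refine absurd (hsep L R hA hB hLR ?_) (by omega)
    intro u hu huR v huv
    by_contra hv
    by_cases h1 : u = x₀ ∧ v = y₀
    · exact hv (hcon u v (by rw [h1.1, h1.2]) huv hu huR)
    by_cases h2 : u = y₀ ∧ v = x₀
    · exact hv (hcon u v (by rw [h2.1, h2.2, Sym2.eq_swap]) huv hu huR)
    exact hv (hno u hu huR v (hadj rfl huv h1 h2))
  have hyR : y ∈ R := (show y ∈ L ∪ R by rw [hLR]; trivial).resolve_left hyL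
  have huniv : ∀ v, v ∈ L ∨ v ∈ R := fun v => (show v ∈ L ∪ R by rw [hLR]; trivial)
  have hno' : ∀ u ∈ R, u ∉ L → ∀ v, (G.deleteEdges {s(x₀, y₀)}).Adj u v → v ∈ R := by
    intro u hu huL v huv
    by_contra hv
    exact huL (hno v ((huniv v).resolve_right hv) hv u huv.symm)
  -- the edge is the only one between `L \ R` and `R \ L`
  have hLx : ∀ u ∈ L, u ∉ R → u ≠ x → ∀ v, G.Adj u v → v ∈ L := by
    intro u hu huR hux v huv
    refine hno u hu huR v (hadj he huv (fun h => hux h.1) fun h => ?_)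
    exact huR (h.1 ▸ hyR)
  have hRy : ∀ u ∈ R, u ∉ L → u ≠ y → ∀ v, G.Adj u v → v ∈ R := by
    intro u hu huL huy v huv
    refine hno' u hu huL v (hadj he huv (fun h => ?_) (fun h => huy h.1))
    exact huL (h.1 ▸ hxL)
  set S := L ∩ R with hS
  have hxS : x ∉ S := fun h => hxR h.2
  have hyS : y ∉ S := fun h => hyL h.1
  have hcard : S.ncard + 1 = k := by
    have h1 : k ≤ (L ∩ insert x R).ncard := by
      refine hsep L (insert x R) hA (hB.trans (Set.subset_insert _ _)) ?_ ?_
      · rw [Set.union_insert, hLR, Set.insert_eq_of_mem (Set.mem_univ _)]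
      · intro u hu huR v huv
        rw [Set.mem_insert_iff, not_or] at huR
        exact hLx u hu huR.2 huR.1 v huv
    rw [Set.inter_insert_of_mem hxL, Set.ncard_insert_of_notMem hxS] at h1
    omega
  -- the two sides
  let side : Set V → SimpleGraph V := fun M =>
    { Adj := fun u v => G.Adj u v ∧ u ∈ M ∧ v ∈ M
      symm := ⟨fun u v h => ⟨h.1.symm, h.2.2, h.2.1⟩⟩
      loopless := ⟨fun u h => G.loopless.irrefl u h.1⟩ }
  have hside_le : ∀ M, side M ≤ G := fun M u v h => h.1
  have hside_sub : ∀ (M C : Set V), ConnOn (side M) C → (C ∩ M).Nonempty → C ⊆ M := by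
    intro M C hC hne z hz
    refine (hC (C ∩ M) Set.inter_subset_left hne ?_ hz).2
    exact fun u hu v hv huv => ⟨hv, huv.2.2⟩
  have hsep1 : SepGE (side L) A (insert x S) k := by
    intro L' R' hA' hS' hLR' hno'
    have huniv' : ∀ v, v ∈ L' ∨ v ∈ R' := fun v => (show v ∈ L' ∪ R' by rw [hLR']; trivial)
    refine (hsep (L' ∩ L) (R' ∪ R) (fun a ha => ⟨hA' ha, hA ha⟩)
      (hB.trans Set.subset_union_right) ?_ ?_).trans (Set.ncard_le_ncard ?_)
    · rw [Set.eq_univ_iff_forall]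
      intro v
      by_cases h1 : v ∈ L'
      · by_cases h2 : v ∈ L
        · exact Or.inl ⟨h1, h2⟩
        · exact Or.inr (Or.inr ((huniv v).resolve_left h2))
      · exact Or.inr (Or.inl ((huniv' v).resolve_left h1))
    · rintro u ⟨hu', hu⟩ huR v huv
      simp only [Set.mem_union, not_or] at huR
      have hvL : v ∈ L := hLx u hu huR.2 (fun h => huR.1 (hS' (h ▸ Set.mem_insert _ _))) v huv
      exact ⟨hno' u hu' huR.1 v ⟨huv, hu, hvL⟩, hvL⟩
    · rintro v ⟨⟨h1, h2⟩, h3 | h3⟩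
      · exact ⟨h1, h3⟩
      · exact ⟨h1, hS' (Set.mem_insert_of_mem _ ⟨h2, h3⟩)⟩
  have hsep2 : SepGE (side R) (insert y S) B k := by
    intro L' R' hS' hB' hLR' hno'
    have huniv' : ∀ v, v ∈ L' ∨ v ∈ R' := fun v => (show v ∈ L' ∪ R' by rw [hLR']; trivial)
    refine (hsep (L' ∪ L) (R' ∩ R) (hA.trans Set.subset_union_right)
      (fun b hb => ⟨hB' hb, hB hb⟩) ?_ ?_).trans (Set.ncard_le_ncard ?_)
    · rw [Set.eq_univ_iff_forall]
      intro v
      by_cases h1 : v ∈ R'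
      · by_cases h2 : v ∈ R
        · exact Or.inr ⟨h1, h2⟩
        · exact Or.inl (Or.inr ((huniv v).resolve_right h2))
      · exact Or.inl (Or.inl ((huniv' v).resolve_right h1))
    · intro u _ huR v huv
      by_contra hv
      simp only [Set.mem_union, not_or] at hv
      have hvR' := (huniv' v).resolve_left hv.1
      have hvR := (huniv v).resolve_left hv.2
      have huR2 : u ∈ R := hRy v hvR hv.2 (fun h => hv.1 (hS' (h ▸ Set.mem_insert _ _))) u huv.symm
      have huR' : u ∉ R' := fun h => huR ⟨h, huR2⟩
      exact hv.1 (hno' u ((huniv' u).resolve_right huR') huR' v ⟨huv, huR2, hvR⟩)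
    · rintro v ⟨h3 | h3, h1, h2⟩
      · exact ⟨h3, h1⟩
      · exact ⟨hS' (Set.mem_insert_of_mem _ ⟨h3, h2⟩), h1⟩
  obtain ⟨C₁, c1, c2, c3⟩ := ih _ (hlt (hside_le L) hxy (fun h => hyL h.2.2)) _ rfl _ _ hsep1
  obtain ⟨C₂, d1, d2, d3⟩ := ih _ (hlt (hside_le R) hxy (fun h => hxR h.2.1)) _ rfl _ _ hsep2
  have hC₁ : ∀ i, C₁ i ⊆ L := fun i => by
    obtain ⟨a, ha, haA⟩ := (c3 i).1
    exact hside_sub _ _ (c1 i) ⟨a, ha, hA haA⟩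
  have hC₂ : ∀ i, C₂ i ⊆ R := fun i => by
    obtain ⟨b, hb, hbB⟩ := (d3 i).2
    exact hside_sub _ _ (d1 i) ⟨b, hb, hB hbB⟩
  obtain ⟨f₁, p1, p2, p3⟩ := exists_transversal C₁ (insert x S) (by
    rw [Set.ncard_insert_of_notMem hxS, hcard]) c2 fun i => (c3 i).2
  obtain ⟨f₂, q1, q2, q3⟩ := exists_transversal C₂ (insert y S) (by
    rw [Set.ncard_insert_of_notMem hyS, hcard]) d2 fun i => (d3 i).1
  have hmatch : ∀ i, ∃ j, (f₁ i = f₂ j ∧ f₁ i ∈ S) ∨ (f₁ i = x ∧ f₂ j = y) := by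
    intro i
    rcases (p1 i).2 with h | h
    · obtain ⟨j, hj⟩ := q3 y (Set.mem_insert _ _)
      exact ⟨j, Or.inr ⟨h, hj⟩⟩
    · obtain ⟨j, hj⟩ := q3 _ (Set.mem_insert_of_mem _ h)
      exact ⟨j, Or.inl ⟨hj.symm, h⟩⟩
  choose π hπ using hmatch
  have hf₁ : Function.Injective f₁ := by
    intro i j hij
    by_contra hne
    exact Set.disjoint_left.1 (c2 i j hne) (p1 i).1 (hij ▸ (p1 j).1)
  have hπinj : Function.Injective π := by
    intro i j hij
    refine hf₁ ?_
    rcases hπ i with h | h <;> rcases hπ j with h' | h'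
    · rw [h.1, h'.1, hij]
    · exact absurd (h.1 ▸ h.2 : f₂ (π i) ∈ S) (by rw [hij, h'.2]; exact hyS)
    · exact absurd (h'.1 ▸ h'.2 : f₂ (π j) ∈ S) (by rw [← hij, h.2]; exact hyS)
    · rw [h.1, h'.1]
  -- sets of the two families meet only in a common target
  have hcross : ∀ i j, j ≠ π i → Disjoint (C₁ i) (C₂ j) := by
    intro i j hj
    refine Set.disjoint_left.2 fun v h1 h2 => ?_
    have hvS : v ∈ S := ⟨hC₁ i h1, hC₂ j h2⟩
    have e1 := p2 i v h1 (Set.mem_insert_of_mem _ hvS)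
    have e2 := q2 j v h2 (Set.mem_insert_of_mem _ hvS)
    rcases hπ i with h | h
    · refine Set.disjoint_left.1 (d2 j (π i) hj) (q1 j).1 ?_
      rw [← e2, e1, h.1]
      exact (q1 _).1
    · exact hxS (h.1 ▸ e1 ▸ hvS)
  refine ⟨fun i => C₁ i ∪ C₂ (π i), fun i => ?_, fun i j hij => ?_, fun i => ?_⟩
  · refine ((c1 i).mono (hside_le L)).union ((d1 _).mono (hside_le R))
      ⟨f₁ i, (p1 i).1, f₂ (π i), (q1 _).1, ?_⟩
    rcases hπ i with h | h
    · exact Or.inl h.1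
    · rw [h.1, h.2]
      exact Or.inr hxy
  · refine Set.disjoint_union_left.2 ⟨Set.disjoint_union_right.2 ⟨c2 i j hij, ?_⟩,
      Set.disjoint_union_right.2 ⟨?_, d2 _ _ fun h => hij (hπinj h)⟩⟩
    · exact hcross i _ fun h => hij (hπinj h).symm
    · exact (hcross j _ fun h => hij (hπinj h)).symm
  · exact ⟨(c3 i).1.mono (Set.inter_subset_inter_left _ Set.subset_union_left),
      (d3 _).2.mono (Set.inter_subset_inter_left _ Set.subset_union_right)⟩

/-! ### Pieces from tree decompositions -/

/-- The nodes on the side of `d` of the edge `cd` of the tree `T`. -/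
def treeBranch {ι : Type} (T : SimpleGraph ι) (c d : ι) : Set ι :=
  {y | (T.deleteEdges {s(c, d)}).Reachable d y}

section treeBranch

variable {ι : Type} {T : SimpleGraph ι} {c d : ι}

theorem self_mem_treeBranch : d ∈ treeBranch T c d := SimpleGraph.Reachable.refl _

theorem notMem_treeBranch (hT : T.IsAcyclic) (hcd : T.Adj c d) : c ∉ treeBranch T c d := by
  intro h
  have := SimpleGraph.isAcyclic_iff_forall_adj_isBridge.1 hT hcd
  rw [SimpleGraph.isBridge_iff] at this
  exact this (SimpleGraph.Reachable.symm h)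

/-- The edge `cd` is the only one that leaves the branch. -/
theorem treeBranch_exit (hT : T.IsAcyclic) (hcd : T.Adj c d) {y z : ι}
    (hy : y ∈ treeBranch T c d) (hz : z ∉ treeBranch T c d) (hyz : T.Adj y z) :
    y = d ∧ z = c := by
  by_cases h : s(y, z) = s(c, d)
  · rw [Sym2.eq_iff] at h
    rcases h with h | h
    · exact absurd (h.1 ▸ hy) (notMem_treeBranch hT hcd)
    · exact h
  · exact absurd (SimpleGraph.Reachable.trans hy
      (SimpleGraph.Adj.reachable (by simpa [SimpleGraph.deleteEdges_adj] using ⟨hyz, by simpa using h⟩))) hz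

theorem treeBranch_avoid (hT : T.IsAcyclic) (hcd : T.Adj c d) {y : ι}
    (hy : y ∈ treeBranch T c d) (w : ι) : (T.deleteEdges {s(c, w)}).Reachable d y := by
  have h : Relation.ReflTransGen (T.deleteEdges {s(c, d)}).Adj d y :=
    (SimpleGraph.reachable_iff_reflTransGen _ _).1 hy
  induction h with
  | refl => exact SimpleGraph.Reachable.refl _
  | @tail b z hb hbz ih =>
    have hb' : b ∈ treeBranch T c d := (SimpleGraph.reachable_iff_reflTransGen _ _).2 hb
    refine (ih hb').trans (SimpleGraph.Adj.reachable ?_)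
    rw [SimpleGraph.deleteEdges_adj] at hbz ⊢
    refine ⟨hbz.1, fun h => ?_⟩
    rw [Set.mem_singleton_iff, Sym2.eq_iff] at h
    rcases h with h | h
    · exact notMem_treeBranch hT hcd (h.1 ▸ hb')
    · exact notMem_treeBranch hT hcd (h.2 ▸ hy)

theorem treeBranch_disjoint (hT : T.IsAcyclic) (hcd : T.Adj c d) {d' : ι} (hcd' : T.Adj c d')
    (hne : d ≠ d') : Disjoint (treeBranch T c d) (treeBranch T c d') := by
  refine Set.disjoint_left.2 fun y hy hy' => notMem_treeBranch hT hcd' ?_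
  refine SimpleGraph.Reachable.trans
    (SimpleGraph.Reachable.trans hy' (treeBranch_avoid hT hcd hy d').symm) ?_
  refine SimpleGraph.Adj.reachable ?_
  rw [SimpleGraph.deleteEdges_adj]
  refine ⟨hcd.symm, ?_⟩
  rw [Set.mem_singleton_iff, Sym2.eq_iff]
  rintro (h | h)
  · exact hcd.ne h.1.symm
  · exact hne h.1

theorem treeBranch_ssubset (hT : T.IsAcyclic) {x : ι} (hxc : T.Adj x c) (hcd : T.Adj c d)
    (hne : d ≠ x) : treeBranch T c d ⊂ treeBranch T x c := by
  refine ⟨fun y hy => ?_, fun h => notMem_treeBranch hT hcd (h self_mem_treeBranch)⟩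
  have h := treeBranch_avoid hT hcd hy x
  rw [Sym2.eq_swap] at h
  refine SimpleGraph.Reachable.trans (SimpleGraph.Adj.reachable ?_) h
  rw [SimpleGraph.deleteEdges_adj]
  refine ⟨hcd, ?_⟩
  rw [Set.mem_singleton_iff, Sym2.eq_iff]
  rintro (h | h)
  · exact hxc.ne h.1.symm
  · exact hne h.2

/-- The nodes of a tree other than `c` lie in the branches at `c`. -/
theorem exists_mem_treeBranch {y : ι} (h : T.Reachable c y) :
    y = c ∨ ∃ d, T.Adj c d ∧ y ∈ treeBranch T c d := by
  replace h := (SimpleGraph.reachable_iff_reflTransGen _ _).1 h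
  induction h with
  | refl => exact Or.inl rfl
  | @tail b z hb hbz ih =>
    rcases ih with rfl | ⟨d, hd, hbd⟩
    · exact Or.inr ⟨z, hbz, self_mem_treeBranch⟩
    · by_cases hz : s(b, z) = s(c, d)
      · rw [Sym2.eq_iff] at hz
        rcases hz with h | h
        · exact Or.inr ⟨d, hd, h.2 ▸ self_mem_treeBranch⟩
        · exact Or.inl h.2
      · refine Or.inr ⟨d, hd, SimpleGraph.Reachable.trans hbd (SimpleGraph.Adj.reachable ?_)⟩
        rw [SimpleGraph.deleteEdges_adj]
        exact ⟨hbz, by simpa using hz⟩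

theorem mem_treeBranch_cases (hT : T.IsAcyclic) {x y : ι} (hxc : T.Adj x c)
    (h : y ∈ treeBranch T x c) :
    y = c ∨ ∃ d, T.Adj c d ∧ d ≠ x ∧ y ∈ treeBranch T c d := by
  have h' : T.Reachable c y := SimpleGraph.Reachable.mono (SimpleGraph.deleteEdges_le _) h
  rcases exists_mem_treeBranch h' with h1 | ⟨d, hd, hy⟩
  · exact Or.inl h1
  · refine Or.inr ⟨d, hd, ?_, hy⟩
    rintro rfl
    -- `y` would lie on both sides of the edge `cd`
    refine notMem_treeBranch hT hd.symm ?_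
    refine SimpleGraph.Reachable.trans h (SimpleGraph.Reachable.symm ?_)
    have := hy
    unfold treeBranch at this
    rwa [Sym2.eq_swap] at this

end treeBranch

namespace TreeDecomp

variable {X : Type} {H : SimpleGraph X} (D : TreeDecomp H)

/-- The vertices in the bags of a set of nodes. -/
def verts (S : Set D.ι) : Set X := {v | ∃ y ∈ S, v ∈ D.bag y}

theorem connOn (v : X) : ConnOn D.T {x | v ∈ D.bag x} := connOn_iff.2 (D.conn v).preconnected

/-- A vertex that occurs in bags on both sides of the edge `cd` belongs to the bags of both its
ends. -/
theorem mem_bag_of_cross {c d : D.ι} (hcd : D.T.Adj c d) {v : X}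
    (hv : v ∈ D.verts (treeBranch D.T c d)) {z : D.ι} (hz : z ∉ treeBranch D.T c d)
    (hvz : v ∈ D.bag z) : v ∈ D.bag c ∧ v ∈ D.bag d := by
  obtain ⟨y, hy, hvy⟩ := hv
  by_contra hcon
  refine hz (D.connOn v ({x | v ∈ D.bag x} ∩ treeBranch D.T c d) Set.inter_subset_left
    ⟨y, hvy, hy⟩ ?_ hvz).2
  intro a ha b hb hab
  refine ⟨hb, ?_⟩
  by_contra hbn
  obtain ⟨rfl, rfl⟩ := treeBranch_exit D.isTree.isAcyclic hcd ha.2 hbn hab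
  exact hcon ⟨hb, ha.1⟩

/-- The branches at the node `c` form pieces with the root-bag of `c`, by a change of the root-bag,
and these pieces are united. They are disjoint, as a vertex that occurs in two branches belongs to
the bag of `c`. -/
theorem piece_of_branches [Finite X] {t : ℕ} (hw : D.WidthLT t) (c : D.ι) (N : Set D.ι)
    (hN : ∀ d ∈ N, D.T.Adj c d)
    (ih : ∀ d ∈ N, Piece H t (D.bag d) (D.verts (treeBranch D.T c d) \ D.bag d)) :
    Piece H t (D.bag c) ({v | ∃ d ∈ N, v ∈ D.verts (treeBranch D.T c d)} \ D.bag c) := by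
  have hac := D.isTree.isAcyclic
  have one : ∀ d ∈ N, Piece H t (D.bag c) (D.verts (treeBranch D.T c d) \ D.bag c) := by
    intro d hd
    have hcd := hN d hd
    have hcn := notMem_treeBranch hac hcd
    have hdisj : Disjoint (D.bag c) (D.verts (treeBranch D.T c d) \ D.bag d) :=
      Set.disjoint_left.2 fun v hv hv' => hv'.2 (D.mem_bag_of_cross hcd hv'.1 hcn hv).2
    have e : D.verts (treeBranch D.T c d) \ D.bag c =
        (D.verts (treeBranch D.T c d) \ D.bag d) ∪ (D.bag d \ D.bag c) := by
      ext v
      constructor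
      · rintro ⟨h1, h2⟩
        by_cases h : v ∈ D.bag d
        · exact Or.inr ⟨h, h2⟩
        · exact Or.inl ⟨h1, h⟩
      · rintro (h | h)
        · exact ⟨h.1, fun h' => Set.disjoint_left.1 hdisj h' h⟩
        · exact ⟨⟨d, self_mem_treeBranch, h.1⟩, h.2⟩
    rw [e]
    refine .shift (ih d hd) (hw c) hdisj ?_
    rw [← e]
    rintro u ⟨hu, huc⟩ v huv
    obtain ⟨z, hz1, hz2⟩ := D.edge u v huv
    by_cases hvc : v ∈ D.bag c
    · exact Or.inl hvc
    · refine Or.inr ⟨⟨z, ?_, hz2⟩, hvc⟩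
      by_contra hz
      exact huc (D.mem_bag_of_cross hcd hu hz hz1).1
  have := D.fin
  refine Set.Finite.induction_on_subset (motive := fun M _ =>
    Piece H t (D.bag c) ({v | ∃ d ∈ M, v ∈ D.verts (treeBranch D.T c d)} \ D.bag c)) N
    (Set.toFinite N) ?_ ?_
  · have : ({v | ∃ d ∈ (∅ : Set D.ι), v ∈ D.verts (treeBranch D.T c d)} \ D.bag c) = ∅ := by
      ext; simp
    rw [this]
    exact .nil _ (hw c)
  · intro a M ha hM haM hp
    have e : ({v | ∃ d ∈ insert a M, v ∈ D.verts (treeBranch D.T c d)} \ D.bag c) =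
        (D.verts (treeBranch D.T c a) \ D.bag c) ∪
        ({v | ∃ d ∈ M, v ∈ D.verts (treeBranch D.T c d)} \ D.bag c) := by
      ext v
      simp only [Set.mem_insert_iff, Set.mem_sdiff, Set.mem_ofPred_eq, Set.mem_union,
        exists_eq_or_imp]
      tauto
    rw [e]
    refine .union (one a ha) hp (Set.disjoint_left.2 ?_)
    rintro v ⟨hv, hvc⟩ ⟨⟨d, hd, y, hy, hvy⟩, -⟩
    have hne : a ≠ d := fun h => haM (h ▸ hd)
    have hya : y ∉ treeBranch D.T c a := fun h =>
      Set.disjoint_left.1 (treeBranch_disjoint hac (hN a ha) (hN d (hM hd)) hne) h hy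
    exact hvc (D.mem_bag_of_cross (hN a ha) hv hya hvy).1

theorem piece_branch [Finite X] {t : ℕ} (hw : D.WidthLT t) : ∀ (n : ℕ) (x c : D.ι),
    D.T.Adj x c → (treeBranch D.T x c).ncard = n →
    Piece H t (D.bag c) (D.verts (treeBranch D.T x c) \ D.bag c) := by
  have := D.fin
  have hac := D.isTree.isAcyclic
  intro n
  induction n using Nat.strong_induction_on with
  | _ n ih =>
  rintro x c hxc rfl
  have := D.piece_of_branches hw c {d | D.T.Adj c d ∧ d ≠ x} (fun d hd => hd.1)
    (fun d hd => ih _ (Set.ncard_lt_ncard (treeBranch_ssubset hac hxc hd.1 hd.2)) c d hd.1 rfl)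
  convert this using 1
  ext v
  constructor
  · rintro ⟨⟨y, hy, hvy⟩, hvc⟩
    rcases mem_treeBranch_cases hac hxc hy with rfl | ⟨d, h1, h2, h3⟩
    · exact absurd hvy hvc
    · exact ⟨⟨d, ⟨h1, h2⟩, y, h3, hvy⟩, hvc⟩
  · rintro ⟨⟨d, ⟨h1, h2⟩, y, h3, hvy⟩, hvc⟩
    exact ⟨⟨y, (treeBranch_ssubset hac hxc h1 h2).1 h3, hvy⟩, hvc⟩

/-- The graph is a piece, with any bag as the root-bag. -/
theorem piece [Finite X] {t : ℕ} (hw : D.WidthLT t) (r : D.ι) :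
    Piece H t (D.bag r) (D.bag r)ᶜ := by
  have := D.piece_of_branches hw r {d | D.T.Adj r d} (fun d hd => hd)
    (fun d hd => D.piece_branch hw _ r d hd rfl)
  convert this using 1
  ext v
  constructor
  · intro hv
    obtain ⟨y, hy⟩ := D.cover v
    rcases exists_mem_treeBranch (D.isTree.connected.preconnected r y) with rfl | ⟨d, h1, h2⟩
    · exact absurd hy hv
    · exact ⟨⟨d, h1, y, h2, hy⟩, hv⟩
  · exact fun hv => hv.2

end TreeDecomp

/-- The vertices of a protrusion that are not in its boundary form a piece. -/
theorem IsProtrusion.piece {V : Type} [Finite V] {G : SimpleGraph V} {W : Set V} {t : ℕ}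
    (h : IsProtrusion G W t) : Piece G t (bdry G W) (W \ bdry G W) := by
  obtain ⟨hb, D, hw, r, hr⟩ := h
  have hcl : ∀ u ∈ W \ bdry G W, ∀ v, G.Adj u v → v ∈ W := by
    intro u hu v huv
    by_contra hv
    exact hu.2 ⟨hu.1, v, hv, huv⟩
  have hp := (D.piece hw r).map (G' := G) Subtype.val Subtype.val_injective.injOn (by
    rintro ⟨u, huW⟩ hu w huw
    exact ⟨⟨w, hcl u ⟨huW, fun h => hu (hr ⟨u, huW⟩ h)⟩ w huw⟩, huw, rfl⟩)
  have e : W \ bdry G W = Subtype.val '' (D.bag r)ᶜ ∪ (Subtype.val '' D.bag r \ bdry G W) := by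
    ext v
    constructor
    · rintro ⟨h1, h2⟩
      by_cases h : (⟨v, h1⟩ : W) ∈ D.bag r
      · exact Or.inr ⟨⟨_, h, rfl⟩, h2⟩
      · exact Or.inl ⟨_, h, rfl⟩
    · rintro (⟨v, hv, rfl⟩ | ⟨⟨v, hv, rfl⟩, h2⟩)
      · exact ⟨v.2, fun h => hv (hr v h)⟩
      · exact ⟨v.2, h2⟩
  rw [e]
  refine .shift hp hb ?_ ?_
  · refine Set.disjoint_left.2 ?_
    rintro _ hv ⟨v, hv', rfl⟩
    exact hv' (hr v hv)
  · rw [← e]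
    intro u hu v huv
    by_cases hv : v ∈ bdry G W
    · exact Or.inl hv
    · exact Or.inr ⟨hcl u hu v huv, hv⟩

/-! ### Minor-closed classes -/

/-- The class `𝒢` is closed under induced subgraphs and isomorphism. -/
def Hereditary (𝒢 : Set FinGraph) : Prop :=
  ∀ G₁ G₂ : FinGraph, Nonempty (G₁.graph ↪g G₂.graph) → G₂ ∈ 𝒢 → G₁ ∈ 𝒢

theorem connected_iff_connOn {V : Type} {G : SimpleGraph V} {S : Set V} :
    (G.induce S).Connected ↔ ConnOn G S ∧ S.Nonempty := by
  rw [SimpleGraph.connected_iff, connOn_iff, Set.nonempty_coe_sort]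

theorem IsMinor.of_embedding {H G₁ G₂ : FinGraph} (f : G₁.graph ↪g G₂.graph)
    (h : IsMinor H G₁) : IsMinor H G₂ := by
  obtain ⟨β, h1, h2, h3⟩ := h
  refine ⟨fun h => f '' β h, fun h => ?_, fun h h' hne => ?_, fun h h' hadj => ?_⟩
  · obtain ⟨hc, hne⟩ := connected_iff_connOn.1 (h1 h)
    exact connected_iff_connOn.2
      ⟨hc.image f fun u _ v _ huv => f.map_rel_iff.2 huv, hne.image _⟩
  · exact (Set.disjoint_image_iff f.injective).2 (h2 h h' hne)
  · obtain ⟨u, hu, v, hv, huv⟩ := h3 h h' hadj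
    exact ⟨f u, ⟨u, hu, rfl⟩, f v, ⟨v, hv, rfl⟩, f.map_rel_iff.2 huv⟩

theorem IsTopMinor.of_embedding {H G₁ G₂ : FinGraph} (f : G₁.graph ↪g G₂.graph)
    (h : IsTopMinor H G₁) : IsTopMinor H G₂ := by
  obtain ⟨φ, P, h1, h2, h3, h4⟩ := h
  refine ⟨f ∘ φ, fun a b hab => (P a b hab).map f.toHom, f.injective.comp h1, ?_, ?_, ?_⟩
  · exact fun a b hab => (h2 a b hab).map f.injective
  · intro a b hab c hc
    rw [SimpleGraph.Walk.support_map, List.mem_map] at hc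
    obtain ⟨x, hx, hxc⟩ := hc
    exact h3 a b hab c (f.injective hxc ▸ hx)
  · intro a b hab c d hcd hne x hx hx'
    rw [SimpleGraph.Walk.support_map, List.mem_map] at hx hx'
    obtain ⟨y, hy, rfl⟩ := hx
    obtain ⟨z, hz, hzy⟩ := hx'
    obtain ⟨h, rfl⟩ := h4 a b hab c d hcd hne y hy (f.injective hzy ▸ hz)
    exact ⟨h, rfl⟩

theorem hereditary_of_eq {H : FinGraph} {𝒢 : Set FinGraph}
    (h : 𝒢 = minorFree H ∨ 𝒢 = topMinorFree H) : Hereditary 𝒢 := by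
  rintro G₁ G₂ ⟨f⟩ h₂ 
  rcases h with rfl | rfl
  · exact fun h₁ => h₂ (IsMinor.of_embedding f h₁)
  · exact fun h₁ => h₂ (IsTopMinor.of_embedding f h₁)

/-! ### Gluing -/

namespace BGraph

open Classical in
/-- The vertex of `G ⊕ K` that comes from the vertex `v` of `K`. -/
noncomputable def right (G K : BGraph) (v : K.V) : GlueV G K :=
  if h : ∃ u i, G.bd.lab u = some i ∧ K.bd.lab v = some i then .inl h.choose
  else .inr ⟨v, fun u i hu hv => h ⟨u, i, hu, hv⟩⟩

variable {G K : BGraph}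

theorem right_of_lab {u : G.V} {v : K.V} {i : ℕ} (hu : G.bd.lab u = some i)
    (hv : K.bd.lab v = some i) : right G K v = .inl u := by
  have h : ∃ u i, G.bd.lab u = some i ∧ K.bd.lab v = some i := ⟨u, i, hu, hv⟩
  rw [right, dif_pos h]
  obtain ⟨j, hj, hj'⟩ := h.choose_spec
  have : i = j := by rw [hv] at hj'; exact Option.some.inj hj'
  exact congrArg _ (G.bd.inj _ _ i (this ▸ hj) hu)

theorem right_of_not {v : K.V} (h : ∀ u i, G.bd.lab u = some i → K.bd.lab v ≠ some i) :
    right G K v = .inr ⟨v, h⟩ := by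
  rw [right, dif_neg]
  rintro ⟨u, i, h1, h2⟩
  exact h u i h1 h2

theorem fromRight_iff {v : K.V} {x : GlueV G K} : FromRight G K v x ↔ x = right G K v := by
  constructor
  · rcases x with u | w
    · rintro ⟨i, h1, h2⟩
      exact (right_of_lab h1 h2).symm
    · rintro (rfl : w.1 = v)
      exact (right_of_not w.2).symm
  · rintro rfl
    by_cases h : ∃ u i, G.bd.lab u = some i ∧ K.bd.lab v = some i
    · obtain ⟨u, i, h1, h2⟩ := h
      rw [right_of_lab h1 h2]
      exact ⟨i, h1, h2⟩
    · push Not at h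
      rw [right_of_not h]
      exact rfl

theorem right_injective : Function.Injective (right G K) := by
  intro v w hvw
  by_cases h : ∃ u i, G.bd.lab u = some i ∧ K.bd.lab v = some i
  · obtain ⟨u, i, h1, h2⟩ := h
    rw [right_of_lab h1 h2] at hvw
    obtain ⟨j, hj, hj'⟩ := fromRight_iff.2 hvw
    have : i = j := by rw [h1] at hj; exact Option.some.inj hj
    exact K.bd.inj v w i h2 (this ▸ hj')
  · push Not at h
    rw [right_of_not h] at hvw
    exact fromRight_iff.2 hvw

theorem glue_adj {x y : GlueV G K} : (glue G K).graph.Adj x y ↔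
    (∃ a b, G.graph.Adj a b ∧ x = .inl a ∧ y = .inl b) ∨
    ∃ a b, K.graph.Adj a b ∧ x = right G K a ∧ y = right G K b := by
  simp only [glue, SimpleGraph.fromRel_adj, fromRight_iff]
  constructor
  · rintro ⟨-, (h | h) | ⟨a, b, h, h1, h2⟩ | ⟨a, b, h, h1, h2⟩⟩
    · exact Or.inl h
    · exact Or.inr h
    · exact Or.inl ⟨b, a, h.symm, h2, h1⟩
    · exact Or.inr ⟨b, a, h.symm, h2, h1⟩
  · rintro (⟨a, b, h, rfl, rfl⟩ | ⟨a, b, h, rfl, rfl⟩)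
    · exact ⟨fun he => h.ne (Sum.inl.inj he), Or.inl (Or.inl ⟨a, b, h, rfl, rfl⟩)⟩
    · exact ⟨fun he => h.ne (right_injective he), Or.inl (Or.inr ⟨a, b, h, rfl, rfl⟩)⟩

theorem eq_inl_or_right (x : GlueV G K) : (∃ u, x = .inl u) ∨ ∃ v, x = right G K v := by
  rcases x with u | w
  · exact Or.inl ⟨u, rfl⟩
  · exact Or.inr ⟨w.1, (right_of_not w.2).symm⟩

end BGraph

/-! ### Recognizable properties -/

open BGraph in
/-- The colour of the vertex labelled `i`, if there is one. -/
noncomputable def boundaryColour {A : Type} (t : ℕ) (G : BGraph) (c : G.V → A) (i : Fin (t + 1)) :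
    Option A :=
  open Classical in if h : ∃ v, G.bd.lab v = some (i : ℕ) then some (c h.choose) else none

theorem boundaryColour_eq {A : Type} {t : ℕ} {G : BGraph} {c : G.V → A} {v : G.V}
    {i : Fin (t + 1)} (hv : G.bd.lab v = some (i : ℕ)) : boundaryColour t G c i = some (c v) := by
  have h : ∃ v, G.bd.lab v = some (i : ℕ) := ⟨v, hv⟩
  rw [boundaryColour, dif_pos h, G.bd.inj _ _ _ h.choose_spec hv]

theorem boundaryColour_eq_some {A : Type} {t : ℕ} {G : BGraph} {c : G.V → A}
    {i : Fin (t + 1)} {a : A} (h : boundaryColour t G c i = some a) :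
    ∃ v, G.bd.lab v = some (i : ℕ) ∧ c v = a := by
  rw [boundaryColour] at h
  split_ifs at h with h'
  exact ⟨_, h'.choose_spec, Option.some.inj h⟩

theorem BGraph.IsBoundaried.le {t : ℕ} {G : BGraph} (h : G.IsBoundaried t) {v : G.V} {i : ℕ}
    (hv : G.bd.lab v = some i) : i < t + 1 := by
  have : i ∈ G.labels := by simp only [BGraph.labels, Set.Finite.mem_toFinset]; exact ⟨v, hv⟩
  have := Finset.mem_Icc.1 (h this)
  omega

/-- The colourings `c` of `G` and `d` of `K` agree on the vertices that are identified. -/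
def Compatible {A : Type} (G K : BGraph) (c : G.V → A) (d : K.V → A) : Prop :=
  ∀ u v i, G.bd.lab u = some i → K.bd.lab v = some i → c u = d v

/-- The colouring of `G ⊕ K` that is composed of `c` and `d`. -/
def glueColour {A : Type} (G K : BGraph) (c : G.V → A) (d : K.V → A) : BGraph.GlueV G K → A :=
  Sum.elim c (fun w => d w.1)

theorem glueColour_right {A : Type} {G K : BGraph} {c : G.V → A} {d : K.V → A}
    (h : Compatible G K c d) (v : K.V) : glueColour G K c d (BGraph.right G K v) = d v := by
  by_cases hv : ∃ u i, G.bd.lab u = some i ∧ K.bd.lab v = some i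
  · obtain ⟨u, i, h1, h2⟩ := hv
    rw [BGraph.right_of_lab h1 h2]
    exact h u v i h1 h2
  · push Not at hv
    rw [BGraph.right_of_not hv]
    rfl

/-- A property of coloured graphs is recognizable (with respect to gluing along labels from
`{1, …, t}`) if its truth in a gluing depends on one of the two graphs only through its state, one
of finitely many, and the colours of its boundary. Properties definable in monadic second-order
logic are of this kind. -/
def Recognizable (t : ℕ) {A : Type} (P : ∀ G : FinGraph, (G.V → A) → Prop) : Prop :=
  ∃ (S : Type) (_ : Finite S) (τ : ∀ G : BGraph, (G.V → A) → S),
    ∀ (G₁ G₂ K : BGraph) (c₁ : G₁.V → A) (c₂ : G₂.V → A) (d : K.V → A),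
      G₁.IsBoundaried t → G₂.IsBoundaried t → Compatible G₁ K c₁ d → Compatible G₂ K c₂ d →
      boundaryColour t G₁ c₁ = boundaryColour t G₂ c₂ → τ G₁ c₁ = τ G₂ c₂ →
      (P (BGraph.glue G₁ K) (glueColour G₁ K c₁ d) ↔ P (BGraph.glue G₂ K) (glueColour G₂ K c₂ d))

namespace Recognizable

variable {t : ℕ} {A B : Type}

theorem forall_vertex (Q : A → Prop) : Recognizable t (A := A) fun G c => ∀ v : G.V, Q (c v) := by
  refine ⟨Prop, inferInstance, fun G c => ∀ v, Q (c v), ?_⟩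
  have key : ∀ (G K : BGraph) (c : G.V → A) (d : K.V → A), Compatible G K c d →
      ((∀ x : (BGraph.glue G K).V, Q (glueColour G K c d x)) ↔ (∀ v, Q (c v)) ∧ ∀ v, Q (d v)) := by
    intro G K c d h
    constructor
    · exact fun hx => ⟨fun v => hx (.inl v), fun v => glueColour_right h v ▸ hx _⟩
    · rintro ⟨h1, h2⟩ x
      rcases BGraph.eq_inl_or_right x with ⟨u, rfl⟩ | ⟨v, rfl⟩
      · exact h1 u
      · rw [glueColour_right h]; exact h2 v
  intro G₁ G₂ K c₁ c₂ d _ _ h₁ h₂ _ hτ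
  exact (key _ _ _ _ h₁).trans ((and_congr_left' (iff_of_eq hτ)).trans (key _ _ _ _ h₂).symm)

theorem forall_adj (Q : A → A → Prop) :
    Recognizable t (A := A) fun G c => ∀ u v : G.V, G.graph.Adj u v → Q (c u) (c v) := by
  refine ⟨Prop, inferInstance, fun G c => ∀ u v, G.graph.Adj u v → Q (c u) (c v), ?_⟩
  have key : ∀ (G K : BGraph) (c : G.V → A) (d : K.V → A), Compatible G K c d →
      ((∀ x y : (BGraph.glue G K).V, (BGraph.glue G K).graph.Adj x y →
        Q (glueColour G K c d x) (glueColour G K c d y)) ↔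
      (∀ u v, G.graph.Adj u v → Q (c u) (c v)) ∧ ∀ u v, K.graph.Adj u v → Q (d u) (d v)) := by
    intro G K c d h
    constructor
    · refine fun hx => ⟨fun u v huv => hx (.inl u) (.inl v) ?_, fun u v huv => ?_⟩
      · exact BGraph.glue_adj.2 (Or.inl ⟨u, v, huv, rfl, rfl⟩)
      · have := hx _ _ (BGraph.glue_adj.2 (Or.inr ⟨u, v, huv, rfl, rfl⟩))
        rwa [glueColour_right h, glueColour_right h] at this
    · rintro ⟨h1, h2⟩ x y hxy
      rcases BGraph.glue_adj.1 hxy with ⟨a, b, hab, rfl, rfl⟩ | ⟨a, b, hab, rfl, rfl⟩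
      · exact h1 a b hab
      · rw [glueColour_right h, glueColour_right h]; exact h2 a b hab
  intro G₁ G₂ K c₁ c₂ d _ _ h₁ h₂ _ hτ
  exact (key _ _ _ _ h₁).trans ((and_congr_left' (iff_of_eq hτ)).trans (key _ _ _ _ h₂).symm)

theorem not {P : ∀ G : FinGraph, (G.V → A) → Prop} (h : Recognizable t P) :
    Recognizable t fun G c => ¬ P G c := by
  obtain ⟨S, hS, τ, h⟩ := h
  exact ⟨S, hS, τ, fun G₁ G₂ K c₁ c₂ d b₁ b₂ h₁ h₂ hb hτ =>
    not_congr (h G₁ G₂ K c₁ c₂ d b₁ b₂ h₁ h₂ hb hτ)⟩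

theorem all {I : Type} [Finite I] {P : I → ∀ G : FinGraph, (G.V → A) → Prop}
    (h : ∀ i, Recognizable t (P i)) : Recognizable t fun G c => ∀ i, P i G c := by
  choose S hS τ h using h
  exact ⟨∀ i, S i, inferInstance, fun G c i => τ i G c,
    fun G₁ G₂ K c₁ c₂ d b₁ b₂ h₁ h₂ hb hτ =>
      forall_congr' fun i => h i G₁ G₂ K c₁ c₂ d b₁ b₂ h₁ h₂ hb (congrFun hτ i)⟩

theorem const (p : Prop) : Recognizable t (A := A) fun _ _ => p :=
  ⟨Unit, inferInstance, fun _ _ => (), fun _ _ _ _ _ _ _ _ _ _ _ _ => Iff.rfl⟩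

theorem and {P Q : ∀ G : FinGraph, (G.V → A) → Prop} (hP : Recognizable t P)
    (hQ : Recognizable t Q) : Recognizable t fun G c => P G c ∧ Q G c := by
  obtain ⟨S, hS, τ, h⟩ := hP
  obtain ⟨S', hS', τ', h'⟩ := hQ
  exact ⟨S × S', inferInstance, fun G c => (τ G c, τ' G c),
    fun G₁ G₂ K c₁ c₂ d b₁ b₂ h₁ h₂ hb hτ =>
      and_congr (h G₁ G₂ K c₁ c₂ d b₁ b₂ h₁ h₂ hb (congrArg Prod.fst hτ))
        (h' G₁ G₂ K c₁ c₂ d b₁ b₂ h₁ h₂ hb (congrArg Prod.snd hτ))⟩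

theorem imp {P Q : ∀ G : FinGraph, (G.V → A) → Prop} (hP : Recognizable t P)
    (hQ : Recognizable t Q) : Recognizable t fun G c => P G c → Q G c := by
  have := (hP.and hQ.not).not
  simpa only [not_and, not_not] using this

theorem or {P Q : ∀ G : FinGraph, (G.V → A) → Prop} (hP : Recognizable t P)
    (hQ : Recognizable t Q) : Recognizable t fun G c => P G c ∨ Q G c := by
  have := hP.not.imp hQ
  simpa only [or_iff_not_imp_left] using this

/-- Projection: a colour component may be quantified. -/
theorem exists_colour [Finite A] [Finite B] {P : ∀ G : FinGraph, (G.V → A × B) → Prop}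
    (h : Recognizable t P) :
    Recognizable t fun (G : FinGraph) (c : G.V → A) =>
      ∃ b : G.V → B, P G (fun v => (c v, b v)) := by
  obtain ⟨S, hS, τ, h⟩ := h
  refine ⟨Set ((Fin (t + 1) → Option (A × B)) × S), inferInstance,
    fun G c => Set.range fun b : G.V → B =>
      (boundaryColour t G (fun v => (c v, b v)), τ G fun v => (c v, b v)), ?_⟩
  have key : ∀ (G₁ G₂ K : BGraph) (c₁ : G₁.V → A) (c₂ : G₂.V → A) (d : K.V → A),
      G₁.IsBoundaried t → G₂.IsBoundaried t → Compatible G₁ K c₁ d → Compatible G₂ K c₂ d →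
      (Set.range fun b : G₁.V → B =>
        (boundaryColour t G₁ (fun v => (c₁ v, b v)), τ G₁ fun v => (c₁ v, b v))) =
      (Set.range fun b : G₂.V → B =>
        (boundaryColour t G₂ (fun v => (c₂ v, b v)), τ G₂ fun v => (c₂ v, b v))) →
      (∃ b : (BGraph.glue G₁ K).V → B,
        P (BGraph.glue G₁ K) fun v => (glueColour G₁ K c₁ d v, b v)) →
      ∃ b : (BGraph.glue G₂ K).V → B,
        P (BGraph.glue G₂ K) fun v => (glueColour G₂ K c₂ d v, b v) := by
    rintro G₁ G₂ K c₁ c₂ d b₁ b₂ h₁ h₂ hτ ⟨b, hb⟩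
    obtain ⟨b', hb'⟩ : (boundaryColour t G₁ (fun v => (c₁ v, b (.inl v))),
        τ G₁ fun v => (c₁ v, b (.inl v))) ∈ Set.range fun b : G₂.V → B =>
        (boundaryColour t G₂ (fun v => (c₂ v, b v)), τ G₂ fun v => (c₂ v, b v)) := by
      rw [← hτ]; exact ⟨fun v => b (.inl v), rfl⟩
    have hb₁ := (congrArg Prod.fst hb').symm
    have hb₂ := (congrArg Prod.snd hb').symm
    dsimp only at hb₁ hb₂
    let e : K.V → B := fun v => b (BGraph.right G₁ K v)
    have hc₁ : Compatible G₁ K (fun v => (c₁ v, b (.inl v))) (fun v => (d v, e v)) := by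
      intro u v i hu hv
      refine Prod.ext (h₁ u v i hu hv) ?_
      simp only [e, BGraph.right_of_lab hu hv]
    have hc₂ : Compatible G₂ K (fun v => (c₂ v, b' v)) (fun v => (d v, e v)) := by
      intro u v i hu hv
      have e1 := boundaryColour_eq (c := fun v => (c₂ v, b' v)) (i := ⟨i, b₂.le hu⟩) hu
      rw [← hb₁] at e1
      obtain ⟨w, hw, hw'⟩ := boundaryColour_eq_some e1
      exact hw'.symm.trans (hc₁ w v i hw hv)
    have hfun₁ : glueColour G₁ K (fun v => (c₁ v, b (.inl v))) (fun v => (d v, e v)) =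
        fun v => (glueColour G₁ K c₁ d v, b v) := by
      funext x
      rcases x with u | w
      · rfl
      · simp only [glueColour, Sum.elim_inr, e, BGraph.right_of_not w.2]
    have := (h G₁ G₂ K _ _ _ b₁ b₂ hc₁ hc₂ hb₁ hb₂).1 ((congrArg (P _) hfun₁).mpr hb)
    refine ⟨fun x => (glueColour G₂ K (fun v => (c₂ v, b' v)) (fun v => (d v, e v)) x).2, ?_⟩
    refine (congrArg (P (BGraph.glue G₂ K)) (funext fun x => ?_)).mpr this
    rcases x with u | w <;> rfl
  intro G₁ G₂ K c₁ c₂ d b₁ b₂ h₁ h₂ _ hτ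
  exact ⟨key G₁ G₂ K c₁ c₂ d b₁ b₂ h₁ h₂ hτ, key G₂ G₁ K c₂ c₁ d b₂ b₁ h₂ h₁ hτ.symm⟩

theorem forall_colour [Finite A] [Finite B] {P : ∀ G : FinGraph, (G.V → A × B) → Prop}
    (h : Recognizable t P) :
    Recognizable t fun (G : FinGraph) (c : G.V → A) =>
      ∀ b : G.V → B, P G (fun v => (c v, b v)) := by
  have := h.not.exists_colour.not
  simpa only [not_exists, not_not] using this

/-- A class of graphs whose complement is a recognizable property has finite index. -/
theorem finite_quotient {P : ∀ G : FinGraph, (G.V → Unit) → Prop} (h : Recognizable t P)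
    {𝒢 : Set FinGraph} (h𝒢 : ∀ G, G ∈ 𝒢 ↔ ¬ P G fun _ => ()) :
    Finite (Quotient (classSetoid t 𝒢)) := by
  obtain ⟨S, hS, τ, h⟩ := h
  let f : Quotient (classSetoid t 𝒢) → (Fin (t + 1) → Option Unit) × S := fun q =>
    (boundaryColour t q.out.1 (fun _ => ()), τ q.out.1 fun _ => ())
  refine Finite.of_injective f fun p q hpq => ?_
  rw [← Quotient.out_equiv_out]
  intro K _
  have e := h p.out.1 q.out.1 K _ _ (fun _ => ()) p.out.2.1 q.out.2.1 (fun _ _ _ _ _ => rfl)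
    (fun _ _ _ _ _ => rfl) (congrArg Prod.fst hpq) (congrArg Prod.snd hpq)
  rw [h𝒢, h𝒢]
  exact not_congr e

end Recognizable

/-- Branch sets of a minor as a colouring, with connectedness expressed by quantification over
sets. -/
theorem isMinor_iff_colour (H G : FinGraph) : IsMinor H G ↔ ∃ c : G.V → Option H.V,
    (∀ h, ¬ ∀ v, c v ≠ some h) ∧
    (∀ h, ∀ Z : G.V → Prop,
      (∀ u v, G.graph.Adj u v → c u = some h → c v = some h → Z u → Z v) →
      (∀ v, c v = some h → ¬ Z v) ∨ ∀ v, c v = some h → Z v) ∧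
    ∀ p : H.V × H.V, H.graph.Adj p.1 p.2 →
      ¬ ∀ u v, G.graph.Adj u v → ¬ (c u = some p.1 ∧ c v = some p.2) := by
  classical
  constructor
  · rintro ⟨β, h1, h2, h3⟩
    let c : G.V → Option H.V := fun v => if h : ∃ x, v ∈ β x then some h.choose else none
    have hc : ∀ v x, c v = some x ↔ v ∈ β x := by
      intro v x
      by_cases h : ∃ x, v ∈ β x
      · simp only [c, dif_pos h, Option.some.injEq]
        refine ⟨fun hx => hx ▸ h.choose_spec, fun hx => ?_⟩
        by_contra hne
        exact Set.disjoint_left.1 (h2 _ _ hne) h.choose_spec hx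
      · simp only [c, dif_neg h]
        exact ⟨fun h => by simp at h, fun hx => (h ⟨x, hx⟩).elim⟩
    refine ⟨c, fun h hn => ?_, fun h Z hZ => ?_, fun p hp hn => ?_⟩
    · obtain ⟨v, hv⟩ := (connected_iff_connOn.1 (h1 h)).2
      exact hn v ((hc v h).2 hv)
    · by_contra hcon
      push Not at hcon
      obtain ⟨⟨u, hu, hZu⟩, v, hv, hZv⟩ := hcon
      refine hZv ((connected_iff_connOn.1 (h1 h)).1 {x | x ∈ β h ∧ Z x} (fun x hx => hx.1)
        ⟨u, (hc u h).1 hu, hZu⟩ ?_ ((hc v h).1 hv)).2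
      exact fun a ha b hb hab =>
        ⟨hb, hZ a b hab ((hc a h).2 ha.1) ((hc b h).2 hb) ha.2⟩
    · obtain ⟨u, hu, v, hv, huv⟩ := h3 _ _ hp
      exact hn u v huv ⟨(hc _ _).2 hu, (hc _ _).2 hv⟩
  · rintro ⟨c, h1, h2, h3⟩
    refine ⟨fun h => {v | c v = some h}, fun h => ?_, fun h h' hne => ?_, fun h h' hadj => ?_⟩
    · refine connected_iff_connOn.2 ⟨fun Z hZ hne hcl v hv => ?_, ?_⟩
      · rcases h2 h (· ∈ Z) (fun u v huv _ hv hu => hcl u hu v hv huv) with h' | h'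
        · obtain ⟨z, hz⟩ := hne
          exact absurd hz (h' z (hZ hz))
        · exact h' v hv
      · have := h1 h
        push Not at this
        exact this
    · refine Set.disjoint_left.2 fun v hv hv' => hne ?_
      exact Option.some.inj (Eq.trans (Eq.symm hv) hv')
    · have := h3 (h, h') hadj
      push Not at this
      obtain ⟨u, v, huv, hu, hv⟩ := this
      exact ⟨u, hu, v, hv, huv⟩

theorem recognizable_isMinor (t : ℕ) (H : FinGraph) :
    Recognizable t fun (G : FinGraph) (_ : G.V → Unit) => IsMinor H G := by
  simp only [isMinor_iff_colour]
  refine Recognizable.exists_colour (P := fun G c => (∀ h, ¬ ∀ v, (c v).2 ≠ some h) ∧ 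
    (∀ h, ∀ Z : G.V → Prop,
      (∀ u v, G.graph.Adj u v → (c u).2 = some h → (c v).2 = some h → Z u → Z v) →
      (∀ v, (c v).2 = some h → ¬ Z v) ∨ ∀ v, (c v).2 = some h → Z v) ∧
    ∀ p : H.V × H.V, H.graph.Adj p.1 p.2 →
      ¬ ∀ u v, G.graph.Adj u v → ¬ ((c u).2 = some p.1 ∧ (c v).2 = some p.2)) ?_
  refine .and (.all fun h => (Recognizable.forall_vertex fun a : Unit × Option H.V =>
      a.2 ≠ some h).not)
    (.and (.all fun h => ?_) (.all fun p => .imp (.const _)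
      (Recognizable.forall_adj fun a b : Unit × Option H.V =>
          ¬ (a.2 = some p.1 ∧ b.2 = some p.2)).not))
  refine Recognizable.forall_colour (A := Unit × Option H.V) (B := Prop) (P := fun G c =>
    (∀ u v, G.graph.Adj u v → (c u).1.2 = some h → (c v).1.2 = some h → (c u).2 → (c v).2) →
      (∀ v, (c v).1.2 = some h → ¬ (c v).2) ∨ ∀ v, (c v).1.2 = some h → (c v).2) ?_
  exact .imp (Recognizable.forall_adj fun a b : (Unit × Option H.V) × Prop =>
      a.1.2 = some h → b.1.2 = some h → a.2 → b.2)
    (.or (Recognizable.forall_vertex fun a : (Unit × Option H.V) × Prop => a.1.2 = some h → ¬ a.2)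
      (Recognizable.forall_vertex fun a : (Unit × Option H.V) × Prop => a.1.2 = some h → a.2))

/-- The colours allowed on the path that represents the edge `ab` of a topological minor: its ends
have the colours `a` and `b`, and its inner vertices have the colour `s(a, b)`. -/
def IsPathColour {W : Type} (a b : W) (x : Option (W ⊕ Sym2 W)) : Prop :=
  x = some (.inl a) ∨ x = some (.inl b) ∨ x = some (.inr s(a, b))

theorem exists_path_of_closed {V : Type} {G : SimpleGraph V} {S : V → Prop} {x y : V} (hx : S x)
    (h : ∀ Z : V → Prop, (∀ u v, G.Adj u v → S u → S v → Z u → Z v) → Z x → Z y) :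
    ∃ p : G.Walk x y, p.IsPath ∧ ∀ v ∈ p.support, S v := by
  classical
  have hy := h (fun v => ∃ p : G.Walk x v, ∀ w ∈ p.support, S w) (by
    rintro u v huv hu hv ⟨p, hp⟩
    refine ⟨p.concat huv, fun w hw => ?_⟩
    rw [SimpleGraph.Walk.support_concat] at hw
    simp only [List.mem_append, List.mem_singleton] at hw
    rcases hw with hw | rfl
    · exact hp w hw
    · exact hv) ⟨.nil, by simpa using hx⟩
  obtain ⟨p, hp⟩ := hy
  exact ⟨p.bypass, p.bypass_isPath, fun v hv => hp v (p.support_bypass_subset_support hv)⟩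

theorem isTopMinor_iff_colour (H G : FinGraph) : IsTopMinor H G ↔
    ∃ c : G.V → Option (H.V ⊕ Sym2 H.V),
    (∀ h, ¬ ∀ v, c v ≠ some (.inl h)) ∧
    (∀ h, ∀ Z : G.V → Prop, (∀ v, c v = some (.inl h) → Z v) ∨
      ∀ v, c v = some (.inl h) → ¬ Z v) ∧
    ∀ p : H.V × H.V, H.graph.Adj p.1 p.2 → ∀ Z : G.V → Prop,
      (∀ u v, G.graph.Adj u v → IsPathColour p.1 p.2 (c u) → IsPathColour p.1 p.2 (c v) →
        Z u → Z v) →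
      (∀ v, c v = some (.inl p.1) → ¬ Z v) ∨ ∀ v, c v = some (.inl p.2) → Z v := by
  classical
  constructor
  · rintro ⟨φ, P, h1, h2, h3, h4⟩
    let E : G.V → Prop := fun v => ∃ p : H.V × H.V, ∃ h : H.graph.Adj p.1 p.2,
      v ∈ (P p.1 p.2 h).support
    let c : G.V → Option (H.V ⊕ Sym2 H.V) := fun v =>
      if h : ∃ x, φ x = v then some (.inl h.choose)
      else if h : E v then some (.inr s(h.choose.1, h.choose.2)) else none
    have hc : ∀ v x, c v = some (.inl x) ↔ v = φ x := by
      intro v x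
      by_cases h : ∃ x, φ x = v
      · simp only [c, dif_pos h, Option.some.injEq, Sum.inl.injEq]
        refine ⟨fun hx => hx ▸ h.choose_spec.symm, fun hx => h1 ?_⟩
        rw [h.choose_spec, hx]
      · simp only [c, dif_neg h]
        refine ⟨fun h' => ?_, fun hx => (h ⟨x, hx.symm⟩).elim⟩
        split_ifs at h'; simp at h'
    have hcP : ∀ a b (h : H.graph.Adj a b), ∀ v ∈ (P a b h).support, IsPathColour a b (c v) := by
      intro a b h v hv
      by_cases hφ : ∃ x, φ x = v
      · obtain ⟨x, rfl⟩ := hφ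
        rcases h3 a b h x hv with rfl | rfl
        · exact Or.inl ((hc _ _).2 rfl)
        · exact Or.inr (Or.inl ((hc _ _).2 rfl))
      · have hE : E v := ⟨(a, b), h, hv⟩
        refine Or.inr (Or.inr ?_)
        simp only [c, dif_neg hφ, dif_pos hE, Option.some.injEq, Sum.inr.injEq]
        obtain ⟨h', hv'⟩ := hE.choose_spec
        by_contra hne
        exact hφ (h4 _ _ h' a b h hne v hv' hv)
    refine ⟨c, fun h hn => hn (φ h) ((hc _ _).2 rfl), fun h Z => ?_, fun p hp Z hZ => ?_⟩
    · simp only [hc, forall_eq]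
      exact em _
    · simp only [hc, forall_eq]
      refine or_iff_not_imp_left.2 fun hZ' => ?_
      rw [not_not] at hZ'
      have key : ∀ (x y : G.V) (q : G.graph.Walk x y),
          (∀ v ∈ q.support, IsPathColour p.1 p.2 (c v)) → Z x → Z y := by
        intro x y q
        induction q with
        | nil => exact fun _ h => h
        | cons hadj q ih =>
          intro hS hx
          refine ih (fun v hv => hS v (by simp [hv])) (hZ _ _ hadj (hS _ (by simp))
            (hS _ (by simp)) hx)
      exact key _ _ (P p.1 p.2 hp) (hcP _ _ hp) hZ'
  · rintro ⟨c, h1, h2, h3⟩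
    have h1' : ∀ h, ∃ v, c v = some (.inl h) := by
      intro h; have := h1 h; push Not at this; exact this
    choose φ hφ using h1'
    have huniq : ∀ h v, c v = some (.inl h) → v = φ h := by
      intro h v hv
      rcases h2 h (· = φ h) with h' | h'
      · exact h' v hv
      · exact absurd rfl (h' _ (hφ h))
    have hpath : ∀ a b, H.graph.Adj a b → ∃ p : G.graph.Walk (φ a) (φ b),
        p.IsPath ∧ ∀ v ∈ p.support, IsPathColour a b (c v) := by
      intro a b hab
      refine exists_path_of_closed (Or.inl (hφ a)) fun Z hZ ha => ?_
      rcases h3 (a, b) hab Z hZ with h | h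
      · exact absurd ha (h _ (hφ a))
      · exact h _ (hφ b)
    choose P hP1 hP2 using hpath
    refine ⟨φ, P, fun a b hab => ?_, hP1, fun a b h x hx => ?_, ?_⟩
    · have := hφ b
      rw [← hab, hφ a] at this
      simpa using this
    · have := hP2 a b h _ hx
      rw [IsPathColour, hφ x] at this
      simpa using this
    · intro a b h a' b' h' hne x hx hx'
      have e1 := hP2 a b h x hx
      have e2 := hP2 a' b' h' x hx'
      rcases e1 with e1 | e1 | e1
      · exact ⟨a, (huniq a x e1).symm⟩
      · exact ⟨b, (huniq b x e1).symm⟩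
      · rw [e1] at e2
        rcases e2 with e2 | e2 | e2
        · simp at e2
        · simp at e2
        · exact absurd (by simpa using e2) hne

theorem recognizable_isTopMinor (t : ℕ) (H : FinGraph) :
    Recognizable t fun (G : FinGraph) (_ : G.V → Unit) => IsTopMinor H G := by
  have : Finite (Sym2 H.V) := Quot.finite _
  simp only [isTopMinor_iff_colour]
  refine Recognizable.exists_colour (A := Unit) (B := Option (H.V ⊕ Sym2 H.V)) (P := fun G c =>
    (∀ h, ¬ ∀ v, (c v).2 ≠ some (.inl h)) ∧
    (∀ h, ∀ Z : G.V → Prop, (∀ v, (c v).2 = some (.inl h) → Z v) ∨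
      ∀ v, (c v).2 = some (.inl h) → ¬ Z v) ∧
    ∀ p : H.V × H.V, H.graph.Adj p.1 p.2 → ∀ Z : G.V → Prop,
      (∀ u v, G.graph.Adj u v → IsPathColour p.1 p.2 (c u).2 → IsPathColour p.1 p.2 (c v).2 →
        Z u → Z v) →
      (∀ v, (c v).2 = some (.inl p.1) → ¬ Z v) ∨ ∀ v, (c v).2 = some (.inl p.2) → Z v) ?_
  refine .and (.all fun h => (Recognizable.forall_vertex fun a : Unit × Option (H.V ⊕ Sym2 H.V) =>
      a.2 ≠ some (.inl h)).not)
    (.and (.all fun h => ?_) (.all fun p => .imp (.const _) ?_))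
  · refine Recognizable.forall_colour (A := Unit × Option (H.V ⊕ Sym2 H.V)) (B := Prop) (P := fun G c =>
      (∀ v, (c v).1.2 = some (.inl h) → (c v).2) ∨ ∀ v, (c v).1.2 = some (.inl h) → ¬ (c v).2) ?_
    exact .or (Recognizable.forall_vertex fun a : (Unit × Option (H.V ⊕ Sym2 H.V)) × Prop =>
        a.1.2 = some (.inl h) → a.2)
      (Recognizable.forall_vertex fun a : (Unit × Option (H.V ⊕ Sym2 H.V)) × Prop =>
          a.1.2 = some (.inl h) → ¬ a.2)
  · refine Recognizable.forall_colour (A := Unit × Option (H.V ⊕ Sym2 H.V)) (B := Prop) (P := fun G c =>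
      (∀ u v, G.graph.Adj u v → IsPathColour p.1 p.2 (c u).1.2 → IsPathColour p.1 p.2 (c v).1.2 →
        (c u).2 → (c v).2) →
      (∀ v, (c v).1.2 = some (.inl p.1) → ¬ (c v).2) ∨
        ∀ v, (c v).1.2 = some (.inl p.2) → (c v).2) ?_
    exact .imp (Recognizable.forall_adj fun a b : (Unit × Option (H.V ⊕ Sym2 H.V)) × Prop =>
        IsPathColour p.1 p.2 a.1.2 → IsPathColour p.1 p.2 b.1.2 → a.2 → b.2)
      (.or (Recognizable.forall_vertex fun a : (Unit × Option (H.V ⊕ Sym2 H.V)) × Prop =>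
          a.1.2 = some (.inl p.1) → ¬ a.2)
        (Recognizable.forall_vertex fun a : (Unit × Option (H.V ⊕ Sym2 H.V)) × Prop =>
            a.1.2 = some (.inl p.2) → a.2))

/-- The number `r_{𝒢,t}` is finite. -/
theorem finite_quotient_classSetoid {H : FinGraph} {𝒢 : Set FinGraph}
    (h : 𝒢 = minorFree H ∨ 𝒢 = topMinorFree H) (t : ℕ) :
    Finite (Quotient (classSetoid t 𝒢)) := by
  rcases h with rfl | rfl
  · exact (recognizable_isMinor t H).finite_quotient fun _ => Iff.rfl
  · exact (recognizable_isTopMinor t H).finite_quotient fun _ => Iff.rfl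

/-! ### The relation `∼*` -/

namespace Encoder

variable {o : Objective} {E : Encoder} {d : ℕ} {G₁ G₂ G₃ : BGraph} {c c' : ℤ}

theorem isShift_iff : E.IsShift o d G₁ G₂ c ↔ ∀ R ∈ E.C G₁.labels,
    (E.truncValue o d G₁ R = none ∧ E.truncValue o d G₂ R = none) ∨
    ∃ m₁ m₂ : ℕ, E.truncValue o d G₁ R = some m₁ ∧ E.truncValue o d G₂ R = some m₂ ∧
      (m₁ : ℤ) = m₂ + c := by
  refine forall₂_congr fun R _ => ?_
  generalize E.truncValue o d G₁ R = a
  generalize E.truncValue o d G₂ R = b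
  cases a <;> cases b <;> simp

theorem IsShift.symm (hl : G₁.labels = G₂.labels) (h : E.IsShift o d G₁ G₂ c) :
    E.IsShift o d G₂ G₁ (-c) := by
  rw [isShift_iff] at h ⊢
  intro R hR
  rcases h R (hl ▸ hR) with ⟨h1, h2⟩ | ⟨m₁, m₂, h1, h2, h3⟩
  · exact Or.inl ⟨h2, h1⟩
  · exact Or.inr ⟨m₂, m₁, h2, h1, by omega⟩

theorem IsShift.trans (hl : G₁.labels = G₂.labels) (h : E.IsShift o d G₁ G₂ c)
    (h' : E.IsShift o d G₂ G₃ c') : E.IsShift o d G₁ G₃ (c + c') := by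
  rw [isShift_iff] at h h' ⊢
  intro R hR
  rcases h R hR with ⟨h1, h2⟩ | ⟨m₁, m₂, h1, h2, h3⟩ <;>
    rcases h' R (hl ▸ hR) with ⟨h4, h5⟩ | ⟨m₃, m₄, h4, h5, h6⟩
  · exact Or.inl ⟨h1, h5⟩
  · rw [h2] at h4; cases h4
  · rw [h2] at h4; cases h4
  · rw [h2] at h4; cases h4
    exact Or.inr ⟨m₁, m₄, h1, h5, by omega⟩

/-- Some encoding has a finite truncated value. -/
def HasFinite (o : Objective) (E : Encoder) (d : ℕ) (G : BGraph) : Prop :=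
  ∃ R ∈ E.C G.labels, ∃ m, E.truncValue o d G R = some m

theorem IsShift.eq_add (h : E.IsShift o d G₁ G₂ c) {R : List ℕ} (hR : R ∈ E.C G₁.labels) {m : ℕ}
    (hm : E.truncValue o d G₁ R = some m) :
    ∃ m', E.truncValue o d G₂ R = some m' ∧ (m : ℤ) = m' + c := by
  have := h R hR
  rw [hm] at this
  cases h2 : E.truncValue o d G₂ R with
  | none => simp [h2] at this
  | some m' => exact ⟨m', rfl, by simpa [h2] using this⟩

theorem IsShift.unique (hf : E.HasFinite o d G₁) (h : E.IsShift o d G₁ G₂ c)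
    (h' : E.IsShift o d G₁ G₂ c') : c = c' := by
  obtain ⟨R, hR, m, hm⟩ := hf
  obtain ⟨m₁, h1, h2⟩ := h.eq_add hR hm
  obtain ⟨m₂, h3, h4⟩ := h'.eq_add hR hm
  rw [h1] at h3
  cases h3
  omega

theorem IsShift.of_not_hasFinite (hf : ¬ E.HasFinite o d G₁) (h : E.IsShift o d G₁ G₂ c) (c' : ℤ) :
    E.IsShift o d G₁ G₂ c' := by
  intro R hR
  have e := h R hR
  cases h1 : E.truncValue o d G₁ R with
  | some m => exact (hf ⟨R, hR, m, h1⟩).elim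
  | none => cases h2 : E.truncValue o d G₂ R <;> simp_all

theorem IsShift.hasFinite (hl : G₁.labels = G₂.labels) (hf : E.HasFinite o d G₁)
    (h : E.IsShift o d G₁ G₂ c) : E.HasFinite o d G₂ := by
  obtain ⟨R, hR, m, hm⟩ := hf
  obtain ⟨m₁, h1, -⟩ := h.eq_add hR hm
  exact ⟨R, hl ▸ hR, m₁, h1⟩

variable {g : ℕ → ℕ} {t : ℕ}

theorem delta_eq (hf : E.HasFinite o (g t) G₁) (h : E.IsShift o (g t) G₁ G₂ c) :
    E.delta o g t G₁ G₂ = c := by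
  have hu : ∃! c, E.IsShift o (g t) G₁ G₂ c := ⟨c, h, fun c' h' => h'.unique hf h⟩
  rw [delta, dif_pos hu]
  exact hu.choose_spec.1.unique hf h

theorem delta_eq_zero (hf : ¬ E.HasFinite o (g t) G₁) : E.delta o g t G₁ G₂ = 0 := by
  rw [delta, dif_neg]
  rintro ⟨c, hc, hu⟩
  have := hu _ (IsShift.of_not_hasFinite hf hc (c + 1))
  omega

theorem Sim.isShift_delta (h : E.Sim o g t G₁ G₂) :
    E.IsShift o (g t) G₁ G₂ (E.delta o g t G₁ G₂) := by
  obtain ⟨_, c, hc⟩ := h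
  by_cases hf : E.HasFinite o (g t) G₁
  · rwa [delta_eq hf hc]
  · exact hc.of_not_hasFinite hf _

theorem Sim.delta_trans (h : E.Sim o g t G₁ G₂) (h' : E.Sim o g t G₂ G₃) :
    E.delta o g t G₁ G₃ = E.delta o g t G₁ G₂ + E.delta o g t G₂ G₃ := by
  by_cases hf : E.HasFinite o (g t) G₁
  · exact delta_eq hf (h.isShift_delta.trans h.1 h'.isShift_delta)
  · have hf' : ¬ E.HasFinite o (g t) G₂ := fun hf' =>
      hf ((h.isShift_delta.symm h.1).hasFinite h.1.symm hf')
    rw [delta_eq_zero hf, delta_eq_zero hf, delta_eq_zero hf', add_zero]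

theorem Sim.delta_symm (h : E.Sim o g t G₁ G₂) :
    E.delta o g t G₂ G₁ = - E.delta o g t G₁ G₂ := by
  by_cases hf : E.HasFinite o (g t) G₂
  · exact delta_eq hf (h.isShift_delta.symm h.1)
  · have hf' : ¬ E.HasFinite o (g t) G₁ := fun hf' =>
      hf (h.isShift_delta.hasFinite h.1 hf')
    rw [delta_eq_zero hf, delta_eq_zero hf', neg_zero]

end Encoder

theorem BGraph.mem_labels {G : BGraph} {i : ℕ} : i ∈ G.labels ↔ ∃ v, G.bd.lab v = some i := by
  simp only [BGraph.labels, Set.Finite.mem_toFinset]; exact Iff.rfl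

namespace BGraph.Iso

variable {G₁ G₂ : BGraph}

/-- The inverse isomorphism. -/
def symm (e : BGraph.Iso G₁ G₂) : BGraph.Iso G₂ G₁ where
  toIso := e.toIso.symm
  lab_eq v := by rw [← e.lab_eq]; simp

theorem labels_eq (e : BGraph.Iso G₁ G₂) : G₁.labels = G₂.labels := by
  ext i
  rw [mem_labels, mem_labels]
  constructor
  · rintro ⟨v, hv⟩
    exact ⟨e.toIso v, by rw [e.lab_eq, hv]⟩
  · rintro ⟨v, hv⟩
    exact ⟨e.toIso.symm v, by rw [← e.lab_eq]; simpa using hv⟩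

theorem value_eq (e : BGraph.Iso G₁ G₂) (o : Objective) (E : Encoder) (R : List ℕ) :
    E.value o G₁ R = E.value o G₂ R := by
  have key : ∀ p : ℕ → Prop, (∃ S : Set G₁.V, p S.ncard ∧ E.L G₁ S R) ↔
      ∃ S : Set G₂.V, p S.ncard ∧ E.L G₂ S R := by
    intro p
    constructor
    · rintro ⟨S, h1, h2⟩
      refine ⟨e.toIso '' S, ?_, (E.L_iso _ _ e S R).1 h2⟩
      rwa [Set.ncard_image_of_injective _ e.toIso.injective]
    · rintro ⟨S, h1, h2⟩
      refine ⟨e.toIso.symm '' S, ?_, (E.L_iso _ _ e.symm S R).1 h2⟩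
      rwa [Set.ncard_image_of_injective _ e.toIso.symm.injective]
  unfold Encoder.value
  have k1 : (∃ S : Set G₁.V, E.L G₁ S R) ↔ ∃ S : Set G₂.V, E.L G₂ S R := by
    have := key (fun _ => True)
    simpa only [true_and] using this
  by_cases h : ∃ S : Set G₁.V, E.L G₁ S R
  · rw [if_pos h, if_pos (k1.1 h)]
    cases o
    · exact congrArg some (congrArg sInf (Set.ext fun k => key (fun n => n ≤ k)))
    · exact congrArg some (congrArg sSup (Set.ext fun k => key (fun n => k ≤ n)))
  · rw [if_neg h, if_neg (fun h' => h (k1.2 h'))]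

theorem truncValue_eq (e : BGraph.Iso G₁ G₂) (o : Objective) (E : Encoder) (d : ℕ) (R : List ℕ) :
    E.truncValue o d G₁ R = E.truncValue o d G₂ R := by
  have hv : E.value o G₁ = E.value o G₂ := funext fun R => e.value_eq o E R
  unfold Encoder.truncValue Encoder.TooFar
  rw [hv, e.labels_eq]

/-- The bijection between the vertices of two gluings that is induced by an isomorphism. -/
def glueEquiv (e : BGraph.Iso G₁ G₂) (K : BGraph) : GlueV G₁ K ≃ GlueV G₂ K :=
  Equiv.sumCongr e.toIso.toEquiv (Equiv.subtypeEquivRight fun v => by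
    constructor
    · intro h u i hu
      refine h (e.toIso.symm u) i ?_
      rw [← e.lab_eq]; simpa using hu
    · intro h u i hu
      exact h (e.toIso u) i (by rw [e.lab_eq, hu]))

theorem glueEquiv_right (e : BGraph.Iso G₁ G₂) (K : BGraph) (v : K.V) :
    e.glueEquiv K (right G₁ K v) = right G₂ K v := by
  by_cases hv : ∃ u i, G₁.bd.lab u = some i ∧ K.bd.lab v = some i
  · obtain ⟨u, i, h1, h2⟩ := hv
    rw [right_of_lab h1 h2, right_of_lab (u := e.toIso u) (by rw [e.lab_eq, h1]) h2]
    rfl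
  · push Not at hv
    rw [right_of_not hv, right_of_not]
    rfl

/-- Gluing respects isomorphism. -/
def glue (e : BGraph.Iso G₁ G₂) (K : BGraph) :
    (BGraph.glue G₁ K).graph ≃g (BGraph.glue G₂ K).graph where
  toEquiv := e.glueEquiv K
  map_rel_iff' := by
    intro x y
    have hl : ∀ u, e.glueEquiv K (.inl (e.toIso.symm u)) = .inl u := fun u =>
      congrArg Sum.inl (e.toIso.apply_symm_apply u)
    refine glue_adj.trans (Iff.trans ?_ glue_adj.symm)
    constructor
    · rintro (⟨a, b, h, h1, h2⟩ | ⟨a, b, h, h1, h2⟩)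
      · exact Or.inl ⟨e.toIso.symm a, e.toIso.symm b, e.toIso.symm.map_adj_iff.2 h,
          (e.glueEquiv K).injective (h1.trans (hl a).symm),
          (e.glueEquiv K).injective (h2.trans (hl b).symm)⟩
      · exact Or.inr ⟨a, b, h, (e.glueEquiv K).injective (h1.trans (e.glueEquiv_right K a).symm),
          (e.glueEquiv K).injective (h2.trans (e.glueEquiv_right K b).symm)⟩
    · rintro (⟨a, b, h, rfl, rfl⟩ | ⟨a, b, h, rfl, rfl⟩)
      · exact Or.inl ⟨e.toIso a, e.toIso b, e.toIso.map_adj_iff.2 h, rfl, rfl⟩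
      · exact Or.inr ⟨a, b, h, e.glueEquiv_right K a, e.glueEquiv_right K b⟩

end BGraph.Iso

namespace SimIn

variable {o : Objective} {E : Encoder} {g : ℕ → ℕ} {t : ℕ} {𝒢 : Set FinGraph} {G₁ G₂ G₃ : BGraph}

theorem sim (h : SimIn o E g t 𝒢 G₁ G₂) : E.Sim o g t G₁ G₂ := h.2.2.1

theorem symm (h : SimIn o E g t 𝒢 G₁ G₂) : SimIn o E g t 𝒢 G₂ G₁ := by
  obtain ⟨h1, h2, ⟨hl, c, hc⟩, hr⟩ := h
  exact ⟨h2, h1, ⟨hl.symm, _, hc.symm hl⟩, (classSetoid t 𝒢).iseqv.symm hr⟩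

theorem trans (h : SimIn o E g t 𝒢 G₁ G₂) (h' : SimIn o E g t 𝒢 G₂ G₃) :
    SimIn o E g t 𝒢 G₁ G₃ := by
  obtain ⟨h1, h2, ⟨hl, c, hc⟩, hr⟩ := h
  obtain ⟨_, h3, ⟨hl', c', hc'⟩, hr'⟩ := h'
  exact ⟨h1, h3, ⟨hl.trans hl', _, hc.trans hl hc'⟩, (classSetoid t 𝒢).iseqv.trans hr hr'⟩

theorem of_iso (h𝒢 : Hereditary 𝒢) (h : G₁ ∈ BClass t 𝒢) (e : BGraph.Iso G₁ G₂) :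
    SimIn o E g t 𝒢 G₁ G₂ := by
  refine ⟨h, ⟨?_, h𝒢 _ _ ⟨e.toIso.symm.toEmbedding⟩ h.2⟩, ⟨e.labels_eq, 0, ?_⟩, ?_⟩
  · have := h.1
    unfold BGraph.IsBoundaried at this ⊢
    rwa [← e.labels_eq]
  · intro R _
    rw [e.truncValue_eq]; simp
  · intro K _
    exact ⟨h𝒢 _ _ ⟨(e.glue K).symm.toEmbedding⟩, h𝒢 _ _ ⟨(e.glue K).toEmbedding⟩⟩

theorem refl (h𝒢 : Hereditary 𝒢) (h : G₁ ∈ BClass t 𝒢) : SimIn o E g t 𝒢 G₁ G₁ :=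
  of_iso h𝒢 h ⟨SimpleGraph.Iso.refl, fun _ => rfl⟩

theorem delta_of_iso (e : BGraph.Iso G₁ G₂) : E.delta o g t G₁ G₂ = 0 := by
  by_cases hf : E.HasFinite o (g t) G₁
  · refine Encoder.delta_eq hf fun R _ => ?_
    rw [e.truncValue_eq]; simp
  · exact Encoder.delta_eq_zero hf

end SimIn

/-! ### The number of classes -/

namespace Encoder

variable {o : Objective} {E : Encoder} {d : ℕ} {G : BGraph}

/-- Finite truncated values differ by at most `d`. -/
theorem truncValue_le_add {R R' : List ℕ} {m m' : ℕ} (hR : R ∈ E.C G.labels)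
    (hR' : R' ∈ E.C G.labels) (h : E.truncValue o d G R = some m)
    (h' : E.truncValue o d G R' = some m') : m ≤ m' + d := by
  have key : ∀ {R m}, E.truncValue o d G R = some m →
      E.value o G R = some m ∧ ¬ E.TooFar o d G m := by
    intro R m h
    unfold truncValue at h
    split at h
    · cases h
    · rename_i k hk
      split_ifs at h with ht
      cases h
      exact ⟨hk, ht⟩
  obtain ⟨h1, h2⟩ := key h
  obtain ⟨h3, h4⟩ := key h'
  by_contra hlt
  cases o
  · exact h2 ⟨R', hR', m', h3, by omega⟩
  · exact h4 ⟨R, hR, m, h1, by omega⟩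

/-- The least finite truncated value (`0` if there is none). -/
noncomputable def baseValue (o : Objective) (E : Encoder) (d : ℕ) (G : BGraph) : ℕ :=
  sInf {m | ∃ R ∈ E.C G.labels, E.truncValue o d G R = some m}

/-- The truncated value relative to the least one, where `d + 1` stands for the infinite value. -/
noncomputable def relValue (o : Objective) (E : Encoder) (d : ℕ) (G : BGraph) (R : List ℕ) :
    Fin (d + 2) :=
  match E.truncValue o d G R with
  | none => Fin.last (d + 1)
  | some m => ⟨min (m - E.baseValue o d G) d, by omega⟩

/-- The truncated values can be recovered from the relative ones, since they exceed the least one by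
at most `d`. -/
theorem truncValue_of_relValue {R : List ℕ} (hR : R ∈ E.C G.labels) :
    E.truncValue o d G R =
      if (E.relValue o d G R : ℕ) = d + 1 then none
      else some (E.relValue o d G R + E.baseValue o d G) := by
  unfold relValue
  cases h : E.truncValue o d G R with
  | none => simp
  | some m =>
    have hne : {m | ∃ R ∈ E.C G.labels, E.truncValue o d G R = some m}.Nonempty := ⟨m, R, hR, h⟩
    obtain ⟨R', hR', h'⟩ := Nat.sInf_mem hne
    have h1 := truncValue_le_add hR hR' h h'
    have h2 : E.baseValue o d G ≤ m := Nat.sInf_le ⟨R, hR, h⟩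
    have h3 : m ≤ E.baseValue o d G + d := h1
    dsimp only
    rw [if_neg (by omega)]
    congr 1
    omega

/-- The relative values of all the encodings of the label set `I`, in an enumeration. -/
noncomputable def profile (o : Objective) (E : Encoder) (d s : ℕ) (I : Finset ℕ) (G : BGraph)
    (j : Fin s) : Fin (d + 2) :=
  if h : (j : ℕ) < (E.C I).card then E.relValue o d G ((E.C I).equivFin.symm ⟨j, h⟩) else 0

/-- Graphs with the same label set and the same profile differ by a constant. -/
theorem isShift_of_profile_eq {G₁ G₂ : BGraph} {s : ℕ} (hl : G₁.labels = G₂.labels)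
    (hs : (E.C G₁.labels).card ≤ s)
    (h : E.profile o d s G₁.labels G₁ = E.profile o d s G₂.labels G₂) :
    E.IsShift o d G₁ G₂ (E.baseValue o d G₁ - E.baseValue o d G₂) := by
  intro R hR
  have e : E.relValue o d G₁ R = E.relValue o d G₂ R := by
    have hj := ((E.C G₁.labels).equivFin ⟨R, hR⟩).2
    have := congrFun h ⟨(E.C G₁.labels).equivFin ⟨R, hR⟩, hj.trans_le hs⟩
    rw [← hl] at this
    simp only [profile, dif_pos hj, Fin.eta, Equiv.symm_apply_apply] at this
    exact this
  rw [truncValue_of_relValue hR, truncValue_of_relValue (hl ▸ hR), e]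
  split_ifs
  · rfl
  · refine congrArg some ?_
    push_cast
    ring

end Encoder

/-- The possible classes of `∼*`: the label set, the class of `∼_{𝒢,t}` and the profile. -/
abbrev SimClass (E : Encoder) (g : ℕ → ℕ) (t : ℕ) (𝒢 : Set FinGraph) : Type 1 :=
  (Finset.Icc 1 t).powerset × Quotient (classSetoid t 𝒢) × (Fin (E.s t) → Fin (g t + 2))

/-- The class of a boundaried graph. -/
noncomputable def simClass (o : Objective) (E : Encoder) (g : ℕ → ℕ) (t : ℕ) (𝒢 : Set FinGraph)
    (G : BClass t 𝒢) : SimClass E g t 𝒢 :=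
  (⟨G.1.labels, Finset.mem_powerset.2 G.2.1⟩, Quotient.mk _ G,
    E.profile o (g t) (E.s t) G.1.labels G.1)

theorem simIn_of_simClass_eq {o : Objective} {E : Encoder} {g : ℕ → ℕ} {t : ℕ}
    {𝒢 : Set FinGraph} {G₁ G₂ : BClass t 𝒢}
    (h : simClass o E g t 𝒢 G₁ = simClass o E g t 𝒢 G₂) : SimIn o E g t 𝒢 G₁.1 G₂.1 := by
  have hl : G₁.1.labels = G₂.1.labels := congrArg Subtype.val (congrArg Prod.fst h)
  refine ⟨G₁.2, G₂.2, ⟨hl, _, Encoder.isShift_of_profile_eq hl ?_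
    (congrArg (fun x => x.2.2) h)⟩, Quotient.exact (congrArg (fun x => x.2.1) h)⟩
  exact Finset.le_sup (f := fun I => (E.C I).card) (Finset.mem_powerset.2 G₁.2.1)

theorem card_simClass (E : Encoder) (g : ℕ → ℕ) (t : ℕ) (𝒢 : Set FinGraph) :
    Nat.card (SimClass E g t 𝒢) = classBound E g t 𝒢 := by
  have h1 : Nat.card (Finset.Icc 1 t).powerset = 2 ^ t := by
    rw [Nat.card_eq_fintype_card, Fintype.card_coe, Finset.card_powerset, Nat.card_Icc,
      Nat.add_sub_cancel]
  have h2 : Nat.card (Fin (E.s t) → Fin (g t + 2)) = (g t + 2) ^ E.s t := by simp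
  rw [Nat.card_prod, Nat.card_prod, h1, h2, classBound, numClasses]
  ring

/-! ### Replacing pieces -/

section

variable {o : Objective} {E : Encoder} {g : ℕ → ℕ} {t : ℕ} {𝒢 : Set FinGraph}

/-- `ν` labels exactly the vertices of `B`, by labels from `{1, …, t}`. -/
def LabelsExactly {V : Type} (ν : Labelling V) (B : Set V) (t : ℕ) : Prop :=
  ν.dom = B ∧ ∀ v i, ν.lab v = some i → i ≤ t

theorem exists_labelsExactly {V : Type} [Finite V] {B : Set V} (h : B.ncard ≤ t) :
    ∃ ν : Labelling V, LabelsExactly ν B t := by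
  classical
  have e : B ≃ Fin B.ncard := by
    rw [← Nat.card_coe_set_eq]; exact Finite.equivFin B
  refine ⟨⟨fun v => if h : v ∈ B then some (e ⟨v, h⟩ + 1) else none, ?_, ?_⟩, ?_, ?_⟩
  · intro v i hi
    split_ifs at hi with hv
    cases hi
    omega
  · intro u v i hu hv
    split_ifs at hu hv with h1 h2
    cases hu
    have : e ⟨u, h1⟩ = e ⟨v, h2⟩ := Fin.ext (by have := Option.some.inj hv; omega)
    exact congrArg Subtype.val (e.injective this)
  · ext v
    constructor
    · rintro ⟨i, hi⟩
      dsimp only at hi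
      split_ifs at hi with hv
      exact hv
    · intro hv
      exact ⟨_, dif_pos hv⟩
  · intro v i hi
    dsimp only at hi
    split_ifs at hi with hv
    cases hi
    have := (e ⟨v, hv⟩).2
    omega

theorem mem_of_lab {V : Type} {ν : Labelling V} {B : Set V} (hν : LabelsExactly ν B t) {v : V}
    {i : ℕ} (h : ν.lab v = some i) : v ∈ B := hν.1 ▸ ⟨i, h⟩

theorem induced_mem_BClass (h𝒢 : Hereditary 𝒢) {G : FinGraph} (hG : G ∈ 𝒢) {B : Set G.V}
    (W : Set G.V) {ν : Labelling G.V} (hν : LabelsExactly ν B t) :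
    BGraph.induced G W ν ∈ BClass t 𝒢 := by
  refine ⟨fun i hi => ?_, h𝒢 _ G ⟨SimpleGraph.Embedding.induce W⟩ hG⟩
  obtain ⟨v, hv⟩ := BGraph.mem_labels.1 hi
  exact Finset.mem_Icc.2 ⟨ν.pos _ _ hv, hν.2 _ _ hv⟩

/-- Replacing a piece by an equivalent, smaller part of itself does not make the optimal value
grow: otherwise, by repeatedly replacing the smaller part by the larger one, one would obtain
graphs of negative value. -/
theorem delta_nonneg_of_self_replacement (hDP : DPFriendly o E g t 𝒢)
    {G : BGraph} {B U : Set G.V} {ν : Labelling G.V} (hν : LabelsExactly ν B t)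
    (hUB : Disjoint U B) (hUG : Disjoint U G.boundary)
    (hcl : ∀ u ∈ U, ∀ v, G.graph.Adj u v → v ∈ B ∪ U)
    (h : SimIn o E g t 𝒢 G (BGraph.induced G.toFinGraph (B ∪ U) ν))
    (h𝒢 : Hereditary 𝒢) : 0 ≤ E.delta o g t G (BGraph.induced G.toFinGraph (B ∪ U) ν) := by
  set D := BGraph.induced G.toFinGraph (B ∪ U) ν
  -- the part `D` of `G` is replaced by `G`, the part `D` of that copy again by `G`, and so on
  let K : ℕ → BGraph := fun i => Nat.rec D (fun _ K => BGraph.glueInto G Uᶜ ν K) i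
  have hK : ∀ i : ℕ, SimIn o E g t 𝒢 D (K i) ∧
      E.delta o g t D (K i) = i * E.delta o g t D G := by
    intro i
    induction i with
    | zero =>
      refine ⟨SimIn.refl h𝒢 h.2.1, ?_⟩
      rw [Nat.cast_zero, zero_mul]
      exact SimIn.delta_of_iso ⟨SimpleGraph.Iso.refl, fun _ => rfl⟩
    | succ i ih =>
      obtain ⟨h1, h2⟩ := hDP G h.1 B U ν hν.1 hν.2 hUB hUG
        (fun u hu v huv hv => (hcl u hu v huv).resolve_left hv) (K i) ih.1
      refine ⟨h.symm.trans h1, ?_⟩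
      rw [h.symm.sim.delta_trans h1.sim, h2]
      change _ + E.delta o g t D (K i) = _
      rw [ih.2]
      push_cast
      ring
  by_cases hf : E.HasFinite o (g t) D
  · rw [h.symm.sim.delta_symm]
    by_contra hlt
    obtain ⟨R, hR, m, hm⟩ := hf
    -- if `Δ` were negative, then `m + 1` rounds would lower the finite value `m` below zero
    obtain ⟨m', -, he⟩ := (hK (m + 1)).1.sim.isShift_delta.eq_add hR hm
    rw [(hK (m + 1)).2] at he
    push_cast at he
    nlinarith
  · rw [h.symm.sim.delta_symm, Encoder.delta_eq_zero hf, neg_zero]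

/-- The part of the graph `G[B₁ ∪ U₁]` that is induced by the subset `B₂ ∪ U₂` is
`G[B₂ ∪ U₂]`. -/
def inducedInducedIso {G : FinGraph} {W W₂ : Set G.V} (hsub : W₂ ⊆ W) (ν₁ ν₂ : Labelling G.V) :
    BGraph.Iso (BGraph.induced (BGraph.induced G W ν₁).toFinGraph
      (Subtype.val ⁻¹' W₂) (ν₂.restrict W)) (BGraph.induced G W₂ ν₂) where
  toIso :=
    { toFun := fun v => ⟨v.1.1, v.2⟩
      invFun := fun v => ⟨⟨v.1, hsub v.2⟩, v.2⟩
      left_inv := fun _ => rfl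
      right_inv := fun _ => rfl
      map_rel_iff' := Iff.rfl }
  lab_eq _ := rfl

/-- Replacing the outer one of two equivalent nested cuts by the inner one does not increase the
parameter. -/
theorem delta_nonneg_of_nested (hDP : DPFriendly o E g t 𝒢) (h𝒢 : Hereditary 𝒢) {G : FinGraph}
    {x y : Set G.V × Set G.V} {ν₁ ν₂ : Labelling G.V} (hx : IsCut G.graph t x)
    (hy : IsCut G.graph t y) (hν₁ : LabelsExactly ν₁ x.1 t) (hν₂ : LabelsExactly ν₂ y.1 t)
    (hn : Nested x y) (h : SimIn o E g t 𝒢 (BGraph.induced G (x.1 ∪ x.2) ν₁)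
      (BGraph.induced G (y.1 ∪ y.2) ν₂)) :
    0 ≤ E.delta o g t (BGraph.induced G (x.1 ∪ x.2) ν₁) (BGraph.induced G (y.1 ∪ y.2) ν₂) := by
  have e := inducedInducedIso hn.2 ν₁ ν₂
  have hs := h.trans (SimIn.of_iso h𝒢 h.2.1 e.symm)
  have hν : LabelsExactly (ν₂.restrict (x.1 ∪ x.2)) (Subtype.val ⁻¹' y.1) t :=
    ⟨by rw [← hν₂.1]; rfl, fun v i hi => hν₂.2 _ _ hi⟩
  have := delta_nonneg_of_self_replacement hDP (G := BGraph.induced G (x.1 ∪ x.2) ν₁)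
    (B := Subtype.val ⁻¹' y.1) (U := Subtype.val ⁻¹' y.2) hν
    (hy.disj.symm.preimage _) (by
      refine Set.disjoint_left.2 fun v hv hv' => ?_
      obtain ⟨i, hi⟩ := hv'
      exact Set.disjoint_left.1 hx.disj (mem_of_lab hν₁ hi) (hn.1 hv))
    (fun u hu v huv => hy.closed _ hu _ huv) hs h𝒢
  have he := h.sim.delta_trans (SimIn.of_iso h𝒢 h.2.1 e.symm).sim
  rw [SimIn.delta_of_iso e.symm, add_zero] at he
  exact le_of_le_of_eq this he

/-- The boundaried graph `K` belongs to `𝓕_t` (up to edges inside the boundary). -/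
def RootedPiece (t : ℕ) (K : BGraph) : Prop := Piece K.graph t K.boundary K.boundaryᶜ

theorem BGraph.labels_subset_of_induced {G : FinGraph} {B W : Set G.V} {ν : Labelling G.V}
    (hν : LabelsExactly ν B t) (hW : B ⊆ W) {i : ℕ} :
    i ∈ (BGraph.induced G W ν).labels ↔ ∃ v, ν.lab v = some i := by
  rw [BGraph.mem_labels]
  constructor
  · rintro ⟨v, hv⟩; exact ⟨v.1, hv⟩
  · rintro ⟨v, hv⟩; exact ⟨⟨v, hW (mem_of_lab hν hv)⟩, hv⟩

/-- If the subpiece `(B₁, U₁)` of a graph from `𝓕_t` is replaced by its own subpiece `(B₂, U₂)`, then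
the result belongs to `𝓕_t` again, and is smaller if `U₂ ≠ U₁`. -/
theorem rootedPiece_glueInto {K : BGraph} {B₁ U₁ B₂ U₂ : Set K.V} {ν₁ ν₂ : Labelling K.V}
    (h₁ : Subpiece K.graph t K.boundary K.boundaryᶜ B₁ U₁)
    (h₂ : Subpiece K.graph t B₁ U₁ B₂ U₂) (hss : U₂ ⊂ U₁)
    (hν₁ : LabelsExactly ν₁ B₁ t) (hν₂ : LabelsExactly ν₂ B₂ t)
    (hl : (BGraph.induced K.toFinGraph (B₁ ∪ U₁) ν₁).labels =
      (BGraph.induced K.toFinGraph (B₂ ∪ U₂) ν₂).labels) :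
    RootedPiece t (BGraph.glueInto K U₁ᶜ ν₁ (BGraph.induced K.toFinGraph (B₂ ∪ U₂) ν₂)) ∧
    Nat.card (BGraph.glueInto K U₁ᶜ ν₁ (BGraph.induced K.toFinGraph (B₂ ∪ U₂) ν₂)).V <
      Nat.card K.V := by
  classical
  set D := BGraph.induced K.toFinGraph (B₂ ∪ U₂) ν₂ with hD
  set A := BGraph.induced K.toFinGraph U₁ᶜ ν₁ with hA
  set K' := BGraph.glueInto K U₁ᶜ ν₁ D with hK'
  have hp₁ := h₁.piece_right
  have hp₂ := h₂.piece_right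
  have hB₁ : B₁ ⊆ U₁ᶜ := fun v hv hv' => Set.disjoint_left.1 hp₁.disjoint hv hv'
  have hlab : ∀ i, (∃ v, ν₁.lab v = some i) ↔ ∃ v, ν₂.lab v = some i := by
    intro i
    rw [← BGraph.labels_subset_of_induced hν₁ Set.subset_union_left, hl,
      BGraph.labels_subset_of_induced hν₂ Set.subset_union_left]
  -- the vertices of `D` with a label are glued to those of `B₁`
  have hrB : ∀ (v : K.V) (hv : v ∈ B₂), ∃ a, ∃ ha : a ∈ B₁,
      BGraph.right A D ⟨v, Or.inl hv⟩ = .inl ⟨a, hB₁ ha⟩ := by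
    intro v hv
    obtain ⟨i, hi⟩ : v ∈ ν₂.dom := hν₂.1 ▸ hv
    obtain ⟨a, ha⟩ := (hlab i).2 ⟨v, hi⟩
    exact ⟨a, mem_of_lab hν₁ ha,
      BGraph.right_of_lab (G := A) (K := D) (u := ⟨a, hB₁ (mem_of_lab hν₁ ha)⟩) ha hi⟩
  have hrB' : ∀ (a : K.V) (ha : a ∈ B₁), ∃ v, ∃ hv : v ∈ B₂,
      BGraph.right A D ⟨v, Or.inl hv⟩ = .inl ⟨a, hB₁ ha⟩ := by
    intro a ha
    obtain ⟨i, hi⟩ : a ∈ ν₁.dom := hν₁.1 ▸ ha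
    obtain ⟨v, hv⟩ := (hlab i).1 ⟨a, hi⟩
    exact ⟨v, mem_of_lab hν₂ hv, BGraph.right_of_lab (G := A) (K := D) (u := ⟨a, hB₁ ha⟩) hi hv⟩
  have hrU : ∀ (v : K.V) (hv : v ∈ U₂), ∃ h, BGraph.right A D ⟨v, Or.inr hv⟩ =
      .inr ⟨⟨v, Or.inr hv⟩, h⟩ := by
    intro v hv
    refine ⟨?_, BGraph.right_of_not ?_⟩ <;>
    · intro u i _ h
      exact Set.disjoint_left.1 hp₂.disjoint (mem_of_lab hν₂ h) hv
  have hinr : ∀ w : {v : D.V // ∀ u i, A.bd.lab u = some i → D.bd.lab v ≠ some i},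
      w.1.1 ∈ U₂ := by
    rintro ⟨⟨v, hv | hv⟩, hw⟩
    · exfalso
      obtain ⟨i, hi⟩ : v ∈ ν₂.dom := hν₂.1 ▸ hv
      obtain ⟨a, ha⟩ := (hlab i).2 ⟨v, hi⟩
      exact hw ⟨a, hB₁ (mem_of_lab hν₁ ha)⟩ i ha hi
    · exact hv
  refine ⟨?_, ?_⟩
  · rcases isEmpty_or_nonempty K'.V with hempty | ⟨⟨w₀⟩⟩
    · unfold RootedPiece
      have e1 : K'.boundaryᶜ = ∅ := Set.eq_empty_of_isEmpty _
      have e2 : K'.boundary = ∅ := Set.eq_empty_of_isEmpty _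
      rw [e1, e2]
      exact .nil _ (by simp)
    let f : K.V → K'.V := fun v => if h : v ∈ U₁ᶜ then .inl ⟨v, h⟩ else w₀
    have hf : ∀ v (h : v ∈ U₁ᶜ), f v = .inl ⟨v, h⟩ := fun v h => dif_pos h
    let φ : K.V → K'.V := fun v => if h : v ∈ B₂ ∪ U₂ then BGraph.right A D ⟨v, h⟩ else w₀
    have hφ : ∀ v (h : v ∈ B₂ ∪ U₂), φ v = BGraph.right A D ⟨v, h⟩ := fun v h => dif_pos h
    let Z : Set K'.V := Set.range Sum.inr
    have hφB : φ '' B₂ = f '' B₁ := by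
      ext x
      constructor
      · rintro ⟨v, hv, rfl⟩
        obtain ⟨a, ha, he⟩ := hrB v hv
        exact ⟨a, ha, by rw [hf a (hB₁ ha), hφ v (Or.inl hv), he]⟩
      · rintro ⟨a, ha, rfl⟩
        obtain ⟨v, hv, he⟩ := hrB' a ha
        exact ⟨v, hv, by rw [hf a (hB₁ ha), hφ v (Or.inl hv), he]⟩
    have hφU : φ '' U₂ = Z := by
      ext x
      constructor
      · rintro ⟨v, hv, rfl⟩
        obtain ⟨h, he⟩ := hrU v hv
        rw [hφ v (Or.inr hv), he]
        exact ⟨_, rfl⟩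
      · rintro ⟨w, rfl⟩
        refine ⟨w.1.1, hinr w, ?_⟩
        rw [hφ _ (Or.inr (hinr w))]
        exact BGraph.right_of_not w.2
    have hZ : Piece K'.graph t (f '' B₁) Z := by
      rw [← hφB, ← hφU]
      refine hp₂.map φ ?_ ?_
      · intro v hv w hw hvw
        rw [hφ v hv, hφ w hw] at hvw
        exact congrArg Subtype.val (BGraph.right_injective hvw)
      · intro u hu w huw
        obtain ⟨h, he⟩ := hrU u hu
        rw [hφ u (Or.inr hu)] at huw
        rcases BGraph.glue_adj.1 huw with ⟨a, b, -, h1, -⟩ | ⟨a, b, hab, h1, h2⟩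
        · rw [he] at h1; cases h1
        · have := BGraph.right_injective h1
          subst this
          exact ⟨b.1, hab, (hφ b.1 b.2).trans h2.symm⟩
    have hcomp : K'.boundaryᶜ = f '' (K.boundaryᶜ \ U₁) ∪ Z := by
      ext x
      rcases x with u | w
      · constructor
        · intro hu
          refine Or.inl ⟨u.1, ⟨fun hb => hu ?_, u.2⟩, hf u.1 u.2⟩
          obtain ⟨i, hi⟩ := hb
          exact ⟨i, hi⟩
        · rintro (⟨v, ⟨hv1, hv2⟩, he⟩ | ⟨w, hw⟩)
          · rw [hf v hv2] at he
            cases Sum.inl.inj he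
            exact fun ⟨i, hi⟩ => hv1 ⟨i, hi⟩
          · cases hw
      · refine ⟨fun _ => Or.inr ⟨w, rfl⟩, fun _ => ?_⟩
        rintro ⟨i, hi⟩
        cases hi
    have hbd : K'.boundary = f '' K.boundary := by
      ext x
      have hsub : K.boundary ⊆ U₁ᶜ := fun v hv hv' => h₁.subset hv' hv
      constructor
      · rcases x with u | w
        · rintro ⟨i, hi⟩
          exact ⟨u.1, ⟨i, hi⟩, hf u.1 u.2⟩
        · rintro ⟨i, hi⟩
          cases hi
      · rintro ⟨v, ⟨i, hi⟩, rfl⟩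
        rw [hf v (hsub ⟨i, hi⟩)]
        exact ⟨i, hi⟩
    unfold RootedPiece
    rw [hcomp, hbd]
    refine h₁.replace f Z hZ ?_ ?_ ?_
    · intro v hv w hw hvw
      rw [hf v hv, hf w hw] at hvw
      exact congrArg Subtype.val (Sum.inl.inj hvw)
    · refine Set.disjoint_left.2 ?_
      rintro _ ⟨v, hv, rfl⟩ ⟨w, hw⟩
      rw [hf v hv] at hw
      cases hw
    · intro a ha w haw
      rw [hf a ha] at haw
      rcases BGraph.glue_adj.1 haw with ⟨a', b, hab, h1, h2⟩ | ⟨a', b, hab, h1, h2⟩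
      · cases Sum.inl.inj h1
        exact Or.inl ⟨b.1, b.2, hab, (hf b.1 b.2).trans h2.symm⟩
      · obtain ⟨i, hi, -⟩ := BGraph.fromRight_iff.2 h1
        refine Or.inr ⟨mem_of_lab hν₁ hi, ?_⟩
        have hw : w = φ b.1 := h2.trans (hφ b.1 b.2).symm
        rw [hw, ← hφB, ← hφU]
        exact b.2.imp (fun h => ⟨_, h, rfl⟩) (fun h => ⟨_, h, rfl⟩)
  · let ι : K'.V → K.V := Sum.elim (fun u => u.1) (fun w => w.1.1)
    have : Fintype K'.V := Fintype.ofFinite _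
    have : Fintype K.V := Fintype.ofFinite _
    rw [Nat.card_eq_fintype_card, Nat.card_eq_fintype_card]
    refine Fintype.card_lt_of_injective_of_notMem ι ?_ (b := (Set.exists_of_ssubset hss).choose) ?_
    · rintro (u | w) (u' | w') h
      · exact congrArg Sum.inl (Subtype.ext h)
      · exact absurd (hss.1 (hinr w')) (show (w'.1.1 : K.V) ∉ U₁ from
          (show u.1 = w'.1.1 from h) ▸ u.2)
      · exact absurd (hss.1 (hinr w)) (show (w.1.1 : K.V) ∉ U₁ from
          (show w.1.1 = u'.1 from h) ▸ u'.2)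
      · exact congrArg Sum.inr (Subtype.ext (Subtype.ext h))
    · obtain ⟨h1, h2⟩ := (Set.exists_of_ssubset hss).choose_spec
      rintro ⟨u | w, hx⟩
      · exact u.2 (show u.1 ∈ U₁ by rw [show u.1 = _ from hx]; exact h1)
      · exact h2 (by rw [← hx]; exact hinr w)

/-- Every graph from `𝓕_t` is equivalent to one with a bounded number of vertices, which is not of
greater value. -/
theorem exists_small_equivalent (hDP : DPFriendly o E g t 𝒢) (h𝒢 : Hereditary 𝒢)
    [Finite (Quotient (classSetoid t 𝒢))] : ∀ (n : ℕ) (K : BGraph), Nat.card K.V = n →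
    K ∈ BClass t 𝒢 → RootedPiece t K → ∃ K', SimIn o E g t 𝒢 K K' ∧ RootedPiece t K' ∧
      0 ≤ E.delta o g t K K' ∧ K'.boundaryᶜ.ncard ≤ 2 ^ classBound E g t 𝒢 * t := by
  classical
  intro n
  induction n using Nat.strong_induction_on with
  | _ n ih =>
  rintro K rfl hK hp
  by_cases hsmall : K.boundaryᶜ.ncard ≤ 2 ^ classBound E g t 𝒢 * t
  · refine ⟨K, SimIn.refl h𝒢 hK, hp, ?_, hsmall⟩
    rw [SimIn.delta_of_iso ⟨SimpleGraph.Iso.refl, fun _ => rfl⟩]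
  push Not at hsmall
  have : Nonempty (Labelling K.V) :=
    ⟨{ lab := fun _ => none, pos := nofun, inj := nofun }⟩
  choose! ν hν using fun B : Set K.V => fun h : B.ncard ≤ t => exists_labelsExactly h
  let cls : Set K.V → Set K.V → SimClass E g t 𝒢 := fun B U =>
    if h : B.ncard ≤ t then simClass o E g t 𝒢 ⟨BGraph.induced K.toFinGraph (B ∪ U) (ν B),
      induced_mem_BClass h𝒢 hK.2 _ (hν B h)⟩ else simClass o E g t 𝒢 ⟨K, hK⟩
  have : Fintype (SimClass E g t 𝒢) := Fintype.ofFinite _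
  rcases Piece.exists_repeated cls hp Finset.univ (by
    rw [Finset.card_univ, ← Nat.card_eq_fintype_card, card_simClass]; exact hsmall) with
    ⟨_, _, _, h⟩ | ⟨B₁, U₁, B₂, U₂, h1, h2, hss, hcls⟩
  · exact absurd (Finset.mem_univ _) h
  have hB₁ := h1.piece_right.ncard_le
  have hB₂ := h2.piece_right.ncard_le
  simp only [cls, dif_pos hB₁, dif_pos hB₂] at hcls
  have hsim := simIn_of_simClass_eq hcls
  dsimp only at hsim
  have hcut₁ := h1.piece_right.isCut
  obtain ⟨h3, h4⟩ := hDP K hK B₁ U₁ (ν B₁) (hν B₁ hB₁).1 (hν B₁ hB₁).2 hcut₁.disj.symm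
    (Set.disjoint_left.2 fun v hv hv' => h1.subset hv hv')
    (fun u hu v huv hv => (hcut₁.closed u hu v huv).resolve_left hv) _ hsim
  have hnn := delta_nonneg_of_nested hDP h𝒢 hcut₁ h2.piece_right.isCut (hν B₁ hB₁)
    (hν B₂ hB₂) ⟨h2.subset, h2.union_subset⟩ hsim
  obtain ⟨h5, h6⟩ := rootedPiece_glueInto h1 h2 hss (hν B₁ hB₁) (hν B₂ hB₂) hsim.sim.1
  obtain ⟨K', k1, k2, k3, k4⟩ := ih _ h6 _ rfl h3.2.1 h5
  refine ⟨K', h3.trans k1, k2, ?_, k4⟩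
  rw [h3.sim.delta_trans k1.sim, h4]
  exact add_nonneg hnn k3

end

/-! ### Reducible cuts -/

namespace IsCut

variable {V : Type} {G : SimpleGraph V} {s : ℕ} {x : Set V × Set V} {C : Set V} {v : V}

theorem connOn_inter (hx : IsCut G s x) (hC : ConnOn G C) (hv : C ∩ x.1 = {v}) :
    ConnOn G (C ∩ (x.1 ∪ x.2)) := by
  refine hC.inter_side (R := x.2ᶜ) (v := v) ?_ ?_ ?_ ?_
  · intro a _
    by_cases h : a ∈ x.2
    · exact Or.inl (Or.inr h)
    · exact Or.inr h
  · intro a _ ha b hab _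
    exact hx.closed a (not_not.1 ha) b hab
  · rw [← hv]
    ext a
    refine and_congr_right fun _ => ⟨fun h => h.1.resolve_right h.2, fun h => ⟨Or.inl h, ?_⟩⟩
    exact Set.disjoint_left.1 hx.disj h
  · intro a _ ha b hab _ hb
    exact ha (hx.closed b hb a hab.symm)

theorem connOn_diff (hx : IsCut G s x) (hC : ConnOn G C) (hv : C ∩ x.1 = {v}) :
    ConnOn G (C ∩ x.2ᶜ) := by
  refine hC.inter_side (R := x.1 ∪ x.2) (v := v) ?_ ?_ ?_ ?_
  · intro a _
    by_cases h : a ∈ x.2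
    · exact Or.inr (Or.inr h)
    · exact Or.inl h
  · intro a _ ha b hab _ hb
    exact ha (hx.closed b hb a hab.symm)
  · rw [← hv]
    ext a
    refine and_congr_right fun _ => ⟨fun h => h.2.resolve_right h.1, fun h => ⟨?_, Or.inl h⟩⟩
    exact Set.disjoint_left.1 hx.disj h
  · intro a _ ha b hab _
    exact hx.closed a (not_not.1 ha) b hab

end IsCut

/-- In a linked chain of cuts of order `s'`, there are `s'` disjoint connected sets that cross every
cut of the chain in exactly one vertex. -/
theorem CutChain.exists_crossing {V : Type} [Finite V] {G : SimpleGraph V} {s s' m : ℕ}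
    (hs : s' ≤ s) (hm : 1 ≤ m) {c : ℕ → Set V × Set V} (hc : CutChain G s' m c)
    (hcard : ∀ i < m, (c i).1.ncard = s')
    (hl : ∀ z, IsCut G s z → Nested (c 0) z → Nested z (c (m - 1)) → s' ≤ z.1.ncard) :
    ∃ (C : Fin s' → Set V) (f : ℕ → Fin s' → V), (∀ q, ConnOn G (C q)) ∧
      (∀ p q, p ≠ q → Disjoint (C p) (C q)) ∧
      ∀ i < m, (∀ q, C q ∩ (c i).1 = {f i q}) ∧ Set.range (f i) = (c i).1 := by
  have h0 := hc.cut 0 (by omega)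
  have hlast := hc.cut (m - 1) (by omega)
  have hn := hc.nested_le (Nat.zero_le (m - 1)) (by omega)
  set A := (c 0).1
  set U₀ := (c 0).2
  set B := (c (m - 1)).1
  set U₁ := (c (m - 1)).2
  let Reg : Set V := (A ∪ U₀) \ U₁
  let G' : SimpleGraph V :=
    { Adj := fun u v => G.Adj u v ∧ u ∈ Reg ∧ v ∈ Reg
      symm := ⟨fun u v h => ⟨h.1.symm, h.2.2, h.2.1⟩⟩
      loopless := ⟨fun u h => G.loopless.irrefl u h.1⟩ }
  have hAReg : A ⊆ Reg := fun v hv =>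
    ⟨Or.inl hv, fun h => Set.disjoint_left.1 h0.disj hv (hn.1 h)⟩
  have hBReg : B ⊆ Reg := fun v hv =>
    ⟨hn.2 (Or.inl hv), fun h => Set.disjoint_left.1 hlast.disj hv h⟩
  have hsep : SepGE G' A B s' := by
    intro L R hA hB hLR hcl
    have hB' : ∀ v ∈ B, v ∈ L ∩ R ∩ Reg ∨ v ∈ (R \ L) ∩ U₀ := by
      intro v hv
      by_cases hvL : v ∈ L
      · exact Or.inl ⟨⟨hvL, hB hv⟩, hBReg hv⟩
      · exact Or.inr ⟨⟨hB hv, hvL⟩, (hn.2 (Or.inl hv)).resolve_left fun h => hvL (hA h)⟩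
    by_contra hlt
    have hle : (L ∩ R ∩ Reg).ncard ≤ (L ∩ R).ncard := Set.ncard_le_ncard Set.inter_subset_left
    have := hl (L ∩ R ∩ Reg, U₁ ∪ (R \ L) ∩ U₀) ⟨by dsimp only; omega, ?_, ?_⟩ ⟨?_, ?_⟩ ⟨?_, ?_⟩
    · dsimp only at this; omega
    · refine Set.disjoint_left.2 ?_
      rintro v ⟨⟨h1, -⟩, -, h2⟩ (h | ⟨⟨-, h⟩, -⟩)
      · exact h2 h
      · exact h h1
    · rintro u (hu | ⟨⟨huR, huL⟩, hu0⟩) v huv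
      · rcases hlast.closed u hu v huv with hv | hv
        · exact (hB' v hv).imp id Or.inr
        · exact Or.inr (Or.inl hv)
      · by_cases hu1 : u ∈ U₁
        · rcases hlast.closed u hu1 v huv with hv | hv
          · exact (hB' v hv).imp id Or.inr
          · exact Or.inr (Or.inl hv)
        have hv0 := h0.closed u hu0 v huv
        by_cases hv1 : v ∈ U₁
        · exact Or.inr (Or.inl hv1)
        have hvR : v ∈ R := by
          by_contra hvR
          have hvL : v ∈ L := (show v ∈ L ∪ R from hLR ▸ Set.mem_univ v).resolve_right hvR
          exact huL (hcl v hvL hvR u ⟨huv.symm, ⟨hv0, hv1⟩, ⟨Or.inr hu0, hu1⟩⟩)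
        by_cases hvL : v ∈ L
        · exact Or.inl ⟨⟨hvL, hvR⟩, hv0, hv1⟩
        · exact Or.inr (Or.inr ⟨⟨hvR, hvL⟩, hv0.resolve_left fun h => hvL (hA h)⟩)
    · rintro v (hv | hv)
      · exact hn.1 hv
      · exact hv.2
    · rintro v (hv | hv | hv)
      · exact hv.2.1
      · exact Or.inr (hn.1 hv)
      · exact Or.inr hv.2
    · exact Set.subset_union_left
    · rintro v (hv | hv)
      · exact (hB' v hv).imp id Or.inr
      · exact Or.inr (Or.inl hv)
  obtain ⟨C, hC, hdj, hne⟩ := exists_linkage s' G' A B hsep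
  have hCG : ∀ q, ConnOn G (C q) := fun q => (hC q).mono (G := G') (fun _ _ h => h.1)
  have hmeet : ∀ i < m, ∀ q, (C q ∩ (c i).1).Nonempty := by
    intro i hi q
    by_contra hcon
    obtain ⟨⟨a, ha, haA⟩, b, hb, hbB⟩ := hne q
    have hbi := (hc.nested_le (show i ≤ m - 1 by omega) (by omega)).2 (Or.inl hbB)
    have := (hCG q).subset_of_closed (hc.cut i hi).closed
      ⟨b, hb, hbi.resolve_left fun h => hcon ⟨b, hb, h⟩⟩ hcon ha
    exact Set.disjoint_left.1 h0.disj haA ((hc.nested_le (Nat.zero_le i) hi).1 this)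
  have hf : ∀ i, ∃ f : Fin s' → V, i < m → (∀ q, C q ∩ (c i).1 = {f q}) ∧
      Set.range f = (c i).1 := by
    intro i
    by_cases hi : i < m
    · obtain ⟨f, hf1, hf2, hf3⟩ := exists_transversal C (c i).1 (hcard i hi) hdj (hmeet i hi)
      refine ⟨f, fun _ => ⟨fun q => ?_, ?_⟩⟩
      · ext v
        constructor
        · rintro ⟨hv, hv'⟩; exact hf2 q v hv hv'
        · rintro rfl; exact hf1 q
      · ext v
        constructor
        · rintro ⟨q, rfl⟩; exact (hf1 q).2
        · exact hf3 v
    · exact ⟨fun q => (hne q).1.some, fun h => absurd h hi⟩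
  choose f hf using hf
  exact ⟨C, f, hCG, hdj, hf⟩

/-- The labelling that gives the label `q + 1` to the vertex `f q`. -/
noncomputable def Labelling.ofInjective {V : Type} {s : ℕ} (f : Fin s → V)
    (_hf : Function.Injective f) : Labelling V := by
  classical
  exact
  { lab := fun v => if h : ∃ q, f q = v then some (h.choose + 1) else none
    pos := by
      intro v i h
      split_ifs at h
      cases h
      omega
    inj := by
      intro u v i hu hv
      split_ifs at hu hv with h1 h2
      have h : h1.choose = h2.choose := Fin.ext (by
        have := (Option.some.inj hu).trans (Option.some.inj hv).symm
        omega)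
      rw [← h1.choose_spec, h, h2.choose_spec] }

theorem Labelling.ofInjective_lab {V : Type} {s : ℕ} {f : Fin s → V}
    {hf : Function.Injective f} {v : V} {i : ℕ} :
    (Labelling.ofInjective f hf).lab v = some i ↔ ∃ q, f q = v ∧ (q : ℕ) + 1 = i := by
  classical
  change (if h : ∃ q, f q = v then some ((h.choose : ℕ) + 1) else none) = some i ↔ _
  constructor
  · intro h
    split_ifs at h with h1
    exact ⟨h1.choose, h1.choose_spec, Option.some.inj h⟩
  · rintro ⟨q, rfl, rfl⟩
    have h1 : ∃ q', f q' = f q := ⟨q, rfl⟩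
    rw [dif_pos h1, hf h1.choose_spec]

theorem labelsExactly_ofInjective {V : Type} {s t : ℕ} (hs : s ≤ t) {f : Fin s → V}
    (hf : Function.Injective f) : LabelsExactly (Labelling.ofInjective f hf) (Set.range f) t := by
  refine ⟨?_, ?_⟩
  · ext v
    constructor
    · rintro ⟨i, hi⟩
      obtain ⟨q, hq, -⟩ := Labelling.ofInjective_lab.1 hi
      exact ⟨q, hq⟩
    · rintro ⟨q, hq⟩
      exact ⟨_, Labelling.ofInjective_lab.2 ⟨q, hq, rfl⟩⟩
  · intro v i hi
    obtain ⟨q, -, rfl⟩ := Labelling.ofInjective_lab.1 hi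
    omega

/-- `K` is a minor of `M` in such a way that the branch set of a labelled vertex contains the vertex
of `M` with the same label. -/
def RootedMinor (K M : BGraph) : Prop :=
  ∃ β : K.V → Set M.V, (∀ v, (β v).Nonempty ∧ ConnOn M.graph (β v)) ∧
    (∀ u v, u ≠ v → Disjoint (β u) (β v)) ∧
    (∀ u v, K.graph.Adj u v → ∃ a ∈ β u, ∃ b ∈ β v, M.graph.Adj a b) ∧
    ∀ v w i, K.bd.lab v = some i → M.bd.lab w = some i → w ∈ β v

/-- Disjoint connected sets that cross both of the nested cuts `x` and `y` make `G[y]` a rooted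
minor of `G[x]`. -/
theorem rootedMinor_of_crossing {G : FinGraph} {s r : ℕ} {x y : Set G.V × Set G.V}
    (hx : IsCut G.graph r x) (hy : IsCut G.graph r y) (hn : Nested x y) (C : Fin s → Set G.V)
    (hC : ∀ q, ConnOn G.graph (C q)) (hdj : ∀ p q, p ≠ q → Disjoint (C p) (C q))
    {f f' : Fin s → G.V} (hf : Function.Injective f) (hf' : Function.Injective f')
    (hfx : ∀ q, C q ∩ x.1 = {f q}) (hfy : ∀ q, C q ∩ y.1 = {f' q})
    (hrf' : Set.range f' = y.1) :
    RootedMinor (BGraph.induced G (y.1 ∪ y.2) (Labelling.ofInjective f' hf'))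
      (BGraph.induced G (x.1 ∪ x.2) (Labelling.ofInjective f hf)) := by
  classical
  let D : Fin s → Set G.V := fun q => C q ∩ (x.1 ∪ x.2) ∩ y.2ᶜ
  have hfm : ∀ q, f q ∈ C q ∧ f q ∈ x.1 := fun q => by
    have : f q ∈ C q ∩ x.1 := by rw [hfx]; rfl
    exact this
  have hfm' : ∀ q, f' q ∈ C q ∧ f' q ∈ y.1 := fun q => by
    have : f' q ∈ C q ∩ y.1 := by rw [hfy]; rfl
    exact this
  have hD : ∀ q, ConnOn G.graph (D q) := by
    intro q
    refine hy.connOn_diff (v := f' q) (hx.connOn_inter (hC q) (hfx q)) ?_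
    rw [← hfy q]
    ext a
    exact ⟨fun h => ⟨h.1.1, h.2⟩, fun h => ⟨⟨h.1, hn.2 (Or.inl h.2)⟩, h.2⟩⟩
  have hf'D : ∀ q, f' q ∈ D q := fun q => ⟨⟨(hfm' q).1, hn.2 (Or.inl (hfm' q).2)⟩,
    fun h => Set.disjoint_left.1 hy.disj (hfm' q).2 h⟩
  have hfD : ∀ q, f q ∈ D q := fun q => ⟨⟨(hfm q).1, Or.inl (hfm q).2⟩,
    fun h => Set.disjoint_left.1 hx.disj (hfm q).2 (hn.1 h)⟩
  have hDdj : ∀ p q v, v ∈ D p → v ∈ D q → p = q := by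
    intro p q v hp hq
    by_contra hne
    exact Set.disjoint_left.1 (hdj p q hne) hp.1.1 hq.1.1
  -- the branch set of `v`
  let β : G.V → Set G.V := fun v => if h : ∃ q, f' q = v then D h.choose else {v}
  have hβf : ∀ q, β (f' q) = D q := by
    intro q
    have h : ∃ q', f' q' = f' q := ⟨q, rfl⟩
    change (if h : ∃ q', f' q' = f' q then D h.choose else {f' q}) = D q
    rw [dif_pos h, hf' h.choose_spec]
  have hβU : ∀ v ∈ y.2, β v = {v} := by
    intro v hv
    refine dif_neg ?_
    rintro ⟨q, rfl⟩
    exact Set.disjoint_left.1 hy.disj (hfm' q).2 hv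
  have hcases : ∀ v ∈ y.1 ∪ y.2, (∃ q, v = f' q) ∨ v ∈ y.2 := by
    rintro v (hv | hv)
    · rw [← hrf'] at hv
      obtain ⟨q, rfl⟩ := hv
      exact Or.inl ⟨q, rfl⟩
    · exact Or.inr hv
  have hself : ∀ v ∈ y.1 ∪ y.2, v ∈ β v := by
    intro v hv
    rcases hcases v hv with ⟨q, rfl⟩ | hv
    · rw [hβf]; exact hf'D q
    · rw [hβU v hv]; rfl
  have hsub : ∀ v ∈ y.1 ∪ y.2, β v ⊆ x.1 ∪ x.2 := by
    intro v hv
    rcases hcases v hv with ⟨q, rfl⟩ | hv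
    · rw [hβf]; exact fun a ha => ha.1.2
    · rw [hβU v hv]; rintro _ rfl; exact Or.inr (hn.1 hv)
  refine ⟨fun v => Subtype.val ⁻¹' β v.1, ?_, ?_, ?_, ?_⟩
  · rintro ⟨v, hv⟩
    refine ⟨⟨⟨v, hn.2 hv⟩, hself v hv⟩, ConnOn.preimage_val ?_ (hsub v hv)⟩
    rcases hcases v hv with ⟨q, rfl⟩ | hv
    · rw [hβf]; exact hD q
    · rw [hβU v hv]; exact connOn_singleton v
  · rintro ⟨u, hu⟩ ⟨v, hv⟩ huv
    refine Set.disjoint_left.2 ?_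
    rintro ⟨a, _⟩ hau hav
    change a ∈ β u at hau
    change a ∈ β v at hav
    apply huv
    apply Subtype.ext
    rcases hcases u hu with ⟨p, rfl⟩ | hu <;> rcases hcases v hv with ⟨q, rfl⟩ | hv
    · rw [hβf] at hau hav
      exact congrArg f' (hDdj p q a hau hav)
    · rw [hβf] at hau
      rw [hβU v hv, Set.mem_singleton_iff] at hav
      subst hav
      exact absurd hv hau.2
    · rw [hβf] at hav
      rw [hβU u hu, Set.mem_singleton_iff] at hau
      subst hau
      exact absurd hu hav.2
    · rw [hβU u hu] at hau
      rw [hβU v hv] at hav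
      exact (Set.mem_singleton_iff.1 hau).symm.trans hav
  · rintro ⟨u, hu⟩ ⟨v, hv⟩ huv
    exact ⟨⟨u, hn.2 hu⟩, hself u hu, ⟨v, hn.2 hv⟩, hself v hv, huv⟩
  · rintro ⟨v, hv⟩ ⟨w, hw⟩ i h1 h2
    obtain ⟨p, hp, hpi⟩ := (Labelling.ofInjective_lab (hf := hf')).1 h1
    obtain ⟨q, hq, hqi⟩ := (Labelling.ofInjective_lab (hf := hf)).1 h2
    obtain rfl : p = q := Fin.ext (by omega)
    change w ∈ β v
    dsimp only at hp hq
    rw [← hp, ← hq, hβf]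
    exact hfD p

section

variable {o : Objective} {E : Encoder} {g : ℕ → ℕ} {t : ℕ} {𝒢 : Set FinGraph}

/-- The length of a chain of nested cuts that is long enough to contain two linked equivalent
ones. -/
noncomputable def chainLength (E : Encoder) (g : ℕ → ℕ) (t : ℕ) (𝒢 : Set FinGraph) : ℕ :=
  (classBound E g t 𝒢 + 1) ^ (t + 1)

/-- A large piece contains a cut of bounded size that can be replaced by an equivalent, properly
smaller graph which is a rooted minor of it. -/
theorem exists_reducible (hDP : DPFriendly o E g t 𝒢) (h𝒢 : Hereditary 𝒢)
    [Finite (Quotient (classSetoid t 𝒢))] {G : FinGraph} (hG : G ∈ 𝒢) {B U : Set G.V}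
    (hp : Piece G.graph t B U) (hU : 2 ^ chainLength E g t 𝒢 * t < U.ncard) :
    ∃ (s : ℕ) (f : Fin s → G.V) (hf : Function.Injective f) (U' : Set G.V) (K : BGraph), s ≤ t ∧
      IsCut G.graph t (Set.range f, U') ∧ U' ⊆ U ∧
      U'.ncard ≤ 2 * (2 ^ chainLength E g t 𝒢 * t) ∧
      SimIn o E g t 𝒢
        (BGraph.induced G (Set.range f ∪ U') (Labelling.ofInjective f hf)) K ∧
      0 ≤ E.delta o g t
        (BGraph.induced G (Set.range f ∪ U') (Labelling.ofInjective f hf)) K ∧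
      Nat.card K.V < (Set.range f ∪ U').ncard ∧
      RootedMinor K (BGraph.induced G (Set.range f ∪ U') (Labelling.ofInjective f hf)) := by
  classical
  have hNt : t ≤ 2 ^ chainLength E g t 𝒢 * t := Nat.le_mul_of_pos_left _ (by positivity)
  obtain ⟨B₁, U₁, hp₁, hU₁, -, hlt, hle⟩ := hp.exists_window hNt hU
  obtain ⟨c, hc, hcn⟩ := hp₁.exists_chain (chainLength E g t 𝒢) hlt
  have hc' : CutChain G.graph t ((classBound E g t 𝒢 + 1) ^ (t + 1)) c :=
    ⟨fun i hi => hc.cut i (hi.trans (Nat.lt_succ_self _)),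
      fun i j hij hj => hc.nested i j hij (hj.trans (Nat.lt_succ_self _)),
      fun i j hij hj => hc.strict i j hij (hj.trans (Nat.lt_succ_self _))⟩
  obtain ⟨d, s, hst, hd, hcard, hnest, hlink⟩ := CutChain.exists_linked (by omega) t hc'
  obtain ⟨C, f, hC, hdj, hf⟩ := hd.exists_crossing hst (by omega) hcard hlink
  have hinj : ∀ i < classBound E g t 𝒢 + 1, Function.Injective (f i) := by
    intro i hi p q hpq
    by_contra hne
    have h1 : f i p ∈ C p ∩ (d i).1 := by rw [(hf i hi).1]; rfl
    have h2 : f i q ∈ C q ∩ (d i).1 := by rw [(hf i hi).1]; rfl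
    exact Set.disjoint_left.1 (hdj p q hne) h1.1 (hpq ▸ h2.1)
  let M : Fin (classBound E g t 𝒢 + 1) → BGraph := fun i =>
    BGraph.induced G ((d i).1 ∪ (d i).2) (Labelling.ofInjective (f i) (hinj i i.2))
  have hM : ∀ i, M i ∈ BClass t 𝒢 := fun i =>
    induced_mem_BClass h𝒢 hG _ (labelsExactly_ofInjective hst _)
  have : Fintype (SimClass E g t 𝒢) := Fintype.ofFinite _
  -- there are more linked cuts than classes
  obtain ⟨i, j, hij, he⟩ := Fintype.exists_ne_map_eq_of_card_lt
    (fun i => simClass o E g t 𝒢 ⟨M i, hM i⟩) (by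
      rw [← Nat.card_eq_fintype_card, card_simClass, Fintype.card_fin]
      exact Nat.lt_succ_self _)
  wlog hlt' : i < j generalizing i j
  · exact this j i hij.symm he.symm (lt_of_le_of_ne (not_lt.1 hlt') hij.symm)
  have hsim := simIn_of_simClass_eq he
  have hn := hd.nested i j hlt' j.2
  have hci : IsCut G.graph t (d i) :=
    ⟨(hd.cut i i.2).ncard_le.trans hst, (hd.cut i i.2).disj, (hd.cut i i.2).closed⟩
  have hcj : IsCut G.graph t (d j) :=
    ⟨(hd.cut j j.2).ncard_le.trans hst, (hd.cut j j.2).disj, (hd.cut j j.2).closed⟩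
  have hνi := labelsExactly_ofInjective hst (hinj i i.2)
  have hνj := labelsExactly_ofInjective hst (hinj j j.2)
  rw [(hf i i.2).2] at hνi
  rw [(hf j j.2).2] at hνj
  have hsub : (d i).2 ⊆ U₁ := ((hcn 0 (by omega)).trans (hnest i i.2)).1
  refine ⟨s, f i, hinj i i.2, (d i).2, M j, hst, ?_, hsub.trans hU₁,
    (Set.ncard_le_ncard hsub).trans hle, ?_, ?_, ?_, ?_⟩
  · rw [(hf i i.2).2]; exact hci
  · rw [(hf i i.2).2]; exact hsim
  · rw [(hf i i.2).2]; exact delta_nonneg_of_nested hDP h𝒢 hci hcj hνi hνj hn hsim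
  · rw [(hf i i.2).2]
    change Nat.card ((d j).1 ∪ (d j).2 : Set G.V) < _
    rw [Nat.card_coe_set_eq, Set.ncard_union_eq hcj.disj, Set.ncard_union_eq hci.disj,
      hcard i i.2, hcard j j.2]
    have := Set.ncard_lt_ncard (hn.1.ssubset_of_ne (hd.strict i j hlt' j.2))
    omega
  · rw [(hf i i.2).2]
    exact rootedMinor_of_crossing hci hcj hn C hC hdj (hinj i i.2) (hinj j j.2)
      (hf i i.2).1 (hf j j.2).1 (hf j j.2).2

end

/-! ### Equivalent graphs without boundary -/

section

variable {o : Objective} {E : Encoder} {g : ℕ → ℕ} {t : ℕ} {𝒢 : Set FinGraph}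

/-- For a graph without boundary, the value of the only encoding decides the problem. -/
theorem yes_iff_truncValue {Q : ParamProblem 𝒢} {LQ : VertexLanguage} (hQ : IsCertifying o LQ Q)
    {R₀ : List ℕ} (hC : E.C ∅ = {R₀})
    (hL : ∀ G : BGraph, G.labels = ∅ → G.toFinGraph ∈ 𝒢 →
      ∀ S : Set G.V, E.L G S R₀ ↔ LQ G.toFinGraph S)
    {G : BGraph} (hl : G.labels = ∅) (hG : G.toFinGraph ∈ 𝒢) (d : ℕ) (k : ℤ) :
    Q.yes G.toFinGraph k ↔ ∃ m : ℕ, E.truncValue o d G R₀ = some m ∧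
      match o with
      | .minimize => (m : ℤ) ≤ k
      | .maximize => k ≤ (m : ℤ) := by
  have hfar : ∀ m, E.value o G R₀ = some m → ¬ E.TooFar o d G m := by
    rintro m hm ⟨R, hR, m', hm', h⟩
    rw [hl, hC, Finset.mem_singleton] at hR
    rw [hR, hm] at hm'
    cases hm'
    cases o <;> dsimp only at h <;> omega
  have htr : E.truncValue o d G R₀ = E.value o G R₀ := by
    unfold Encoder.truncValue
    cases h : E.value o G R₀ with
    | none => rfl
    | some m => exact if_neg (hfar m h)
  rw [hQ _ hG, htr]
  by_cases hex : ∃ S, E.L G S R₀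
  · obtain ⟨S₀, hS₀⟩ := hex
    unfold Encoder.value
    rw [if_pos ⟨S₀, hS₀⟩]
    simp only [Option.some.injEq, exists_eq_left']
    cases o with
    | minimize =>
      dsimp only
      constructor
      · rintro ⟨S, hS, hLS⟩
        refine le_trans ?_ hS
        exact_mod_cast Nat.sInf_le (s := {k : ℕ | ∃ S : Set G.V, S.ncard ≤ k ∧ E.L G S R₀})
          ⟨S, le_rfl, (hL G hl hG S).2 hLS⟩
      · intro h
        obtain ⟨S, hS, hLS⟩ := Nat.sInf_mem
          (s := {k : ℕ | ∃ S : Set G.V, S.ncard ≤ k ∧ E.L G S R₀}) ⟨_, S₀, le_rfl, hS₀⟩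
        exact ⟨S, le_trans (by exact_mod_cast hS) h, (hL G hl hG S).1 hLS⟩
    | maximize =>
      dsimp only
      have hb : BddAbove {k : ℕ | ∃ S : Set G.V, k ≤ S.ncard ∧ E.L G S R₀} := by
        refine ⟨Nat.card G.V, ?_⟩
        rintro k ⟨S, hS, -⟩
        exact hS.trans (Set.ncard_le_card S)
      constructor
      · rintro ⟨S, hS, hLS⟩
        refine hS.trans ?_
        exact_mod_cast le_csSup hb ⟨S, le_rfl, (hL G hl hG S).2 hLS⟩
      · intro h
        obtain ⟨S, hS, hLS⟩ := Nat.sSup_mem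
          (s := {k : ℕ | ∃ S : Set G.V, k ≤ S.ncard ∧ E.L G S R₀}) ⟨_, S₀, le_rfl, hS₀⟩ hb
        exact ⟨S, h.trans (by exact_mod_cast hS), (hL G hl hG S).1 hLS⟩
  · have hv : E.value o G R₀ = none := if_neg hex
    rw [hv]
    constructor
    · intro h
      cases o <;> obtain ⟨S, -, hS⟩ := h <;> exact (hex ⟨S, (hL G hl hG S).2 hS⟩).elim
    · rintro ⟨m, hm, -⟩
      cases hm

/-- For graphs without boundary, `∼*` implies the equivalence of instances, up to the shift by `Δ`.
-/
theorem yes_iff_of_simIn {Q : ParamProblem 𝒢} {LQ : VertexLanguage} (hQ : IsCertifying o LQ Q)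
    (hE : E.IsEncoderFor 𝒢 LQ) {G₁ G₂ : BGraph} (hl : G₁.labels = ∅)
    (h : SimIn o E g t 𝒢 G₁ G₂) (k : ℤ) :
    Q.yes G₁.toFinGraph k ↔ Q.yes G₂.toFinGraph (k - E.delta o g t G₁ G₂) := by
  obtain ⟨R₀, hC, hL⟩ := hE
  have hs := h.sim.isShift_delta R₀ (by rw [hl, hC]; exact Finset.mem_singleton_self _)
  rw [yes_iff_truncValue hQ hC hL hl h.1.2 (g t), yes_iff_truncValue hQ hC hL
    (h.sim.1 ▸ hl) h.2.1.2 (g t)]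
  generalize E.delta o g t G₁ G₂ = c at *
  cases h1 : E.truncValue o (g t) G₁ R₀ with
  | none =>
    cases h2 : E.truncValue o (g t) G₂ R₀ with
    | none => simp
    | some m => rw [h1, h2] at hs; cases hs
  | some m₁ =>
    cases h2 : E.truncValue o (g t) G₂ R₀ with
    | none => rw [h1, h2] at hs; cases hs
    | some m₂ =>
      rw [h1, h2] at hs
      have he : (m₁ : ℤ) = m₂ + c := Option.some.inj hs
      simp only [Option.some.injEq, exists_eq_left']
      cases o <;> dsimp only <;> constructor <;> intro <;> omega

end

/-! ### Replacement rules -/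

/-- The boundaried graph on `{0, …, ℓ - 1}` whose boundary consists of the first `s` vertices; the
vertex `j` has the label `j + 1`. -/
def stdGraph (s : ℕ) {ℓ : ℕ} (M : SimpleGraph (Fin ℓ)) : BGraph where
  V := Fin ℓ
  graph := M
  bd :=
    { lab := fun j => if (j : ℕ) < s then some (j + 1) else none
      pos := by
        intro j i h
        split_ifs at h
        cases h
        omega
      inj := by
        intro u v i hu hv
        split_ifs at hu hv
        have := (Option.some.inj hu).trans (Option.some.inj hv).symm
        exact Fin.ext (by omega) }

theorem stdGraph_lab {s ℓ i : ℕ} {M : SimpleGraph (Fin ℓ)} {j : Fin ℓ} :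
    (stdGraph s M).bd.lab j = some i ↔ (j : ℕ) < s ∧ (j : ℕ) + 1 = i := by
  change (if (j : ℕ) < s then some ((j : ℕ) + 1) else none) = some i ↔ _
  split_ifs with h <;> simp [h]

/-- Every boundaried graph with label set `{1, …, s}` is isomorphic to a standard one. -/
theorem exists_iso_stdGraph {s : ℕ} {K : BGraph} (hl : K.labels = Finset.Icc 1 s) :
    ∃ M : SimpleGraph (Fin (Nat.card K.V)), s ≤ Nat.card K.V ∧
      Nonempty (BGraph.Iso K (stdGraph s M)) := by
  classical
  have hex : ∀ i : Fin s, ∃ v, K.bd.lab v = some ((i : ℕ) + 1) := fun i =>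
    BGraph.mem_labels.1 (by rw [hl]; exact Finset.mem_Icc.2 ⟨by omega, by omega⟩)
  choose b hb using hex
  have hbinj : Function.Injective b := by
    intro i j hij
    have := hb i
    rw [hij, hb j] at this
    exact Fin.ext (by have := Option.some.inj this; omega)
  have hle : s ≤ Nat.card K.V := by
    simpa using Nat.card_le_card_of_injective b hbinj
  let e₀ : K.V ≃ Fin (Nat.card K.V) := Finite.equivFin K.V
  have : Fintype K.V := Fintype.ofFinite _
  let a : Fin s → K.V := fun i => e₀.symm (Fin.castLE hle i)
  have hainj : Function.Injective a := e₀.symm.injective.comp (Fin.castLE_injective hle)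
  let π : Equiv.Perm K.V := ((Equiv.ofInjective b hbinj).symm.trans
    (Equiv.ofInjective a hainj)).extendSubtype
  have hπ : ∀ i, π (b i) = a i := by
    intro i
    have := Equiv.extendSubtype_apply_of_mem ((Equiv.ofInjective b hbinj).symm.trans
      (Equiv.ofInjective a hainj)) (b i) ⟨i, rfl⟩
    refine this.trans ?_
    have h2 : (Equiv.ofInjective b hbinj).symm ⟨b i, ⟨i, rfl⟩⟩ = i :=
      Equiv.ofInjective_symm_apply hbinj i
    rw [Equiv.trans_apply, h2]
    rfl
  let e := π.trans e₀
  have he : ∀ i, (e (b i) : ℕ) = i := fun i => by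
    change (e₀ (π (b i)) : ℕ) = i
    rw [hπ, Equiv.apply_symm_apply]
    rfl
  refine ⟨K.graph.map e.toEmbedding, hle, ⟨⟨SimpleGraph.Iso.map e K.graph, ?_⟩⟩⟩
  intro v
  change (stdGraph s _).bd.lab (e v) = K.bd.lab v
  have hlab : ∀ i, K.bd.lab v = some i → 1 ≤ i ∧ i ≤ s := fun i hi =>
    Finset.mem_Icc.1 (hl ▸ BGraph.mem_labels.2 ⟨v, hi⟩)
  apply Option.ext
  intro i
  rw [stdGraph_lab]
  constructor
  · rintro ⟨h1, h2⟩
    have : b ⟨e v, h1⟩ = v := e.injective (Fin.ext (he _))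
    rw [← this, hb, ← h2]
  · intro h
    obtain ⟨h1, h2⟩ := hlab i h
    have : v = b ⟨i - 1, by omega⟩ := by
      refine K.bd.inj _ _ i h ?_
      rw [hb]
      congr 1
      dsimp only
      omega
    rw [this, he]
    dsimp only
    omega

/-- A replacement rule. The graph `M` on `ℓ` vertices is replaced by the graph `K` on `ℓ'`
vertices; they have the first `s` vertices in common. If `whole` is set, the rule applies only if
all the vertices of the part of the partition that it is applied to are replaced. The
parameter of the problem decreases by `δ`. -/
structure Rule where
  ℓ : ℕ
  s : ℕ
  M : SimpleGraph (Fin ℓ)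
  whole : Bool
  ℓ' : ℕ
  K : SimpleGraph (Fin ℓ')
  δ : ℕ

/-- The conditions under which a rule is sound. The last one ensures that the parts of the partition
remain pieces, so that further rules are applicable. -/
structure Rule.Valid (o : Objective) (E : Encoder) (g : ℕ → ℕ) (t : ℕ) (𝒢 : Set FinGraph)
    (r : Rule) : Prop where
  s_le_t : r.s ≤ t
  s_le : r.s ≤ r.ℓ'
  lt : r.ℓ' < r.ℓ
  sim : SimIn o E g t 𝒢 (stdGraph r.s r.M) (stdGraph r.s r.K)
  delta : E.delta o g t (stdGraph r.s r.M) (stdGraph r.s r.K) = r.δ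
  keep : if r.whole then RootedPiece t (stdGraph r.s r.K)
    else RootedMinor (stdGraph r.s r.K) (stdGraph r.s r.M)

/-- A graph on the remaining (`alive`) vertices of `V`. -/
structure Config (V : Type) where
  graph : SimpleGraph V
  alive : Set V
  supp : ∀ u v, graph.Adj u v → u ∈ alive

/-- The graph induced by the remaining vertices. -/
def Config.toFinGraph {V : Type} [Finite V] (S : Config V) : FinGraph :=
  ⟨S.alive, S.graph.induce S.alive⟩

/-- The rule `r` applies to the tuple `x` of vertices, whose elements with the indices `≥ s` lie in
a common part of the partition. -/
structure Rule.Applies {V : Type} (r : Rule) (S : Config V) (part : V → ℕ) (x : Fin r.ℓ → V) :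
    Prop where
  inj : Function.Injective x
  mem : ∀ i, x i ∈ S.alive
  adj : ∀ i j, S.graph.Adj (x i) (x j) ↔ r.M.Adj i j
  closed : ∀ i : Fin r.ℓ, r.s ≤ i → ∀ v, S.graph.Adj (x i) v → ∃ j, v = x j
  part_ne : ∀ i : Fin r.ℓ, r.s ≤ i → part (x i) ≠ 0
  part_eq : ∀ i j : Fin r.ℓ, r.s ≤ i → r.s ≤ j → part (x i) = part (x j)
  whole : r.whole = true → (∀ i : Fin r.ℓ, i < r.s → part (x i) = 0) ∧
    ∀ i : Fin r.ℓ, r.s ≤ i → ∀ v ∈ S.alive, part v = part (x i) → ∃ j, v = x j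

/-- The adjacency of the vertices with the indices `i` and `j` after the rule has been applied. -/
def Rule.NewAdj (r : Rule) (i j : Fin r.ℓ) : Prop :=
  (∃ a b : Fin r.ℓ', (a : ℕ) = i ∧ (b : ℕ) = j ∧ r.K.Adj a b) ∨ (i < r.s ∧ j < r.s ∧ r.M.Adj i j)

theorem Rule.NewAdj.symm {r : Rule} {i j : Fin r.ℓ} (h : r.NewAdj i j) : r.NewAdj j i := by
  rcases h with ⟨a, b, ha, hb, hab⟩ | ⟨h1, h2, h3⟩
  · exact Or.inl ⟨b, a, hb, ha, hab.symm⟩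
  · exact Or.inr ⟨h2, h1, h3.symm⟩

/-- The result of the application of a rule. The elements of the tuple with the indices `≥ ℓ'` are
deleted; the other ones serve as the vertices of `K`. -/
def Rule.apply {V : Type} (r : Rule) (S : Config V) (x : Fin r.ℓ → V) : Config V where
  alive := {v | v ∈ S.alive ∧ ∀ i : Fin r.ℓ, r.ℓ' ≤ i → v ≠ x i}
  graph :=
    { Adj := fun u v => ((∃ i j, u = x i ∧ v = x j ∧ r.NewAdj i j) ∨
        (S.graph.Adj u v ∧ ¬ ((∃ i, u = x i) ∧ ∃ j, v = x j))) ∧ u ≠ v ∧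
        (u ∈ S.alive ∧ ∀ i : Fin r.ℓ, r.ℓ' ≤ i → u ≠ x i) ∧
        (v ∈ S.alive ∧ ∀ i : Fin r.ℓ, r.ℓ' ≤ i → v ≠ x i)
      symm := ⟨by
        rintro u v ⟨h, hne, h1, h2⟩
        refine ⟨h.imp ?_ ?_, hne.symm, h2, h1⟩
        · rintro ⟨i, j, hi, hj, hij⟩
          exact ⟨j, i, hj, hi, hij.symm⟩
        · rintro ⟨huv, hn⟩
          exact ⟨huv.symm, fun h => hn ⟨h.2, h.1⟩⟩⟩
      loopless := ⟨fun u h => h.2.1 rfl⟩ }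
  supp u v h := h.2.2.1

section

variable {o : Objective} {E : Encoder} {g : ℕ → ℕ} {t : ℕ} {𝒢 : Set FinGraph} {V : Type} [Finite V]
  {r : Rule} {S : Config V} {part : V → ℕ} {x : Fin r.ℓ → V}

/-- A valid rule leads to an equivalent instance. -/
theorem Rule.Applies.sound (hDP : DPFriendly o E g t 𝒢) (h𝒢 : Hereditary 𝒢)
    {Q : ParamProblem 𝒢} {LQ : VertexLanguage} (hQ : IsCertifying o LQ Q)
    (hE : E.IsEncoderFor 𝒢 LQ) (hr : r.Valid o E g t 𝒢) (h : r.Applies S part x)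
    (hS : S.toFinGraph ∈ 𝒢) : (r.apply S x).toFinGraph ∈ 𝒢 ∧
      ∀ k : ℤ, Q.yes S.toFinGraph k ↔ Q.yes (r.apply S x).toFinGraph (k - r.δ) := by
  classical
  let G : BGraph := ⟨S.toFinGraph, { lab := fun _ => none, pos := nofun, inj := nofun }⟩
  have hGl : G.labels = ∅ := by
    refine Finset.eq_empty_of_forall_notMem fun i hi => ?_
    obtain ⟨v, hv⟩ := BGraph.mem_labels.1 hi
    cases hv
  have hsℓ : r.s ≤ r.ℓ := hr.s_le.trans hr.lt.le
  let y : Fin r.ℓ → G.V := fun i => ⟨x i, h.mem i⟩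
  have hy : Function.Injective y := fun i j hij => h.inj (congrArg Subtype.val hij)
  let f : Fin r.s → G.V := fun q => y (Fin.castLE hsℓ q)
  have hf : Function.Injective f := hy.comp (Fin.castLE_injective hsℓ)
  let ν := Labelling.ofInjective f hf
  let U : Set G.V := {v | ∃ i : Fin r.ℓ, r.s ≤ i ∧ v = y i}
  have hrange : ∀ v : G.V, v ∈ Set.range f ∪ U ↔ ∃ i, v = y i := by
    intro v
    constructor
    · rintro (⟨q, rfl⟩ | ⟨i, -, rfl⟩)
      · exact ⟨_, rfl⟩
      · exact ⟨_, rfl⟩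
    · rintro ⟨i, rfl⟩
      by_cases hi : (i : ℕ) < r.s
      · exact Or.inl ⟨⟨i, hi⟩, rfl⟩
      · exact Or.inr ⟨i, not_lt.1 hi, rfl⟩
  have hfU : ∀ i : Fin r.ℓ, y i ∈ U ↔ r.s ≤ i := by
    intro i
    constructor
    · rintro ⟨j, hj, he⟩
      rw [hy he]
      exact hj
    · exact fun hi => ⟨i, hi, rfl⟩
  have hνy : ∀ (i : Fin r.ℓ) (a : ℕ), ν.lab (y i) = some a ↔ (i : ℕ) < r.s ∧ (i : ℕ) + 1 = a := by
    intro i a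
    rw [Labelling.ofInjective_lab]
    constructor
    · rintro ⟨q, hq, rfl⟩
      rw [← hy hq]
      exact ⟨q.2, rfl⟩
    · rintro ⟨h1, rfl⟩
      exact ⟨⟨i, h1⟩, rfl, rfl⟩
  -- the part that is replaced is isomorphic to the left-hand side of the rule
  let eM : BGraph.Iso (stdGraph r.s r.M) (BGraph.induced G.toFinGraph (Set.range f ∪ U) ν) :=
    { toIso :=
        { toEquiv := Equiv.ofBijective (fun i => ⟨y i, (hrange _).2 ⟨i, rfl⟩⟩) (by
            constructor
            · intro i j hij
              exact hy (congrArg Subtype.val hij)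
            · rintro ⟨v, hv⟩
              obtain ⟨i, rfl⟩ := (hrange v).1 hv
              exact ⟨i, rfl⟩)
          map_rel_iff' := h.adj _ _ }
      lab_eq := by
        intro i
        apply Option.ext
        intro a
        exact (hνy i a).trans stdGraph_lab.symm }
  let D := BGraph.induced G.toFinGraph (Set.range f ∪ U) ν
  have hM := hr.sim
  have hD : SimIn o E g t 𝒢 D (stdGraph r.s r.K) :=
    (SimIn.of_iso h𝒢 hM.1 eM).symm.trans hM
  have hDδ : E.delta o g t D (stdGraph r.s r.K) = r.δ := by
    have := (SimIn.of_iso (o := o) (E := E) (g := g) h𝒢 hM.1 eM).symm.sim.delta_trans hM.sim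
    rw [hr.delta, SimIn.delta_of_iso eM.symm, zero_add] at this
    exact this
  have hcl : ∀ i : Fin r.ℓ, r.s ≤ i → ∀ v : G.V, G.graph.Adj (y i) v → ∃ j, v = y j := by
    intro i hi v hv
    obtain ⟨j, hj⟩ := h.closed i hi v.1 hv
    exact ⟨j, Subtype.ext hj⟩
  obtain ⟨h1, h2⟩ := hDP G ⟨by rw [BGraph.IsBoundaried, hGl]; exact Finset.empty_subset _, hS⟩
    (Set.range f) U ν (labelsExactly_ofInjective hr.s_le_t hf).1
    (labelsExactly_ofInjective hr.s_le_t hf).2 (by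
      refine Set.disjoint_left.2 ?_
      rintro _ ⟨i, hi, rfl⟩ ⟨q, hq⟩
      rw [← hy hq] at hi
      exact absurd q.2 (not_lt.2 hi)) (by
      refine Set.disjoint_left.2 ?_
      rintro v _ ⟨i, hi⟩
      cases hi) (by
      rintro _ ⟨i, hi, rfl⟩ v huv hv
      obtain ⟨j, rfl⟩ := hcl i hi v huv
      exact ((hrange _).2 ⟨j, rfl⟩).resolve_left hv) _ hD
  set A := BGraph.induced G.toFinGraph Uᶜ ν with hA
  set F := BGraph.glueInto G Uᶜ ν (stdGraph r.s r.K) with hF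
  -- the result of the replacement is isomorphic to the new configuration
  let c : Fin r.ℓ' → Fin r.ℓ := Fin.castLE hr.lt.le
  let e : F.V → V := Sum.elim (fun u => u.1.1) (fun w => x (c w.1))
  have hinr : ∀ w : {v : (stdGraph r.s r.K).V // ∀ u i, A.bd.lab u = some i →
      (stdGraph r.s r.K).bd.lab v ≠ some i}, r.s ≤ Fin.val (n := r.ℓ') w.1 := by
    rintro ⟨w, hw⟩
    by_contra hge
    have hlt := not_le.1 hge
    have hyA : y (c w) ∈ Uᶜ := fun hu => absurd ((hfU _).1 hu) (not_le.2 hlt)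
    exact hw ⟨y (c w), hyA⟩ (Fin.val (n := r.ℓ') w + 1) ((hνy (c w) _).2 ⟨hlt, rfl⟩)
      (stdGraph_lab.2 ⟨hlt, rfl⟩)
  have heR : ∀ a : Fin r.ℓ', e (BGraph.right A (stdGraph r.s r.K) a) = x (c a) := by
    intro a
    by_cases ha : (a : ℕ) < r.s
    · have hyA : y (c a) ∈ Uᶜ := fun hu => absurd ((hfU _).1 hu) (not_le.2 ha)
      exact congrArg e (BGraph.right_of_lab (G := A) (K := stdGraph r.s r.K)
        (u := ⟨y (c a), hyA⟩) (i := a + 1) ((hνy (c a) _).2 ⟨ha, rfl⟩) (stdGraph_lab.2 ⟨ha, rfl⟩))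
    · refine congrArg e (BGraph.right_of_not (G := A) (K := stdGraph r.s r.K) ?_)
      rintro u i - hi
      exact ha (stdGraph_lab.1 hi).1
  have hinj : Function.Injective e := by
    have hmix : ∀ (u : A.V) (w : {v : (stdGraph r.s r.K).V // ∀ u i, A.bd.lab u = some i →
        (stdGraph r.s r.K).bd.lab v ≠ some i}), u.1.1 ≠ x (c w.1) := by
      intro u w he
      apply u.2
      have : u.1 = y (c w.1) := Subtype.ext he
      rw [this]
      exact (hfU _).2 (hinr w)
    rintro (u | w) (u' | w') he
    · exact congrArg Sum.inl (Subtype.ext (Subtype.ext he))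
    · exact absurd he (hmix u w')
    · exact absurd he.symm (hmix u' w)
    · exact congrArg Sum.inr (Subtype.ext (Fin.castLE_injective hr.lt.le (h.inj he)))
  have hmem : ∀ p, e p ∈ (r.apply S x).alive := by
    rintro (u | w)
    · refine ⟨u.1.2, fun i hi he => u.2 ?_⟩
      have : u.1 = y i := Subtype.ext he
      rw [this]
      exact (hfU _).2 (hr.s_le.trans hi)
    · refine ⟨h.mem _, fun i hi he => ?_⟩
      have := congrArg Fin.val (h.inj he)
      exact absurd (Fin.isLt (n := r.ℓ') w.1) (not_lt.2 (hi.trans_eq this.symm))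
  have hsurj : ∀ v ∈ (r.apply S x).alive, ∃ p, e p = v := by
    rintro v ⟨hv, hv'⟩
    by_cases hU : (⟨v, hv⟩ : G.V) ∈ U
    · obtain ⟨i, hi, he⟩ := hU
      have he' : v = x i := congrArg Subtype.val he
      have hlt : (i : ℕ) < r.ℓ' := by
        by_contra hge
        exact hv' i (not_lt.1 hge) he'
      exact ⟨BGraph.right A (stdGraph r.s r.K) (⟨i, hlt⟩ : Fin r.ℓ'), (heR ⟨i, hlt⟩).trans he'.symm⟩
    · exact ⟨Sum.inl ⟨⟨v, hv⟩, hU⟩, rfl⟩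
  have hxs : ∀ (i : Fin r.ℓ) (u : F.V), e u = x i → (i : ℕ) < r.s →
      ∃ hi : y i ∈ Uᶜ, u = Sum.inl ⟨y i, hi⟩ := by
    intro i u hu hi
    have hyA : y i ∈ Uᶜ := fun hu => absurd ((hfU _).1 hu) (not_le.2 hi)
    exact ⟨hyA, hinj (hu.trans rfl)⟩
  have hadj : ∀ p q, (r.apply S x).graph.Adj (e p) (e q) ↔ F.graph.Adj p q := by
    intro p q
    refine Iff.trans ?_ BGraph.glue_adj.symm
    constructor
    · rintro ⟨⟨i, j, hi, hj, hij⟩ | ⟨hadj, hn⟩, -⟩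
      · rcases hij with ⟨a, b, ha, hb, hab⟩ | ⟨hi', hj', hij⟩
        · refine Or.inr ⟨a, b, hab, hinj ?_, hinj ?_⟩
          · rw [hi]; exact ((heR a).trans (congrArg x (Fin.ext ha))).symm
          · rw [hj]; exact ((heR b).trans (congrArg x (Fin.ext hb))).symm
        · obtain ⟨h3, rfl⟩ := hxs i p hi hi'
          obtain ⟨h4, rfl⟩ := hxs j q hj hj'
          exact Or.inl ⟨⟨y i, h3⟩, ⟨y j, h4⟩, (h.adj i j).2 hij, rfl, rfl⟩
      · rcases p with u | w
        · rcases q with u' | w'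
          · exact Or.inl ⟨u, u', hadj, rfl, rfl⟩
          · exact absurd ⟨h.closed _ (hinr w') _ hadj.symm, _, rfl⟩ hn
        · exact absurd ⟨⟨_, rfl⟩, h.closed _ (hinr w) _ hadj⟩ hn
    · intro hpq
      refine ⟨?_, ?_, hmem p, hmem q⟩
      · rcases hpq with ⟨a, b, hab, rfl, rfl⟩ | ⟨a, b, hab, rfl, rfl⟩
        · by_cases hr' : (∃ i, a.1.1 = x i) ∧ ∃ j, b.1.1 = x j
          · obtain ⟨⟨i, hi⟩, j, hj⟩ := hr'
            have hlt : ∀ (a : A.V) (i : Fin r.ℓ), a.1.1 = x i → (i : ℕ) < r.s := by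
              intro a i hi
              by_contra hge
              apply a.2
              have : a.1 = y i := Subtype.ext hi
              rw [this]
              exact (hfU i).2 (not_lt.1 hge)
            refine Or.inl ⟨i, j, hi, hj, Or.inr ⟨hlt a i hi, hlt b j hj, (h.adj i j).1 ?_⟩⟩
            rw [← hi, ← hj]
            exact hab
          · exact Or.inr ⟨hab, hr'⟩
        · exact Or.inl ⟨c a, c b, heR a, heR b, Or.inl ⟨a, b, rfl, rfl, hab⟩⟩
      · intro he
        have := hinj he
        subst this
        exact (F.graph.loopless.irrefl p) (BGraph.glue_adj.2 hpq)
  let iso : F.graph ≃g (r.apply S x).toFinGraph.graph :=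
    { toEquiv := Equiv.ofBijective (fun p => ⟨e p, hmem p⟩)
        ⟨fun p q hpq => hinj (congrArg Subtype.val hpq), fun v => by
          obtain ⟨p, hp⟩ := hsurj v.1 v.2
          exact ⟨p, Subtype.ext hp⟩⟩
      map_rel_iff' := hadj _ _ }
  have hmem𝒢 : (r.apply S x).toFinGraph ∈ 𝒢 := h𝒢 _ F.toFinGraph ⟨iso.symm.toEmbedding⟩ h1.2.1.2
  refine ⟨hmem𝒢, fun k => ?_⟩
  have := yes_iff_of_simIn hQ hE hGl h1 k
  rw [h2, hDδ] at this
  exact this.trans (Q.yes_iso _ h1.2.1.2 _ hmem𝒢 ⟨iso⟩ _)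

end

/-! ### Keeping the parts of bounded treewidth -/

section

variable {o : Objective} {E : Encoder} {g : ℕ → ℕ} {t : ℕ} {𝒢 : Set FinGraph} {V : Type} [Finite V]

/-- Every part of the partition, except for the part `0`, is a piece which is attached to the
part `0`. -/
def Parted (t : ℕ) (S : Config V) (part : V → ℕ) : Prop :=
  ∀ p, p ≠ 0 → ∃ B, (∀ v ∈ B, v ∈ S.alive ∧ part v = 0) ∧
    Piece S.graph t B {v | v ∈ S.alive ∧ part v = p}

/-- If a subgraph of a part is replaced by a rooted minor, then the new part is a minor of the old
one, together with its boundary, and therefore a piece. -/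
theorem Rule.Applies.parted_of_rootedMinor {r : Rule} {S : Config V} {part : V → ℕ}
    {x : Fin r.ℓ → V} (h : r.Applies S part x) (hs : r.s ≤ r.ℓ') (hlt : r.ℓ' < r.ℓ)
    (hm : RootedMinor (stdGraph r.s r.K) (stdGraph r.s r.M)) (hP : Parted t S part) :
    Parted t (r.apply S x) part := by
  classical
  obtain ⟨β₀, h1, h2, h3, h4⟩ := hm
  replace h1 : ∀ v : Fin r.ℓ', (β₀ v).Nonempty ∧ ConnOn r.M (β₀ v) := h1
  replace h2 : ∀ u v : Fin r.ℓ', u ≠ v → Disjoint (β₀ u) (β₀ v) := h2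
  replace h3 : ∀ u v : Fin r.ℓ', r.K.Adj u v → ∃ a : Fin r.ℓ, a ∈ β₀ u ∧ ∃ b : Fin r.ℓ, b ∈ β₀ v ∧
    r.M.Adj a b := h3
  have h4' : ∀ (v : Fin r.ℓ') (w : Fin r.ℓ), (v : ℕ) = w → (v : ℕ) < r.s → w ∈ β₀ v := by
    intro v w hvw hv
    exact h4 v w (v + 1) (stdGraph_lab.2 ⟨hv, rfl⟩) (stdGraph_lab.2 ⟨hvw ▸ hv, by rw [hvw]⟩)
  let c : Fin r.ℓ' → Fin r.ℓ := Fin.castLE hlt.le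
  -- the branch sets in the large graph
  let β : V → Set V := fun v => {w | (∃ j, v = x (c j) ∧ w ∈ x '' (β₀ j)) ∨
    (v = w ∧ v ∈ S.alive ∧ ∀ i, v ≠ x i)}
  have hβx : ∀ j, β (x (c j)) = x '' (β₀ j) := by
    intro j
    ext w
    constructor
    · rintro (⟨j', he, hw⟩ | ⟨-, -, he⟩)
      · obtain rfl : j = j' := Fin.castLE_injective hlt.le (h.inj he)
        exact hw
      · exact absurd rfl (he _)
    · exact fun hw => Or.inl ⟨j, rfl, hw⟩
  have hβo : ∀ v, v ∈ S.alive → (∀ i, v ≠ x i) → β v = {v} := by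
    intro v hv hx
    ext w
    constructor
    · rintro (⟨j, rfl, -⟩ | ⟨rfl, -⟩)
      · exact absurd rfl (hx _)
      · rfl
    · rintro rfl
      exact Or.inr ⟨rfl, hv, hx⟩
  have hcases : ∀ v, (β v).Nonempty → (∃ j, v = x (c j)) ∨ (v ∈ S.alive ∧ ∀ i, v ≠ x i) := by
    rintro v ⟨w, ⟨j, hj, -⟩ | ⟨-, hv⟩⟩
    · exact Or.inl ⟨j, hj⟩
    · exact Or.inr hv
  have halive : ∀ v, v ∈ (r.apply S x).alive ↔
      (∃ j, v = x (c j)) ∨ (v ∈ S.alive ∧ ∀ i, v ≠ x i) := by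
    intro v
    constructor
    · rintro ⟨hv, hv'⟩
      by_cases hx : ∃ i, v = x i
      · obtain ⟨i, rfl⟩ := hx
        have hi : (i : ℕ) < r.ℓ' := by
          by_contra hge
          exact hv' i (not_lt.1 hge) rfl
        exact Or.inl ⟨⟨i, hi⟩, rfl⟩
      · exact Or.inr ⟨hv, fun i hi => hx ⟨i, hi⟩⟩
    · rintro (⟨j, rfl⟩ | ⟨hv, hx⟩)
      · refine ⟨h.mem _, fun i hi he => ?_⟩
        have : (c j : ℕ) = i := congrArg Fin.val (h.inj he)
        have h5 : (c j : ℕ) = j := rfl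
        have := j.2
        omega
      · exact ⟨hv, fun i _ => hx i⟩
  have hconn : ∀ v, ConnOn S.graph (β v) := by
    intro v
    by_cases hne : (β v).Nonempty
    · rcases hcases v hne with ⟨j, rfl⟩ | ⟨hv, hx⟩
      · rw [hβx]
        exact (h1 j).2.image x fun a _ b _ hab => (h.adj a b).2 hab
      · rw [hβo v hv hx]
        exact connOn_singleton v
    · rw [Set.not_nonempty_iff_eq_empty.1 hne]
      exact connOn_empty
  have hdisj : ∀ u v, u ≠ v → Disjoint (β u) (β v) := by
    intro u v huv
    refine Set.disjoint_left.2 fun w hu hv => huv ?_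
    rcases hu with ⟨j, hj, a, ha, rfl⟩ | ⟨hu, -, hux⟩ <;>
      rcases hv with ⟨j', hj', a', ha', he⟩ | ⟨hv, -, hvx⟩
    · obtain rfl := h.inj he
      by_contra hne
      refine Set.disjoint_left.1 (h2 j j' fun hjj => hne ?_) ha ha'
      rw [hj, hj', hjj]
    · exact absurd hv (hvx a)
    · exact absurd (hu.trans he.symm) (hux a')
    · exact hu.trans hv.symm
  -- a vertex outside `U` belongs to its own branch set
  have hself : ∀ v, v ∈ (r.apply S x).alive → (∀ i : Fin r.ℓ, r.s ≤ i → v ≠ x i) → v ∈ β v := by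
    intro v hv hx
    rcases (halive v).1 hv with ⟨j, rfl⟩ | ⟨hv, hx⟩
    · rw [hβx]
      have hj : (j : ℕ) < r.s := by
        by_contra hge
        exact hx (c j) (not_lt.1 hge) rfl
      exact ⟨c j, h4' j (c j) rfl hj, rfl⟩
    · rw [hβo v hv hx]; rfl
  have hin : ∀ v w, w ∈ β v → w = v ∨ ∃ i : Fin r.ℓ, r.s ≤ i ∧ w = x i := by
    rintro v w (⟨j, rfl, a, ha, rfl⟩ | ⟨rfl, -⟩)
    · by_cases hs' : r.s ≤ a
      · exact Or.inr ⟨a, hs', rfl⟩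
      · push Not at hs'
        left
        -- the vertex labelled like `x a` is the only one whose branch set contains `x a`
        have hm := h4' ⟨a, hs'.trans_le hs⟩ a rfl hs'
        have : j = ⟨a, hs'.trans_le hs⟩ := by
          by_contra hne
          exact Set.disjoint_left.1 (h2 _ _ hne) ha hm
        rw [this]
        rfl
    · exact Or.inl rfl
  have hin' : ∀ j : Fin r.ℓ', r.s ≤ j → ∀ w ∈ β (x (c j)), ∃ i : Fin r.ℓ, r.s ≤ i ∧ w = x i := by
    intro j hj w hw
    rcases hin _ w hw with rfl | h5
    · exact ⟨c j, hj, rfl⟩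
    · exact h5
  have hadj : ∀ u v, (r.apply S x).graph.Adj u v → ∃ a ∈ β u, ∃ b ∈ β v, S.graph.Adj a b := by
    rintro u v ⟨⟨i, j, rfl, rfl, ⟨a, b, ha, hb, hab⟩ | ⟨hi, hj, hij⟩⟩ | ⟨huv, hn⟩, -, hu, hv⟩
    · obtain ⟨a', ha', b', hb', hab'⟩ := h3 a b hab
      obtain rfl : c a = i := Fin.ext ha
      obtain rfl : c b = j := Fin.ext hb
      rw [hβx, hβx]
      exact ⟨_, ⟨a', ha', rfl⟩, _, ⟨b', hb', rfl⟩, (h.adj _ _).2 hab'⟩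
    · refine ⟨x i, hself _ hu ?_, x j, hself _ hv ?_, (h.adj i j).2 hij⟩
      · intro i' hi' he
        rw [h.inj he] at hi
        omega
      · intro i' hi' he
        rw [h.inj he] at hj
        omega
    · refine ⟨u, hself _ hu ?_, v, hself _ hv ?_, huv⟩
      · rintro i hi rfl
        exact hn ⟨⟨i, rfl⟩, h.closed i hi v huv⟩
      · rintro i hi rfl
        exact hn ⟨h.closed i hi u huv.symm, i, rfl⟩
  intro q hq
  obtain ⟨B, hB, hp⟩ := hP q hq
  have hp' := hp.minor β hconn hdisj hadj
  have hBU : ∀ i : Fin r.ℓ, r.s ≤ i → x i ∉ B := fun i hi hb => h.part_ne i hi (hB _ hb).2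
  -- alternatives for a remaining vertex
  have halt : ∀ v, v ∈ (r.apply S x).alive → (∃ j : Fin r.ℓ', r.s ≤ j ∧ v = x (c j)) ∨ v ∈ β v := by
    intro v hv
    by_cases hx : ∀ i : Fin r.ℓ, r.s ≤ i → v ≠ x i
    · exact Or.inr (hself v hv hx)
    · push Not at hx
      obtain ⟨i, hi, rfl⟩ := hx
      have hlt' : (i : ℕ) < r.ℓ' := by
        by_contra hge
        exact hv.2 i (not_lt.1 hge) rfl
      exact Or.inl ⟨⟨i, hlt'⟩, hi, rfl⟩
  have hβalive : ∀ v, (β v).Nonempty → v ∈ (r.apply S x).alive := fun v hv =>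
    (halive v).2 (hcases v hv)
  have e1 : {v | (β v ∩ B).Nonempty} = {v | v ∈ (r.apply S x).alive ∧ v ∈ B} := by
    ext v
    constructor
    · rintro ⟨w, hw, hwB⟩
      refine ⟨hβalive v ⟨w, hw⟩, ?_⟩
      rcases hin v w hw with rfl | ⟨i, hi, rfl⟩
      · exact hwB
      · exact absurd hwB (hBU i hi)
    · rintro ⟨hv, hvB⟩
      rcases halt v hv with ⟨j, hj, rfl⟩ | hv'
      · exact absurd hvB (hBU (c j) hj)
      · exact ⟨v, hv', hvB⟩
  have e2 : {v | (β v ∩ {v | v ∈ S.alive ∧ part v = q}).Nonempty ∧ ¬ (β v ∩ B).Nonempty} =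
      {v | v ∈ (r.apply S x).alive ∧ part v = q} := by
    ext v
    constructor
    · rintro ⟨⟨w, hw, hwU⟩, hvB⟩
      have hv := hβalive v ⟨w, hw⟩
      refine ⟨hv, ?_⟩
      have hsub := (hconn v).subset_of_closed hp.closed ⟨w, hw, hwU⟩ hvB
      rcases halt v hv with ⟨j, hj, rfl⟩ | hv'
      · obtain ⟨i, hi, rfl⟩ := hin' j hj w hw
        exact (h.part_eq (c j) i hj hi).trans hwU.2
      · exact (hsub hv').2
    · rintro ⟨hv, hvq⟩
      rcases halt v hv with ⟨j, hj, rfl⟩ | hv'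
      · have hall : ∀ w ∈ β (x (c j)), w ∈ S.alive ∧ part w = q := by
          intro w hw
          obtain ⟨i, hi, rfl⟩ := hin' j hj w hw
          exact ⟨h.mem i, (h.part_eq i (c j) hi hj).trans hvq⟩
        refine ⟨?_, ?_⟩
        · obtain ⟨a, ha⟩ := (h1 j).1
          have : x a ∈ β (x (c j)) := by rw [hβx]; exact ⟨a, ha, rfl⟩
          exact ⟨x a, this, hall _ this⟩
        · rintro ⟨w, hw, hwB⟩
          exact hq ((hall w hw).2.symm.trans (hB w hwB).2)
      · refine ⟨⟨v, hv', hv.1, hvq⟩, ?_⟩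
        rintro ⟨w, hw, hwB⟩
        rcases hin v w hw with rfl | ⟨i, hi, rfl⟩
        · exact hq (hvq.symm.trans (hB _ hwB).2)
        · exact hBU i hi hwB
  rw [e1, e2] at hp'
  exact ⟨_, fun v hv => ⟨hv.1, (hB v hv.2).2⟩, hp'⟩

/-- If a part is replaced as a whole by a graph from `𝓕_t`, then the new part is a piece because
this graph is one. -/
theorem Rule.Applies.parted_of_rootedPiece {r : Rule} {S : Config V} {part : V → ℕ}
    {x : Fin r.ℓ → V} (h : r.Applies S part x) (hs : r.s ≤ r.ℓ') (hlt : r.ℓ' < r.ℓ)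
    (hw : r.whole = true) (hm : RootedPiece t (stdGraph r.s r.K)) (hP : Parted t S part) :
    Parted t (r.apply S x) part := by
  obtain ⟨hw1, hw2⟩ := h.whole hw
  let c : Fin r.ℓ' → Fin r.ℓ := Fin.castLE hlt.le
  let i₀ : Fin r.ℓ := ⟨r.s, by omega⟩
  have hi₀ : r.s ≤ i₀ := le_rfl
  have halive : ∀ j, x (c j) ∈ (r.apply S x).alive := by
    refine fun j => ⟨h.mem _, fun i hi he => ?_⟩
    have : (c j : ℕ) = i := congrArg Fin.val (h.inj he)
    have h5 : (c j : ℕ) = j := rfl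
    have := j.2
    omega
  intro q hq
  by_cases hqp : q = part (x i₀)
  · have hm' : Piece r.K t {j : Fin r.ℓ' | (j : ℕ) < r.s} {j : Fin r.ℓ' | r.s ≤ j} := by
      have e1 : (stdGraph r.s r.K).boundary = {j : Fin r.ℓ' | (j : ℕ) < r.s} := by
        ext j
        constructor
        · rintro ⟨i, hi⟩
          exact (stdGraph_lab.1 hi).1
        · intro hj
          exact ⟨_, stdGraph_lab.2 ⟨hj, rfl⟩⟩
      have e2 : {j : Fin r.ℓ' | r.s ≤ j} = {j : Fin r.ℓ' | (j : ℕ) < r.s}ᶜ := by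
        ext j
        simp
      rw [e2]
      unfold RootedPiece at hm
      rw [e1] at hm
      exact hm
    refine ⟨(fun j => x (c j)) '' {j : Fin r.ℓ' | (j : ℕ) < r.s}, ?_, ?_⟩
    · rintro _ ⟨j, hj, rfl⟩
      exact ⟨halive j, hw1 _ hj⟩
    · have e : {v | v ∈ (r.apply S x).alive ∧ part v = q} =
          (fun j => x (c j)) '' {j : Fin r.ℓ' | r.s ≤ j} := by
        ext v
        constructor
        · rintro ⟨hv, hvq⟩
          obtain ⟨i, rfl⟩ := hw2 i₀ hi₀ v hv.1 (hvq.trans hqp)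
          have hi : (i : ℕ) < r.ℓ' := by
            by_contra hge
            exact hv.2 i (not_lt.1 hge) rfl
          refine ⟨⟨i, hi⟩, ?_, rfl⟩
          by_contra his
          exact hq (hvq.symm.trans (hw1 i (not_le.1 his)))
        · rintro ⟨j, hj, rfl⟩
          exact ⟨halive j, (h.part_eq (c j) i₀ hj hi₀).trans hqp.symm⟩
      rw [e]
      refine hm'.map _ ?_ ?_
      · intro a _ b _ hab
        exact Fin.castLE_injective hlt.le (h.inj hab)
      · rintro j hj w ⟨⟨a, b, ha, hb, ⟨a', b', ha', hb', hab⟩ | ⟨ha', -⟩⟩ | ⟨hadj, hn⟩, -⟩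
        · have haj : j = a' := Fin.ext (by
            have := congrArg Fin.val (h.inj ha)
            exact Eq.trans this ha'.symm)
          refine ⟨b', haj ▸ hab, ?_⟩
          rw [hb]
          exact congrArg x (Fin.ext hb')
        · have : (j : ℕ) = a := congrArg Fin.val (h.inj ha)
          have h5 : r.s ≤ (j : ℕ) := hj
          omega
        · exact absurd ⟨⟨_, rfl⟩, h.closed (c j) hj _ hadj⟩ hn
  · obtain ⟨B, hB, hp⟩ := hP q hq
    have hout : ∀ v ∈ S.alive, part v = 0 ∨ part v = q → v ∈ (r.apply S x).alive := by
      intro v hv hv'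
      refine ⟨hv, ?_⟩
      rintro i hi rfl
      rcases hv' with h0 | h0
      · exact h.part_ne i (hs.trans hi) h0
      · exact hqp (h0.symm.trans (h.part_eq i i₀ (hs.trans hi) hi₀))
    refine ⟨B, fun v hv => ⟨hout v (hB v hv).1 (Or.inl (hB v hv).2), (hB v hv).2⟩, ?_⟩
    have e : {v | v ∈ (r.apply S x).alive ∧ part v = q} = {v | v ∈ S.alive ∧ part v = q} := by
      ext v
      exact ⟨fun hv => ⟨hv.1.1, hv.2⟩, fun hv => ⟨hout v hv.1 (Or.inr hv.2), hv.2⟩⟩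
    rw [e]
    refine hp.congr_adj ?_
    rintro u ⟨hu, huq⟩ w ⟨⟨i, -, rfl, -⟩ | ⟨huw, -⟩, -⟩
    · exfalso
      by_cases hi : (i : ℕ) < r.s
      · exact hq (huq.symm.trans (hw1 i hi))
      · exact hqp (huq.symm.trans (h.part_eq i i₀ (not_lt.1 hi) hi₀))
    · exact huw

/-- The application of a valid rule keeps the parts of bounded treewidth. -/
theorem Rule.Applies.parted {r : Rule} {S : Config V} {part : V → ℕ}
    {x : Fin r.ℓ → V} (h : r.Applies S part x) (hr : r.Valid o E g t 𝒢) (hP : Parted t S part) :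
    Parted t (r.apply S x) part := by
  have hk := hr.keep
  split_ifs at hk with hw
  · exact h.parted_of_rootedPiece hr.s_le hr.lt hw hk hP
  · exact h.parted_of_rootedMinor hr.s_le hr.lt hk hP

end

theorem Rule.Applies.alive_ssubset {V : Type} {r : Rule} {S : Config V} {part : V → ℕ}
    {x : Fin r.ℓ → V} (h : r.Applies S part x) (hlt : r.ℓ' < r.ℓ) : (r.apply S x).alive ⊂ S.alive := by
  refine ⟨fun v hv => hv.1, fun hsub => ?_⟩
  exact (hsub (h.mem ⟨r.ℓ', hlt⟩)).2 ⟨r.ℓ', hlt⟩ le_rfl rfl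

/-! ### Large parts are reducible -/

theorem RootedMinor.congr {K K' M M' : BGraph} (h : RootedMinor K M) (e : BGraph.Iso K K')
    (f : BGraph.Iso M M') : RootedMinor K' M' := by
  obtain ⟨β, h1, h2, h3, h4⟩ := h
  refine ⟨fun v => f.toIso '' β (e.toIso.symm v), fun v => ⟨(h1 _).1.image _, ?_⟩, ?_, ?_, ?_⟩
  · exact (h1 _).2.image _ fun a _ b _ hab => f.toIso.map_rel_iff.2 hab
  · intro u v huv
    exact (Set.disjoint_image_iff f.toIso.injective).2
      (h2 _ _ fun he => huv (e.toIso.symm.injective he))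
  · intro u v huv
    obtain ⟨a, ha, b, hb, hab⟩ := h3 _ _ (e.toIso.symm.map_rel_iff.2 huv)
    exact ⟨_, ⟨a, ha, rfl⟩, _, ⟨b, hb, rfl⟩, f.toIso.map_rel_iff.2 hab⟩
  · intro v w i hv hw
    refine ⟨f.toIso.symm w, h4 _ _ i ?_ ?_, f.toIso.apply_symm_apply w⟩
    · rw [← e.lab_eq, e.toIso.apply_symm_apply]
      exact hv
    · rw [← f.lab_eq, f.toIso.apply_symm_apply]
      exact hw

theorem BGraph.Iso.image_boundary {K K' : BGraph} (e : BGraph.Iso K K') :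
    e.toIso '' K.boundary = K'.boundary := by
  ext v
  constructor
  · rintro ⟨u, ⟨i, hi⟩, rfl⟩
    exact ⟨i, (e.lab_eq u).trans hi⟩
  · rintro ⟨i, hi⟩
    refine ⟨e.toIso.symm v, ⟨i, ?_⟩, e.toIso.apply_symm_apply v⟩
    rw [← e.lab_eq, e.toIso.apply_symm_apply]
    exact hi

theorem RootedPiece.congr {t : ℕ} {K K' : BGraph} (h : RootedPiece t K) (e : BGraph.Iso K K') :
    RootedPiece t K' := by
  have := Piece.map (G' := K'.graph) h e.toIso e.toIso.injective.injOn (fun u _ w huw =>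
    ⟨e.toIso.symm w, e.toIso.map_rel_iff.1 (by rw [e.toIso.apply_symm_apply]; exact huw),
      e.toIso.apply_symm_apply w⟩)
  rw [Set.image_compl_eq e.toIso.bijective, e.image_boundary] at this
  exact this

section

variable {o : Objective} {E : Encoder} {g : ℕ → ℕ} {t : ℕ} {𝒢 : Set FinGraph} {V : Type} [Finite V]

/-- An equivalent smaller graph for a cut of a part gives rise to an applicable rule. -/
theorem exists_rule_of_simIn (h𝒢 : Hereditary 𝒢) {S : Config V}
    {part : V → ℕ} {p : ℕ} (hp : p ≠ 0) {s : ℕ} (hst : s ≤ t) (f : Fin s → S.alive)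
    (hf : Function.Injective f) {U : Set S.alive} (hU : ∀ v ∈ U, part v.1 = p)
    (hcut : IsCut S.toFinGraph.graph t (Set.range f, U)) {K : BGraph}
    (hsim : SimIn o E g t 𝒢
      (BGraph.induced S.toFinGraph (Set.range f ∪ U) (Labelling.ofInjective f hf)) K)
    (hδ : 0 ≤ E.delta o g t
      (BGraph.induced S.toFinGraph (Set.range f ∪ U) (Labelling.ofInjective f hf)) K)
    (hcard : Nat.card K.V < (Set.range f ∪ U).ncard) (w : Bool)
    (hw : w = true → (∀ i, part (f i).1 = 0) ∧ ∀ v, part v.1 = p → v ∈ U)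
    (hkeep : if w then RootedPiece t K else RootedMinor K
      (BGraph.induced S.toFinGraph (Set.range f ∪ U) (Labelling.ofInjective f hf))) :
    ∃ (r : Rule) (x : Fin r.ℓ → V), r.Valid o E g t 𝒢 ∧ r.Applies S part x ∧
      r.ℓ = (Set.range f ∪ U).ncard := by
  set D := BGraph.induced S.toFinGraph (Set.range f ∪ U) (Labelling.ofInjective f hf) with hD
  have hlab : ∀ (v : D.V) (i : ℕ), D.bd.lab v = some i ↔ ∃ q, f q = v.1 ∧ (q : ℕ) + 1 = i :=
    fun v i => Labelling.ofInjective_lab (hf := hf)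
  have hDl : D.labels = Finset.Icc 1 s := by
    ext i
    rw [BGraph.mem_labels, Finset.mem_Icc]
    constructor
    · rintro ⟨v, hv⟩
      obtain ⟨q, -, rfl⟩ := (hlab v i).1 hv
      omega
    · rintro ⟨h1, h2⟩
      refine ⟨⟨f ⟨i - 1, by omega⟩, Or.inl ⟨_, rfl⟩⟩, (hlab _ _).2 ⟨_, rfl, ?_⟩⟩
      dsimp only
      omega
  obtain ⟨M₀, hsM, ⟨eM⟩⟩ := exists_iso_stdGraph hDl
  obtain ⟨K₀, hsK, ⟨eK⟩⟩ := exists_iso_stdGraph (hsim.sim.1.symm.trans hDl)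
  have hDcard : Nat.card D.V = (Set.range f ∪ U).ncard := Nat.card_coe_set_eq _
  let y : Fin (Nat.card D.V) → D.V := fun j => eM.toIso.symm j
  have hy : Function.Injective y := eM.toIso.symm.injective
  have hylab : ∀ j i, D.bd.lab (y j) = some i ↔ (j : ℕ) < s ∧ (j : ℕ) + 1 = i := by
    intro j i
    rw [← eM.lab_eq (y j)]
    have : eM.toIso (y j) = j := eM.toIso.apply_symm_apply j
    rw [this]
    exact stdGraph_lab
  have hyf : ∀ j : Fin (Nat.card D.V), (j : ℕ) < s → ∃ q, f q = (y j).1 := by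
    intro j hj
    obtain ⟨q, hq, -⟩ := (hlab _ _).1 ((hylab j _).2 ⟨hj, rfl⟩)
    exact ⟨q, hq⟩
  have hyU : ∀ j : Fin (Nat.card D.V), s ≤ (j : ℕ) → (y j).1 ∈ U := by
    intro j hj
    refine (y j).2.resolve_left ?_
    rintro ⟨q, hq⟩
    have := ((hylab j _).1 ((hlab (y j) _).2 ⟨q, hq, rfl⟩)).1
    omega
  have hysurj : ∀ v ∈ Set.range f ∪ U, ∃ j, v = (y j).1 := fun v hv =>
    ⟨eM.toIso ⟨v, hv⟩, congrArg Subtype.val (eM.toIso.symm_apply_apply ⟨v, hv⟩).symm⟩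
  let r : Rule := ⟨Nat.card D.V, s, M₀, w, Nat.card K.V, K₀,
    (E.delta o g t (stdGraph s M₀) (stdGraph s K₀)).toNat⟩
  have h1 : SimIn o E g t 𝒢 (stdGraph s M₀) D := (SimIn.of_iso h𝒢 hsim.1 eM).symm
  have h2 : SimIn o E g t 𝒢 K (stdGraph s K₀) := SimIn.of_iso h𝒢 hsim.2.1 eK
  refine ⟨r, fun j => (y j).1.1, ⟨hst, hsK, hcard.trans_eq hDcard.symm, h1.trans (hsim.trans h2), ?_, ?_⟩,
    ⟨?_, ?_, ?_, ?_, ?_, ?_, ?_⟩, hDcard⟩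
  · refine (Int.toNat_of_nonneg ?_).symm
    rw [h1.sim.delta_trans (hsim.trans h2).sim, hsim.sim.delta_trans h2.sim,
      SimIn.delta_of_iso eM.symm, SimIn.delta_of_iso eK, zero_add, add_zero]
    exact hδ
  · change if w = true then _ else _
    split_ifs with hw'
    · rw [if_pos hw'] at hkeep
      exact hkeep.congr eK
    · rw [if_neg hw'] at hkeep
      exact hkeep.congr eK eM
  · exact fun i j hij => hy (Subtype.ext (Subtype.ext hij))
  · exact fun i => (y i).1.2
  · exact fun i j => eM.toIso.symm.map_rel_iff
  · intro i hi v hv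
    obtain ⟨j, hj⟩ := hysurj _ (hcut.closed _ (hyU i hi) ⟨v, S.supp v _ hv.symm⟩ hv)
    exact ⟨j, congrArg Subtype.val hj⟩
  · exact fun i hi => (hU _ (hyU i hi)).trans_ne hp
  · exact fun i j hi hj => (hU _ (hyU i hi)).trans (hU _ (hyU j hj)).symm
  · intro hw'
    obtain ⟨h3, h4⟩ := hw hw'
    refine ⟨fun i hi => ?_, fun i hi v hv hvp => ?_⟩
    · obtain ⟨q, hq⟩ := hyf i hi
      rw [← hq]
      exact h3 q
    · obtain ⟨j, hj⟩ := hysurj ⟨v, hv⟩ (Or.inr (h4 ⟨v, hv⟩ (hvp.trans (hU _ (hyU i hi)))))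
      exact ⟨j, congrArg Subtype.val hj⟩

/-- A bound for the number of vertices in the left-hand sides of the rules that are needed. -/
noncomputable def patternBound (E : Encoder) (g : ℕ → ℕ) (t : ℕ) (𝒢 : Set FinGraph) : ℕ :=
  t + 2 * (2 ^ chainLength E g t 𝒢 * t)

/-- A valid rule of bounded size applies as long as there is a part with more than `b` vertices. -/
theorem exists_rule (hDP : DPFriendly o E g t 𝒢) (h𝒢 : Hereditary 𝒢)
    [Finite (Quotient (classSetoid t 𝒢))] {S : Config V} {part : V → ℕ}
    (hS : S.toFinGraph ∈ 𝒢) (hP : Parted t S part) {p : ℕ} (hp : p ≠ 0)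
    (hbig : sizeBound E g t 𝒢 < {v | v ∈ S.alive ∧ part v = p}.ncard) :
    ∃ (r : Rule) (x : Fin r.ℓ → V), r.Valid o E g t 𝒢 ∧ r.Applies S part x ∧
      r.ℓ ≤ patternBound E g t 𝒢 := by
  classical
  obtain ⟨B, hB, hpc⟩ := hP p hp
  set U := {v | v ∈ S.alive ∧ part v = p} with hUdef
  have hne : U.Nonempty := by
    rw [← Set.ncard_pos]; omega
  obtain ⟨v₀, hv₀⟩ := hne
  -- transport the piece to the graph induced by the remaining vertices
  let φ : V → S.toFinGraph.V := fun v => if h : v ∈ S.alive then ⟨v, h⟩ else ⟨v₀, hv₀.1⟩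
  have hφ : ∀ v (h : v ∈ S.alive), φ v = ⟨v, h⟩ := fun v h => dif_pos h
  have hBU : ∀ v ∈ B ∪ U, v ∈ S.alive := by
    rintro v (hv | hv)
    · exact (hB v hv).1
    · exact hv.1
  have hinj : Set.InjOn φ (B ∪ U) := by
    intro u hu v hv huv
    rw [hφ u (hBU u hu), hφ v (hBU v hv)] at huv
    exact congrArg Subtype.val huv
  have hpc' : Piece S.toFinGraph.graph t (φ '' B) (φ '' U) := by
    refine hpc.map φ hinj ?_
    rintro u hu ⟨w, hw⟩ huw
    rw [hφ u hu.1] at huw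
    exact ⟨w, huw, hφ w hw⟩
  have hφU : ∀ v ∈ φ '' U, part v.1 = p := by
    rintro _ ⟨v, hv, rfl⟩
    rw [hφ v hv.1]
    exact hv.2
  have hcU : (φ '' U).ncard = U.ncard :=
    (hinj.mono Set.subset_union_right).ncard_image
  -- a part of more than constant size contains a reducible cut of constant size, and any other
  -- part is replaced as a whole
  by_cases hlarge : 2 ^ chainLength E g t 𝒢 * t < U.ncard
  · obtain ⟨s, f, hf, U', K, hst, hcut, hU', hle, hsim, hδ, hcard, hm⟩ :=
      exists_reducible hDP h𝒢 hS hpc' (by rw [hcU]; exact hlarge)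
    obtain ⟨r, x, hr, hx, hrℓ⟩ := exists_rule_of_simIn h𝒢 hp hst f hf
      (fun v hv => hφU v (hU' hv)) hcut hsim hδ hcard false (by simp) (by simpa using hm)
    refine ⟨r, x, hr, hx, ?_⟩
    rw [hrℓ]
    refine (Set.ncard_union_le _ _).trans (add_le_add ?_ hle)
    exact hcut.ncard_le
  · set B' := φ '' B with hB'
    have hst : B'.ncard ≤ t := hpc'.ncard_le
    let e : Fin B'.ncard ≃ B' := (Finite.equivFinOfCardEq (Nat.card_coe_set_eq B')).symm
    let f : Fin B'.ncard → S.toFinGraph.V := fun i => (e i).1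
    have hf : Function.Injective f := Subtype.val_injective.comp e.injective
    have hrf : Set.range f = B' := by
      ext v
      constructor
      · rintro ⟨i, rfl⟩; exact (e i).2
      · exact fun hv => ⟨e.symm ⟨v, hv⟩, congrArg Subtype.val (e.apply_symm_apply ⟨v, hv⟩)⟩
    have hmf : ∀ v, v ∈ Set.range f ↔ v ∈ B' := fun v => by rw [hrf]
    have hν := labelsExactly_ofInjective hst hf
    set D := BGraph.induced S.toFinGraph (Set.range f ∪ φ '' U) (Labelling.ofInjective f hf)
    have hDm : D ∈ BClass t 𝒢 := induced_mem_BClass h𝒢 hS _ hν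
    have hDp : RootedPiece t D := by
      let ψ : S.toFinGraph.V → D.V := fun v => if h : v ∈ Set.range f ∪ φ '' U then ⟨v, h⟩ else
        ⟨φ v₀, Or.inr ⟨v₀, hv₀, rfl⟩⟩
      have hψ : ∀ v (h : v ∈ Set.range f ∪ φ '' U), ψ v = ⟨v, h⟩ := fun v h => dif_pos h
      have e1 : ψ '' B' = D.boundary := by
        ext v
        constructor
        · rintro ⟨u, hu, rfl⟩
          have hu' := (hmf u).2 hu
          rw [hψ u (Or.inl hu')]
          obtain ⟨q, hq⟩ := hu'
          exact ⟨_, (Labelling.ofInjective_lab (hf := hf)).2 ⟨q, hq, rfl⟩⟩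
        · rintro ⟨i, hi⟩
          have hv : v.1 ∈ Set.range f := mem_of_lab hν hi
          exact ⟨v.1, (hmf _).1 hv, hψ _ _⟩
      have e2 : ψ '' (φ '' U) = D.boundaryᶜ := by
        rw [← e1]
        ext v
        constructor
        · rintro ⟨u, hu, rfl⟩ ⟨u', hu', he⟩
          rw [hψ u (Or.inr hu), hψ u' (Or.inl ((hmf u').2 hu'))] at he
          have : u' = u := congrArg Subtype.val he
          exact Set.disjoint_left.1 hpc'.disjoint (this ▸ hu') hu
        · intro hv
          rcases v.2 with h | h
          · exact absurd ⟨v.1, (hmf _).1 h, hψ _ _⟩ hv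
          · exact ⟨v.1, h, hψ _ _⟩
      unfold RootedPiece
      rw [← e2, ← e1]
      refine hpc'.map ψ ?_ ?_
      · intro u hu v hv huv
        rw [hψ u (hu.imp (hmf u).2 id), hψ v (hv.imp (hmf v).2 id)] at huv
        exact congrArg Subtype.val huv
      · intro u hu w huw
        rw [hψ u (Or.inr hu)] at huw
        exact ⟨w.1, huw, hψ _ _⟩
    obtain ⟨K, hsim, hKp, hδ, hKc⟩ := exists_small_equivalent hDP h𝒢 _ D rfl hDm hDp
    have hUn : U.ncard ≤ 2 * (2 ^ chainLength E g t 𝒢 * t) := by omega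
    have hcutf : IsCut S.toFinGraph.graph t (Set.range f, φ '' U) := by
      rw [hrf]; exact hpc'.isCut
    have hdisj : Disjoint (Set.range f) (φ '' U) := by rw [hrf]; exact hpc'.disjoint
    have hKcard : Nat.card K.V < (Set.range f ∪ φ '' U).ncard := by
      have h1 : K.boundary.ncard ≤ B'.ncard := by
        -- the labels of `K` are those of `D`
        have hlab : ∀ v : K.boundary, ∃ q : Fin B'.ncard, K.bd.lab v = some ((q : ℕ) + 1) := by
          rintro ⟨v, i, hi⟩
          have : i ∈ D.labels := hsim.sim.1 ▸ BGraph.mem_labels.2 ⟨v, hi⟩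
          obtain ⟨u, hu⟩ := BGraph.mem_labels.1 this
          obtain ⟨q, -, hq⟩ := (Labelling.ofInjective_lab (hf := hf)).1 hu
          exact ⟨q, hq ▸ hi⟩
        choose q hq using hlab
        have := Nat.card_le_card_of_injective q (fun u v huv => Subtype.ext
          (K.bd.inj _ _ _ (hq u) (huv ▸ hq v)))
        simpa using this
      have h2 := Set.ncard_add_ncard_compl K.boundary
      rw [Set.ncard_union_eq hdisj, hrf, hcU]
      -- `K` has at most as many boundary vertices as `D`, and fewer other ones, as `U` is large
      have h3 : 2 ^ classBound E g t 𝒢 * t ≤ sizeBound E g t 𝒢 := by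
        unfold sizeBound
        exact Nat.mul_le_mul_right _ (Nat.pow_le_pow_right (by omega) (by omega))
      omega
    have hwhole : true = true → (∀ i, part (f i).1 = 0) ∧ ∀ v : S.alive, part v.1 = p →
        v ∈ φ '' U := by
      refine fun _ => ⟨fun i => ?_, ?_⟩
      · obtain ⟨v, hv, he⟩ : f i ∈ φ '' B := (hmf _).1 ⟨i, rfl⟩
        rw [← he, hφ v (hB v hv).1]
        exact (hB v hv).2
      · rintro ⟨v, hv⟩ hvp
        exact ⟨v, ⟨hv, hvp⟩, hφ v hv⟩
    obtain ⟨r, x, hr, hx, hrℓ⟩ := exists_rule_of_simIn h𝒢 hp hst f hf hφU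
      hcutf hsim hδ hKcard true hwhole (by simpa using hKp)
    refine ⟨r, x, hr, hx, ?_⟩
    rw [hrℓ]
    refine (Set.ncard_union_le _ _).trans (add_le_add ?_ ?_)
    · exact hcutf.ncard_le
    · exact hcU.trans_le hUn

end

/-! ### A programming language with bounded loops -/

/-- The contents of the arrays. -/
abbrev Arrays := ℕ → ℤ → ℤ

/-- Integer expressions with variables. -/
inductive Ex
  | var (i : ℕ)
  | num (c : ℤ)
  | add (e f : Ex)
  | sub (e f : Ex)
  | load (a : ℕ) (e : Ex)

/-- First-order formulas, with quantifiers that range over `{0, …, n - 1}`. -/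
inductive Fm
  | pos (e : Ex)
  | not (φ : Fm)
  | and (φ ψ : Fm)
  | ex (k : ℕ) (φ : Fm)

/-- Commands. In `forEach k c`, the variable `k` takes the values `n - 1, …, 0`. -/
inductive Cmd
  | skip
  | assign (a : ℕ) (i e : Ex)
  | seq (c d : Cmd)
  | ite (φ : Fm) (c d : Cmd)
  | forEach (k : ℕ) (c : Cmd)

/-- The value of an expression, for given values `v` of the variables. -/
def Ex.eval (A : Arrays) (v : ℕ → ℤ) : Ex → ℤ
  | var i => v i
  | num c => c
  | add e f => e.eval A v + f.eval A v
  | sub e f => e.eval A v - f.eval A v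
  | load a e => A a (e.eval A v)

/-- Satisfaction of a formula. -/
def Fm.Sat (n : ℕ) (A : Arrays) : Fm → (ℕ → ℤ) → Prop
  | pos e, v => 0 < e.eval A v
  | not φ, v => ¬ φ.Sat n A v
  | and φ ψ, v => φ.Sat n A v ∧ ψ.Sat n A v
  | ex k φ, v => ∃ i : ℕ, i < n ∧ φ.Sat n A (Function.update v k i)

/-- Apply `f (m - 1)`, …, `f 0`, in this order. -/
def iterDown {α : Type} (f : ℕ → α → α) : ℕ → α → α
  | 0, a => a
  | m + 1, a => iterDown f m (f m a)

/-- The array `a` with the entry at `i` replaced by `c`. -/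
def Arrays.set (A : Arrays) (a : ℕ) (i c : ℤ) : Arrays :=
  Function.update A a (Function.update (A a) i c)

open Classical in
/-- The effect of a command on the arrays. -/
noncomputable def Cmd.eval (n : ℕ) : Cmd → (ℕ → ℤ) → Arrays → Arrays
  | skip, _, A => A
  | assign a i e, v, A => A.set a (i.eval A v) (e.eval A v)
  | seq c d, v, A => d.eval n v (c.eval n v A)
  | ite φ c d, v, A => if φ.Sat n A v then c.eval n v A else d.eval n v A
  | forEach k c, v, A => iterDown (fun i A => c.eval n (Function.update v k i) A) n A

/-- Compilation of expressions. The variable `i` is kept in the register `ρ i`, the registers from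
`b` on are free, and the result is left in the register `b`. -/
def Ex.compile (ρ : ℕ → ℕ) : ℕ → Ex → Prog
  | b, var i => .seq (.const b 0) (.add b b (ρ i))
  | b, num c => .const b c
  | b, add e f => .seq (e.compile ρ b) (.seq (f.compile ρ (b + 1)) (.add b b (b + 1)))
  | b, sub e f => .seq (e.compile ρ b) (.seq (f.compile ρ (b + 1)) (.sub b b (b + 1)))
  | b, load a e => .seq (e.compile ρ b) (.load b a b)

/-- Run `P` with the values `n - 1, …, 0` in the register `c`. The register `0` holds `n`. -/
def loopProg (c d : ℕ) (P : Prog) : Prog :=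
  .seq (.const c 0) (.seq (.add c c 0)
    (.whilePos c (.seq (.const d 1) (.seq (.sub c c d) P))))

/-- Compilation of formulas. The register `b` becomes positive if and only if the formula holds. -/
def Fm.compile : (ℕ → ℕ) → ℕ → Fm → Prog
  | ρ, b, pos e => e.compile ρ b
  | ρ, b, not φ => .seq (φ.compile ρ b) (.ifPos b (.const b 0) (.const b 1))
  | ρ, b, and φ ψ => .seq (φ.compile ρ b) (.ifPos b (ψ.compile ρ b) .skip)
  | ρ, b, ex k φ => .seq (.const b 0) (loopProg (b + 1) (b + 2)
      (.seq (φ.compile (Function.update ρ k (b + 1)) (b + 2))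
        (.ifPos (b + 2) (.const b 1) .skip)))

/-- Compilation of commands. -/
def Cmd.compile : (ℕ → ℕ) → ℕ → Cmd → Prog
  | _, _, skip => .skip
  | ρ, b, assign a i e => .seq (i.compile ρ b) (.seq (e.compile ρ (b + 1)) (.store a b (b + 1)))
  | ρ, b, seq c d => .seq (c.compile ρ b) (d.compile ρ b)
  | ρ, b, ite φ c d => .seq (φ.compile ρ b) (.ifPos b (c.compile ρ b) (d.compile ρ b))
  | ρ, b, forEach k c => loopProg b (b + 1) (c.compile (Function.update ρ k b) (b + 1))

/-- The number of steps that the compiled expression takes. -/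
def Ex.cost : Ex → ℕ
  | var _ => 2
  | num _ => 1
  | add e f => e.cost + (f.cost + 1)
  | sub e f => e.cost + (f.cost + 1)
  | load _ e => e.cost + 1

open Polynomial in
/-- A bound for the number of steps that the compiled formula takes, as a polynomial in `n`. -/
noncomputable def Fm.cost : Fm → Polynomial ℕ
  | pos e => C e.cost
  | not φ => φ.cost + 3
  | and φ ψ => φ.cost + (ψ.cost + 2)
  | ex _ φ => 1 + (X * (φ.cost + 6) + 3)

open Polynomial in
/-- A bound for the number of steps that the compiled command takes, as a polynomial in `n`. -/
noncomputable def Cmd.cost : Cmd → Polynomial ℕ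
  | skip => 1
  | assign _ i e => C (i.cost + (e.cost + 1))
  | seq c d => c.cost + d.cost
  | ite φ c d => φ.cost + (c.cost + d.cost + 1)
  | forEach _ c => X * (c.cost + 3) + 3

/-- Started in `σ`, the program `P` halts after at most `N` steps in a state with the property
`post`. -/
def Does (P : Prog) (σ : Memory) (N : ℕ) (post : Memory → Prop) : Prop :=
  ∃ σ' m, Run P σ σ' m ∧ m ≤ N ∧ post σ'

namespace Does

variable {P Q : Prog} {σ : Memory} {N N' : ℕ} {post post' : Memory → Prop}

theorem mono (h : Does P σ N post) (hN : N ≤ N') (hp : ∀ σ', post σ' → post' σ') :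
    Does P σ N' post' := by
  obtain ⟨σ', m, h1, h2, h3⟩ := h
  exact ⟨σ', m, h1, h2.trans hN, hp _ h3⟩

theorem seq (h : Does P σ N post) (h' : ∀ σ', post σ' → Does Q σ' N' post') :
    Does (.seq P Q) σ (N + N') post' := by
  obtain ⟨σ', m, h1, h2, h3⟩ := h
  obtain ⟨σ'', m', h4, h5, h6⟩ := h' σ' h3
  exact ⟨σ'', m + m', .seq h1 h4, add_le_add h2 h5, h6⟩

theorem ifPos {x : ℕ} (h : 0 < σ.reg x → Does P σ N post)
    (h' : σ.reg x ≤ 0 → Does Q σ N' post) : Does (.ifPos x P Q) σ (N + N' + 1) post := by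
  by_cases hx : 0 < σ.reg x
  · obtain ⟨σ', m, h1, h2, h3⟩ := h hx
    exact ⟨σ', m + 1, .ifPos_true hx h1, by omega, h3⟩
  · obtain ⟨σ', m, h1, h2, h3⟩ := h' (not_lt.1 hx)
    exact ⟨σ', m + 1, .ifPos_false (not_lt.1 hx) h1, by omega, h3⟩

theorem skip (h : post σ) : Does .skip σ 1 post := ⟨_, 1, .skip _, le_rfl, h⟩

theorem const {x : ℕ} {c : ℤ} (h : post (σ.setReg x c)) : Does (.const x c) σ 1 post :=
  ⟨_, 1, .const _ _ _, le_rfl, h⟩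

theorem add {x y z : ℕ} (h : post (σ.setReg x (σ.reg y + σ.reg z))) :
    Does (.add x y z) σ 1 post := ⟨_, 1, .add _ _ _ _, le_rfl, h⟩

theorem load {x a y : ℕ} (h : post (σ.setReg x (σ.arr a (σ.reg y)))) :
    Does (.load x a y) σ 1 post := ⟨_, 1, .load _ _ _ _, le_rfl, h⟩

theorem store {a x y : ℕ} (h : post (σ.setArr a (σ.reg x) (σ.reg y))) :
    Does (.store a x y) σ 1 post := ⟨_, 1, .store _ _ _ _, le_rfl, h⟩

theorem while_countdown {c d : ℕ} (hcd : c ≠ d) (I : ℕ → Memory → Prop)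
    (hI : ∀ m σ, I m σ → σ.reg c = m)
    (hstep : ∀ m σ, I (m + 1) σ → Does P ((σ.setReg d 1).setReg c m) N (I m)) :
    ∀ m σ, I m σ →
      Does (.whilePos c (.seq (.const d 1) (.seq (.sub c c d) P))) σ (m * (N + 3) + 1) (I 0) := by
  intro m
  induction m with
  | zero =>
    intro σ h
    exact ⟨σ, 1, .whilePos_false (by rw [hI 0 σ h]; rfl), by omega, h⟩
  | succ m ih =>
    intro σ h
    have hreg := hI _ σ h
    obtain ⟨σ', k, h1, h2, h3⟩ := hstep m σ h
    obtain ⟨σ'', k', h4, h5, h6⟩ := ih σ' h3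
    have hsub : Run (.sub c c d) (σ.setReg d 1) ((σ.setReg d 1).setReg c m) 1 := by
      have := Run.sub (σ.setReg d 1) c c d
      have e : (σ.setReg d 1).reg c - (σ.setReg d 1).reg d = m := by
        simp only [Memory.setReg, Function.update_self, Function.update_of_ne hcd]
        rw [hreg]
        push_cast
        ring
      rwa [e] at this
    refine ⟨σ'', _, .whilePos_true (by rw [hreg]; positivity)
      (.seq (.const σ d 1) (.seq hsub h1)) h4, ?_, h6⟩
    have : (m + 1) * (N + 3) = m * (N + 3) + (N + 3) := by ring
    omega

/-- The rule for loops: `I m` is an invariant that holds when `m` rounds remain. -/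
theorem loop {n c d : ℕ} (hcd : c ≠ d) (hc : c ≠ 0) (hn : σ.reg 0 = n) (I : ℕ → Memory → Prop)
    (hI : ∀ m σ, I m σ → σ.reg c = m) (h0 : I n (σ.setReg c n))
    (hstep : ∀ m σ, I (m + 1) σ → m < n → Does P ((σ.setReg d 1).setReg c m) N (I m)) :
    Does (loopProg c d P) σ (n * (N + 3) + 3) (I 0) := by
  have h1 : Does (.add c c 0) (σ.setReg c 0) 1 (fun σ' => σ' = σ.setReg c n) := by
    refine add ?_
    simp only [Memory.setReg, Function.update_self, Function.update_of_ne hc.symm, hn,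
      zero_add, Function.update_idem]
  have h2 : Does (.const c 0) σ 1 (fun σ' => σ' = σ.setReg c 0) := const rfl
  refine (h2.seq (N' := 1 + (n * (N + 3) + 1)) (post' := fun σ' => I 0 σ' ∧ 0 ≤ n) ?_).mono
    (by omega) fun _ h => h.1
  rintro _ rfl
  refine h1.seq ?_
  rintro _ rfl
  refine (while_countdown hcd (fun m σ => I m σ ∧ m ≤ n) (fun m σ h => hI m σ h.1) ?_ n _
    ⟨h0, le_rfl⟩)
  rintro m σ ⟨h, hm⟩
  exact (hstep m σ h hm).mono le_rfl fun σ' h' => ⟨h', by omega⟩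

end Does

/-- `σ'` differs from `σ` only in the registers from `b` on. -/
def Frame (b : ℕ) (σ σ' : Memory) : Prop := σ'.arr = σ.arr ∧ ∀ x < b, σ'.reg x = σ.reg x

theorem Frame.trans {b b' : ℕ} {σ σ' σ'' : Memory} (h : Frame b σ σ') (h' : Frame b' σ' σ'')
    (hb : b ≤ b') : Frame b σ σ'' :=
  ⟨h'.1.trans h.1, fun x hx => (h'.2 x (hx.trans_le hb)).trans (h.2 x hx)⟩

theorem Frame.setReg {b x : ℕ} (hx : b ≤ x) (σ : Memory) (c : ℤ) : Frame b σ (σ.setReg x c) :=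
  ⟨rfl, fun y hy => Function.update_of_ne (by omega) _ _⟩

/-- The registers below `b` hold the size `n` and the values `v` of the variables. -/
structure Holds (n : ℕ) (ρ : ℕ → ℕ) (b : ℕ) (v : ℕ → ℤ) (σ : Memory) : Prop where
  pos : 0 < b
  size : σ.reg 0 = n
  lt : ∀ i, ρ i < b
  val : ∀ i, σ.reg (ρ i) = v i

theorem Holds.frame {n b b' : ℕ} {ρ : ℕ → ℕ} {v : ℕ → ℤ} {σ σ' : Memory} (h : Holds n ρ b v σ)
    (hf : ∀ x < b, σ'.reg x = σ.reg x) (hb : b ≤ b') : Holds n ρ b' v σ' :=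
  ⟨h.pos.trans_le hb, (hf 0 h.pos).trans h.size, fun i => (h.lt i).trans_le hb,
    fun i => (hf _ (h.lt i)).trans (h.val i)⟩

/-- Bind the variable `k` to the register `c`. -/
theorem Holds.bind {n b c b' : ℕ} {ρ : ℕ → ℕ} {v : ℕ → ℤ} {σ σ' : Memory} (h : Holds n ρ b v σ)
    (hf : ∀ x < b, σ'.reg x = σ.reg x) (hb : b ≤ b') (hc : c < b') (k : ℕ) {m : ℤ}
    (hm : σ'.reg c = m) :
    Holds n (Function.update ρ k c) b' (Function.update v k m) σ' := by
  refine ⟨h.pos.trans_le hb, (hf 0 h.pos).trans h.size, fun i => ?_, fun i => ?_⟩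
  · by_cases hi : i = k
    · subst hi; rw [Function.update_self]; exact hc
    · rw [Function.update_of_ne hi]; exact (h.lt i).trans_le hb
  · by_cases hi : i = k
    · subst hi; rw [Function.update_self, Function.update_self]; exact hm
    · rw [Function.update_of_ne hi, Function.update_of_ne hi]
      exact (hf _ (h.lt i)).trans (h.val i)

theorem Ex.compile_spec {n : ℕ} {ρ : ℕ → ℕ} {v : ℕ → ℤ} (e : Ex) : ∀ (b : ℕ) (σ : Memory),
    Holds n ρ b v σ → Does (e.compile ρ b) σ e.cost fun σ' =>
      Frame b σ σ' ∧ σ'.reg b = e.eval σ.arr v := by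
  have binop : ∀ (e f : Ex) (P : ℕ → ℕ → ℕ → Prog) (op : ℤ → ℤ → ℤ),
      (∀ (x y z : ℕ) (σ : Memory), Run (P x y z) σ (σ.setReg x (op (σ.reg y) (σ.reg z))) 1) →
      (∀ (b : ℕ) (σ : Memory), Holds n ρ b v σ → Does (e.compile ρ b) σ e.cost fun σ' =>
        Frame b σ σ' ∧ σ'.reg b = e.eval σ.arr v) →
      (∀ (b : ℕ) (σ : Memory), Holds n ρ b v σ → Does (f.compile ρ b) σ f.cost fun σ' =>
        Frame b σ σ' ∧ σ'.reg b = f.eval σ.arr v) →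
      ∀ (b : ℕ) (σ : Memory), Holds n ρ b v σ →
      Does (.seq (e.compile ρ b) (.seq (f.compile ρ (b + 1)) (P b b (b + 1)))) σ
        (e.cost + (f.cost + 1)) fun σ' =>
        Frame b σ σ' ∧ σ'.reg b = op (e.eval σ.arr v) (f.eval σ.arr v) := by
    intro e f P op hP he hf b σ h
    refine (he b σ h).seq ?_
    rintro σ₁ ⟨h1, h2⟩
    refine (hf (b + 1) σ₁ (h.frame h1.2 (Nat.le_succ b))).seq ?_
    rintro σ₂ ⟨h3, h4⟩
    refine ⟨_, 1, hP _ _ _ _, le_rfl, (h1.trans h3 (Nat.le_succ b)).trans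
      (Frame.setReg le_rfl _ _) le_rfl, ?_⟩
    rw [h4, h3.2 b (Nat.lt_succ_self b), h2, h1.1]
    exact Function.update_self _ _ _
  induction e with
  | var i =>
    intro b σ h
    refine Does.seq (N := 1) (N' := 1) (Does.const (post := fun σ' => σ' = σ.setReg b 0) rfl) ?_
    rintro _ rfl
    refine Does.add ⟨(Frame.setReg le_rfl _ _).trans (Frame.setReg le_rfl _ _) le_rfl, ?_⟩
    have : ρ i ≠ b := (h.lt i).ne
    simp only [Memory.setReg, Function.update_self, Function.update_of_ne this, zero_add]
    exact h.val i
  | num c => exact fun b σ _ => Does.const ⟨Frame.setReg le_rfl _ _, Function.update_self _ _ _⟩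
  | add e f he hf => exact binop e f .add (· + ·) (fun x y z σ => .add σ x y z) he hf
  | sub e f he hf => exact binop e f .sub (· - ·) (fun x y z σ => .sub σ x y z) he hf
  | load a e he =>
    intro b σ h
    refine (he b σ h).seq ?_
    rintro σ₁ ⟨h1, h2⟩
    refine Does.load ⟨h1.trans (Frame.setReg le_rfl _ _) le_rfl, ?_⟩
    rw [h2, h1.1]
    exact Function.update_self _ _ _

theorem Fm.compile_spec {n : ℕ} (φ : Fm) : ∀ (ρ : ℕ → ℕ) (v : ℕ → ℤ) (b : ℕ) (σ : Memory),
    Holds n ρ b v σ → Does (φ.compile ρ b) σ (φ.cost.eval n) fun σ' =>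
      Frame b σ σ' ∧ (0 < σ'.reg b ↔ φ.Sat n σ.arr v) := by
  induction φ with
  | pos e =>
    intro ρ v b σ h
    refine (e.compile_spec b σ h).mono (by simp [Fm.cost]) ?_
    rintro σ' ⟨h1, h2⟩
    exact ⟨h1, by rw [h2]; rfl⟩
  | not φ ih =>
    intro ρ v b σ h
    refine ((ih ρ v b σ h).seq (N' := 1 + 1 + 1)
      (post' := fun σ' => Frame b σ σ' ∧ (0 < σ'.reg b ↔ ¬ φ.Sat n σ.arr v)) ?_).mono ?_
      fun _ h => h
    · rintro σ₁ ⟨h1, h2⟩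
      refine Does.ifPos (fun hp => Does.const ⟨h1.trans (Frame.setReg le_rfl _ _) le_rfl, ?_⟩)
        (fun hp => Does.const ⟨h1.trans (Frame.setReg le_rfl _ _) le_rfl, ?_⟩)
      · rw [← h2]
        simp [Memory.setReg, hp]
      · rw [← h2]
        simp [Memory.setReg, hp]
    · simp [Fm.cost]
  | and φ ψ ih ih' =>
    intro ρ v b σ h
    refine ((ih ρ v b σ h).seq (N' := ψ.cost.eval n + 1 + 1)
      (post' := fun σ' => Frame b σ σ' ∧ (0 < σ'.reg b ↔ φ.Sat n σ.arr v ∧ ψ.Sat n σ.arr v))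
      ?_).mono (by simp [Fm.cost, add_assoc]) fun _ h => h
    rintro σ₁ ⟨h1, h2⟩
    refine Does.ifPos (fun hp => ?_) (fun hp => Does.skip ⟨h1, ?_⟩)
    · refine (ih' ρ v b σ₁ (h.frame h1.2 le_rfl)).mono le_rfl ?_
      rintro σ₂ ⟨h3, h4⟩
      refine ⟨h1.trans h3 le_rfl, ?_⟩
      rw [h4, h1.1]
      exact ⟨fun h => ⟨h2.1 hp, h⟩, fun h => h.2⟩
    · rw [← h2]
      exact ⟨fun h => absurd h (not_lt.2 hp), fun h => h.1⟩
  | ex k φ ih =>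
    intro ρ v b σ h
    let I : ℕ → Memory → Prop := fun m σ' => Frame b σ σ' ∧ σ'.reg (b + 1) = m ∧
      (0 < σ'.reg b ↔ ∃ i : ℕ, m ≤ i ∧ i < n ∧ φ.Sat n σ.arr (Function.update v k i))
    refine ((Does.const (post := fun σ' => σ' = σ.setReg b 0) rfl).seq (N' := _)
      (post' := I 0) ?_).mono (N := 1 + (n * ((φ.cost.eval n + (1 + 1 + 1)) + 3) + 3)) ?_ ?_
    · rintro _ rfl
      have hf0 : Frame b σ (σ.setReg b 0) := Frame.setReg le_rfl _ _
      refine Does.loop (by omega) (by omega) ?_ I (fun m σ' h => h.2.1) ?_ ?_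
      · exact (hf0.2 0 h.pos).trans h.size
      · refine ⟨hf0.trans (Frame.setReg (Nat.le_succ b) _ _) le_rfl, Function.update_self _ _ _, ?_⟩
        have e : ((σ.setReg b 0).setReg (b + 1) n).reg b = 0 := by simp [Memory.setReg]
        rw [e]
        constructor
        · intro h; exact absurd h (lt_irrefl 0)
        · rintro ⟨i, h1, h2, -⟩; omega
      · rintro m σ₁ ⟨h1, h2, h3⟩ hm
        have hf : Frame (b + 1) σ₁ ((σ₁.setReg (b + 2) 1).setReg (b + 1) m) :=
          (Frame.setReg (by omega) _ _).trans (Frame.setReg le_rfl _ _) le_rfl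
        have hfb := h1.trans hf (Nat.le_succ b)
        have hH := h.bind hfb.2 (show b ≤ b + 2 by omega) (show b + 1 < b + 2 by omega) k
          (m := m) (Function.update_self _ _ _)
        refine (ih _ _ (b + 2) _ hH).seq ?_
        rintro σ₂ ⟨h4, h5⟩
        rw [hfb.1] at h5
        have hreg : σ₂.reg (b + 1) = m :=
          (h4.2 _ (by omega)).trans (Function.update_self _ _ _)
        have hacc : σ₂.reg b = σ₁.reg b := (h4.2 _ (by omega)).trans (hf.2 b (by omega))
        have hfr := hfb.trans h4 (show b ≤ b + 2 by omega)
        refine Does.ifPos (fun hp => Does.const ⟨hfr.trans (Frame.setReg le_rfl _ _) le_rfl, ?_, ?_⟩)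
          (fun hp => Does.skip ⟨hfr, hreg, ?_⟩)
        · refine Eq.trans ?_ hreg
          exact Function.update_of_ne (by omega) _ _
        · have : (σ₂.setReg b 1).reg b = 1 := Function.update_self _ _ _
          rw [this]
          exact ⟨fun _ => ⟨m, le_rfl, hm, h5.1 hp⟩, fun _ => one_pos⟩
        · rw [hacc, h3]
          constructor
          · rintro ⟨i, h6, h7⟩; exact ⟨i, by omega, h7⟩
          · rintro ⟨i, h6, h7⟩
            rcases h6.eq_or_lt with rfl | h6
            · exact absurd (h5.2 h7.2) (not_lt.2 hp)
            · exact ⟨i, h6, h7⟩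
    · simp [Fm.cost, add_assoc]
    · rintro σ' ⟨h1, -, h2⟩
      refine ⟨h1, h2.trans ?_⟩
      exact ⟨fun ⟨i, _, h3, h4⟩ => ⟨i, h3, h4⟩, fun ⟨i, h3, h4⟩ => ⟨i, Nat.zero_le _, h3, h4⟩⟩

/-- A compiled command has the effect `Cmd.eval` on the arrays, within the time `Cmd.cost`, and
changes only registers that are free. -/
theorem Cmd.compile_spec {n : ℕ} (c : Cmd) : ∀ (ρ : ℕ → ℕ) (v : ℕ → ℤ) (b : ℕ) (σ : Memory),
    Holds n ρ b v σ → Does (c.compile ρ b) σ (c.cost.eval n) fun σ' =>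
      σ'.arr = c.eval n v σ.arr ∧ ∀ x < b, σ'.reg x = σ.reg x := by
  induction c with
  | skip =>
    exact fun ρ v b σ h =>
      (Does.skip ⟨rfl, fun _ _ => rfl⟩).mono (by simp [Cmd.cost]) fun _ h => h
  | assign a i e =>
    intro ρ v b σ h
    refine ((i.compile_spec b σ h).seq (N' := e.cost + 1)
      (post' := fun σ' => σ'.arr = (Cmd.assign a i e).eval n v σ.arr ∧
        ∀ x < b, σ'.reg x = σ.reg x) ?_).mono (by simp [Cmd.cost]) fun _ h => h
    rintro σ₁ ⟨h1, h2⟩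
    refine (e.compile_spec (b + 1) σ₁ (h.frame h1.2 (Nat.le_succ b))).seq ?_
    rintro σ₂ ⟨h3, h4⟩
    refine Does.store ⟨?_, (h1.trans h3 (Nat.le_succ b)).2⟩
    rw [h4, h3.2 b (Nat.lt_succ_self b), h2, h1.1]
    change (fun A : Arrays => Function.update A a _) σ₂.arr = _
    rw [h3.1, h1.1]
    rfl
  | seq c d ihc ihd =>
    intro ρ v b σ h
    refine ((ihc ρ v b σ h).seq (N' := d.cost.eval n)
      (post' := fun σ' => σ'.arr = (Cmd.seq c d).eval n v σ.arr ∧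
        ∀ x < b, σ'.reg x = σ.reg x) ?_).mono (by simp [Cmd.cost]) fun _ h => h
    rintro σ₁ ⟨h1, h2⟩
    refine (ihd ρ v b σ₁ (h.frame h2 le_rfl)).mono le_rfl ?_
    rintro σ₂ ⟨h3, h4⟩
    exact ⟨by rw [h3, h1]; rfl, fun x hx => (h4 x hx).trans (h2 x hx)⟩
  | ite φ c d ihc ihd =>
    intro ρ v b σ h
    refine ((φ.compile_spec ρ v b σ h).seq (N' := c.cost.eval n + d.cost.eval n + 1)
      (post' := fun σ' => σ'.arr = (Cmd.ite φ c d).eval n v σ.arr ∧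
        ∀ x < b, σ'.reg x = σ.reg x) ?_).mono (by simp [Cmd.cost]) fun _ h => h
    rintro σ₁ ⟨h1, h2⟩
    have hH := h.frame h1.2 le_rfl
    refine Does.ifPos (fun hp => (ihc ρ v b σ₁ hH).mono le_rfl ?_)
      (fun hp => (ihd ρ v b σ₁ hH).mono le_rfl ?_)
    · rintro σ₂ ⟨h3, h4⟩
      refine ⟨?_, fun x hx => (h4 x hx).trans (h1.2 x hx)⟩
      rw [h3, h1.1]
      exact (if_pos (h2.1 hp)).symm
    · rintro σ₂ ⟨h3, h4⟩
      refine ⟨?_, fun x hx => (h4 x hx).trans (h1.2 x hx)⟩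
      rw [h3, h1.1]
      exact (if_neg fun hs => absurd (h2.2 hs) (not_lt.2 hp)).symm
  | forEach k c ih =>
    intro ρ v b σ h
    let f : ℕ → Arrays → Arrays := fun i A => c.eval n (Function.update v k i) A
    let I : ℕ → Memory → Prop := fun m σ' => σ'.reg b = m ∧
      (∀ x < b, σ'.reg x = σ.reg x) ∧ iterDown f m σ'.arr = iterDown f n σ.arr
    refine (Does.loop (N := c.cost.eval n) (Nat.lt_succ_self b).ne h.pos.ne' h.size I
      (fun m σ' h => h.1) ?_ ?_).mono
      ?_ ?_
    · exact ⟨Function.update_self _ _ _, (Frame.setReg le_rfl _ _).2, rfl⟩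
    · rintro m σ₁ ⟨h1, h2, h3⟩ hm
      have hf : Frame b σ₁ ((σ₁.setReg (b + 1) 1).setReg b m) :=
        (Frame.setReg (by omega) _ _).trans (Frame.setReg le_rfl _ _) le_rfl
      have hfb : ∀ x < b, ((σ₁.setReg (b + 1) 1).setReg b m).reg x = σ.reg x :=
        fun x hx => (hf.2 x hx).trans (h2 x hx)
      have hH := h.bind hfb (Nat.le_succ b) (Nat.lt_succ_self b) k
          (m := m) (Function.update_self _ _ _)
      refine (ih _ _ (b + 1) _ hH).mono le_rfl ?_
      rintro σ₂ ⟨h4, h5⟩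
      refine ⟨(h5 b (Nat.lt_succ_self b)).trans (Function.update_self _ _ _),
        fun x hx => (h5 x (by omega)).trans (hfb x hx), ?_⟩
      rw [← h3, h4]
      rfl
    · simp [Cmd.cost]
    · rintro σ' ⟨-, h1, h2⟩
      exact ⟨h2, h1⟩

/-! ### Reasoning about loops -/

section iterDown

variable {α : Type}

/-- The invariant `I m` holds when `m` rounds remain. -/
theorem iterDown_induction {f : ℕ → α → α} (I : ℕ → α → Prop) : ∀ {m : ℕ} {a : α}, I m a →
    (∀ i a, i < m → I (i + 1) a → I i (f i a)) → I 0 (iterDown f m a) := by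
  intro m
  induction m with
  | zero => exact fun h _ => h
  | succ m ih =>
    intro a h hstep
    exact ih (hstep m a (Nat.lt_succ_self m) h) fun i a hi => hstep i a (by omega)

end iterDown

namespace Fm

def tt : Fm := pos (.num 1)
def or (φ ψ : Fm) : Fm := not (and (not φ) (not ψ))
def imp (φ ψ : Fm) : Fm := not (and φ (not ψ))
def all (k : ℕ) (φ : Fm) : Fm := not (ex k (not φ))
def eq (e f : Ex) : Fm := and (not (pos (.sub e f))) (not (pos (.sub f e)))
def conj : List Fm → Fm := List.foldr and tt

open Classical in
/-- The conjunction of the `φ i` with the property `p i`. -/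
noncomputable def conjFin {ℓ : ℕ} (p : Fin ℓ → Prop) (φ : Fin ℓ → Fm) : Fm :=
  conj (((List.finRange ℓ).filter fun i => p i).map φ)

/-- The disjunction of the `φ i`. -/
noncomputable def disjFin {ℓ : ℕ} (φ : Fin ℓ → Fm) : Fm :=
  not (conjFin (fun _ => True) fun i => not (φ i))

variable {n : ℕ} {A : Arrays} {v : ℕ → ℤ}

theorem sat_pos {e : Ex} : (pos e).Sat n A v ↔ 0 < e.eval A v := Iff.rfl

theorem sat_not {φ : Fm} : (not φ).Sat n A v ↔ ¬ φ.Sat n A v := Iff.rfl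

theorem sat_and {φ ψ : Fm} : (and φ ψ).Sat n A v ↔ φ.Sat n A v ∧ ψ.Sat n A v := Iff.rfl

theorem sat_ex {k : ℕ} {φ : Fm} :
    (ex k φ).Sat n A v ↔ ∃ i : Fin n, φ.Sat n A (Function.update v k ((i : ℕ) : ℤ)) :=
  ⟨fun ⟨i, hi, h⟩ => ⟨⟨i, hi⟩, h⟩, fun ⟨i, h⟩ => ⟨i, i.2, h⟩⟩

theorem sat_tt : tt.Sat n A v := show (0 : ℤ) < 1 from one_pos

theorem sat_or {φ ψ : Fm} : (or φ ψ).Sat n A v ↔ φ.Sat n A v ∨ ψ.Sat n A v := by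
  simp only [or, sat_not, sat_and]
  tauto

theorem sat_imp {φ ψ : Fm} : (imp φ ψ).Sat n A v ↔ (φ.Sat n A v → ψ.Sat n A v) := by
  simp only [imp, sat_not, sat_and]
  tauto

theorem sat_all {k : ℕ} {φ : Fm} :
    (all k φ).Sat n A v ↔ ∀ i : Fin n, φ.Sat n A (Function.update v k ((i : ℕ) : ℤ)) := by
  simp only [all, sat_not, sat_ex, not_exists, not_not]

theorem sat_eq {e f : Ex} : (eq e f).Sat n A v ↔ e.eval A v = f.eval A v := by
  simp only [eq, sat_not, sat_and, sat_pos, Ex.eval]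
  omega

theorem sat_conj {l : List Fm} : (conj l).Sat n A v ↔ ∀ φ ∈ l, φ.Sat n A v := by
  induction l with
  | nil => simp [conj, sat_tt]
  | cons φ l ih =>
    rw [List.forall_mem_cons, ← ih]
    exact Iff.rfl

theorem sat_conjFin {ℓ : ℕ} {p : Fin ℓ → Prop} {φ : Fin ℓ → Fm} :
    (conjFin p φ).Sat n A v ↔ ∀ i, p i → (φ i).Sat n A v := by
  simp [conjFin, sat_conj]

theorem sat_disjFin {ℓ : ℕ} {φ : Fin ℓ → Fm} :
    (disjFin φ).Sat n A v ↔ ∃ i, (φ i).Sat n A v := by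
  simp [disjFin, sat_conjFin, sat_not]

end Fm

/-- The expression `e` does not read the array `a`. -/
def Ex.Avoids (a : ℕ) : Ex → Prop
  | var _ => True
  | num _ => True
  | add e f => e.Avoids a ∧ f.Avoids a
  | sub e f => e.Avoids a ∧ f.Avoids a
  | load a' e => a' ≠ a ∧ e.Avoids a

/-- The formula `φ` does not read the array `a`. -/
def Fm.Avoids (a : ℕ) : Fm → Prop
  | pos e => e.Avoids a
  | not φ => φ.Avoids a
  | and φ ψ => φ.Avoids a ∧ ψ.Avoids a
  | ex _ φ => φ.Avoids a

/-- `A` and `A'` may differ in the array `a` only. -/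
def AgreeOff (a : ℕ) (A A' : Arrays) : Prop := ∀ a', a' ≠ a → A a' = A' a'

theorem Ex.Avoids.eval_eq {a : ℕ} {A A' : Arrays} (hA : AgreeOff a A A') {v : ℕ → ℤ} {e : Ex}
    (he : e.Avoids a) : e.eval A v = e.eval A' v := by
  induction e with
  | var i => rfl
  | num c => rfl
  | add e f ihe ihf => exact congrArg₂ _ (ihe he.1) (ihf he.2)
  | sub e f ihe ihf => exact congrArg₂ _ (ihe he.1) (ihf he.2)
  | load a' e ih =>
    change A a' (e.eval A v) = A' a' (e.eval A' v)
    rw [hA a' he.1, ih he.2]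

theorem Fm.Avoids.sat_iff {a n : ℕ} {A A' : Arrays} (hA : AgreeOff a A A') {φ : Fm} :
    ∀ {v : ℕ → ℤ}, φ.Avoids a → (φ.Sat n A v ↔ φ.Sat n A' v) := by
  induction φ with
  | pos e => exact fun h => by rw [sat_pos, sat_pos, Ex.Avoids.eval_eq hA h]
  | not φ ih => exact fun h => not_congr (ih h)
  | and φ ψ ih ih' => exact fun h => and_congr (ih h.1) (ih' h.2)
  | ex k φ ih => exact fun h => exists_congr fun i => and_congr_right fun _ => ih h

theorem Arrays.set_self {A : Arrays} {a : ℕ} {i c : ℤ} : (A.set a i c) a i = c := by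
  simp [Arrays.set]

theorem Arrays.set_of_ne {A : Arrays} {a : ℕ} {i j c : ℤ} (h : j ≠ i) :
    (A.set a i c) a j = A a j := by
  simp [Arrays.set, h]

theorem Arrays.set_agreeOff (A : Arrays) (a : ℕ) (i c : ℤ) : AgreeOff a (A.set a i c) A :=
  fun _ h => Function.update_of_ne h _ _

theorem AgreeOff.trans {a : ℕ} {A B C : Arrays} (h : AgreeOff a A B) (h' : AgreeOff a B C) :
    AgreeOff a A C := fun a' ha => (h a' ha).trans (h' a' ha)

/-- On arrays that agree with `A₀` off `a`, the command `c` changes only the array `a`, and the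
index-value pairs that it writes are those in `W`. -/
def Cmd.Writes (n : ℕ) (v : ℕ → ℤ) (a : ℕ) (A₀ : Arrays) (c : Cmd) (W : Set (ℤ × ℤ)) : Prop :=
  ∀ A, AgreeOff a A A₀ → AgreeOff a (c.eval n v A) A₀ ∧
    ∀ z, (z, c.eval n v A a z) ∈ W ∨ (c.eval n v A a z = A a z ∧ ∀ y, (z, y) ∉ W)

namespace Cmd.Writes

variable {n : ℕ} {v : ℕ → ℤ} {a : ℕ} {A₀ : Arrays} {c d : Cmd} {W W' : Set (ℤ × ℤ)}

theorem skip : Cmd.skip.Writes n v a A₀ ∅ :=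
  fun _ h => ⟨h, fun _ => Or.inr ⟨rfl, fun _ => Set.notMem_empty _⟩⟩

theorem assign {i e : Ex} (hi : i.Avoids a) (he : e.Avoids a) :
    (Cmd.assign a i e).Writes n v a A₀ {(i.eval A₀ v, e.eval A₀ v)} := by
  intro A hA
  have ev : (Cmd.assign a i e).eval n v A = A.set a (i.eval A₀ v) (e.eval A₀ v) := by
    rw [← hi.eval_eq hA, ← he.eval_eq hA]
    rfl
  rw [ev]
  refine ⟨(A.set_agreeOff _ _ _).trans hA, fun z => ?_⟩
  by_cases hz : z = i.eval A₀ v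
  · subst hz
    rw [Arrays.set_self]
    exact Or.inl rfl
  · rw [Arrays.set_of_ne hz]
    exact Or.inr ⟨rfl, fun y hy => hz (congrArg Prod.fst hy)⟩

theorem seq (hc : c.Writes n v a A₀ W) (hd : d.Writes n v a A₀ W') :
    (Cmd.seq c d).Writes n v a A₀ (W ∪ W') := by
  intro A hA
  obtain ⟨h1, h2⟩ := hc A hA
  obtain ⟨h3, h4⟩ := hd _ h1
  refine ⟨h3, fun z => ?_⟩
  rcases h4 z with h | ⟨h, h'⟩
  · exact Or.inl (Or.inr h)
  · change (z, d.eval n v (c.eval n v A) a z) ∈ _ ∨ d.eval n v (c.eval n v A) a z = _ ∧ _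
    rw [h]
    rcases h2 z with h5 | ⟨h5, h6⟩
    · exact Or.inl (Or.inl h5)
    · exact Or.inr ⟨h5, fun y hy => hy.elim (h6 y) (h' y)⟩

theorem ite {φ : Fm} (hφ : φ.Avoids a) (hc : c.Writes n v a A₀ W) (hd : d.Writes n v a A₀ W') :
    (Cmd.ite φ c d).Writes n v a A₀
      {p | (φ.Sat n A₀ v ∧ p ∈ W) ∨ (¬ φ.Sat n A₀ v ∧ p ∈ W')} := by
  intro A hA
  by_cases h : φ.Sat n A₀ v
  · have ev : (Cmd.ite φ c d).eval n v A = c.eval n v A :=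
      if_pos ((Fm.Avoids.sat_iff hA hφ).2 h)
    rw [ev]
    simpa [h] using hc A hA
  · have ev : (Cmd.ite φ c d).eval n v A = d.eval n v A :=
      if_neg fun h' => h ((Fm.Avoids.sat_iff hA hφ).1 h')
    rw [ev]
    simpa [h] using hd A hA

theorem forEach {k : ℕ} {W : ℕ → Set (ℤ × ℤ)}
    (hc : ∀ i < n, c.Writes n (Function.update v k i) a A₀ (W i)) :
    (Cmd.forEach k c).Writes n v a A₀ {p | ∃ i < n, p ∈ W i} := by
  intro A hA
  have := iterDown_induction (f := fun i A => c.eval n (Function.update v k i) A)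
    (fun m A' => AgreeOff a A' A₀ ∧ ∀ z, (∃ i, m ≤ i ∧ i < n ∧ (z, A' a z) ∈ W i) ∨
      (A' a z = A a z ∧ ∀ y i, m ≤ i → i < n → (z, y) ∉ W i)) (m := n) (a := A)
    ⟨hA, fun z => Or.inr ⟨rfl, fun y i h h' => by omega⟩⟩ ?_
  · refine ⟨this.1, fun z => ?_⟩
    rcases this.2 z with ⟨i, -, h1, h2⟩ | ⟨h1, h2⟩
    · exact Or.inl ⟨i, h1, h2⟩
    · exact Or.inr ⟨h1, fun y ⟨i, hi, hy⟩ => h2 y i (Nat.zero_le _) hi hy⟩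
  · rintro m A' hm ⟨h1, h2⟩
    obtain ⟨h3, h4⟩ := hc m hm A' h1
    refine ⟨h3, fun z => ?_⟩
    rcases h4 z with h5 | ⟨h5, h6⟩
    · exact Or.inl ⟨m, le_rfl, hm, h5⟩
    · rw [h5]
      rcases h2 z with ⟨i, h7, h8, h9⟩ | ⟨h7, h8⟩
      · exact Or.inl ⟨i, by omega, h8, h9⟩
      · refine Or.inr ⟨h7, fun y i hi hin => ?_⟩
        rcases hi.eq_or_lt with rfl | hlt
        · exact h6 y
        · exact h8 y i hlt hin

/-- The value at an index that is written, provided that only one value is written there. -/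
theorem eval_eq {A : Arrays} (h : c.Writes n v a A W) {z y : ℤ} (hz : (z, y) ∈ W)
    (huniq : ∀ y', (z, y') ∈ W → y' = y) : c.eval n v A a z = y := by
  rcases (h A fun _ _ => rfl).2 z with h1 | ⟨-, h1⟩
  · exact huniq _ h1
  · exact absurd hz (h1 y)

theorem eval_of_notMem {A : Arrays} (h : c.Writes n v a A W) {z : ℤ} (hz : ∀ y, (z, y) ∉ W) :
    c.eval n v A a z = A a z := by
  rcases (h A fun _ _ => rfl).2 z with h1 | ⟨h1, -⟩
  · exact absurd h1 (hz _)
  · exact h1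

theorem eval_off {A : Arrays} (h : c.Writes n v a A W) {a' : ℕ} (ha : a' ≠ a) :
    c.eval n v A a' = A a' := (h A fun _ _ => rfl).1 a' ha

end Cmd.Writes

/-- Perform the commands `c i` one after the other. -/
def Cmd.seqList : List Cmd → Cmd := List.foldr Cmd.seq Cmd.skip

theorem Cmd.Writes.seqFin {n ℓ : ℕ} {v : ℕ → ℤ} {a : ℕ} {A₀ : Arrays} {c : Fin ℓ → Cmd}
    {W : Fin ℓ → Set (ℤ × ℤ)} (h : ∀ i, (c i).Writes n v a A₀ (W i)) :
    (Cmd.seqList ((List.finRange ℓ).map c)).Writes n v a A₀ {p | ∃ i, p ∈ W i} := by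
  have key : ∀ l : List (Fin ℓ), (Cmd.seqList (l.map c)).Writes n v a A₀ {p | ∃ i ∈ l, p ∈ W i} := by
    intro l
    induction l with
    | nil =>
      have e : {p : ℤ × ℤ | ∃ i ∈ ([] : List (Fin ℓ)), p ∈ W i} = ∅ := by
        ext; simp
      rw [e]
      exact Cmd.Writes.skip
    | cons j l ih =>
      have e : {p | ∃ i ∈ j :: l, p ∈ W i} = W j ∪ {p | ∃ i ∈ l, p ∈ W i} := by
        ext; simp
      rw [e]
      exact (h j).seq ih
  simpa using key (List.finRange ℓ)

/-- For every `u`, add to the entry `u` of the array `a` the value of `e`, as often as there are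
values `w` for which `φ` holds. The values of the variables `0` and `1` are `u` and `w`. -/
def Cmd.accumulate (a : ℕ) (φ : Fm) (e : Ex) : Cmd :=
  .forEach 0 (.forEach 1 (.ite φ (.assign a (.var 0) (.add (.load a (.var 0)) e)) .skip))

/-- The values of the variables `0` and `1` are set to `u` and `w`. -/
def env2 (v : ℕ → ℤ) (u w : ℕ) : ℕ → ℤ := Function.update (Function.update v 0 u) 1 w

open Classical in
theorem Cmd.accumulate_eval {n a : ℕ} {φ : Fm} {e : Ex} (hφ : φ.Avoids a) (he : e.Avoids a)
    {v : ℕ → ℤ} {A : Arrays} (val : ℕ → ℤ)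
    (hval : ∀ u w : ℕ, u < n → w < n → e.eval A (env2 v u w) = val u) :
    AgreeOff a ((Cmd.accumulate a φ e).eval n v A) A ∧
    ∀ u : ℕ, u < n → (Cmd.accumulate a φ e).eval n v A a u =
      A a u + Nat.count (fun w => φ.Sat n A (env2 v u w)) n * val u := by
  have inner : ∀ u : ℕ, u < n → ∀ A' : Arrays, AgreeOff a A' A →
      ((Cmd.forEach 1 (.ite φ (.assign a (.var 0) (.add (.load a (.var 0)) e)) .skip)).eval n
        (Function.update v 0 u) A') =
      A'.set a u (A' a u + Nat.count (fun w => φ.Sat n A (env2 v u w)) n * val u) := by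
    intro u hu A' hA'
    change iterDown _ n A' = _
    have key : ∀ m ≤ n, ∀ A' : Arrays, AgreeOff a A' A →
        iterDown (fun i A => Cmd.eval n (.ite φ (.assign a (.var 0) (.add (.load a (.var 0)) e))
          .skip) (Function.update (Function.update v 0 u) 1 i) A) m A' =
        A'.set a u (A' a u + Nat.count (fun w => φ.Sat n A (env2 v u w)) m * val u) := by
      intro m
      induction m with
      | zero =>
        intro _ A' _
        simp [iterDown, Arrays.set]
      | succ m ih =>
        intro hm A' hA'
        change iterDown _ m (Cmd.eval n (.ite φ _ .skip) (env2 v u m) A') = _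
        by_cases h : φ.Sat n A (env2 v u m)
        · have ev : Cmd.eval n (.ite φ (.assign a (.var 0) (.add (.load a (.var 0)) e)) .skip)
              (env2 v u m) A' = A'.set a u (A' a u + val u) := by
            refine (if_pos ((Fm.Avoids.sat_iff hA' hφ).2 h)).trans ?_
            have h0 : env2 v u m 0 = u := by simp [env2]
            change A'.set a (env2 v u m 0) (A' a (env2 v u m 0) + e.eval A' (env2 v u m)) = _
            rw [h0, he.eval_eq hA', hval u m hu (by omega)]
          rw [ev, ih (by omega) _ ((A'.set_agreeOff _ _ _).trans hA'), Arrays.set_self,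
            Nat.count_succ, if_pos h]
          simp only [Arrays.set, Function.update_self, Function.update_idem]
          push_cast
          congr 2
          ring
        · have ev : Cmd.eval n (.ite φ (.assign a (.var 0) (.add (.load a (.var 0)) e)) .skip)
              (env2 v u m) A' = A' :=
            if_neg fun h' => h ((Fm.Avoids.sat_iff hA' hφ).1 h')
          rw [ev, ih (by omega) _ hA', Nat.count_succ, if_neg h, add_zero]
    exact key n le_rfl A' hA'
  have := iterDown_induction (f := fun i A => Cmd.eval n (.forEach 1
      (.ite φ (.assign a (.var 0) (.add (.load a (.var 0)) e)) .skip)) (Function.update v 0 i) A)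
    (fun m A' => AgreeOff a A' A ∧ ∀ u : ℕ, u < n → A' a u = if m ≤ u then
      A a u + Nat.count (fun w => φ.Sat n A (env2 v u w)) n * val u else A a u) (m := n) (a := A)
    ⟨fun _ _ => rfl, fun u hu => (if_neg (by omega)).symm⟩ ?_
  · exact ⟨this.1, fun u hu => (this.2 u hu).trans (if_pos (Nat.zero_le u))⟩
  · rintro m A' hm ⟨h1, h2⟩
    rw [inner m hm A' h1]
    refine ⟨(A'.set_agreeOff _ _ _).trans h1, fun u hu => ?_⟩
    by_cases hum : u = m
    · subst hum
      rw [Arrays.set_self, if_pos le_rfl, h2 u hu, if_neg (by omega)]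
    · rw [Arrays.set_of_ne (by exact_mod_cast hum), h2 u hu]
      have : m + 1 ≤ u ↔ m ≤ u := by omega
      simp only [this]

/-- The function `f` preserves `I`; it lowers the potential `μ`, unless the property `D` (nothing
is to be done) holds, when it does not change anything. -/
def Progress (I : Arrays → Prop) (μ : Arrays → ℕ) (D : Arrays → Prop) (f : Arrays → Arrays) :
    Prop :=
  ∀ A, I A → I (f A) ∧ ((¬ D A ∧ μ (f A) < μ A) ∨ (D A ∧ f A = A))

namespace Progress

variable {I : Arrays → Prop} {μ : Arrays → ℕ} {D D' : Arrays → Prop} {f f' : Arrays → Arrays}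

theorem id : Progress I μ (fun _ => True) (fun A => A) :=
  fun _ h => ⟨h, Or.inr ⟨trivial, rfl⟩⟩

/-- Progress of a composition: if the first function changes anything, then the second one cannot
raise the potential again. -/
theorem comp (h : Progress I μ D f) (h' : Progress I μ D' f') :
    Progress I μ (fun A => D A ∧ D' A) (fun A => f' (f A)) := by
  intro A hA
  obtain ⟨h1, ⟨h2, h3⟩ | ⟨h2, h3⟩⟩ := h A hA
  · obtain ⟨h4, h5⟩ := h' _ h1
    refine ⟨h4, Or.inl ⟨fun hd => h2 hd.1, ?_⟩⟩
    change μ (f' (f A)) < μ A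
    rcases h5 with ⟨-, h5⟩ | ⟨-, h5⟩
    · exact h5.trans h3
    · rw [h5]; exact h3
  · dsimp only
    rw [h3]
    obtain ⟨h4, ⟨h5, h6⟩ | ⟨h5, h6⟩⟩ := h' A hA
    · exact ⟨h4, Or.inl ⟨fun hd => h5 hd.2, h6⟩⟩
    · exact ⟨h4, Or.inr ⟨⟨h2, h5⟩, h6⟩⟩

theorem congr (h : Progress I μ D f) (hD : ∀ A, D A ↔ D' A) : Progress I μ D' f := by
  intro A hA
  rw [← hD]
  exact h A hA

theorem iterDown {D : ℕ → Arrays → Prop} {f : ℕ → Arrays → Arrays} {n : ℕ}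
    (h : ∀ i < n, Progress I μ (D i) (f i)) :
    Progress I μ (fun A => ∀ i < n, D i A) (iterDown f n) := by
  induction n with
  | zero => exact id.congr fun A => by simp
  | succ n ih =>
    refine ((h n (Nat.lt_succ_self n)).comp (ih fun i hi => h i (by omega))).congr fun A => ?_
    constructor
    · rintro ⟨h1, h2⟩ i hi
      rcases Nat.lt_succ_iff_lt_or_eq.1 hi with h3 | rfl
      · exact h2 i h3
      · exact h1
    · exact fun h => ⟨h n (Nat.lt_succ_self n), fun i hi => h i (by omega)⟩

/-- After `μ A` rounds, nothing is left to be done. -/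
theorem iterate {f : ℕ → Arrays → Arrays} (h : ∀ i, Progress I μ D (f i)) :
    ∀ (m : ℕ) {A : Arrays}, I A → μ A ≤ m →
      I (ProtrusionKernel.iterDown f m A) ∧ D (ProtrusionKernel.iterDown f m A) := by
  intro m
  induction m with
  | zero =>
    intro A hA hμ
    refine ⟨hA, ?_⟩
    rcases (h 0 A hA).2 with ⟨-, h1⟩ | ⟨h1, -⟩
    · omega
    · exact h1
  | succ m ih =>
    intro A hA hμ
    obtain ⟨h1, h2⟩ := h m A hA
    rcases h2 with ⟨-, h2⟩ | ⟨h2, h3⟩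
    · exact ih h1 (by omega)
    · have fixed : ∀ m, ProtrusionKernel.iterDown f m A = A := by
        intro m
        induction m with
        | zero => rfl
        | succ m ih' =>
          change ProtrusionKernel.iterDown f m (f m A) = A
          rcases (h m A hA).2 with ⟨h4, -⟩ | ⟨-, h4⟩
          · exact absurd h2 h4
          · rw [h4, ih']
      rw [fixed]
      exact ⟨hA, h2⟩

theorem seqList {n : ℕ} {v : ℕ → ℤ} {α : Type} (c : α → Cmd) {D : α → Arrays → Prop} (l : List α)
    (h : ∀ r ∈ l, Progress I μ (D r) ((c r).eval n v)) :
    Progress I μ (fun A => ∀ r ∈ l, D r A) ((Cmd.seqList (l.map c)).eval n v) := by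
  induction l with
  | nil => exact id.congr fun A => by simp
  | cons r l ih =>
    refine ((h r (by simp)).comp (ih fun r hr => h r (by simp [hr]))).congr fun A => ?_
    simp

end Progress

/-- Loops over all the values of the variables `0, …, ℓ - 1`. -/
def Cmd.loops : ℕ → Cmd → Cmd
  | 0, c => c
  | ℓ + 1, c => Cmd.loops ℓ (.forEach ℓ c)

/-- Running a command for all the values `x` of the variables makes progress, unless nothing is to
be done for any `x`. -/
theorem Progress.loops {I : Arrays → Prop} {μ : Arrays → ℕ} {n : ℕ} : ∀ {ℓ : ℕ} {c : Cmd}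
    {D : (Fin ℓ → Fin n) → Arrays → Prop},
    (∀ (x : Fin ℓ → Fin n) (v : ℕ → ℤ), (∀ i : Fin ℓ, v i = ((x i : ℕ) : ℤ)) →
      Progress I μ (D x) (c.eval n v)) →
    ∀ v, Progress I μ (fun A => ∀ x, D x A) ((Cmd.loops ℓ c).eval n v) := by
  intro ℓ
  induction ℓ with
  | zero =>
    intro c D h v
    refine (h Fin.elim0 v fun i => i.elim0).congr fun A => ?_
    constructor
    · intro h x
      rwa [Subsingleton.elim x Fin.elim0]
    · exact fun h => h _
  | succ ℓ ih =>
    intro c D h v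
    refine (ih (c := .forEach ℓ c) (D := fun x A => ∀ i (hi : i < n),
      D (Fin.snoc (α := fun _ => Fin n) x ⟨i, hi⟩) A) ?_ v).congr fun A => ?_
    · intro x v hv
      refine (Progress.iterDown (D := fun i A => ∀ hi : i < n,
        D (Fin.snoc (α := fun _ => Fin n) x ⟨i, hi⟩) A) ?_).congr fun A => ?_
      · intro i hi
        refine (h (Fin.snoc (α := fun _ => Fin n) x ⟨i, hi⟩) _ ?_).congr fun A =>
          ⟨fun h _ => h, fun h => h hi⟩
        intro j
        refine Fin.lastCases ?_ (fun j => ?_) j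
        · rw [Fin.snoc_last]
          exact Function.update_self _ _ _
        · rw [Fin.snoc_castSucc, ← hv]
          exact Function.update_of_ne (by have := j.2; simp; omega) _ _
      · exact ⟨fun h i hi => h i hi hi, fun h i _ hi => h i hi⟩
    · constructor
      · intro h x
        have := h (Fin.init x) (x (Fin.last ℓ)) (x (Fin.last ℓ)).2
        rwa [Fin.eta, Fin.snoc_init_self] at this
      · exact fun h x i hi => h _

/-! ### Applying the rules by a program -/

/-- The vertex `i` has not been deleted. -/
def Fm.alive (i : ℕ) : Fm := .not (.pos (.load 5 (.var i)))

/-- The vertices `i` and `j` are adjacent in the current graph. -/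
def Fm.edge (i j : ℕ) : Fm :=
  .and (.pos (.load 6 (.add (.load 2 (.var i)) (.var j)))) (.and (.alive i) (.alive j))

/-- The arrays represent the configuration `S` and the partition `part`: the array `2` contains the
indices at which the rows of the adjacency matrix start, the matrix itself is in the array `6`
(where the entries for deleted vertices are irrelevant), and the arrays `4` and `5` contain the
partition and the marks of the deleted vertices. -/
structure Represents {n : ℕ} (A : Arrays) (S : Config (Fin n)) (part : Fin n → ℕ) : Prop where
  base : ∀ u : Fin n, A 2 ((u : ℕ) : ℤ) = (u : ℕ) * n
  alive : ∀ u : Fin n, u ∈ S.alive ↔ ¬ 0 < A 5 ((u : ℕ) : ℤ)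
  adj : ∀ u w : Fin n, S.graph.Adj u w ↔
    0 < A 6 ((u : ℕ) * n + (w : ℕ)) ∧ u ∈ S.alive ∧ w ∈ S.alive
  part : ∀ u : Fin n, A 4 ((u : ℕ) : ℤ) = part u

/-- Different entries of an `n × n` matrix have different indices. -/
theorem mul_add_inj {n : ℕ} {u w u' w' : Fin n}
    (h : ((u : ℕ) : ℤ) * n + (w : ℕ) = (u' : ℕ) * n + (w' : ℕ)) : u = u' ∧ w = w' := by
  have h' : (u : ℕ) * n + w = u' * n + w' := by exact_mod_cast h
  have hn : 0 < n := u.pos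
  have h1 : (u : ℕ) = u' := by
    have := congrArg (· / n) h'
    simpa [Nat.add_div_of_dvd_right, Nat.mul_comm _ n, Nat.mul_add_div hn, Nat.div_eq_of_lt w.2,
      Nat.div_eq_of_lt w'.2] using this
  have h2 : (w : ℕ) = w' := by rw [h1] at h'; omega
  exact ⟨Fin.ext h1, Fin.ext h2⟩

section Represents

variable {n : ℕ} {A : Arrays} {S : Config (Fin n)} {part : Fin n → ℕ} {v : ℕ → ℤ} {i j : ℕ}
  {u w : Fin n}

theorem Represents.sat_alive (h : Represents A S part) (hi : v i = ((u : ℕ) : ℤ)) :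
    (Fm.alive i).Sat n A v ↔ u ∈ S.alive := by
  rw [h.alive, ← hi]
  exact Iff.rfl

theorem Represents.sat_edge (h : Represents A S part) (hi : v i = ((u : ℕ) : ℤ))
    (hj : v j = ((w : ℕ) : ℤ)) : (Fm.edge i j).Sat n A v ↔ S.graph.Adj u w := by
  rw [h.adj, ← h.sat_alive hi, ← h.sat_alive hj, ← h.base, ← hi, ← hj]
  exact Iff.rfl

end Represents

namespace Rule

/-- The part of the partition to which the vertex `i` belongs. -/
def partOf (i : ℕ) : Ex := .load 4 (.var i)

/-- The formula that says that the rule applies to the tuple of the first `ℓ` variables. -/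
noncomputable def cond (r : Rule) : Fm :=
  .and (.conjFin (fun _ => True) fun i : Fin r.ℓ => .conjFin (fun j : Fin r.ℓ => i ≠ j)
    fun j : Fin r.ℓ => .not (.eq (.var i) (.var j))) <|
  .and (.conjFin (fun _ => True) fun i : Fin r.ℓ => .alive i) <|
  .and (.conjFin (fun _ => True) fun i : Fin r.ℓ => .conjFin (fun j : Fin r.ℓ => r.M.Adj i j)
    fun j : Fin r.ℓ => .edge i j) <|
  .and (.conjFin (fun _ => True) fun i : Fin r.ℓ => .conjFin (fun j : Fin r.ℓ => ¬ r.M.Adj i j)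
    fun j : Fin r.ℓ => .not (.edge i j)) <|
  .and (.conjFin (fun i : Fin r.ℓ => r.s ≤ i) fun i : Fin r.ℓ => .all r.ℓ <| .imp (.edge i r.ℓ) <|
    .disjFin fun j : Fin r.ℓ => .eq (.var r.ℓ) (.var j)) <|
  .and (.conjFin (fun i : Fin r.ℓ => r.s ≤ i) fun i : Fin r.ℓ =>
    .not (.eq (partOf i) (.num 0))) <|
  .and (.conjFin (fun i : Fin r.ℓ => r.s ≤ i) fun i : Fin r.ℓ =>
    .conjFin (fun j : Fin r.ℓ => r.s ≤ j) fun j : Fin r.ℓ => .eq (partOf i) (partOf j)) <|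
  .and (.conjFin (fun i : Fin r.ℓ => r.whole = true ∧ (i : ℕ) < r.s) fun i : Fin r.ℓ =>
    .eq (partOf i) (.num 0)) <|
  .conjFin (fun i : Fin r.ℓ => r.whole = true ∧ r.s ≤ i) fun i : Fin r.ℓ => .all r.ℓ <|
    .imp (.and (.alive r.ℓ) (.eq (partOf r.ℓ) (partOf i))) <|
    .disjFin fun j : Fin r.ℓ => .eq (.var r.ℓ) (.var j)

open Classical in
/-- The program that applies the rule to the tuple of the first `ℓ` variables. The sum of the
numbers `δ` is kept in the array `8`. -/
noncomputable def rewrite (r : Rule) : Cmd :=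
  .seq (Cmd.seqList ((List.finRange r.ℓ).map fun i : Fin r.ℓ =>
    Cmd.seqList ((List.finRange r.ℓ).map fun j : Fin r.ℓ =>
    .assign 6 (.add (.load 2 (.var i)) (.var j)) (.num (if r.NewAdj i j then 1 else 0))))) <|
  .seq (Cmd.seqList ((List.finRange r.ℓ).map fun i : Fin r.ℓ =>
    if r.ℓ' ≤ i then .assign 5 (.var i) (.num 1) else .skip)) <|
  .assign 8 (.num 0) (.add (.load 8 (.num 0)) (.num r.δ))

variable {n : ℕ} {r : Rule} {A : Arrays} {S : Config (Fin n)} {part : Fin n → ℕ} {v : ℕ → ℤ}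
  {x : Fin r.ℓ → Fin n}

theorem sat_cond (h : Represents A S part) (hv : ∀ i : Fin r.ℓ, v i = ((x i : ℕ) : ℤ)) :
    r.cond.Sat n A v ↔ r.Applies S part x := by
  have hvu : ∀ (z : Fin n) (i : Fin r.ℓ),
      Function.update v r.ℓ ((z : ℕ) : ℤ) i = ((x i : ℕ) : ℤ) := fun z i => by
    rw [Function.update_of_ne (by have := i.2; omega), hv]
  have hvl : ∀ z : Fin n, Function.update v r.ℓ ((z : ℕ) : ℤ) r.ℓ = ((z : ℕ) : ℤ) := fun z =>
    Function.update_self _ _ _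
  have heq : ∀ (z : Fin n) (j : Fin r.ℓ), (Fm.eq (.var r.ℓ) (.var j)).Sat n A
      (Function.update v r.ℓ ((z : ℕ) : ℤ)) ↔ z = x j := by
    intro z j
    rw [Fm.sat_eq]
    change Function.update v r.ℓ ((z : ℕ) : ℤ) r.ℓ = Function.update v r.ℓ ((z : ℕ) : ℤ) j ↔ _
    rw [hvl, hvu]
    exact ⟨fun h => Fin.ext (by exact_mod_cast h), fun h => by rw [h]⟩
  have hne : ∀ i j : Fin r.ℓ, (Fm.eq (.var i) (.var j)).Sat n A v ↔ x i = x j := by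
    intro i j
    rw [Fm.sat_eq]
    change v i = v j ↔ _
    rw [hv, hv]
    exact ⟨fun h => Fin.ext (by exact_mod_cast h), fun h => by rw [h]⟩
  have hp : ∀ i : Fin r.ℓ, (partOf i).eval A v = part (x i) := fun i => by
    change A 4 (v i) = _
    rw [hv, h.part]
  have hpu : ∀ (z : Fin n) (i : Fin r.ℓ), (partOf i).eval A (Function.update v r.ℓ ((z : ℕ) : ℤ)) =
      part (x i) := fun z i => by
    change A 4 (Function.update v r.ℓ ((z : ℕ) : ℤ) i) = _
    rw [hvu, h.part]
  have hpl : ∀ z : Fin n, (partOf r.ℓ).eval A (Function.update v r.ℓ ((z : ℕ) : ℤ)) =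
      part z := fun z => by
    change A 4 (Function.update v r.ℓ ((z : ℕ) : ℤ) r.ℓ) = _
    rw [hvl, h.part]
  have hnum : ∀ (v : ℕ → ℤ), (Ex.num 0).eval A v = ((0 : ℕ) : ℤ) := fun _ => rfl
  simp only [cond, Fm.sat_and, Fm.sat_conjFin, Fm.sat_not, hne, h.sat_alive (hv _),
    h.sat_edge (hv _) (hv _), Fm.sat_all, Fm.sat_imp, h.sat_edge (hvu _ _) (hvl _), Fm.sat_disjFin,
    heq, Fm.sat_eq (e := partOf _), hp, hnum, hpu, hpl, h.sat_alive (hvl _), Nat.cast_inj,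
    true_implies]
  constructor
  · rintro ⟨h1, h2, h3, h4, h5, h6, h7, h8, h9⟩
    exact ⟨fun i j hij => by_contra fun hne => h1 i j hne hij, h2,
      fun i j => ⟨fun hij => by_contra fun hn => h4 i j hn hij, h3 i j⟩, h5, h6,
      fun i j hi hj => h7 i hi j hj, fun hw => ⟨fun i hi => h8 i ⟨hw, hi⟩,
        fun i hi z hz hzp => h9 i ⟨hw, hi⟩ z ⟨hz, hzp⟩⟩⟩
  · intro h
    exact ⟨fun i j hij he => hij (h.inj he), h.mem, fun i j hij => (h.adj i j).2 hij,
      fun i j hij he => hij ((h.adj i j).1 he), h.closed, h.part_ne,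
      fun i hi j hj => h.part_eq i j hi hj, fun i hi => (h.whole hi.1).1 i hi.2,
      fun i hi z hz => (h.whole hi.1).2 i hi.2 z hz.1 hz.2⟩

/-- The program `rewrite` carries out the application of the rule. -/
theorem rewrite_eval (h : Represents A S part) (hv : ∀ i : Fin r.ℓ, v i = ((x i : ℕ) : ℤ))
    (hx : r.Applies S part x) : Represents (r.rewrite.eval n v A) (r.apply S x) part ∧
      r.rewrite.eval n v A 8 0 = A 8 0 + r.δ ∧ ∀ a, 8 < a → r.rewrite.eval n v A a = A a := by
  classical
  have w1 : ∀ A₀ : Arrays, (Cmd.seqList ((List.finRange r.ℓ).map fun i : Fin r.ℓ => Cmd.seqList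
      ((List.finRange r.ℓ).map fun j : Fin r.ℓ => Cmd.assign 6 (.add (.load 2 (.var i)) (.var j))
        (.num (if r.NewAdj i j then 1 else 0))))).Writes n v 6 A₀
      {p | ∃ i j : Fin r.ℓ, p = (A₀ 2 (v i) + v j, if r.NewAdj i j then 1 else 0)} :=
    fun A₀ => Cmd.Writes.seqFin fun i => Cmd.Writes.seqFin fun j =>
      Cmd.Writes.assign (by simp [Ex.Avoids]) trivial
  have w2 : ∀ A₀ : Arrays, (Cmd.seqList ((List.finRange r.ℓ).map fun i : Fin r.ℓ =>
      if r.ℓ' ≤ i then Cmd.assign 5 (.var i) (.num 1) else .skip)).Writes n v 5 A₀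
      {p | ∃ i : Fin r.ℓ, p ∈ if r.ℓ' ≤ i then ({(v i, (1 : ℤ))} : Set (ℤ × ℤ)) else ∅} := by
    refine fun A₀ => Cmd.Writes.seqFin fun i => ?_
    split_ifs
    · exact Cmd.Writes.assign trivial trivial
    · exact Cmd.Writes.skip
  obtain ⟨A₁, hA₁⟩ : ∃ A₁, A₁ = (Cmd.seqList ((List.finRange r.ℓ).map fun i : Fin r.ℓ => Cmd.seqList
      ((List.finRange r.ℓ).map fun j : Fin r.ℓ => Cmd.assign 6 (.add (.load 2 (.var i)) (.var j))
        (.num (if r.NewAdj i j then 1 else 0))))).eval n v A := ⟨_, rfl⟩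
  obtain ⟨A₂, hA₂⟩ : ∃ A₂, A₂ = (Cmd.seqList ((List.finRange r.ℓ).map fun i : Fin r.ℓ =>
      if r.ℓ' ≤ i then Cmd.assign 5 (.var i) (.num 1) else .skip)).eval n v A₁ := ⟨_, rfl⟩
  have hev : r.rewrite.eval n v A = A₂.set 8 0 (A₂ 8 0 + r.δ) := by
    rw [hA₂, hA₁]; rfl
  have off1 : ∀ a, a ≠ 6 → A₁ a = A a := fun a ha => by rw [hA₁]; exact (w1 A).eval_off ha
  have off2 : ∀ a, a ≠ 5 → A₂ a = A₁ a := fun a ha => by rw [hA₂]; exact (w2 A₁).eval_off ha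
  have off3 : ∀ a, a ≠ 8 → A₂.set 8 0 (A₂ 8 0 + r.δ) a = A₂ a := fun a ha =>
    A₂.set_agreeOff _ _ _ a ha
  have hdead : ∀ u : Fin n, (¬ 0 < A₂ 5 ((u : ℕ) : ℤ)) ↔ u ∈ (r.apply S x).alive := by
    intro u
    by_cases hu : ∃ i : Fin r.ℓ, r.ℓ' ≤ i ∧ u = x i
    · obtain ⟨i, hi, rfl⟩ := hu
      have : A₂ 5 ((x i : ℕ) : ℤ) = 1 := by
        rw [hA₂]
        refine (w2 A₁).eval_eq ⟨i, ?_⟩ ?_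
        · rw [if_pos hi, hv]; rfl
        · rintro y ⟨j, hj⟩
          split_ifs at hj
          · exact congrArg Prod.snd hj
          · exact hj.elim
      rw [this]
      simp only [one_pos, not_true, false_iff]
      exact fun h => h.2 i hi rfl
    · have : A₂ 5 ((u : ℕ) : ℤ) = A 5 ((u : ℕ) : ℤ) := by
        rw [hA₂, (w2 A₁).eval_of_notMem, off1 5 (by decide)]
        rintro y ⟨i, hi⟩
        split_ifs at hi with hle
        · refine hu ⟨i, hle, Fin.ext ?_⟩
          have := congrArg Prod.fst hi
          dsimp only at this
          rw [hv] at this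
          exact_mod_cast this
        · exact hi
      rw [this, ← h.alive]
      exact ⟨fun h => ⟨h, fun i hi he => hu ⟨i, hi, he⟩⟩, fun h => h.1⟩
  have hmem1 : ∀ (u w : Fin n) (y : ℤ), ((((u : ℕ) : ℤ) * n + (w : ℕ), y) ∈
      {p : ℤ × ℤ | ∃ i j : Fin r.ℓ, p = (A 2 (v i) + v j, if r.NewAdj i j then 1 else 0)}) ↔
      ∃ i j, u = x i ∧ w = x j ∧ y = if r.NewAdj i j then 1 else 0 := by
    intro u w y
    constructor
    · rintro ⟨i, j, hij⟩
      have h1 := congrArg Prod.fst hij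
      dsimp only at h1
      rw [hv, hv, h.base] at h1
      obtain ⟨h2, h3⟩ := mul_add_inj h1
      exact ⟨i, j, h2, h3, congrArg Prod.snd hij⟩
    · rintro ⟨i, j, rfl, rfl, rfl⟩
      exact ⟨i, j, by rw [hv, hv, h.base]⟩
  refine ⟨?_, ?_, ?_⟩
  · rw [hev]
    refine ⟨fun u => ?_, fun u => ?_, fun u w => ?_, fun u => ?_⟩
    · rw [off3 2 (by decide), off2 2 (by decide), off1 2 (by decide), h.base]
    · rw [off3 5 (by decide), hdead]
    · rw [off3 6 (by decide), off2 6 (by decide)]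
      by_cases huw : (∃ i, u = x i) ∧ ∃ j, w = x j
      · obtain ⟨⟨i, rfl⟩, j, rfl⟩ := huw
        have hval : A₁ 6 (((x i : ℕ) : ℤ) * n + (x j : ℕ)) = if r.NewAdj i j then 1 else 0 := by
          rw [hA₁]
          refine (w1 A).eval_eq ((hmem1 _ _ _).2 ⟨i, j, rfl, rfl, rfl⟩) fun y hy => ?_
          obtain ⟨i', j', hi, hj, rfl⟩ := (hmem1 _ _ _).1 hy
          rw [hx.inj hi, hx.inj hj]
        rw [hval]
        constructor
        · rintro ⟨⟨i', j', hi, hj, hij⟩ | ⟨-, hn⟩, -, hu, hw⟩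
          · rw [← hx.inj hi, ← hx.inj hj] at hij
            rw [if_pos hij]
            exact ⟨one_pos, hu, hw⟩
          · exact absurd ⟨⟨i, rfl⟩, j, rfl⟩ hn
        · rintro ⟨hpos, hu, hw⟩
          have hij : r.NewAdj i j := by
            by_contra hn
            rw [if_neg hn] at hpos
            exact lt_irrefl _ hpos
          refine ⟨Or.inl ⟨i, j, rfl, rfl, hij⟩, fun he => ?_, hu, hw⟩
          obtain rfl := hx.inj he
          rcases hij with ⟨a, b, ha, hb, hab⟩ | ⟨-, -, hab⟩
          · exact hab.ne (Fin.ext (ha.trans hb.symm))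
          · exact hab.ne rfl
      · have hval : A₁ 6 (((u : ℕ) : ℤ) * n + (w : ℕ)) = A 6 (((u : ℕ) : ℤ) * n + (w : ℕ)) := by
          rw [hA₁]
          refine (w1 A).eval_of_notMem fun y hy => huw ?_
          obtain ⟨i', j', hi, hj, -⟩ := (hmem1 _ _ _).1 hy
          exact ⟨⟨i', hi⟩, j', hj⟩
        rw [hval]
        constructor
        · rintro ⟨⟨i', j', hi, hj, -⟩ | ⟨hadj, -⟩, -, hu, hw⟩
          · exact absurd ⟨⟨i', hi⟩, j', hj⟩ huw
          · exact ⟨((h.adj u w).1 hadj).1, hu, hw⟩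
        · rintro ⟨hpos, hu, hw⟩
          have hadj := (h.adj u w).2 ⟨hpos, hu.1, hw.1⟩
          exact ⟨Or.inr ⟨hadj, huw⟩, hadj.ne, hu, hw⟩
    · rw [off3 4 (by decide), off2 4 (by decide), off1 4 (by decide), h.part]
  · rw [hev, Arrays.set_self, off2 8 (by decide), off1 8 (by decide)]
  · intro a ha
    rw [hev, off3 a (by omega), off2 a (by omega), off1 a (by omega)]

/-- Apply the rule wherever it is possible. -/
noncomputable def cmd (r : Rule) : Cmd := Cmd.loops r.ℓ (.ite r.cond r.rewrite .skip)

end Rule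

/-- The number of vertices that have not been deleted. -/
noncomputable def aliveCount (n : ℕ) (A : Arrays) : ℕ :=
  {u : Fin n | ¬ 0 < A 5 ((u : ℕ) : ℤ)}.ncard

section

variable {o : Objective} {E : Encoder} {g : ℕ → ℕ} {t : ℕ} {𝒢 : Set FinGraph} {n : ℕ}

/-- The state of the algorithm is an instance that is equivalent to the instance `(G, k)`, and whose
parts have bounded treewidth. The arrays from `9` on are not in use yet. -/
def Reached {𝒢 : Set FinGraph} (Q : ParamProblem 𝒢) (t : ℕ) (G : FinGraph) (part : Fin n → ℕ)
    (A : Arrays) : Prop :=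
  ∃ S, Represents A S part ∧ S.toFinGraph ∈ 𝒢 ∧ Parted t S part ∧ 0 ≤ A 8 0 ∧
    (∀ a, 8 < a → A a = 0) ∧ ∀ k, Q.yes G k ↔ Q.yes S.toFinGraph (k - A 8 0)

/-- The program of a rule deletes a vertex, unless the rule does not apply anywhere. -/
theorem Rule.progress (hDP : DPFriendly o E g t 𝒢) (h𝒢 : Hereditary 𝒢)
    {Q : ParamProblem 𝒢} {LQ : VertexLanguage} (hQ : IsCertifying o LQ Q)
    (hE : E.IsEncoderFor 𝒢 LQ) {r : Rule} (hr : r.Valid o E g t 𝒢) (G : FinGraph)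
    (part : Fin n → ℕ) (v : ℕ → ℤ) :
    Progress (Reached Q t G part) (aliveCount n)
      (fun A => ∀ x : Fin r.ℓ → Fin n, ∀ S, Represents A S part → ¬ r.Applies S part x)
      (r.cmd.eval n v) := by
  classical
  refine Progress.loops (fun x v hv => ?_) v
  rintro A ⟨S, h1, h2, h3, h4, h0, h5⟩
  by_cases hx : r.Applies S part x
  · have ev : (Cmd.ite r.cond r.rewrite .skip).eval n v A = r.rewrite.eval n v A :=
      if_pos ((Rule.sat_cond h1 hv).2 hx)
    rw [ev]
    obtain ⟨h6, h7, h7'⟩ := Rule.rewrite_eval h1 hv hx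
    obtain ⟨h8, h9⟩ := hx.sound hDP h𝒢 hQ hE hr h2
    refine ⟨⟨_, h6, h8, hx.parted hr h3, by rw [h7]; positivity,
      fun a ha => (h7' a ha).trans (h0 a ha), fun k => ?_⟩,
      Or.inl ⟨fun h => h S h1 hx, ?_⟩⟩
    · rw [h5, h9, h7]
      have : k - A 8 0 - r.δ = k - (A 8 0 + r.δ) := by ring
      rw [this]
    · have e1 : {u : Fin n | ¬ 0 < r.rewrite.eval n v A 5 ((u : ℕ) : ℤ)} = (r.apply S x).alive := by
        ext u; exact (h6.alive u).symm
      have e2 : {u : Fin n | ¬ 0 < A 5 ((u : ℕ) : ℤ)} = S.alive := by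
        ext u; exact (h1.alive u).symm
      unfold aliveCount
      rw [e1, e2]
      exact Set.ncard_lt_ncard (hx.alive_ssubset hr.lt)
  · have ev : (Cmd.ite r.cond r.rewrite .skip).eval n v A = A :=
      if_neg fun h => hx ((Rule.sat_cond h1 hv).1 h)
    rw [ev]
    refine ⟨⟨S, h1, h2, h3, h4, h0, h5⟩, Or.inr ⟨fun S' h' hx' => hx ?_, rfl⟩⟩
    exact (Rule.sat_cond h1 hv).1 ((Rule.sat_cond h' hv).2 hx')

/-- A finite list of valid rules that contains one for every left-hand side of bounded size for
which there is a valid rule. -/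
theorem exists_rule_list (o : Objective) (E : Encoder) (g : ℕ → ℕ) (t : ℕ) (𝒢 : Set FinGraph)
    (b : ℕ) : ∃ L : List Rule, (∀ r ∈ L, r.Valid o E g t 𝒢) ∧
      ∀ r : Rule, r.Valid o E g t 𝒢 → r.ℓ ≤ b → ∀ (n : ℕ) (S : Config (Fin n)) (part : Fin n → ℕ)
        (x : Fin r.ℓ → Fin n), r.Applies S part x → ∃ r' ∈ L, ∃ x', r'.Applies S part x' := by
  classical
  -- what a rule is applicable to depends only on these data, for which there are finitely many
  -- possibilities if `ℓ` is bounded; the rule itself ranges over an infinite set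
  let key : Rule → (Σ ℓ, SimpleGraph (Fin ℓ)) × ℕ × Bool := fun r => (⟨r.ℓ, r.M⟩, r.s, r.whole)
  let T : Set Rule := {r | r.Valid o E g t 𝒢 ∧ r.ℓ ≤ b}
  have hfin : (key '' T).Finite := by
    let f : (Σ ℓ : Fin (b + 1), SimpleGraph (Fin ℓ)) × Fin (t + 1) × Bool →
        (Σ ℓ, SimpleGraph (Fin ℓ)) × ℕ × Bool := fun p => (⟨p.1.1, p.1.2⟩, p.2.1, p.2.2)
    refine (Set.finite_range f).subset ?_
    rintro _ ⟨r, ⟨hr, hb⟩, rfl⟩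
    exact ⟨(⟨⟨r.ℓ, by omega⟩, r.M⟩, ⟨r.s, by have := hr.s_le_t; omega⟩, r.whole), rfl⟩
  have hsurj : ∀ q : key '' T, ∃ r, r ∈ T ∧ key r = q.1 := by
    rintro ⟨_, r, hr, rfl⟩
    exact ⟨r, hr, rfl⟩
  choose c hc1 hc2 using hsurj
  have := hfin.fintype
  refine ⟨(Finset.univ : Finset (key '' T)).toList.map c, ?_, ?_⟩
  · intro r hr
    obtain ⟨q, -, rfl⟩ := List.mem_map.1 hr
    exact (hc1 q).1
  · intro r hr hb n S part x hx
    let q : key '' T := ⟨key r, r, ⟨hr, hb⟩, rfl⟩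
    refine ⟨c q, List.mem_map.2 ⟨q, by simp, rfl⟩, ?_⟩
    have he : key (c q) = key r := hc2 q
    generalize c q = r' at he
    obtain ⟨ℓ, s, M, w, ℓ', K, δ⟩ := r
    obtain ⟨ℓ₂, s₂, M₂, w₂, ℓ₂', K₂, δ₂⟩ := r'
    simp only [key, Prod.mk.injEq, Sigma.mk.injEq] at he
    obtain ⟨⟨rfl, h1⟩, rfl, rfl⟩ := he
    obtain rfl := eq_of_heq h1
    exact ⟨x, hx.inj, hx.mem, hx.adj, hx.closed, hx.part_ne, hx.part_eq, hx.whole⟩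

end

/-! ### Renumbering the remaining vertices -/

/-- Copy the remaining graph to the array `0`, with the remaining vertices numbered consecutively:
the array `9` contains their new numbers, the entries of the array `10` are the number of remaining
vertices, and the array `11` contains the indices at which the rows of the new adjacency matrix
start. -/
def compaction : Cmd :=
  .seq (Cmd.accumulate 9 (.and (.alive 1) (.pos (.sub (.var 0) (.var 1)))) (.num 1)) <|
  .seq (Cmd.accumulate 10 (.alive 1) (.num 1)) <|
  .seq (Cmd.accumulate 11 (.alive 1) (.load 9 (.var 0))) <|
  .forEach 0 <| .forEach 1 <| .ite (.and (.alive 0) (.alive 1))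
    (.ite (.edge 0 1) (.assign 0 (.add (.load 11 (.var 0)) (.load 9 (.var 1))) (.num 1))
      (.assign 0 (.add (.load 11 (.var 0)) (.load 9 (.var 1))) (.num 0))) .skip

section

variable {n : ℕ} {A A' : Arrays} {S : Config (Fin n)} {part : Fin n → ℕ}

theorem Represents.congr (h : Represents A S part)
    (hA : ∀ a ∈ ({2, 4, 5, 6} : Set ℕ), A' a = A a) : Represents A' S part where
  base u := by rw [hA 2 (by simp), h.base]
  alive u := by rw [hA 5 (by simp), h.alive]
  adj u w := by rw [hA 6 (by simp), h.adj]
  part u := by rw [hA 4 (by simp), h.part]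

/-- The elements of a subset of `Fin n` are numbered by the number of smaller elements. -/
theorem exists_numbering (T : Set (Fin n)) : ∃ e : T ≃ Fin T.ncard,
    ∀ u : T, (e u : ℕ) = {w | w ∈ T ∧ w < u}.ncard := by
  have hlt : ∀ u : T, {w | w ∈ T ∧ w < u}.ncard < T.ncard := fun u =>
    Set.ncard_lt_ncard ⟨fun w hw => hw.1, fun h => lt_irrefl _ (h u.2).2⟩
  have hinj : Function.Injective fun u : T => (⟨_, hlt u⟩ : Fin T.ncard) := by
    have hmono : ∀ u v : T, u < v → {w | w ∈ T ∧ w < u}.ncard < {w | w ∈ T ∧ w < v}.ncard :=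
      fun u v huv => Set.ncard_lt_ncard ⟨fun w hw => ⟨hw.1, hw.2.trans huv⟩,
        fun h => lt_irrefl _ (h ⟨u.2, huv⟩).2⟩
    intro u v huv
    have huv := congrArg Fin.val huv
    dsimp only at huv
    rcases lt_trichotomy u v with h | h | h
    · have := hmono u v h; omega
    · exact h
    · have := hmono v u h; omega
  refine ⟨Equiv.ofBijective _ ((Nat.bijective_iff_injective_and_card _).2 ⟨hinj, ?_⟩),
    fun u => rfl⟩
  rw [Nat.card_coe_set_eq, Nat.card_fin]

open Classical in
theorem count_eq_ncard (T : Set (Fin n)) (P : ℕ → Prop) (h : ∀ u : Fin n, P u ↔ u ∈ T) :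
    Nat.count P n = T.ncard := by
  rw [Nat.count_eq_card_filter_range, ← Set.ncard_image_of_injective T Fin.val_injective,
    ← Set.ncard_coe_finset]
  congr 1
  ext w
  simp only [Finset.coe_filter, Finset.mem_range, Set.mem_image]
  exact ⟨fun hw => ⟨⟨w, hw.1⟩, (h _).1 hw.2, rfl⟩, fun ⟨u, hu, hw⟩ => hw ▸ ⟨u.2, (h u).2 hu⟩⟩

theorem env2_zero {v : ℕ → ℤ} {u w : ℕ} : env2 v u w 0 = u := by simp [env2]

theorem env2_one {v : ℕ → ℤ} {u w : ℕ} : env2 v u w 1 = w := by simp [env2]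

/-- The arrays `9`, `10` and `11` have to be zero at the beginning, since `Cmd.accumulate` adds to
them. -/
theorem compaction_eval (h : Represents A S part) (h0 : ∀ a, 8 < a → A a = 0) (v : ℕ → ℤ) :
    compaction.eval n v A 8 = A 8 ∧ compaction.eval n v A 10 0 = S.alive.ncard ∧
    ∃ e : S.alive ≃ Fin S.alive.ncard, ∀ u w : S.alive,
      (S.graph.Adj u w → compaction.eval n v A 0 ((e u : ℕ) * S.alive.ncard + (e w : ℕ)) = 1) ∧
      (¬ S.graph.Adj u w →
        compaction.eval n v A 0 ((e u : ℕ) * S.alive.ncard + (e w : ℕ)) = 0) := by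
  classical
  obtain ⟨e, he⟩ := exists_numbering S.alive
  obtain ⟨A₁, hA₁⟩ : ∃ A₁, A₁ = (Cmd.accumulate 9
      (.and (.alive 1) (.pos (.sub (.var 0) (.var 1)))) (.num 1)).eval n v A := ⟨_, rfl⟩
  obtain ⟨A₂, hA₂⟩ : ∃ A₂, A₂ = (Cmd.accumulate 10 (.alive 1) (.num 1)).eval n v A₁ := ⟨_, rfl⟩
  obtain ⟨A₃, hA₃⟩ : ∃ A₃, A₃ = (Cmd.accumulate 11 (.alive 1) (.load 9 (.var 0))).eval n v A₂ :=
    ⟨_, rfl⟩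
  obtain ⟨h1, h2⟩ := Cmd.accumulate_eval (n := n) (a := 9)
    (φ := .and (.alive 1) (.pos (.sub (.var 0) (.var 1)))) (e := .num 1)
    (by simp [Fm.Avoids, Ex.Avoids, Fm.alive]) trivial (v := v) (A := A) (fun _ => 1)
    (fun _ _ _ _ => rfl)
  rw [← hA₁] at h1 h2
  have hr1 : Represents A₁ S part := h.congr fun a ha => h1 a (by rintro rfl; simp at ha)
  obtain ⟨h3, h4⟩ := Cmd.accumulate_eval (n := n) (a := 10) (φ := .alive 1) (e := .num 1)
    (by simp [Fm.Avoids, Ex.Avoids, Fm.alive]) trivial (v := v) (A := A₁) (fun _ => 1)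
    (fun _ _ _ _ => rfl)
  rw [← hA₂] at h3 h4
  have hr2 : Represents A₂ S part := hr1.congr fun a ha => h3 a (by rintro rfl; simp at ha)
  obtain ⟨h5, h6⟩ := Cmd.accumulate_eval (n := n) (a := 11) (φ := .alive 1) (e := .load 9 (.var 0))
    (by simp [Fm.Avoids, Ex.Avoids, Fm.alive]) (by simp [Ex.Avoids]) (v := v) (A := A₂)
    (fun u => A₂ 9 u) (fun u w _ _ => by
      change A₂ 9 (env2 v u w 0) = _
      rw [env2_zero])
  rw [← hA₃] at h5 h6
  have hr3 : Represents A₃ S part := hr2.congr fun a ha => h5 a (by rintro rfl; simp at ha)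
  have hn' : ∀ (B : Arrays), Represents B S part → ∀ u,
      Nat.count (fun w => (Fm.alive 1).Sat n B (env2 v u w)) n = S.alive.ncard :=
    fun B hB u => count_eq_ncard _ _ fun w => hB.sat_alive env2_one
  have h9 : ∀ u : S.alive, A₃ 9 ((u : Fin n) : ℕ) = (e u : ℕ) := by
    intro u
    rw [h5 9 (by decide), h3 9 (by decide), h2 _ u.1.2, h0 9 (by decide), he]
    rw [count_eq_ncard {w | w ∈ S.alive ∧ w < u}]
    · simp
    · intro w
      rw [Fm.sat_and, h.sat_alive (u := w) env2_one]
      change _ ∧ 0 < env2 v (u : Fin n) w 0 - env2 v (u : Fin n) w 1 ↔ _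
      rw [env2_zero, env2_one]
      refine and_congr_right fun _ => ?_
      rw [Fin.lt_def]
      omega
  have h11 : ∀ u : S.alive, A₃ 11 ((u : Fin n) : ℕ) = (e u : ℕ) * S.alive.ncard := by
    intro u
    have := h9 u
    rw [h5 9 (by decide)] at this
    rw [h6 _ u.1.2, hn' A₂ hr2, this, h3 11 (by decide), h1 11 (by decide), h0 11 (by decide)]
    simp [mul_comm]
  have h10 : A₃ 10 0 = S.alive.ncard := by
    rw [h5 10 (by decide)]
    rcases Nat.eq_zero_or_pos n with hn | hn
    · subst hn
      have e2 : A₂ = A₁ := by rw [hA₂]; rfl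
      rw [e2, h1 10 (by decide), h0 10 (by decide), Set.eq_empty_of_isEmpty S.alive]
      simp
    · have := h4 0 hn
      rw [hn' A₁ hr1, h1 10 (by decide), h0 10 (by decide)] at this
      simpa using this
  have hev : compaction.eval n v A = (Cmd.forEach 0 <| .forEach 1 <| .ite
      (.and (.alive 0) (.alive 1))
      (.ite (.edge 0 1) (.assign 0 (.add (.load 11 (.var 0)) (.load 9 (.var 1))) (.num 1))
      (.assign 0 (.add (.load 11 (.var 0)) (.load 9 (.var 1))) (.num 0))) .skip).eval n v A₃ := by
    rw [hA₃, hA₂, hA₁]; rfl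
  have hw := Cmd.Writes.forEach (n := n) (v := v) (a := 0) (A₀ := A₃) (k := 0) fun i _ =>
    Cmd.Writes.forEach (n := n) (v := Function.update v 0 i) (a := 0) (A₀ := A₃) (k := 1) fun j _ =>
    Cmd.Writes.ite (v := env2 v i j) (φ := .and (.alive 0) (.alive 1))
      (by simp [Fm.Avoids, Ex.Avoids, Fm.alive])
      (Cmd.Writes.ite (φ := .edge 0 1) (by simp [Fm.Avoids, Ex.Avoids, Fm.alive, Fm.edge])
        (Cmd.Writes.assign (i := .add (.load 11 (.var 0)) (.load 9 (.var 1))) (e := .num 1)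
          (by simp [Ex.Avoids]) trivial)
        (Cmd.Writes.assign (i := .add (.load 11 (.var 0)) (.load 9 (.var 1))) (e := .num 0)
          (by simp [Ex.Avoids]) trivial)) Cmd.Writes.skip
  have hidx : ∀ (i j : Fin n) (hi : i ∈ S.alive) (hj : j ∈ S.alive),
      (Ex.add (.load 11 (.var 0)) (.load 9 (.var 1))).eval A₃ (env2 v i j) =
        (e ⟨i, hi⟩ : ℕ) * S.alive.ncard + (e ⟨j, hj⟩ : ℕ) := by
    intro i j hi hj
    change A₃ 11 (env2 v i j 0) + A₃ 9 (env2 v i j 1) = _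
    rw [env2_zero, env2_one, h11 ⟨i, hi⟩, h9 ⟨j, hj⟩]
  obtain ⟨W, hW, hmem⟩ : ∃ W, (Cmd.forEach 0 <| .forEach 1 <| .ite (.and (.alive 0) (.alive 1))
      (.ite (.edge 0 1) (.assign 0 (.add (.load 11 (.var 0)) (.load 9 (.var 1))) (.num 1))
      (.assign 0 (.add (.load 11 (.var 0)) (.load 9 (.var 1))) (.num 0))) .skip).Writes n v 0 A₃ W ∧
      ∀ (u w : S.alive) (y : ℤ), (((e u : ℕ) : ℤ) * S.alive.ncard + (e w : ℕ), y) ∈ W ↔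
        (S.graph.Adj u w ∧ y = 1) ∨ (¬ S.graph.Adj u w ∧ y = 0) := by
    refine ⟨_, hw, fun u w y => ⟨?_, fun hy => ⟨_, u.1.2, _, w.1.2, Or.inl ⟨?_, ?_⟩⟩⟩⟩
    · rintro ⟨i, hi, j, hj, ⟨⟨hai, haj⟩, hy⟩ | ⟨-, hy⟩⟩
      · have hai := (hr3.sat_alive (u := ⟨i, hi⟩) env2_zero).1 hai
        have haj := (hr3.sat_alive (u := ⟨j, hj⟩) env2_one).1 haj
        have hx := hidx _ _ hai haj
        have key : (((e u : ℕ) : ℤ) * S.alive.ncard + (e w : ℕ) =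
            (Ex.add (.load 11 (.var 0)) (.load 9 (.var 1))).eval A₃ (env2 v i j)) →
            u = ⟨_, hai⟩ ∧ w = ⟨_, haj⟩ := fun hz => by
          obtain ⟨h7, h8⟩ := mul_add_inj (hz.trans hx)
          exact ⟨e.injective h7, e.injective h8⟩
        rcases hy with ⟨hadj, hy⟩ | ⟨hadj, hy⟩
        · obtain ⟨rfl, rfl⟩ := key (congrArg Prod.fst hy)
          exact Or.inl ⟨(hr3.sat_edge (u := ⟨i, hi⟩) (w := ⟨j, hj⟩) env2_zero env2_one).1 hadj,
            congrArg Prod.snd hy⟩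
        · obtain ⟨rfl, rfl⟩ := key (congrArg Prod.fst hy)
          exact Or.inr ⟨fun h => hadj
            ((hr3.sat_edge (u := ⟨i, hi⟩) (w := ⟨j, hj⟩) env2_zero env2_one).2 h),
            congrArg Prod.snd hy⟩
      · exact hy.elim
    · exact ⟨(hr3.sat_alive env2_zero).2 u.2, (hr3.sat_alive env2_one).2 w.2⟩
    · rcases hy with ⟨hadj, rfl⟩ | ⟨hadj, rfl⟩
      · exact Or.inl ⟨(hr3.sat_edge env2_zero env2_one).2 hadj,
          Prod.ext (hidx _ _ u.2 w.2).symm rfl⟩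
      · exact Or.inr ⟨fun h => hadj ((hr3.sat_edge env2_zero env2_one).1 h),
          Prod.ext (hidx _ _ u.2 w.2).symm rfl⟩
  have hoff : ∀ a, a ≠ 0 → compaction.eval n v A a = A₃ a := fun a ha => by
    rw [hev]; exact hW.eval_off ha
  refine ⟨?_, by rw [hoff 10 (by decide), h10], e, fun u w => ⟨fun hadj => ?_, fun hadj => ?_⟩⟩
  · rw [hoff 8 (by decide), h5 8 (by decide), h3 8 (by decide), h1 8 (by decide)]
  · rw [hev]
    refine hW.eval_eq ((hmem _ _ _).2 (Or.inl ⟨hadj, rfl⟩)) fun y hy => ?_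
    rcases (hmem _ _ _).1 hy with h | h
    · exact h.2
    · exact absurd hadj h.1
  · rw [hev]
    refine hW.eval_eq ((hmem _ _ _).2 (Or.inr ⟨hadj, rfl⟩)) fun y hy => ?_
    rcases (hmem _ _ _).1 hy with h | h
    · exact absurd h.1 hadj
    · exact h.2

end

/-! ### The partition at the beginning -/

section InnerPart

variable {V : Type} {G : SimpleGraph V} {ℓ : ℕ} {Y : V → Fin (ℓ + 1)} {i j : Fin (ℓ + 1)} {v : V}

/-- The set `Y_i ∪ N(Y_i)`, for a partition `Y` with `N(Y_i) ⊆ Y_0`. -/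
def closedPart (G : SimpleGraph V) (Y : V → Fin (ℓ + 1)) (i : Fin (ℓ + 1)) : Set V :=
  {v | Y v = i} ∪ {v | Y v = 0 ∧ ∃ u, Y u = i ∧ G.Adj u v}

/-- The vertices of `Y_i ∪ N(Y_i)` all of whose neighbours belong to this set. -/
def innerPart (G : SimpleGraph V) (Y : V → Fin (ℓ + 1)) (i : Fin (ℓ + 1)) : Set V :=
  closedPart G Y i \ bdry G (closedPart G Y i)

theorem mem_innerPart : v ∈ innerPart G Y i ↔
    v ∈ closedPart G Y i ∧ ∀ u, G.Adj v u → u ∈ closedPart G Y i :=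
  ⟨fun h => ⟨h.1, fun u hu => by_contra fun hn => h.2 ⟨h.1, u, hn, hu⟩⟩,
    fun h => ⟨h.1, fun ⟨_, u, hn, hu⟩ => hn (h.2 u hu)⟩⟩

theorem eq_of_mem_closedPart (hj : j ≠ 0) (hv : v ∈ closedPart G Y i) (h : Y v = j) : i = j := by
  rcases hv with hv | hv
  · exact hv.symm.trans h
  · exact absurd (h.symm.trans hv.1) hj

/-- The sets `innerPart G Y j`, for `j ≠ 0`, are disjoint, and `innerPart G Y j` does not even meet
the other sets `closedPart G Y i`. -/
theorem eq_of_mem_innerPart (hi : i ≠ 0) (hvi : v ∈ closedPart G Y i)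
    (hvj : v ∈ innerPart G Y j) : i = j := by
  rw [mem_innerPart] at hvj
  rcases hvi with hv | ⟨-, u, hu, huv⟩
  · exact (eq_of_mem_closedPart hi hvj.1 hv).symm
  · exact (eq_of_mem_closedPart hi (hvj.2 u huv.symm) hu).symm

open Classical in
/-- The partition into the sets `innerPart G Y i`, for `i ≠ 0`, and the part `0`, which consists of
the remaining vertices. -/
noncomputable def startPart (G : SimpleGraph V) (Y : V → Fin (ℓ + 1)) (v : V) : ℕ :=
  if h : ∃ i, i ≠ 0 ∧ v ∈ innerPart G Y i then (h.choose : ℕ) else 0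

theorem startPart_of_mem (hi : i ≠ 0) (hv : v ∈ innerPart G Y i) : startPart G Y v = i := by
  have h : ∃ i, i ≠ 0 ∧ v ∈ innerPart G Y i := ⟨i, hi, hv⟩
  rw [startPart, dif_pos h, eq_of_mem_innerPart h.choose_spec.1 h.choose_spec.2.1 hv]

theorem startPart_of_notMem (hv : ∀ i, i ≠ 0 → v ∉ innerPart G Y i) : startPart G Y v = 0 :=
  dif_neg fun ⟨i, hi, h⟩ => hv i hi h

theorem exists_of_startPart {p : ℕ} (hp : p ≠ 0) (h : startPart G Y v = p) :
    ∃ i : Fin (ℓ + 1), i ≠ 0 ∧ (i : ℕ) = p ∧ v ∈ innerPart G Y i := by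
  by_cases hv : ∃ i, i ≠ 0 ∧ v ∈ innerPart G Y i
  · obtain ⟨i, hi, hvi⟩ := hv
    exact ⟨i, hi, (startPart_of_mem hi hvi).symm.trans h, hvi⟩
  · exact absurd (h.symm.trans (startPart_of_notMem fun i hi hvi => hv ⟨i, hi, hvi⟩)) hp

variable {t : ℕ} {a : ℝ}

theorem IsProtrusionDecomp.eq_zero_of_startPart (h : IsProtrusionDecomp G Y a t)
    (hv : startPart G Y v = 0) : Y v = 0 := by
  by_contra hne
  have : v ∈ innerPart G Y (Y v) := by
    rw [mem_innerPart]
    refine ⟨Or.inl rfl, fun u hu => ?_⟩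
    rcases h.1 v u hu hne with h1 | h1
    · exact Or.inl h1
    · exact Or.inr ⟨h1, v, rfl, hu⟩
  rw [startPart_of_mem hne this] at hv
  exact hne (Fin.ext hv)

/-- The boundaries of the protrusions belong to the part `0`: a neighbour in `Y_i` prevents such a
vertex from lying in `innerPart G Y j` for `j ≠ i`. -/
theorem startPart_bdry (hi : i ≠ 0)
    (hv : v ∈ bdry G (closedPart G Y i)) : startPart G Y v = 0 := by
  refine startPart_of_notMem fun j _ hvj => ?_
  obtain rfl := eq_of_mem_innerPart hi hv.1 hvj
  exact hvj.2 hv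

/-- The interiors of the protrusions are pieces. -/
theorem IsProtrusionDecomp.parted [Finite V] (h : IsProtrusionDecomp G Y a t) :
    Parted t ⟨G, Set.univ, fun _ _ _ => trivial⟩ (startPart G Y) := by
  intro p hp
  by_cases hpl : p < ℓ + 1
  · let i : Fin (ℓ + 1) := ⟨p, hpl⟩
    have hi : i ≠ 0 := fun h => hp (congrArg Fin.val h)
    refine ⟨_, fun v hv => ⟨trivial, startPart_bdry hi hv⟩, ?_⟩
    have he : {v | v ∈ (Set.univ : Set V) ∧ startPart G Y v = p} = innerPart G Y i := by
      ext v
      constructor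
      · rintro ⟨-, hv⟩
        obtain ⟨j, -, hj, hvj⟩ := exists_of_startPart hp hv
        obtain rfl : j = i := Fin.ext hj
        exact hvj
      · exact fun hv => ⟨trivial, startPart_of_mem hi hv⟩
    change Piece G t _ {v | v ∈ (Set.univ : Set V) ∧ startPart G Y v = p}
    rw [he]
    exact (h.2.2.2 i hi).piece
  · refine ⟨∅, fun v hv => hv.elim, ?_⟩
    convert Piece.nil (G := G) (t := t) ∅ (by simp) using 1
    rw [Set.eq_empty_iff_forall_notMem]
    rintro v ⟨-, hv⟩
    obtain ⟨j, -, hj, -⟩ := exists_of_startPart hp hv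
    exact hpl (hj ▸ j.2)

end InnerPart

/-- The vertex `i` belongs to the set `Y_j ∪ N(Y_j)`, where `Y_j` is the part of the vertex `w`. -/
def Fm.inClosedPart (i w : ℕ) : Fm :=
  .or (.eq (.load 1 (.var i)) (.load 1 (.var w))) <|
  .and (.eq (.load 1 (.var i)) (.num 0)) <|
  .ex 2 (.and (.eq (.load 1 (.var 2)) (.load 1 (.var w))) (.edge 2 i))

/-- The vertex `0` belongs to `innerPart G Y j`, where `Y_j` is the part of the vertex `1`, and
`j ≠ 0`. -/
def Fm.inInnerPart : Fm :=
  .and (.not (.eq (.load 1 (.var 1)) (.num 0))) <|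
  .and (.inClosedPart 0 1) (.all 3 (.imp (.edge 0 3) (.inClosedPart 3 1)))

/-- Compute the starts of the rows of the adjacency matrix, copy the adjacency matrix, and compute
the partition into `innerPart G Y 1`, `innerPart G Y 2`, … and the remaining vertices. -/
def setup : Cmd :=
  .seq (Cmd.accumulate 2 .tt (.var 0)) <|
  .seq (.forEach 0 (.forEach 1 (.assign 6 (.add (.load 2 (.var 0)) (.var 1))
    (.load 0 (.add (.load 2 (.var 0)) (.var 1)))))) <|
  .forEach 0 (.forEach 1 (.ite .inInnerPart (.assign 4 (.var 0) (.load 1 (.var 1))) .skip))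

section

variable {n ℓ : ℕ} {G : SimpleGraph (Fin n)} {k : ℤ} {Y : Fin n → Fin (ℓ + 1)} {A : Arrays}

theorem inputMemory_adj (u w : Fin n) :
    0 < (inputMemory G k Y).arr 0 ((u : ℕ) * n + (w : ℕ)) ↔ G.Adj u w := by
  classical
  change 0 < (if ∃ u' v' : Fin n, G.Adj u' v' ∧ ((u : ℕ) : ℤ) * n + (w : ℕ) =
    ((u' : ℕ) : ℤ) * n + (v' : ℕ) then (1 : ℤ) else 0) ↔ _
  constructor
  · intro h
    split_ifs at h with h1
    · obtain ⟨u', v', h2, h3⟩ := h1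
      obtain ⟨rfl, rfl⟩ := mul_add_inj h3
      exact h2
    · exact absurd h (lt_irrefl _)
  · intro h
    rw [if_pos ⟨u, w, h, rfl⟩]
    exact one_pos

theorem inputMemory_part (u : Fin n) :
    (inputMemory G k Y).arr 1 ((u : ℕ) : ℤ) = (Y u : ℕ) := by
  classical
  change (if h : ∃ v : Fin n, ((u : ℕ) : ℤ) = ((v : ℕ) : ℤ) then ((Y h.choose : ℕ) : ℤ) else 0) = _
  have h : ∃ v : Fin n, ((u : ℕ) : ℤ) = ((v : ℕ) : ℤ) := ⟨u, rfl⟩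
  rw [dif_pos h]
  have : u = h.choose := Fin.ext (by exact_mod_cast h.choose_spec)
  rw [← this]

theorem inputMemory_arr {a : ℕ} (ha : 1 < a) : (inputMemory G k Y).arr a = 0 := by
  funext z
  change (if a = 0 then _ else if a = 1 then _ else (0 : ℤ)) = 0
  rw [if_neg (by omega), if_neg (by omega)]

theorem Fm.sat_inClosedPart {S : Config (Fin n)} {part : Fin n → ℕ} (h : Represents A S part)
    (hY : ∀ u : Fin n, A 1 ((u : ℕ) : ℤ) = (Y u : ℕ)) {v : ℕ → ℤ} {i j : ℕ} (hi : i ≠ 2)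
    (hj : j ≠ 2) {u w : Fin n} (hu : v i = ((u : ℕ) : ℤ)) (hw : v j = ((w : ℕ) : ℤ)) :
    (Fm.inClosedPart i j).Sat n A v ↔ u ∈ closedPart S.graph Y (Y w) := by
  have hl : ∀ (v : ℕ → ℤ) (i : ℕ) (u : Fin n), v i = ((u : ℕ) : ℤ) →
      (Ex.load 1 (.var i)).eval A v = (Y u : ℕ) := fun v i u hu => by
    change A 1 (v i) = _
    rw [hu, hY]
  have hx : ∀ z : Fin n, (Fm.and (.eq (.load 1 (.var 2)) (.load 1 (.var j))) (.edge 2 i)).Sat n A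
      (Function.update v 2 ((z : ℕ) : ℤ)) ↔ Y z = Y w ∧ S.graph.Adj z u := by
    intro z
    have h2 : Function.update v 2 ((z : ℕ) : ℤ) 2 = ((z : ℕ) : ℤ) := Function.update_self _ _ _
    rw [sat_and, sat_eq, hl _ 2 z h2, hl _ j w (by rw [Function.update_of_ne hj, hw]),
      h.sat_edge h2 (by rw [Function.update_of_ne hi, hu]), Nat.cast_inj, Fin.ext_iff]
  rw [inClosedPart, sat_or, sat_and, sat_ex, sat_eq, sat_eq, hl _ _ u hu, hl _ _ w hw]
  simp only [hx]
  change _ ∨ ((Y u : ℕ) : ℤ) = ((0 : ℕ) : ℤ) ∧ _ ↔ Y u = Y w ∨ Y u = 0 ∧ _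
  rw [Nat.cast_inj, Nat.cast_inj, Fin.ext_iff, Fin.ext_iff]
  rfl

theorem Fm.sat_inInnerPart {S : Config (Fin n)} {part : Fin n → ℕ} (h : Represents A S part)
    (hY : ∀ u : Fin n, A 1 ((u : ℕ) : ℤ) = (Y u : ℕ)) {v : ℕ → ℤ} {u w : Fin n}
    (hu : v 0 = ((u : ℕ) : ℤ)) (hw : v 1 = ((w : ℕ) : ℤ)) :
    Fm.inInnerPart.Sat n A v ↔ Y w ≠ 0 ∧ u ∈ innerPart S.graph Y (Y w) := by
  have h3 : ∀ z : Fin n, Function.update v 3 ((z : ℕ) : ℤ) 3 = ((z : ℕ) : ℤ) := fun z =>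
    Function.update_self _ _ _
  rw [inInnerPart, sat_and, sat_and, sat_not, sat_eq, sat_all,
    sat_inClosedPart h hY (by decide) (by decide) hu hw, mem_innerPart]
  simp only [sat_imp]
  refine and_congr (not_congr ?_) (and_congr Iff.rfl (forall_congr' fun z => imp_congr ?_ ?_))
  · change A 1 (v 1) = 0 ↔ _
    rw [hw, hY, Fin.ext_iff]
    exact Nat.cast_eq_zero
  · exact h.sat_edge (by rw [Function.update_of_ne (by decide), hu]) (h3 z)
  · exact sat_inClosedPart h hY (by decide) (by decide) (h3 z)
      (by rw [Function.update_of_ne (by decide), hw])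

/-- The program `setup` yields the whole graph, with the partition `startPart`. -/
theorem setup_eval (v : ℕ → ℤ) :
    Represents (setup.eval n v (inputMemory G k Y).arr) ⟨G, Set.univ, fun _ _ _ => trivial⟩
      (startPart G Y) ∧
    ∀ a, 7 ≤ a → setup.eval n v (inputMemory G k Y).arr a = 0 := by
  classical
  obtain ⟨A, hA⟩ : ∃ A, A = (inputMemory G k Y).arr := ⟨_, rfl⟩
  have hA0 : ∀ a, 1 < a → A a = 0 := fun a ha => by rw [hA]; exact inputMemory_arr ha
  rw [← hA]
  obtain ⟨A₁, hA₁⟩ : ∃ A₁, A₁ = (Cmd.accumulate 2 .tt (.var 0)).eval n v A := ⟨_, rfl⟩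
  obtain ⟨A₂, hA₂⟩ : ∃ A₂, A₂ = (Cmd.forEach 0 (.forEach 1 (.assign 6
      (.add (.load 2 (.var 0)) (.var 1)) (.load 0 (.add (.load 2 (.var 0)) (.var 1)))))).eval n v A₁ :=
    ⟨_, rfl⟩
  obtain ⟨h1, h2⟩ := Cmd.accumulate_eval (n := n) (a := 2) (φ := .tt) (e := .var 0) trivial trivial
    (v := v) (A := A) (fun u => u) (fun u w _ _ => env2_zero)
  rw [← hA₁] at h1 h2
  have hbase : ∀ u : Fin n, A₁ 2 ((u : ℕ) : ℤ) = (u : ℕ) * n := fun u => by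
    rw [h2 u u.2, count_eq_ncard Set.univ _ fun _ => iff_of_true Fm.sat_tt trivial,
      Set.ncard_univ, Nat.card_fin, hA0 2 (by decide)]
    simp [mul_comm]
  have hw2 := Cmd.Writes.forEach (n := n) (v := v) (a := 6) (A₀ := A₁) (k := 0) fun i _ =>
    Cmd.Writes.forEach (n := n) (v := Function.update v 0 i) (a := 6) (A₀ := A₁) (k := 1) fun j _ =>
    Cmd.Writes.assign (v := env2 v i j) (i := .add (.load 2 (.var 0)) (.var 1))
      (e := .load 0 (.add (.load 2 (.var 0)) (.var 1))) (by simp [Ex.Avoids]) (by simp [Ex.Avoids])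
  have hidx : ∀ i j : Fin n, (Ex.add (.load 2 (.var 0)) (.var 1)).eval A₁ (env2 v i j) =
      (i : ℕ) * n + (j : ℕ) := fun i j => by
    change A₁ 2 (env2 v i j 0) + env2 v i j 1 = _
    rw [env2_zero, env2_one, hbase]
  have h6 : ∀ u w : Fin n, A₂ 6 ((u : ℕ) * n + (w : ℕ)) = A 0 ((u : ℕ) * n + (w : ℕ)) := by
    intro u w
    rw [hA₂]
    refine hw2.eval_eq ⟨u, u.2, w, w.2, Prod.ext (hidx u w).symm ?_⟩ ?_
    · change _ = A₁ 0 ((Ex.add (.load 2 (.var 0)) (.var 1)).eval A₁ (env2 v u w))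
      rw [hidx, h1 0 (by decide)]
    · rintro y ⟨i, hi, j, hj, hy⟩
      have hy1 := congrArg Prod.fst hy
      have hy2 := congrArg Prod.snd hy
      have hij := hidx ⟨i, hi⟩ ⟨j, hj⟩
      rw [← h1 0 (by decide)]
      refine hy2.trans (congrArg (A₁ 0) ?_)
      exact hy1.symm
  have off2 : ∀ a, a ≠ 6 → A₂ a = A₁ a := fun a ha => by rw [hA₂]; exact hw2.eval_off ha
  have hr2 : Represents A₂ ⟨G, Set.univ, fun _ _ _ => trivial⟩ (fun _ => 0) := by
    refine ⟨fun u => ?_, fun u => ?_, fun u w => ?_, fun u => ?_⟩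
    · rw [off2 2 (by decide), hbase]
    · rw [off2 5 (by decide), h1 5 (by decide), hA0 5 (by decide)]
      exact iff_of_true trivial (lt_irrefl _)
    · rw [h6, hA, inputMemory_adj]
      exact ⟨fun h => ⟨h, trivial, trivial⟩, fun h => h.1⟩
    · rw [off2 4 (by decide), h1 4 (by decide), hA0 4 (by decide)]
      rfl
  have hY : ∀ u : Fin n, A₂ 1 ((u : ℕ) : ℤ) = (Y u : ℕ) := fun u => by
    rw [off2 1 (by decide), h1 1 (by decide), hA, inputMemory_part]
  have hw4 := Cmd.Writes.forEach (n := n) (v := v) (a := 4) (A₀ := A₂) (k := 0) fun i _ =>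
    Cmd.Writes.forEach (n := n) (v := Function.update v 0 i) (a := 4) (A₀ := A₂) (k := 1) fun j _ =>
    Cmd.Writes.ite (v := env2 v i j) (φ := .inInnerPart)
      (by simp [Fm.Avoids, Ex.Avoids, Fm.inInnerPart, Fm.inClosedPart, Fm.alive, Fm.edge, Fm.imp,
        Fm.all, Fm.eq, Fm.or])
      (Cmd.Writes.assign (i := .var 0) (e := .load 1 (.var 1)) trivial (by simp [Ex.Avoids]))
      Cmd.Writes.skip
  have hev : setup.eval n v A = (Cmd.forEach 0 (.forEach 1
      (.ite .inInnerPart (.assign 4 (.var 0) (.load 1 (.var 1))) .skip))).eval n v A₂ := by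
    rw [hA₂, hA₁]; rfl
  have hmem : ∀ (i j : Fin n), (Ex.load 1 (.var 1)).eval A₂ (env2 v i j) = (Y j : ℕ) := fun i j => by
    change A₂ 1 (env2 v i j 1) = _
    rw [env2_one, hY]
  have off4 : ∀ a, a ≠ 4 → setup.eval n v A a = A₂ a := fun a ha => by
    rw [hev]; exact hw4.eval_off ha
  refine ⟨⟨fun u => ?_, fun u => ?_, fun u w => ?_, fun u => ?_⟩, fun a ha => ?_⟩
  · rw [off4 2 (by decide), hr2.base]
  · rw [off4 5 (by decide), hr2.alive]
  · rw [off4 6 (by decide), hr2.adj]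
  · by_cases hu : ∃ i, i ≠ 0 ∧ u ∈ innerPart G Y i
    · obtain ⟨i, hi, hui⟩ := hu
      obtain ⟨w, rfl⟩ : ∃ w, Y w = i := by
        rcases (mem_innerPart.1 hui).1 with h | ⟨-, w, hw, -⟩
        exacts [⟨u, h⟩, ⟨w, hw⟩]
      rw [hev, startPart_of_mem hi hui]
      refine hw4.eval_eq ⟨u, u.2, w, w.2, Or.inl ⟨?_, Prod.ext
        (env2_zero (v := v) (u := u) (w := w)).symm (hmem u w).symm⟩⟩ ?_
      · exact (Fm.sat_inInnerPart hr2 hY env2_zero env2_one).2 ⟨hi, hui⟩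
      · rintro y ⟨i', hi', j, hj, ⟨hsat, hy⟩ | ⟨-, hy⟩⟩
        · have h0 : ((u : ℕ) : ℤ) = env2 v i' j 0 := congrArg Prod.fst hy
          rw [env2_zero, Nat.cast_inj] at h0
          subst h0
          obtain ⟨hj0, hin⟩ := (Fm.sat_inInnerPart (w := ⟨j, hj⟩) hr2 hY env2_zero env2_one).1 hsat
          rw [eq_of_mem_innerPart hi (mem_innerPart.1 hui).1 hin]
          exact (congrArg Prod.snd hy).trans (hmem u ⟨j, hj⟩)
        · exact hy.elim
    · rw [hev, startPart_of_notMem fun i hi h => hu ⟨i, hi, h⟩, hw4.eval_of_notMem, hr2.part]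
      rintro y ⟨i', hi', j, hj, ⟨hsat, hy⟩ | ⟨-, hy⟩⟩
      · have h0 : ((u : ℕ) : ℤ) = env2 v i' j 0 := congrArg Prod.fst hy
        rw [env2_zero, Nat.cast_inj] at h0
        subst h0
        exact hu ⟨_, (Fm.sat_inInnerPart (w := ⟨j, hj⟩) hr2 hY env2_zero env2_one).1 hsat⟩
      · exact hy.elim
  · rw [off4 a (by omega), off2 a (by omega), h1 a (by omega), hA0 a (by omega)]

end

/-! ### The algorithm -/

/-- Apply the rules in the list `L` as long as possible, and renumber the remaining vertices. -/
noncomputable def kernelCmd (L : List Rule) : Cmd :=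
  .seq setup (.seq (.forEach 0 (Cmd.seqList (L.map Rule.cmd))) compaction)

/-- The whole algorithm. The last steps move the new number of vertices to the register `0`, and
subtract from `k` the sum of the numbers `δ` of the rules that have been applied. -/
noncomputable def kernelProg (L : List Rule) : Prog :=
  .seq ((kernelCmd L).compile (fun _ => 3) 4) <|
  .seq (.const 5 0) (.seq (.load 0 10 5) (.seq (.load 6 8 5) (.sub 1 1 6)))

theorem Config.ncard_alive_le {n ℓ b : ℕ} {S : Config (Fin n)} {part : Fin n → ℕ}
    (hℓ : ∀ v, part v ≤ ℓ) (hb : ∀ p, p ≠ 0 → {v | v ∈ S.alive ∧ part v = p}.ncard ≤ b) :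
    S.alive.ncard ≤ {v | part v = 0}.ncard + b * ℓ := by
  classical
  have h1 : S.alive ⊆ {v | part v = 0} ∪ {v | v ∈ S.alive ∧ part v ≠ 0} := fun v hv =>
    (em (part v = 0)).imp id fun h => ⟨hv, h⟩
  have h2 : {v | v ∈ S.alive ∧ part v ≠ 0}.ncard ≤ b * ℓ := by
    rw [Set.ncard_eq_toFinset_card']
    have := Finset.card_le_mul_card_image_of_maps_to
      (s := {v | v ∈ S.alive ∧ part v ≠ 0}.toFinset) (t := Finset.Icc 1 ℓ) (f := part)
      (fun v hv => by
        rw [Set.mem_toFinset] at hv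
        exact Finset.mem_Icc.2 ⟨Nat.one_le_iff_ne_zero.2 hv.2, hℓ v⟩) b fun p hp => by
          have hp0 : p ≠ 0 := by have := (Finset.mem_Icc.1 hp).1; omega
          refine le_trans (le_of_eq ?_) (hb p hp0)
          rw [← Set.ncard_coe_finset]
          congr 1
          ext v
          simp only [Finset.coe_filter, Set.mem_toFinset, Set.mem_ofPred_eq]
          exact ⟨fun h => ⟨h.1.1, h.2⟩, fun h => ⟨⟨h.1, by rw [h.2]; exact hp0⟩, h.2⟩⟩
    simpa using this
  exact (Set.ncard_le_ncard h1).trans ((Set.ncard_union_le _ _).trans (Nat.add_le_add_left h2 _))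

theorem startPart_le {V : Type} {G : SimpleGraph V} {ℓ : ℕ} {Y : V → Fin (ℓ + 1)} (v : V) :
    startPart G Y v ≤ ℓ := by
  by_cases h : startPart G Y v = 0
  · omega
  · obtain ⟨i, -, hi, -⟩ := exists_of_startPart h rfl
    have := i.2
    omega

section

variable {o : Objective} {E : Encoder} {g : ℕ → ℕ} {t : ℕ} {𝒢 : Set FinGraph}

/-- The algorithm computes an equivalent instance of bounded size. When no rule applies any more,
every part has at most `sizeBound E g t 𝒢` vertices. -/
theorem kernelCmd_eval (hDP : DPFriendly o E g t 𝒢) (h𝒢 : Hereditary 𝒢)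
    [Finite (Quotient (classSetoid t 𝒢))] {Q : ParamProblem 𝒢} {LQ : VertexLanguage}
    (hQ : IsCertifying o LQ Q) (hE : E.IsEncoderFor 𝒢 LQ) {L : List Rule}
    (hL : ∀ r ∈ L, r.Valid o E g t 𝒢)
    (hL' : ∀ r : Rule, r.Valid o E g t 𝒢 → r.ℓ ≤ patternBound E g t 𝒢 →
      ∀ (n : ℕ) (S : Config (Fin n)) (part : Fin n → ℕ) (x : Fin r.ℓ → Fin n),
        r.Applies S part x → ∃ r' ∈ L, ∃ x', r'.Applies S part x')
    {n ℓ : ℕ} {G : SimpleGraph (Fin n)} {k : ℤ} {Y : Fin n → Fin (ℓ + 1)} {a : ℝ}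
    (hG : FinGraph.of G ∈ 𝒢) (hY : IsProtrusionDecomp G Y a t) (v : ℕ → ℤ) {A : Arrays}
    (hA : A = (kernelCmd L).eval n v (inputMemory G k Y).arr) :
    ∃ (n' : ℕ) (G' : SimpleGraph (Fin n')), A 10 0 = n' ∧
      (∀ i j : Fin n', (G'.Adj i j → A 0 ((i : ℕ) * n' + (j : ℕ)) = 1) ∧
        (¬ G'.Adj i j → A 0 ((i : ℕ) * n' + (j : ℕ)) = 0)) ∧
      FinGraph.of G' ∈ 𝒢 ∧ 0 ≤ A 8 0 ∧
      (∀ k, Q.yes (FinGraph.of G) k ↔ Q.yes (FinGraph.of G') (k - A 8 0)) ∧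
      n' ≤ {v | Y v = 0}.ncard + sizeBound E g t 𝒢 * ℓ := by
  classical
  obtain ⟨h1, h2⟩ := setup_eval (G := G) (k := k) (Y := Y) v
  set S₀ : Config (Fin n) := ⟨G, Set.univ, fun _ _ _ => trivial⟩ with hS₀
  have iso₀ : S₀.toFinGraph.graph ≃g (FinGraph.of G).graph := SimpleGraph.induceUnivIso G
  have hS₀𝒢 : S₀.toFinGraph ∈ 𝒢 := h𝒢 _ _ ⟨iso₀.toEmbedding⟩ hG
  have hreach : Reached Q t (FinGraph.of G) (startPart G Y)
      (setup.eval n v (inputMemory G k Y).arr) := by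
    have h8 : setup.eval n v (inputMemory G k Y).arr 8 0 = 0 := by
      rw [h2 8 (by decide)]; rfl
    refine ⟨S₀, h1, hS₀𝒢, hY.parted, h8.ge, fun a ha => h2 a (by omega), fun k => ?_⟩
    rw [h8, sub_zero]
    exact (Q.yes_iso _ hS₀𝒢 _ hG ⟨iso₀⟩ k).symm
  have hcount : aliveCount n (setup.eval n v (inputMemory G k Y).arr) ≤ n := by
    refine (Set.ncard_le_ncard (Set.subset_univ _)).trans ?_
    rw [Set.ncard_univ, Nat.card_fin]
  obtain ⟨⟨S, h3, h4, h5, h6, h7, h8⟩, hstuck⟩ := Progress.iterate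
    -- every pass over the rules deletes a vertex or finds that no rule applies, so that `n` passes
    -- suffice
    (fun i => Progress.seqList (n := n) (v := Function.update v 0 ((i : ℕ) : ℤ)) Rule.cmd L
      fun r hr => Rule.progress hDP h𝒢 hQ hE (hL r hr) (FinGraph.of G) (startPart G Y) _)
    n hreach hcount
  obtain ⟨h9, h10, e, he⟩ := compaction_eval h3 h7 v
  have hA' : A = compaction.eval n v (iterDown (fun i A => (Cmd.seqList (L.map Rule.cmd)).eval n
      (Function.update v 0 ((i : ℕ) : ℤ)) A) n (setup.eval n v (inputMemory G k Y).arr)) := hA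
  rw [← hA'] at h9 h10 he
  have iso : S.toFinGraph.graph ≃g
      (FinGraph.of ((S.graph.induce S.alive).map e.toEmbedding)).graph :=
    SimpleGraph.Iso.map e _
  have hG' : FinGraph.of ((S.graph.induce S.alive).map e.toEmbedding) ∈ 𝒢 :=
    h𝒢 _ _ ⟨iso.symm.toEmbedding⟩ h4
  refine ⟨S.alive.ncard, (S.graph.induce S.alive).map e.toEmbedding, h10, fun i j => ?_, hG',
    by rw [h9]; exact h6, fun k => ?_, ?_⟩
  · obtain ⟨u, rfl⟩ := e.surjective i
    obtain ⟨w, rfl⟩ := e.surjective j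
    have hiff : ((S.graph.induce S.alive).map e.toEmbedding).Adj (e u) (e w) ↔ S.graph.Adj u w :=
      (SimpleGraph.Iso.map e (S.graph.induce S.alive)).map_adj_iff
    rw [hiff]
    exact he u w
  · rw [h8, h9]
    exact Q.yes_iso _ h4 _ hG' ⟨iso⟩ _
  · refine (Config.ncard_alive_le (part := startPart G Y) startPart_le fun p hp => ?_).trans
      (Nat.add_le_add_right (Set.ncard_le_ncard fun v hv => hY.eq_zero_of_startPart hv) _)
    by_contra hbig
    obtain ⟨r, x, hr, hx, hle⟩ := exists_rule hDP h𝒢 h4 h5 hp (not_le.1 hbig)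
    obtain ⟨r', hr', x', hx'⟩ := hL' r hr hle n S _ x hx
    exact hstuck r' hr' x' S h3 hx'

theorem eval_mono_nat (p : Polynomial ℕ) {m n : ℕ} (h : m ≤ n) : p.eval m ≤ p.eval n := by
  rw [Polynomial.eval_eq_sum_range, Polynomial.eval_eq_sum_range]
  gcongr

theorem kernelProg_spec {L : List Rule} {n ℓ : ℕ} {G : SimpleGraph (Fin n)} {k : ℤ}
    {Y : Fin n → Fin (ℓ + 1)} : Does (kernelProg L) (inputMemory G k Y)
      ((kernelCmd L).cost.eval n + 4) fun σ =>
      σ.arr = (kernelCmd L).eval n (fun _ => 0) (inputMemory G k Y).arr ∧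
      σ.reg 0 = σ.arr 10 0 ∧ σ.reg 1 = k - σ.arr 8 0 := by
  have hH : Holds n (fun _ => 3) 4 (fun _ => 0) (inputMemory G k Y) :=
    ⟨by decide, rfl, fun _ => by decide, fun _ => rfl⟩
  refine ((kernelCmd L).compile_spec _ _ _ _ hH).seq (N' := 4) ?_
  rintro σ ⟨h1, h2⟩
  have hk : σ.reg 1 = k := h2 1 (by decide)
  refine ⟨_, 1 + (1 + (1 + 1)), .seq (.const _ _ _) (.seq (.load _ _ _ _)
    (.seq (.load _ _ _ _) (.sub _ _ _ _))), le_rfl, h1, ?_, ?_⟩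
  · simp [Memory.setReg]
  · simp [Memory.setReg, hk]

end

end ProtrusionKernel

theorem corollary1 (H : ProtrusionKernel.FinGraph) (𝒢 : Set ProtrusionKernel.FinGraph)
    (h𝒢 : 𝒢 = ProtrusionKernel.minorFree H ∨ 𝒢 = ProtrusionKernel.topMinorFree H)
    (Q : ProtrusionKernel.ParamProblem 𝒢) (o : ProtrusionKernel.Objective)
    (LQ : ProtrusionKernel.VertexLanguage) (hQ : ProtrusionKernel.IsCertifying o LQ Q)
    (E : ProtrusionKernel.Encoder) (hE : E.IsEncoderFor 𝒢 LQ)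
    (g : ℕ → ℕ) (t : ℕ) (hDP : ProtrusionKernel.DPFriendly o E g t 𝒢) (α : ℝ) :
    Finite (Quotient (ProtrusionKernel.classSetoid t 𝒢)) ∧
    ∃ (P : ProtrusionKernel.Prog) (p : Polynomial ℕ),
      ∀ (n : ℕ) (G : SimpleGraph (Fin n)) (k : ℤ) (ℓ : ℕ) (Y : Fin n → Fin (ℓ + 1)),
        ProtrusionKernel.FinGraph.of G ∈ 𝒢 →
        ProtrusionKernel.IsProtrusionDecomp G Y (α * k) t →
        ∃ (σ : ProtrusionKernel.Memory) (m n' : ℕ) (G' : SimpleGraph (Fin n')) (k' : ℤ),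
          ProtrusionKernel.Run P (ProtrusionKernel.inputMemory G k Y) σ m ∧
          m ≤ p.eval (n + k.natAbs) ∧
          ProtrusionKernel.IsOutput σ G' k' ∧
          ProtrusionKernel.FinGraph.of G' ∈ 𝒢 ∧
          (Q.yes (ProtrusionKernel.FinGraph.of G) k ↔
            Q.yes (ProtrusionKernel.FinGraph.of G') k') ∧
          (n' : ℝ) ≤ (1 + (ProtrusionKernel.sizeBound E g t 𝒢 : ℝ)) * (α * k) ∧
          k' ≤ k := by
  classical
  have hfin := ProtrusionKernel.finite_quotient_classSetoid h𝒢 t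
  obtain ⟨L, hL, hL'⟩ := ProtrusionKernel.exists_rule_list o E g t 𝒢
    (ProtrusionKernel.patternBound E g t 𝒢)
  refine ⟨hfin, ProtrusionKernel.kernelProg L, (ProtrusionKernel.kernelCmd L).cost + 4, ?_⟩
  intro n G k ℓ Y hG hY
  obtain ⟨σ, m, hrun, hm, harr, hreg0, hreg1⟩ :=
    ProtrusionKernel.kernelProg_spec (L := L) (G := G) (k := k) (Y := Y)
  obtain ⟨n', G', h1, h2, h3, h4, h5, h6⟩ := ProtrusionKernel.kernelCmd_eval hDP
    (ProtrusionKernel.hereditary_of_eq h𝒢) hQ hE hL hL' hG hY _ harr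
  refine ⟨σ, m, n', G', k - σ.arr 8 0, hrun, ?_, ⟨hreg0.trans h1, hreg1, fun u v => ?_⟩, h3, h5 k,
    ?_, by linarith⟩
  · refine hm.trans ?_
    rw [Polynomial.eval_add]
    refine Nat.add_le_add (ProtrusionKernel.eval_mono_nat _ (Nat.le_add_right _ _)) ?_
    simp
  · split_ifs with h
    · exact (h2 u v).1 h
    · exact (h2 u v).2 h
  · have hℓ : (ℓ : ℝ) ≤ α * k := hY.2.1
    have h0 : ({v | Y v = 0}.ncard : ℝ) ≤ α * k := hY.2.2.1
    have h6' : (n' : ℝ) ≤ {v | Y v = 0}.ncard + ProtrusionKernel.sizeBound E g t 𝒢 * ℓ := by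
      exact_mod_cast h6
    have := mul_le_mul_of_nonneg_left hℓ
      (Nat.cast_nonneg (α := ℝ) (ProtrusionKernel.sizeBound E g t 𝒢))
    linarith
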